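/- **Setting.** Let $V=\mathbb R^{p}\oplus\mathbb R^{q}$ with the symmetric bilinear form $Q$ of signature $(p,q)$, $Q((x,w),(x',w'))=\langle x,x'\rangle-\langle w,w'\rangle$, and let $z_0=0\oplus\mathbb R^q$, with its standard orientation, the inner product $\langle\cdot,\cdot\rangle=-Q|_{z_0}$, the standard basis $e_1,\dots,e_q$, and the $Q$-orthogonal projection $\operatorname{pr}\colon V\to z_0$. Let $G(\mathbb R)^+$ be the identity component of $O(V,Q)$, $\mathfrak g$ its Lie algebra, $K\simeq SO(p)\times SO(q)$ the stabilizer of $z_0$, $\mathfrak k$ its Lie algebra, and $\mathbb D^+=G(\mathbb R)^+/K$ the space of negative definite $q$-planes $z\subset V$ (oriented compatibly with $z_0$), an open subset of the Grassmannian, with the action $L_g z=gz$. Let $E=G(\mathbb R)^+\times_K z_0\to\mathbb D^+$ be the associated oriented Euclidean bundle; its fibre over $z$ is identified with $z$ by $[g,w]\mapsto gw$. Let $\theta\in\Omega^1(G(\mathbb R)^+)\otimes\mathfrak k$ be the projection to $\mathfrak k$ (block-diagonal part) of the Maurer–Cartan form, $\rho$ the restriction to $z_0$, $\nabla=d+\rho(\theta)$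 the induced covariant derivative on $E$, and $R$ its curvature, $R(A,B)=[\theta A,\theta B]-\theta[A,B]$ for left-invariant fields $A,B\in\mathfrak g$. Let $\widetilde\nabla,\widetilde R$ be their pullbacks to $\widetilde E=(G(\mathbb R)^+\times z_0)\times_K z_0\to E$, and ${\bf s}[g,w]=[(g,w),w]$ the tautological section. On forms with values in an exterior algebra bundle use the product $(\omega\otimes s)\wedge(\eta\otimes t)=(-1)^{\deg s\,\deg\eta}(\omega\wedge\eta)\otimes(s\wedge t)$, the exponential $\exp(a)=\sum_{k\ge 0}a^k/k!$, the Berezin integral $\int^B(\omega\otimes s)=\omega\,\langle s,e_1\wedge\dots\wedge e_q\rangle$, and the identification $\mathfrak{so}(z_0)\simeq\wedge^2z_0$, $A\mapsto\sum_{i<j}\langle Ae_i,e_j\rangle e_i\wedge e_j$. The Mathai–Quillen form is $$U_{MQ}=(-1)^{\frac{q(q+1)}2}(2\pi)^{-\frac q2}\int^B\exp\left(-2\pi\|{\bf s}\|^2-2\sqrt\pi\,\widetilde\nabla{\bf s}+\rho(\widetilde R)\right)\in\Omega^q(E).$$ For $v\in V$ let $s_v(z)=[g_z,\operatorname{pr}(g_z^{-1}v)]$,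 where $g_z\in G(\mathbb R)^+$ is any element with $g_zz_0=z$; this is a section of $E$. Let $\varphi^0(v)=s_v^*U_{MQ}\in\Omega^q(\mathbb D^+)$ and $\mathbb D_v^+=\{z\in\mathbb D^+: z\subset v^\perp\}$, the zero locus of $s_v$. Let $L\subset V$ be a lattice, $\Gamma\subset G(\mathbb R)^+$ a torsion-free subgroup preserving $L$, and $\Gamma_v$ the stabilizer of $v$ in $\Gamma$. **Proposition.** 1. For every $v\in V$, $$\varphi^0(v)=(-1)^{\frac{q(q+1)}2}(2\pi)^{-\frac q2}\exp\left(2\pi\,Q|_z(v,v)\right)\int^B\exp\left(-2\sqrt\pi\,\nabla s_v+\rho(R)\right)$$ at the point $z\in\mathbb D^+$, where $Q|_z(v,v)$ denotes the value of $Q$ at the projection of $v$ on $z$. 2. The form $\varphi^0(v)$ depends smoothly on $v\in V$ (jointly with the point of $\mathbb D^+$), and $L_g^*\varphi^0(v)=\varphi^0(g^{-1}v)$ for all $g\in G(\mathbb R)^+$ and $v\in V$; that is, $\varphi^0\in[\Omega^q(\mathbb D^+)\otimes C^\infty(V)]^{G(\mathbb R)^+}$. 3. For every $v\neq0$, $\varphi^0(v)$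 represents the Poincaré dual of $\Gamma_v\backslash\mathbb D_v^+$ in $\Gamma_v\backslash\mathbb D^+$: it is a closed $\Gamma_v$-invariant form, and for every closed compactly supported form $\omega$ on $\Gamma_v\backslash\mathbb D^+$ of degree $pq-q$, $$\int_{\Gamma_v\backslash\mathbb D^+}\varphi^0(v)\wedge\omega=\int_{\Gamma_v\backslash\mathbb D_v^+}\omega .$$ Here $\mathbb D^+$ carries either of its orientations, and $\mathbb D_v^+$ the following one: its normal bundle is oriented through the isomorphism with $E|_{\mathbb D_v^+}$ given by the derivative of $s_v$, and a positive basis of the normal space followed by a positive basis of the tangent space of $\mathbb D_v^+$ is a positive basis of the tangent space of $\mathbb D^+$. (If $Q(v,v)\le0$ then $\mathbb D_v^+$ is empty and the right-hand side is $0$.) -/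

import Mathlib

open scoped TensorProduct RealInnerProductSpace ContDiff
open MeasureTheory Module

noncomputable section

namespace MQ

/-! ### The quadratic space, its orthogonal group and the symmetric space -/

/-- The positive definite summand `z₀^⊥`. -/
abbrev Pos (p : ℕ) := EuclideanSpace ℝ (Fin p)

/-- The base plane `z₀`, with its inner product `⟨w, w'⟩ = -Q(w, w')` and its standard
orthonormal, positively oriented basis. -/
abbrev Neg (q : ℕ) := EuclideanSpace ℝ (Fin q)

/-- The real quadratic space of signature `(p, q)`, split as `z₀^⊥ ⊕ z₀`. -/
abbrev V (p q : ℕ) := Pos p × Neg q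

/-- The algebra of endomorphisms of `V`. -/
abbrev EndV (p q : ℕ) := V p q →L[ℝ] V p q

/-- The vector space `Hom(z₀, z₀^⊥)`. -/
abbrev HomZ (p q : ℕ) := Neg q →L[ℝ] Pos p

variable {p q : ℕ}

/-- The symmetric bilinear form of signature `(p, q)`. -/
def Q (x y : V p q) : ℝ := ⟪x.1, y.1⟫ - ⟪x.2, y.2⟫

/-- The orthogonal group of `Q`. -/
def orthGroup (p q : ℕ) : Subgroup (EndV p q)ˣ where
  carrier := {g | ∀ x y, Q ((g : EndV p q) x) ((g : EndV p q) y) = Q x y}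
  mul_mem' := by
    intro a b ha hb x y
    have h := ha ((b : EndV p q) x) ((b : EndV p q) y)
    rw [hb x y] at h
    simpa using h
  one_mem' := by
    intro x y
    simp
  inv_mem' := by
    intro a ha x y
    have key : ∀ z, (a : EndV p q) (((a⁻¹ : (EndV p q)ˣ) : EndV p q) z) = z :=
      fun z => congrArg (fun f : EndV p q => f z) a.mul_inv
    have h := ha (((a⁻¹ : (EndV p q)ˣ) : EndV p q) x) (((a⁻¹ : (EndV p q)ˣ) : EndV p q) y)
    rw [key, key] at h
    exact h.symm

/-- The identity component `G(ℝ)⁺` of the orthogonal group. -/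
def Gplus (p q : ℕ) : Subgroup (EndV p q)ˣ :=
  (Subgroup.connectedComponentOfOne (orthGroup p q)).map (orthGroup p q).subtype

/-- The embedding `w ↦ X w + w` of `z₀` in `V` as the graph of `X`. -/
def graph (X : HomZ p q) : Neg q →L[ℝ] V p q := X.prod (ContinuousLinearMap.id ℝ (Neg q))

/-- The `q`-plane in `V` which is the graph of `X`. -/
def plane (X : HomZ p q) : Submodule ℝ (V p q) := LinearMap.range (graph X).toLinearMap

/-- The symmetric space `𝔻⁺` of negative `q`-planes, as an open subset of the affine chart
`Hom(z₀, z₀^⊥)` of the Grassmannian. All negative `q`-planes lie in this chart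
(`exists_unique_plane`); in the component of `z₀` (that is, of `X = 0`) the plane of `X` carries the
orientation transported from `z₀` by `graph X`. -/
def Dplus (p q : ℕ) : Set (HomZ p q) := {X | ∀ y ∈ plane X, y ≠ 0 → Q y y < 0}

/-- The submanifold `𝔻_v⁺` of the planes orthogonal to `v`. -/
def Dv (v : V p q) : Set (HomZ p q) := {X | X ∈ Dplus p q ∧ ∀ y ∈ plane X, Q y v = 0}

/-- The action `L_g` of `g` on planes: the plane of `actD g X` is the image by `g` of the plane
of `X` (`plane_actD`). -/
def actD (g : EndV p q) (X : HomZ p q) : HomZ p q :=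
  ((ContinuousLinearMap.fst ℝ (Pos p) (Neg q)).comp (g.comp (graph X))).comp
    (((ContinuousLinearMap.snd ℝ (Pos p) (Neg q)).comp (g.comp (graph X))).inverse)

theorem mem_plane_iff (X : HomZ p q) (y : V p q) : y ∈ plane X ↔ y.1 = X y.2 := by
  constructor
  · rintro ⟨w, rfl⟩
    rfl
  · intro h
    exact ⟨y.2, Prod.ext h.symm rfl⟩

theorem Q_self_nonneg_of_snd_eq_zero (y : V p q) (h : y.2 = 0) : 0 ≤ Q y y := by
  simp [Q, h]

/-- The negative definite `q`-dimensional subspaces of `V` are exactly the planes of the elements of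
`𝔻⁺`, and the latter are unique. -/
theorem exists_unique_plane (z : Submodule ℝ (V p q)) (hz : finrank ℝ z = q)
    (hneg : ∀ y ∈ z, y ≠ 0 → Q y y < 0) : ∃! X : HomZ p q, X ∈ Dplus p q ∧ plane X = z := by
  let f : z →ₗ[ℝ] Neg q := (LinearMap.snd ℝ (Pos p) (Neg q)).comp z.subtype
  have hf : Function.Injective f := by
    rw [← LinearMap.ker_eq_bot, LinearMap.ker_eq_bot']
    intro y hy
    by_contra hne
    have h1 := hneg y y.2 (by simpa using hne)
    have h2 := Q_self_nonneg_of_snd_eq_zero (y : V p q) hy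
    linarith
  let e : z ≃ₗ[ℝ] Neg q := LinearEquiv.ofInjectiveOfFinrankEq f hf (by simp [hz])
  have he : ∀ y : z, e y = (y : V p q).2 := fun y => rfl
  let X : HomZ p q := LinearMap.toContinuousLinearMap
    ((LinearMap.fst ℝ (Pos p) (Neg q)).comp (z.subtype.comp e.symm.toLinearMap))
  have hX : ∀ w, X w = (e.symm w : V p q).1 := fun w => rfl
  have hpl : plane X = z := by
    ext y
    rw [mem_plane_iff, hX]
    constructor
    · intro h
      have h2 : (e.symm y.2 : V p q).2 = y.2 := by
        rw [← he]
        simp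
      have h3 : y = (e.symm y.2 : V p q) := Prod.ext h h2.symm
      rw [h3]
      exact (e.symm y.2).2
    · intro h
      have h3 : e.symm y.2 = ⟨y, h⟩ := by
        rw [LinearEquiv.symm_apply_eq, he]
      rw [h3]
  refine ⟨X, ⟨?_, hpl⟩, ?_⟩
  · intro y hy
    rw [hpl] at hy
    exact hneg y hy
  · rintro Y ⟨-, hY⟩
    ext1 w
    have h : (Y w, w) ∈ plane X := by
      rw [hpl, ← hY, mem_plane_iff]
    exact (mem_plane_iff X _).1 h

theorem plane_actD (g : (EndV p q)ˣ) (hg : g ∈ orthGroup p q) (X : HomZ p q)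
    (hX : X ∈ Dplus p q) :
    plane (actD (g : EndV p q) X) = (plane X).map (g : EndV p q).toLinearMap := by
  have hginj : Function.Injective (g : EndV p q) := by
    intro x y h
    have key : ∀ z, ((g⁻¹ : (EndV p q)ˣ) : EndV p q) ((g : EndV p q) z) = z :=
      fun z => congrArg (fun f : EndV p q => f z) g.inv_mul
    rw [← key x, h, key]
  let D : Neg q →L[ℝ] Neg q :=
    (ContinuousLinearMap.snd ℝ (Pos p) (Neg q)).comp ((g : EndV p q).comp (graph X))
  have hD : Function.Injective D := by
    rw [injective_iff_map_eq_zero]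
    intro w hw
    by_contra hne
    have h1 := hX (graph X w) ⟨w, rfl⟩ (fun h => hne (congrArg Prod.snd h))
    have h2 := Q_self_nonneg_of_snd_eq_zero ((g : EndV p q) (graph X w)) hw
    rw [hg] at h2
    linarith
  let e : Neg q ≃L[ℝ] Neg q :=
    (LinearEquiv.ofInjectiveEndo D.toLinearMap hD).toContinuousLinearEquiv
  have heD : (e : Neg q →L[ℝ] Neg q) = D := by
    ext1 w
    rfl
  have hinv : D.inverse = (e.symm : Neg q →L[ℝ] Neg q) := by
    rw [← heD, ContinuousLinearMap.inverse_equiv]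
  have happ : ∀ w, actD (g : EndV p q) X w = ((g : EndV p q) (graph X (e.symm w))).1 := by
    intro w
    change ((g : EndV p q) (graph X (D.inverse w))).1 = _
    rw [hinv]
    rfl
  have hsnd : ∀ w, ((g : EndV p q) (graph X w)).2 = e w := fun w => rfl
  ext y
  rw [mem_plane_iff, happ, Submodule.mem_map]
  constructor
  · intro h
    refine ⟨graph X (e.symm y.2), ⟨_, rfl⟩, Prod.ext h.symm ?_⟩
    change ((g : EndV p q) (graph X (e.symm y.2))).2 = y.2
    rw [hsnd, e.apply_symm_apply]
  · rintro ⟨_, ⟨w, rfl⟩, rfl⟩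
    change ((g : EndV p q) (graph X w)).1 =
      ((g : EndV p q) (graph X (e.symm ((g : EndV p q) (graph X w)).2))).1
    rw [hsnd, e.symm_apply_apply]

/-! ### The algebra of forms with values in an exterior algebra, at a point

For a tangent space `T`, the space `⋀ T^* ⊗ ⋀ z₀` carries the product
`(ω ⊗ s) ∧ (η ⊗ t) = (-1)^(j k) (ω ∧ η) ⊗ (s ∧ t)` for `s` of degree `j` and `η` of degree `k`.
It is Mathlib's graded tensor product. -/

section Berezin

variable (T : Type) [NormedAddCommGroup T] [NormedSpace ℝ T]

/-- The grading of `⋀ T^*`. -/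
abbrev gradT (i : ℕ) := ⋀[ℝ]^i (Dual ℝ T)

/-- The grading of `⋀ z₀`. -/
abbrev gradZ (q : ℕ) (j : ℕ) := ⋀[ℝ]^j (Neg q)

/-- The bigraded algebra `⋀ T^* ⊗ ⋀ z₀`. -/
abbrev BiForms (q : ℕ) := (gradT T) ᵍ⊗[ℝ] (gradZ q)

variable {T}

/-- The pure tensor `η ⊗ s`. -/
def tens (η : ExteriorAlgebra ℝ (Dual ℝ T)) (s : ExteriorAlgebra ℝ (Neg q)) : BiForms T q :=
  GradedTensorProduct.tmul ℝ η s

/-- The component of bidegree `(0, 0)`. -/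
def scalarPart : BiForms T q →ₗ[ℝ] ℝ :=
  (LinearMap.mul' ℝ ℝ).comp
    ((TensorProduct.map (ExteriorAlgebra.algebraMapInv (R := ℝ) (M := Dual ℝ T)).toLinearMap
      (ExteriorAlgebra.algebraMapInv (R := ℝ) (M := Neg q)).toLinearMap).comp
        (GradedTensorProduct.of ℝ (gradT T) (gradZ q)).symm.toLinearMap)

/-- The exponential `∑ a ^ k / k!`. With `a = a₀ + n`, where `a₀` is the (central) scalar part, it is
`e^{a₀} ∑ n ^ k / k!`, and `n ^ k = 0` for `k > dim T + q`. -/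
def expB (a : BiForms T q) : BiForms T q :=
  Real.exp (scalarPart a) •
    ∑ k ∈ Finset.range (finrank ℝ T + q + 1),
      ((k.factorial : ℝ)⁻¹) • (a - algebraMap ℝ (BiForms T q) (scalarPart a)) ^ k

/-- The standard basis of `z₀`. -/
def stdBasis (q : ℕ) : Basis (Fin q) ℝ (Neg q) := (EuclideanSpace.basisFun (Fin q) ℝ).toBasis

/-- The Berezin integral on `⋀ z₀`, `w ↦ ⟨w, e₁ ∧ ⋯ ∧ e_q⟩`. -/
def berezinZ : ExteriorAlgebra ℝ (Neg q) →ₗ[ℝ] ℝ :=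
  (exteriorPower.alternatingMapLinearEquiv (stdBasis q).det).comp
    (GradedAlgebra.proj (gradZ q) q |>.codRestrict (gradZ q q)
      (fun x => by simp [GradedAlgebra.proj_apply]))

/-- The Berezin integral `η ⊗ s ↦ η ∫^B s`. -/
def berezin : BiForms T q →ₗ[ℝ] ExteriorAlgebra ℝ (Dual ℝ T) :=
  (TensorProduct.rid ℝ (ExteriorAlgebra ℝ (Dual ℝ T))).toLinearMap.comp
    ((TensorProduct.map LinearMap.id berezinZ).comp
      (GradedTensorProduct.of ℝ (gradT T) (gradZ q)).symm.toLinearMap)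

/-- The alternating `k`-form on `T` given by the degree `k` component of an element of `⋀ T^*`:
`λ₁ ∧ ⋯ ∧ λ_k` is sent to `(x₁, …, x_k) ↦ det (λ_i x_j)`. -/
def toForm (k : ℕ) (a : ExteriorAlgebra ℝ (Dual ℝ T)) : T [⋀^Fin k]→ₗ[ℝ] ℝ :=
  (exteriorPower.pairingDual ℝ T k (DirectSum.decompose (gradT T) a k)).compAlternatingMap
    (exteriorPower.ιMulti ℝ k)

/-- A `z₀`-valued `1`-form on `T`, as an element of bidegree `(1, 1)`. -/
def biOfOneForm (l : T →L[ℝ] Neg q) : BiForms T q :=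
  ∑ j : Fin q, tens (ExteriorAlgebra.ι ℝ (((stdBasis q).coord j).comp l.toLinearMap))
    (ExteriorAlgebra.ι ℝ (stdBasis q j))

variable [FiniteDimensional ℝ T]

/-- The element of `⋀² T^*` of an alternating bilinear map `B`: `½ ∑ B(b_i, b_j) b^i ∧ b^j`. -/
def extOfTwoForm (B : T → T → ℝ) : ExteriorAlgebra ℝ (Dual ℝ T) :=
  (2⁻¹ : ℝ) • ∑ i, ∑ j, B (finBasis ℝ T i) (finBasis ℝ T j) •
    (ExteriorAlgebra.ι ℝ ((finBasis ℝ T).coord i) * ExteriorAlgebra.ι ℝ ((finBasis ℝ T).coord j))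

/-- An `𝔰𝔬(z₀)`-valued `2`-form on `T`, as an element of bidegree `(2, 2)` through
`𝔰𝔬(z₀) ≃ ⋀² z₀`, `A ↦ ∑_{i < j} ⟨A e_i, e_j⟩ e_i ∧ e_j`. -/
def biOfTwoForm (B : T → T → (Neg q →L[ℝ] Neg q)) : BiForms T q :=
  ∑ i : Fin q, ∑ j : Fin q, if i < j then
    tens (extOfTwoForm fun x y => ⟪B x y (stdBasis q i), stdBasis q j⟫)
      (ExteriorAlgebra.ι ℝ (stdBasis q i) * ExteriorAlgebra.ι ℝ (stdBasis q j))
  else 0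

end Berezin

/-! ### The principal bundle, its connection and its curvature

Vector fields on the group are trivialised by left translation: the element `A` of the Lie algebra
is the tangent vector `g A` at `g`. -/

/-- The Lie algebra `𝔤` of the orthogonal group. -/
def lieG (p q : ℕ) : Submodule ℝ (EndV p q) where
  carrier := {A | ∀ x y, Q (A x) y + Q x (A y) = 0}
  add_mem' := by
    intro A B hA hB x y
    have h1 := hA x y
    have h2 := hB x y
    simp only [Q, add_apply, Prod.fst_add, Prod.snd_add, inner_add_left,
      inner_add_right] at *
    linarith
  zero_mem' := by
    intro x y
    simp [Q]
  smul_mem' := by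
    intro c A hA x y
    have h1 := hA x y
    simp only [Q, smul_apply, Prod.smul_fst, Prod.smul_snd,
      real_inner_smul_left, real_inner_smul_right] at *
    linear_combination c * h1

/-- The connection form: the projection of `𝔤` on `𝔨 = 𝔰𝔬(z₀^⊥) ⊕ 𝔰𝔬(z₀)` (the block diagonal
part), applied to the Maurer-Cartan form. -/
def theta (A : EndV p q) : EndV p q :=
  ((ContinuousLinearMap.fst ℝ (Pos p) (Neg q)).comp
      (A.comp (ContinuousLinearMap.inl ℝ (Pos p) (Neg q)))).prodMap
    ((ContinuousLinearMap.snd ℝ (Pos p) (Neg q)).comp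
      (A.comp (ContinuousLinearMap.inr ℝ (Pos p) (Neg q))))

/-- The derivative of the representation of `K` on `z₀`: the restriction to `z₀`, as a linear map
(applied to elements of `𝔨`, which preserve `z₀`). -/
def rho : EndV p q →L[ℝ] (Neg q →L[ℝ] Neg q) :=
  (ContinuousLinearMap.compL ℝ (Neg q) (V p q) (Neg q)
      (ContinuousLinearMap.snd ℝ (Pos p) (Neg q))).comp
    ((ContinuousLinearMap.compL ℝ (Neg q) (V p q) (V p q)).flip
      (ContinuousLinearMap.inr ℝ (Pos p) (Neg q)))

/-- The connection `ρ(θ)` on `z₀` is the `z₀`-block of the Maurer-Cartan form. -/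
theorem rho_theta (A : EndV p q) : rho (theta A) = rho A := rfl

/-- The curvature `R(A, B) = [θ A, θ B] - θ [A, B]`. -/
def curv (A B : EndV p q) : EndV p q := ⁅theta A, theta B⁆ - theta ⁅A, B⁆

/-- The tangent map `A ↦ g A` from `𝔤` to the tangent space of the group at `g`. -/
def leftTriv (g : EndV p q) : lieG p q →L[ℝ] EndV p q :=
  (ContinuousLinearMap.compL ℝ (V p q) (V p q) (V p q) g).comp (lieG p q).subtypeL

/-- The projection of the group to `𝔻⁺`, `g ↦ g z₀`. -/
def projD (g : EndV p q) : HomZ p q := actD g 0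

/-- The differential of `projD` at `g`. -/
def dProjD (g : EndV p q) : lieG p q →L[ℝ] HomZ p q :=
  (fderiv ℝ projD g).comp (leftTriv g)

/-- The total space of the bundle `E = G(ℝ)⁺ ×_K z₀` is the open subset `𝔻⁺ × z₀` of
`Hom(z₀, z₀^⊥) × z₀`: the pair `(X, u)` stands for the vector `X u + u` of the fibre of `E` over the
plane of `X` (the fibre is that plane), and the class `[g, w]`, that is, the vector `g w` of the
plane `g z₀`, is the point `projE (g, w)`. -/
def projE (x : EndV p q × Neg q) : HomZ p q × Neg q :=
  (projD x.1, (x.1 (0, x.2)).2)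

/-- The differential of `projE` at `(g, w)`. -/
def dProjE (g : EndV p q) (w : Neg q) : (lieG p q × Neg q) →L[ℝ] (HomZ p q × Neg q) :=
  (fderiv ℝ projE (g, w)).comp ((leftTriv g).prodMap (ContinuousLinearMap.id ℝ (Neg q)))

/-! ### The Mathai-Quillen form and its pullback -/

/-- The lift to `G(ℝ)⁺ × z₀` of the covariant derivative `d𝐬 + ρ(θ) 𝐬` of the tautological section
`𝐬[g, w] = [(g, w), w]`; it sends `(A, w')` to `w' + ρ(θ(A)) w = w' + ρ(A) w` (`rho_theta`). -/
def nablaTaut (w : Neg q) : (lieG p q × Neg q) →L[ℝ] Neg q :=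
  ContinuousLinearMap.snd ℝ (lieG p q) (Neg q) +
    ((rho.flip w).comp (lieG p q).subtypeL).comp
      (ContinuousLinearMap.fst ℝ (lieG p q) (Neg q))

/-- The constant `(-1)^{q(q+1)/2} (2π)^{-q/2}`. -/
def cst (q : ℕ) : ℝ := (-1) ^ (q * (q + 1) / 2) * (2 * Real.pi) ^ (-(q : ℝ) / 2)

/-- The lift to `G(ℝ)⁺ × z₀` of the Mathai-Quillen form, at a point `(g, w)`; in the left
trivialisation it does not depend on `g`. -/
def mqLift (p : ℕ) (w : Neg q) : (lieG p q × Neg q) [⋀^Fin q]→ₗ[ℝ] ℝ :=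
  cst q • toForm q (berezin (expB (
    - algebraMap ℝ (BiForms (lieG p q × Neg q) q) (2 * Real.pi * ‖w‖ ^ 2)
    - (2 * √Real.pi) • biOfOneForm (nablaTaut w)
    + biOfTwoForm (fun x y : lieG p q × Neg q => rho (curv (x.1 : EndV p q) (y.1 : EndV p q))))))

open Classical in
/-- The form on the base of a bundle `π : P → M` which corresponds to a basic form `α` on `P`: its
value at `y` is the form `β` with `π^* β = α` at all the points over `y`. -/
def descend {Pt T M : Type} [NormedAddCommGroup T] [NormedSpace ℝ T] [NormedAddCommGroup M]
    [NormedSpace ℝ M] {k : ℕ} (P : Set Pt) (π : Pt → M) (dπ : Pt → T →L[ℝ] M)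
    (α : Pt → T [⋀^Fin k]→ₗ[ℝ] ℝ) (y : M) : M [⋀^Fin k]→L[ℝ] ℝ :=
  if h : ∃ β : M [⋀^Fin k]→L[ℝ] ℝ, ∀ x ∈ P, π x = y →
      (β.compContinuousLinearMap (dπ x)).toAlternatingMap = α x
  then h.choose else 0

/-- The Mathai-Quillen form `U_MQ` on `E`. -/
def UMQ (p q : ℕ) : HomZ p q × Neg q → (HomZ p q × Neg q) [⋀^Fin q]→L[ℝ] ℝ :=
  descend (Pt := (EndV p q)ˣ × Neg q) (T := lieG p q × Neg q) {x | x.1 ∈ Gplus p q}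
    (fun x => projE ((x.1 : EndV p q), x.2)) (fun x => dProjE (x.1 : EndV p q) x.2)
    (fun x => mqLift p x.2)

open Classical in
/-- An element `g_z` of `G(ℝ)⁺` which sends `z₀` to the plane `z` of `X`. -/
def gz (X : HomZ p q) : (EndV p q)ˣ :=
  if h : ∃ g ∈ Gplus p q, projD (g : EndV p q) = X then h.choose else 1

/-- The section `s_v(z) = [g_z, pr(g_z⁻¹ v)]` of `E`. -/
def sec (v : V p q) (X : HomZ p q) : HomZ p q × Neg q :=
  projE ((gz X : EndV p q), (((gz X)⁻¹ : (EndV p q)ˣ) : EndV p q) v |>.2)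

/-- The form `φ⁰(v) = s_v^* U_MQ` on `𝔻⁺`. -/
def phi0 (v : V p q) (X : HomZ p q) : HomZ p q [⋀^Fin q]→L[ℝ] ℝ :=
  (UMQ p q (sec v X)).compContinuousLinearMap (fderiv ℝ (sec v) X)

/-- The map `f_v(g) = pr(g⁻¹ v)` on the group which corresponds to the section `s_v`. -/
def fv (v : V p q) (g : EndV p q) : Neg q := (Ring.inverse g v).2

/-- The lift `df_v + ρ(θ) f_v` of `∇ s_v` to the group, at `g` (recall `rho_theta`). -/
def nablaSec (v : V p q) (g : EndV p q) : lieG p q →L[ℝ] Neg q :=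
  (fderiv ℝ (fv v) g).comp (leftTriv g) + (rho.flip (fv v g)).comp (lieG p q).subtypeL

/-- The lift to the group, at `g`, of the form
`(-1)^{q(q+1)/2} (2π)^{-q/2} exp(2π Q|_z(v, v)) ∫^B exp(-2√π ∇ s_v + ρ(R))` on `𝔻⁺`. Here `z = g z₀`
and `Q|_z(v, v)`, the value of `Q` at the projection of `v` on `z`, equals `Q|_{z₀}(g⁻¹v, g⁻¹v)`. -/
def berezinFormula (v : V p q) (g : EndV p q) : lieG p q [⋀^Fin q]→ₗ[ℝ] ℝ :=
  (cst q * Real.exp (2 * Real.pi * Q ((0, fv v g) : V p q) (0, fv v g))) •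
    toForm q (berezin (expB (
      - (2 * √Real.pi) • biOfOneForm (nablaSec v g)
      + biOfTwoForm (fun x y : lieG p q => rho (curv (x : EndV p q) (y : EndV p q))))))

/-! ### Forms on the quotient `Γ \ 𝔻⁺` and Poincaré duality

Differential forms on `Γ \ 𝔻⁺` are `Γ`-invariant differential forms on `𝔻⁺`. -/

/-- The pullback `L_g^* η`. -/
def pullD {k : ℕ} (g : EndV p q) (η : HomZ p q → HomZ p q [⋀^Fin k]→L[ℝ] ℝ) (X : HomZ p q) :
    HomZ p q [⋀^Fin k]→L[ℝ] ℝ :=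
  (η (actD g X)).compContinuousLinearMap (fderiv ℝ (actD g) X)

/-- `η` is a closed (smooth) `k`-form on `Γ \ 𝔻⁺`. -/
structure IsClosedForm (Γ : Subgroup (EndV p q)ˣ) {k : ℕ}
    (η : HomZ p q → HomZ p q [⋀^Fin k]→L[ℝ] ℝ) : Prop where
  smooth : ContDiffOn ℝ ∞ η (Dplus p q)
  invariant : ∀ γ ∈ Γ, ∀ X ∈ Dplus p q, pullD (γ : EndV p q) η X = η X
  closed : ∀ X ∈ Dplus p q, extDeriv η X = 0

/-- The support of `η` is compact in `Γ \ 𝔻⁺`. -/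
def HasCompactSupportMod (Γ : Subgroup (EndV p q)ˣ) {k : ℕ}
    (η : HomZ p q → HomZ p q [⋀^Fin k]→L[ℝ] ℝ) : Prop :=
  ∃ C : Set (HomZ p q), IsCompact C ∧ C ⊆ Dplus p q ∧
    ∀ X ∈ Dplus p q, (∀ γ ∈ Γ, actD (γ : EndV p q) X ∉ C) → η X = 0

/-- The Borel set `F` contains exactly one point of every `Γ`-orbit in `S`. -/
structure IsFundamentalSet (Γ : Subgroup (EndV p q)ˣ) (S F : Set (HomZ p q)) : Prop where
  measurable : MeasurableSet F
  subset : F ⊆ S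
  unique : ∀ X ∈ S, ∃! Y, Y ∈ F ∧ ∃ γ ∈ Γ, actD (γ : EndV p q) X = Y

/-- The wedge product of a `q`-form and a `k`-form. -/
def wedge {k : ℕ} (φ : HomZ p q [⋀^Fin q]→L[ℝ] ℝ) (η : HomZ p q [⋀^Fin k]→L[ℝ] ℝ) :
    HomZ p q [⋀^Fin q ⊕ Fin k]→ₗ[ℝ] ℝ :=
  (LinearMap.mul' ℝ ℝ).compAlternatingMap
    (φ.toAlternatingMap.domCoprod η.toAlternatingMap)

/-- The integral over `Γ \ 𝔻⁺` of the top degree form `α` is `I`, for the orientation of `𝔻⁺` for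
which the basis `b` is positive. The integral is computed on any fundamental set. -/
def HasIntegral (Γ : Subgroup (EndV p q)ˣ) {k : ℕ} (b : Basis (Fin q ⊕ Fin k) ℝ (HomZ p q))
    (α : HomZ p q → HomZ p q [⋀^Fin q ⊕ Fin k]→ₗ[ℝ] ℝ) (I : ℝ) : Prop :=
  (∃ F, IsFundamentalSet Γ (Dplus p q) F) ∧
  ∀ F, IsFundamentalSet Γ (Dplus p q) F →
    IntegrableOn (fun X => α X b) F b.addHaar ∧ ∫ X in F, α X b ∂b.addHaar = I

/-- `ψ` is a smooth parametrisation of `𝔻_v⁺` by an open subset `U` of `ℝ^k`, of sign `ε` with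
respect to the following orientation of `𝔻_v⁺`. The normal bundle of `𝔻_v⁺`, the zero locus of
`s_v`, is oriented through its isomorphism with `E` given by the derivative of `s_v` in the
direction of the fibres, the fibres of `E` being oriented by `z₀`; and a positive basis of
the normal space followed by a positive basis of the tangent space of `𝔻_v⁺` is a positive basis of
the tangent space of `𝔻⁺`, oriented by `b`. -/
structure IsParam (v : V p q) {k : ℕ} (b : Basis (Fin q ⊕ Fin k) ℝ (HomZ p q))
    (U : Set (Fin k → ℝ)) (ψ : (Fin k → ℝ) → HomZ p q) (ε : ℤˣ) : Prop where
  isOpen : IsOpen U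
  smooth : ContDiffOn ℝ ∞ ψ U
  injOn : Set.InjOn ψ U
  image : ψ '' U = Dv v
  oriented : ∀ u ∈ U, ∀ n : Fin q → HomZ p q,
    0 < (stdBasis q).det (fun i => (fderiv ℝ (sec v) (ψ u) (n i)).2) →
      0 < ((ε : ℤ) : ℝ) * b.det (Sum.elim n fun i => fderiv ℝ ψ u (Pi.single i 1))

/-- The integral of the `k`-form `η` over `Γ \ 𝔻_v⁺` is `I`, for the orientation of `𝔻_v⁺` which
is described at `IsParam`. -/
def HasIntegralDv (Γ : Subgroup (EndV p q)ˣ) (v : V p q) {k : ℕ}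
    (b : Basis (Fin q ⊕ Fin k) ℝ (HomZ p q)) (η : HomZ p q → HomZ p q [⋀^Fin k]→L[ℝ] ℝ)
    (I : ℝ) : Prop :=
  (∃ F, IsFundamentalSet Γ (Dv v) F) ∧ (∃ U ψ ε, IsParam v b U ψ ε) ∧
  ∀ F, IsFundamentalSet Γ (Dv v) F → ∀ U ψ ε, IsParam v b U ψ ε →
    IntegrableOn (fun u => η (ψ u) fun i => fderiv ℝ ψ u (Pi.single i 1)) (U ∩ ψ ⁻¹' F) ∧
    ((ε : ℤ) : ℝ) * ∫ u in U ∩ ψ ⁻¹' F, η (ψ u) (fun i => fderiv ℝ ψ u (Pi.single i 1)) = I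

/-- The `q`-form `φ` on `Γ \ 𝔻⁺` represents the Poincaré dual of `Γ \ 𝔻_v⁺`. -/
def IsPoincareDual (Γ : Subgroup (EndV p q)ˣ) (v : V p q)
    (φ : HomZ p q → HomZ p q [⋀^Fin q]→L[ℝ] ℝ) : Prop :=
  IsClosedForm Γ φ ∧
  ∀ (k : ℕ) (b : Basis (Fin q ⊕ Fin k) ℝ (HomZ p q))
    (η : HomZ p q → HomZ p q [⋀^Fin k]→L[ℝ] ℝ),
    IsClosedForm Γ η → HasCompactSupportMod Γ η →
      ∃ I : ℝ, HasIntegral Γ b (fun X => wedge (φ X) (η X)) I ∧ HasIntegralDv Γ v b η I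

/-- The stabiliser `Γ_v` of `v` in `Γ`. -/
def stab (Γ : Subgroup (EndV p q)ˣ) (v : V p q) : Subgroup (EndV p q)ˣ where
  carrier := {γ | γ ∈ Γ ∧ (γ : EndV p q) v = v}
  mul_mem' := by
    rintro a b ⟨ha, ha'⟩ ⟨hb, hb'⟩
    exact ⟨Γ.mul_mem ha hb, by simp [hb', ha']⟩
  one_mem' := ⟨Γ.one_mem, by simp⟩
  inv_mem' := by
    rintro a ⟨ha, ha'⟩
    refine ⟨Γ.inv_mem ha, ?_⟩
    have h : ((a⁻¹ : (EndV p q)ˣ) : EndV p q) ((a : EndV p q) v) = v :=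
      congrArg (fun f : EndV p q => f v) a.inv_mul
    rwa [ha'] at h

end MQ

end

noncomputable section

open scoped InnerProduct Topology

set_option maxSynthPendingDepth 3

namespace MQ

variable {p q : ℕ}

/-! ### A quadrature formula for imaginary Gaussian moments -/

/-! A negative plane is the graph of an `X : z₀ → z₀^⊥` of norm less than one, so `𝔻⁺` is an open
ball over which `E` is trivial, and every computation takes place in this chart.

Linearisation. By `rho_curv` the curvature is `(A, B) ↦ b* a - a* b`, where `a` and `b` are the
blocks `z₀ → z₀^⊥` of `A` and `B`. It is therefore `-1/2` times a sum of squares of commuting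
elements of bidegree `(1, 1)` (`biOfTwoForm_eq`). Since `exp (-n² / 2)` is the mean of `exp (i z n)`
over a standard Gaussian `z`, the Berezin integral becomes a mean of `q × q` determinants of
`z₀`-valued linear forms (`toForm_berezin_expB`). By nilpotency only finitely many moments matter,
and the mean is a finite real sum `quadE`, which obeys the Gaussian rule of integration by parts
(`quadE_ibp`).

The form. The explicit smooth form `Uex` on the chart pulls back to the given lift on the group
(`Uex_dProjE`). As the identity component acts transitively (`exists_projD_eq`), this identifies the
Mathai-Quillen form (`UMQ_eq`). The lift does not depend on the point of the group, whence the
invariance `Uex_actE`; lifting the section to the group gives the Berezin formula for `φ⁰(v)`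
(`phi0_dProjD`).

Closedness. By invariance it is enough to look at `X = 0`, where the metric terms are even in `X`
and so do not contribute to the derivative. What remains is an identity between minors, proved by
integration by parts and an exchange of columns (`sum_quadE_eq_zero`).

Duality. A group preserving a lattice acts properly discontinuously, because it preserves a family
of positive definite majorants of `Q`; being torsion-free, it acts freely. A cutoff `χ` whose
translates add up to one on the support of `η` turns integrals over the quotient into integrals over
`𝔻⁺`. The pullback of `Uex` by `(t, X) ↦ s_{tv}(X)` is closed on `ℝ × 𝔻⁺`, so Stokes shows that the
integral of `φ⁰(t v) ∧ η` does not depend on `t` (`integral_cutoff_eq`). As `t → ∞` the Gaussian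
concentrates on the zero locus `𝔻_v⁺`, an affine slice of the ball, and has mass one in the normal
directions (`cst_mul_eq_one`, `integral_cutoff_eq_integral`). If `v ∈ z₀` is nonzero, the integral
tends to `0` and the locus is empty. The integral over the affine slice is finally folded back to an
arbitrary parametrisation and fundamental set (`IsParam.integral_eq`). -/

/-- The moments `E[(i z)^k]` of `i z`, where `z` is a standard Gaussian variable. -/
def imGaussMoment : ℕ → ℝ
  | 0 => 1
  | 1 => 0
  | (k + 2) => -((k : ℝ) + 1) * imGaussMoment k

/-- Stein's identity on monomials. At `k = 0` the truncated subtraction is harmless, because the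
factor `k` vanishes. -/
theorem imGaussMoment_succ (k : ℕ) :
    imGaussMoment (k + 1) = -(k : ℝ) * imGaussMoment (k - 1) := by
  cases k with
  | zero => simp [imGaussMoment]
  | succ k => simp [imGaussMoment]

theorem imGaussMoment_odd (i : ℕ) : imGaussMoment (2 * i + 1) = 0 := by
  induction i with
  | zero => rfl
  | succ i ih =>
    rw [show 2 * (i + 1) + 1 = (2 * i + 1) + 2 by ring, imGaussMoment, ih, mul_zero]

/-- The exponential generating function of the moments of `i z` is `exp (-t² / 2)`; these are its
even coefficients. -/
theorem imGaussMoment_even (i : ℕ) :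
    ((2 * i).factorial : ℝ)⁻¹ * imGaussMoment (2 * i) = (i.factorial : ℝ)⁻¹ * (-(1 / 2)) ^ i := by
  induction i with
  | zero => simp [imGaussMoment]
  | succ i ih =>
    rw [show 2 * (i + 1) = (2 * i) + 2 by ring, imGaussMoment, Nat.factorial_succ,
      Nat.factorial_succ, Nat.factorial_succ, pow_succ]
    have h1 : ((2 * i).factorial : ℝ) ≠ 0 := by positivity
    have h2 : (i.factorial : ℝ) ≠ 0 := by positivity
    have h3 : ((i : ℝ) + 1) ≠ 0 := by positivity
    have h4 : (2 * (i : ℝ) + 1) ≠ 0 := by positivity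
    field_simp at ih
    push_cast
    field_simp
    linear_combination (-(2 * (i : ℝ) + 2)) * ih

/-- Nodes `0, …, N` and weights of a quadrature formula which is exact for the moments of
`i z` of order at most `N`. -/
theorem exists_quadrature (N : ℕ) : ∃ c : Fin (N + 1) → ℝ, ∀ k ≤ N,
    ∑ s, c s * ((s : ℕ) : ℝ) ^ k = imGaussMoment k := by
  -- `H` sends `X ^ k` to the `k`-th moment. Its values on the Lagrange basis of the `N + 1` nodes
  -- are the weights, and a monomial of degree at most `N` equals its interpolant.
  let H : Polynomial ℝ →ₗ[ℝ] ℝ := Polynomial.lsum fun k => imGaussMoment k • LinearMap.id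
  let t : Fin (N + 1) → ℝ := fun s => ((s : ℕ) : ℝ)
  have ht : Set.InjOn t (Finset.univ : Finset (Fin (N + 1))) := by
    intro a _ b _ h
    exact Fin.ext (Nat.cast_injective (R := ℝ) h)
  refine ⟨fun s => H (Lagrange.basis Finset.univ t s), fun k hk => ?_⟩
  have hX : (Polynomial.X ^ k : Polynomial ℝ) =
      Lagrange.interpolate Finset.univ t fun i => (Polynomial.X ^ k : Polynomial ℝ).eval (t i) := by
    apply Lagrange.eq_interpolate ht
    rw [Polynomial.degree_X_pow, Finset.card_univ, Fintype.card_fin]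
    exact_mod_cast Nat.lt_succ_of_le hk
  have h := congrArg H hX
  rw [Lagrange.interpolate_apply, map_sum] at h
  have h0 : H (Polynomial.X ^ k) = imGaussMoment k := by
    rw [Polynomial.X_pow_eq_monomial]
    simp [H, Polynomial.lsum_apply, Polynomial.sum_monomial_index]
  rw [← h0, h]
  refine Finset.sum_congr rfl fun s _ => ?_
  rw [← Polynomial.smul_eq_C_mul, map_smul, smul_eq_mul, mul_comm]
  simp [t]

/-- The weights of the quadrature formula. -/
def quadWeight (N : ℕ) : Fin (N + 1) → ℝ := (exists_quadrature N).choose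

theorem quadWeight_spec {N k : ℕ} (hk : k ≤ N) :
    ∑ s, quadWeight N s * ((s : ℕ) : ℝ) ^ k = imGaussMoment k :=
  (exists_quadrature N).choose_spec k hk

/-- The expectation of a function of `p` independent imaginary Gaussian variables, computed by the
quadrature formula. -/
def quadE (N p : ℕ) (f : (Fin p → ℝ) → ℝ) : ℝ :=
  ∑ s : Fin p → Fin (N + 1), (∏ i, quadWeight N (s i)) * f fun i => ((s i : ℕ) : ℝ)

/-! ### Exponentials of nilpotent elements: squares traded for means of linear terms. -/

section Exp

variable {A : Type*} [Ring A] [Algebra ℝ A] [Module ℚ A]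

theorem qsmul_eq_rsmul (r : ℚ) (a : A) : r • a = (r : ℝ) • a := by
  rw [Rat.cast_smul_eq_qsmul]

theorem nilExp_eq_sum {a : A} {k : ℕ} (h : a ^ k = 0) :
    IsNilpotent.exp a = ∑ i ∈ Finset.range k, (i.factorial : ℝ)⁻¹ • a ^ i := by
  rw [IsNilpotent.exp_eq_sum h]
  refine Finset.sum_congr rfl fun i _ => ?_
  rw [qsmul_eq_rsmul]
  simp

/-- Coefficients of `n ^ k` are compared: for `k ≤ N` the quadrature is exact, and beyond `N` the
power is zero. -/
theorem nilExp_neg_half_sq {N : ℕ} {n : A} (hn : n ^ (N + 1) = 0) :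
    IsNilpotent.exp (-(1 / 2 : ℝ) • n ^ 2) =
      ∑ s, quadWeight N s • IsNilpotent.exp (((s : ℕ) : ℝ) • n) := by
  have hz : ∀ k, N < k → n ^ k = 0 := fun k hk => pow_eq_zero_of_le hk hn
  have h1 : ∀ s : ℝ, IsNilpotent.exp (s • n) =
      ∑ k ∈ Finset.range (2 * (N + 1)), ((k.factorial : ℝ)⁻¹ * s ^ k) • n ^ k := by
    intro s
    rw [nilExp_eq_sum (k := 2 * (N + 1))]
    · simp_rw [smul_pow, smul_smul]
    · rw [smul_pow, hz _ (by omega), smul_zero]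
  have h2 : IsNilpotent.exp (-(1 / 2 : ℝ) • n ^ 2) =
      ∑ i ∈ Finset.range (N + 1), ((i.factorial : ℝ)⁻¹ * (-(1 / 2)) ^ i) • n ^ (2 * i) := by
    rw [nilExp_eq_sum (k := N + 1)]
    · simp_rw [smul_pow, smul_smul, ← pow_mul]
    · rw [smul_pow, ← pow_mul, hz _ (by omega), smul_zero]
  -- The odd moments vanish, so powers are grouped in consecutive pairs `2 i`, `2 i + 1`.
  have h3 : ∀ M : ℕ, ∑ k ∈ Finset.range (2 * M),
      ((k.factorial : ℝ)⁻¹ * imGaussMoment k) • n ^ k =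
        ∑ i ∈ Finset.range M, ((i.factorial : ℝ)⁻¹ * (-(1 / 2)) ^ i) • n ^ (2 * i) := by
    intro M
    induction M with
    | zero => simp
    | succ M ih =>
      rw [show 2 * (M + 1) = 2 * M + 1 + 1 by ring, Finset.sum_range_succ, Finset.sum_range_succ,
        ih, imGaussMoment_odd, Finset.sum_range_succ, imGaussMoment_even]
      simp
  rw [h2, ← h3]
  simp_rw [h1, Finset.smul_sum]
  rw [Finset.sum_comm]
  refine Finset.sum_congr rfl fun k _ => ?_
  by_cases hk : k ≤ N
  · rw [← quadWeight_spec hk, Finset.mul_sum, Finset.sum_smul]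
    refine Finset.sum_congr rfl fun s _ => ?_
    rw [smul_smul]
    congr 1
    ring
  · simp [hz k (by omega)]

theorem nilExp_sub_half_sq {N : ℕ} {a n : A} (hc : Commute a n) (ha : IsNilpotent a)
    (hn : n ^ (N + 1) = 0) :
    IsNilpotent.exp (a - (1 / 2 : ℝ) • n ^ 2) =
      ∑ s, quadWeight N s • IsNilpotent.exp (a + ((s : ℕ) : ℝ) • n) := by
  have hn2 : IsNilpotent (-(1 / 2 : ℝ) • n ^ 2) :=
    ⟨N + 1, by rw [smul_pow, ← pow_mul, pow_eq_zero_of_le (by omega) hn, smul_zero]⟩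
  have hn1 : ∀ s : ℝ, IsNilpotent (s • n) := fun s => ⟨N + 1, by rw [smul_pow, hn, smul_zero]⟩
  rw [sub_eq_add_neg, ← neg_smul, IsNilpotent.exp_add_of_commute
    ((hc.pow_right 2).smul_right _) ha hn2, nilExp_neg_half_sq hn, Finset.mul_sum]
  refine Finset.sum_congr rfl fun s _ => ?_
  rw [IsNilpotent.exp_add_of_commute (hc.smul_right _) ha (hn1 _), mul_smul_comm]

/-- The Hubbard-Stratonovich trick: the exponential of a negative sum of squares is a mean of
exponentials of linear combinations, with one independent variable for each square. -/
theorem quad_nilExp {N p : ℕ} {a : A} {n : Fin p → A} (hc : ∀ i, Commute a (n i))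
    (hcc : ∀ i j, Commute (n i) (n j)) (ha : IsNilpotent a) (hn : ∀ i, n i ^ (N + 1) = 0) :
    IsNilpotent.exp (a - (1 / 2 : ℝ) • ∑ i, n i ^ 2) =
      ∑ s : Fin p → Fin (N + 1), (∏ i, quadWeight N (s i)) •
        IsNilpotent.exp (a + ∑ i, ((s i : ℕ) : ℝ) • n i) := by
  induction p generalizing a with
  | zero => simp
  | succ p ih =>
    have hnil0 : ∀ s : ℝ, IsNilpotent (s • n 0) :=
      fun s => ⟨N + 1, by rw [smul_pow, hn, smul_zero]⟩
    have hsq : IsNilpotent (-((1 / 2 : ℝ) • ∑ i : Fin p, n i.succ ^ 2)) := by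
      apply IsNilpotent.neg
      apply IsNilpotent.smul
      have : ∀ J : Finset (Fin p), IsNilpotent (∑ i ∈ J, n i.succ ^ 2) := by
        intro J
        induction J using Finset.induction_on with
        | empty => simp
        | insert x J hx hJ =>
          rw [Finset.sum_insert hx]
          refine Commute.isNilpotent_add ?_ (IsNilpotent.pow_of_pos ⟨N + 1, hn _⟩ two_ne_zero) hJ
          exact Commute.sum_right _ _ _ fun i _ => (hcc _ _).pow_pow _ _
      exact this _
    have hcs : Commute a (-((1 / 2 : ℝ) • ∑ i : Fin p, n i.succ ^ 2)) :=
      ((Commute.sum_right _ _ _ fun i _ => (hc _).pow_right _).smul_right _).neg_right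
    have h1 : a - (1 / 2 : ℝ) • ∑ i, n i ^ 2 =
        (a - (1 / 2 : ℝ) • ∑ i : Fin p, n i.succ ^ 2) - (1 / 2 : ℝ) • n 0 ^ 2 := by
      rw [Fin.sum_univ_succ, smul_add]
      abel
    rw [h1, nilExp_sub_half_sq (N := N)]
    · rw [← (Fin.consEquiv fun _ => Fin (N + 1)).sum_comp, Fintype.sum_prod_type]
      refine Finset.sum_congr rfl fun s _ => ?_
      -- The linear term of the variable peeled off is absorbed into `a`, which is why the induction
      -- generalises over `a`.
      rw [sub_add_eq_add_sub, ih (a := a + ((s : ℕ) : ℝ) • n 0) (n := fun i => n i.succ)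
        (fun i => (hc _).add_left ((hcc _ _).smul_left _)) (fun i j => hcc _ _)
        (Commute.isNilpotent_add ((hc 0).smul_right _) ha (hnil0 _)) (fun i => hn _),
        Finset.smul_sum]
      refine Finset.sum_congr rfl fun r _ => ?_
      simp only [Fin.consEquiv, Equiv.coe_fn_mk, Fin.prod_univ_succ, Fin.cons_zero, Fin.cons_succ,
        Fin.sum_univ_succ, smul_smul, add_assoc]
    · rw [sub_eq_add_neg]
      refine (hc 0).add_left (Commute.neg_left (Commute.smul_left ?_ _))
      exact Commute.sum_left _ _ _ fun i _ => (hcc _ _).pow_left _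
    · rw [sub_eq_add_neg]
      exact Commute.isNilpotent_add hcs ha hsq
    · exact hn 0

end Exp

/-! ### Products, powers and Berezin integrals in `⋀ T^* ⊗ ⋀ z₀`. -/

section BiFormsAlgebra

variable {q : ℕ} {T : Type} [NormedAddCommGroup T] [NormedSpace ℝ T]

/-- The pure tensor as a bilinear map. -/
def tensₗ : ExteriorAlgebra ℝ (Dual ℝ T) →ₗ[ℝ] ExteriorAlgebra ℝ (Neg q) →ₗ[ℝ] BiForms T q :=
  (TensorProduct.mk ℝ _ _).compr₂ (GradedTensorProduct.of ℝ (gradT T) (gradZ q)).toLinearMap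

theorem tensₗ_apply (a : ExteriorAlgebra ℝ (Dual ℝ T)) (b : ExteriorAlgebra ℝ (Neg q)) :
    tensₗ a b = tens a b := rfl

theorem tens_add_left (a a' : ExteriorAlgebra ℝ (Dual ℝ T)) (b : ExteriorAlgebra ℝ (Neg q)) :
    tens (a + a') b = tens a b + tens a' b := by
  simp only [← tensₗ_apply, map_add, LinearMap.add_apply]

theorem tens_smul_left (c : ℝ) (a : ExteriorAlgebra ℝ (Dual ℝ T)) (b : ExteriorAlgebra ℝ (Neg q)) :
    tens (c • a) b = c • tens a b := by
  simp only [← tensₗ_apply, map_smul, LinearMap.smul_apply]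

theorem tens_sum_left {ι : Type*} (s : Finset ι) (a : ι → ExteriorAlgebra ℝ (Dual ℝ T))
    (b : ExteriorAlgebra ℝ (Neg q)) :
    tens (∑ i ∈ s, a i) b = ∑ i ∈ s, tens (a i) b := by
  simp only [← tensₗ_apply, map_sum, LinearMap.sum_apply]

theorem tens_neg_neg (a : ExteriorAlgebra ℝ (Dual ℝ T)) (b : ExteriorAlgebra ℝ (Neg q)) :
    tens (-a) (-b) = tens a b := by
  simp only [← tensₗ_apply, map_neg, LinearMap.neg_apply, neg_neg]

theorem tens_zero_right (a : ExteriorAlgebra ℝ (Dual ℝ T)) :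
    tens a (0 : ExteriorAlgebra ℝ (Neg q)) = 0 := by
  simp only [← tensₗ_apply, map_zero]

theorem tens_mul_tens {j i : ℕ} (a : ExteriorAlgebra ℝ (Dual ℝ T)) {b : ExteriorAlgebra ℝ (Neg q)}
    (hb : b ∈ gradZ q j) {a' : ExteriorAlgebra ℝ (Dual ℝ T)} (ha' : a' ∈ gradT T i)
    (b' : ExteriorAlgebra ℝ (Neg q)) :
    tens a b * tens a' b' = ((-1 : ℝ) ^ (j * i)) • tens (a * a') (b * b') := by
  have h := GradedTensorProduct.tmul_coe_mul_coe_tmul (R := ℝ) (𝒜 := gradT T) (ℬ := gradZ q) a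
    ⟨b, hb⟩ ⟨a', ha'⟩ b'
  refine h.trans ?_
  rw [Units.smul_def]
  have : ((((-1 : ℤˣ) ^ (j * i) : ℤˣ)) : ℤ) = (-1) ^ (j * i) := by simp
  rw [this, ← Int.cast_smul_eq_zsmul ℝ]
  simp [tens]

theorem ι_mem_gradT (l : Dual ℝ T) : ExteriorAlgebra.ι ℝ l ∈ gradT T 1 := by
  rw [gradT, ExteriorAlgebra.exteriorPower, pow_one]
  exact ⟨_, rfl⟩

theorem ι_mem_gradZ (e : Neg q) : ExteriorAlgebra.ι ℝ e ∈ gradZ q 1 := by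
  rw [gradZ, ExteriorAlgebra.exteriorPower, pow_one]
  exact ⟨_, rfl⟩

/-- The coordinates of a `z₀`-valued linear form. -/
def coordForm (l : T →L[ℝ] Neg q) (j : Fin q) : Dual ℝ T := ((stdBasis q).coord j).comp l.toLinearMap

theorem coordForm_apply (l : T →L[ℝ] Neg q) (j : Fin q) (x : T) : coordForm l j x = l x j := by
  simp [coordForm, stdBasis]

theorem biOfOneForm_eq (l : T →L[ℝ] Neg q) : biOfOneForm l =
    ∑ j : Fin q, tens (ExteriorAlgebra.ι ℝ (coordForm l j)) (ExteriorAlgebra.ι ℝ (stdBasis q j)) :=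
  rfl

theorem biOfOneForm_add (l l' : T →L[ℝ] Neg q) :
    biOfOneForm (l + l') = biOfOneForm l + biOfOneForm l' := by
  rw [biOfOneForm_eq, biOfOneForm_eq, biOfOneForm_eq, ← Finset.sum_add_distrib]
  refine Finset.sum_congr rfl fun j _ => ?_
  rw [← tens_add_left, ← map_add]
  rfl

theorem biOfOneForm_smul (c : ℝ) (l : T →L[ℝ] Neg q) :
    biOfOneForm (c • l) = c • biOfOneForm l := by
  rw [biOfOneForm_eq, biOfOneForm_eq, Finset.smul_sum]
  refine Finset.sum_congr rfl fun j _ => ?_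
  rw [← tens_smul_left, ← map_smul]
  congr 2

theorem biOfOneForm_sum {ι : Type*} (s : Finset ι) (l : ι → T →L[ℝ] Neg q) :
    biOfOneForm (∑ i ∈ s, l i) = ∑ i ∈ s, biOfOneForm (l i) :=
  map_sum (⟨⟨biOfOneForm, biOfOneForm_add⟩, biOfOneForm_smul⟩ : (T →L[ℝ] Neg q) →ₗ[ℝ] BiForms T q)
    l s

theorem ι_mul_ι_comm {M : Type*} [AddCommGroup M] [Module ℝ M] (x y : M) :
    ExteriorAlgebra.ι ℝ x * ExteriorAlgebra.ι ℝ y =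
      -(ExteriorAlgebra.ι ℝ y * ExteriorAlgebra.ι ℝ x) :=
  eq_neg_of_add_eq_zero_left (ExteriorAlgebra.ι_add_mul_swap x y)

theorem tens_ι_mul (a a' : Dual ℝ T) (b b' : Neg q) :
    tens (ExteriorAlgebra.ι ℝ a) (ExteriorAlgebra.ι ℝ b) *
      tens (ExteriorAlgebra.ι ℝ a') (ExteriorAlgebra.ι ℝ b') =
        -tens (ExteriorAlgebra.ι ℝ a * ExteriorAlgebra.ι ℝ a')
          (ExteriorAlgebra.ι ℝ b * ExteriorAlgebra.ι ℝ b') := by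
  rw [tens_mul_tens _ (ι_mem_gradZ b) (ι_mem_gradT a')]
  simp

/-- An exchange of two factors of bidegree `(1, 1)` changes the sign once in `⋀ T^*` and once in `⋀
z₀`. -/
theorem commute_biOfOneForm (l l' : T →L[ℝ] Neg q) :
    Commute (biOfOneForm l) (biOfOneForm l') := by
  rw [biOfOneForm_eq, biOfOneForm_eq]
  refine Commute.sum_left _ _ _ fun i _ => Commute.sum_right _ _ _ fun j _ => ?_
  change _ * _ = _ * _
  rw [tens_ι_mul, tens_ι_mul, ι_mul_ι_comm (coordForm l i), ι_mul_ι_comm (stdBasis q i),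
    tens_neg_neg]

theorem tens_ι_mul_tens {k : ℕ} (a : Dual ℝ T) (e : Neg q) {a' : ExteriorAlgebra ℝ (Dual ℝ T)}
    (ha' : a' ∈ gradT T k) (b' : ExteriorAlgebra ℝ (Neg q)) :
    tens (ExteriorAlgebra.ι ℝ a) (ExteriorAlgebra.ι ℝ e) * tens a' b' =
      ((-1 : ℝ) ^ k) • tens (ExteriorAlgebra.ι ℝ a * a') (ExteriorAlgebra.ι ℝ e * b') := by
  rw [tens_mul_tens _ (ι_mem_gradZ e) ha', one_mul]

theorem ιMulti_mem_gradT (k : ℕ) (f : Fin k → Dual ℝ T) :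
    ExteriorAlgebra.ιMulti ℝ k f ∈ gradT T k :=
  ExteriorAlgebra.ιMulti_range ℝ k ⟨f, rfl⟩

theorem ιMulti_mem_gradZ (k : ℕ) (f : Fin k → Neg q) :
    ExteriorAlgebra.ιMulti ℝ k f ∈ gradZ q k :=
  ExteriorAlgebra.ιMulti_range ℝ k ⟨f, rfl⟩

/-- In the inductive step the vector of the new factor moves past `k` covectors, at the cost of
`(-1) ^ k`; these exponents add up to a triangular number. -/
theorem biOfOneForm_pow (l : T →L[ℝ] Neg q) (k : ℕ) :
    biOfOneForm l ^ k = ((-1 : ℝ) ^ (k * (k - 1) / 2)) • ∑ j : Fin k → Fin q,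
      tens (ExteriorAlgebra.ιMulti ℝ k fun i => coordForm l (j i))
        (ExteriorAlgebra.ιMulti ℝ k fun i => stdBasis q (j i)) := by
  induction k with
  | zero =>
    simp [tens]
    rfl
  | succ k ih =>
    rw [pow_succ', ih, mul_smul_comm, biOfOneForm_eq, Finset.sum_mul,
      ← (Fin.consEquiv fun _ => Fin q).sum_comp, Fintype.sum_prod_type]
    simp_rw [Finset.mul_sum, Finset.smul_sum]
    refine Finset.sum_congr rfl fun i _ => Finset.sum_congr rfl fun j _ => ?_
    rw [tens_ι_mul_tens _ _ (ιMulti_mem_gradT k _), smul_smul, ← pow_add]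
    congr 1
    · congr 1
      have h := Nat.triangle_succ k
      simp only [Nat.add_sub_cancel] at h ⊢
      omega
    · rw [ExteriorAlgebra.ιMulti_succ_apply, ExteriorAlgebra.ιMulti_succ_apply]
      rfl

theorem biOfOneForm_pow_eq_zero (l : T →L[ℝ] Neg q) {k : ℕ} (hk : q < k) :
    biOfOneForm l ^ k = 0 := by
  rw [biOfOneForm_pow, Finset.sum_eq_zero, smul_zero]
  intro j _
  have : ¬ Function.Injective fun i => stdBasis q (j i) := by
    intro h
    have h2 : Function.Injective j := fun a b hab => h (by simp [hab])
    have := Fintype.card_le_of_injective j h2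
    simp at this
    omega
  rw [ExteriorAlgebra.ιMulti_eq_zero_of_not_inj this, tens_zero_right]

theorem berezinZ_ιMulti (f : Fin q → Neg q) :
    berezinZ (ExteriorAlgebra.ιMulti ℝ q f) = (stdBasis q).det f := by
  have h : (GradedAlgebra.proj (gradZ q) q |>.codRestrict (gradZ q q)
      (fun x => by simp [GradedAlgebra.proj_apply])) (ExteriorAlgebra.ιMulti ℝ q f) =
        exteriorPower.ιMulti ℝ q f := by
    apply Subtype.ext
    change (DirectSum.decompose (gradZ q) (ExteriorAlgebra.ιMulti ℝ q f) q :
      ExteriorAlgebra ℝ (Neg q)) = _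
    rw [DirectSum.decompose_of_mem_same _ (ιMulti_mem_gradZ q f)]
    rfl
  rw [berezinZ, LinearMap.comp_apply, h, exteriorPower.alternatingMapLinearEquiv_apply_ιMulti]

theorem berezinZ_of_ne {k : ℕ} (hk : k ≠ q) {b : ExteriorAlgebra ℝ (Neg q)} (hb : b ∈ gradZ q k) :
    berezinZ b = 0 := by
  rw [berezinZ, LinearMap.comp_apply]
  refine (congrArg _ ?_).trans (LinearMap.map_zero _)
  apply Subtype.ext
  change (DirectSum.decompose (gradZ q) b q : ExteriorAlgebra ℝ (Neg q)) = _
  rw [DirectSum.decompose_of_mem_ne _ hb hk]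
  rfl

theorem berezin_tens (a : ExteriorAlgebra ℝ (Dual ℝ T)) (b : ExteriorAlgebra ℝ (Neg q)) :
    berezin (tens a b) = berezinZ b • a := by
  have h : berezin (tens a b) = TensorProduct.rid ℝ (ExteriorAlgebra ℝ (Dual ℝ T))
    (TensorProduct.map LinearMap.id berezinZ (a ⊗ₜ[ℝ] b)) := rfl
  rw [h, TensorProduct.map_tmul, TensorProduct.rid_tmul]
  rfl

theorem toForm_add (k : ℕ) (a b : ExteriorAlgebra ℝ (Dual ℝ T)) :
    toForm k (a + b) = toForm k a + toForm k b := by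
  ext x
  simp [toForm]

theorem toForm_smul (k : ℕ) (c : ℝ) (a : ExteriorAlgebra ℝ (Dual ℝ T)) :
    toForm k (c • a) = c • toForm k a := by
  ext x
  have h : DirectSum.decompose (gradT T) (c • a) k = c • DirectSum.decompose (gradT T) a k := by
    rw [DirectSum.decompose_smul]
    rfl
  simp only [toForm, h, map_smul, LinearMap.compAlternatingMap_apply, LinearMap.smul_apply,
    AlternatingMap.smul_apply]

theorem toForm_ιMulti (k : ℕ) (f : Fin k → Dual ℝ T) (x : Fin k → T) :
    toForm k (ExteriorAlgebra.ιMulti ℝ k f) x = (Matrix.of fun i j => f j (x i)).det := by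
  have h : DirectSum.decompose (gradT T) (ExteriorAlgebra.ιMulti ℝ k f) k =
      exteriorPower.ιMulti ℝ k f := by
    apply Subtype.ext
    rw [DirectSum.decompose_of_mem_same _ (ιMulti_mem_gradT k f)]
    rfl
  simp only [toForm, LinearMap.compAlternatingMap_apply, h]
  rw [exteriorPower.pairingDual_ιMulti_ιMulti]

/-- The Berezin integral of a bigraded element, as a `q`-form on `T` evaluated at `x`. -/
def berezinAt (x : Fin q → T) : BiForms T q →ₗ[ℝ] ℝ where
  toFun a := toForm q (berezin a) x
  map_add' a b := by simp [toForm_add]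
  map_smul' c a := by simp [toForm_smul]

theorem berezinAt_apply (x : Fin q → T) (a : BiForms T q) :
    berezinAt x a = toForm q (berezin a) x := rfl

theorem berezinAt_tens (x : Fin q → T) (a : ExteriorAlgebra ℝ (Dual ℝ T))
    (b : ExteriorAlgebra ℝ (Neg q)) : berezinAt x (tens a b) = berezinZ b * toForm q a x := by
  rw [berezinAt_apply, berezin_tens, toForm_smul, AlternatingMap.smul_apply, smul_eq_mul]

theorem berezinAt_pow_of_ne (x : Fin q → T) (l : T →L[ℝ] Neg q) {k : ℕ} (hk : k ≠ q) :
    berezinAt x (biOfOneForm l ^ k) = 0 := by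
  rw [biOfOneForm_pow, map_smul, map_sum, Finset.sum_eq_zero, smul_zero]
  intro j _
  rw [berezinAt_tens, berezinZ_of_ne hk (ιMulti_mem_gradZ k _), zero_mul]

/-- Only bijective families of indices survive the Berezin integral. Each of the `q!` permutations
contributes the same determinant, since its sign enters once from `⋀ z₀` and once from the columns.
-/
theorem berezinAt_pow (x : Fin q → T) (l : T →L[ℝ] Neg q) :
    berezinAt x (biOfOneForm l ^ q) =
      (-1 : ℝ) ^ (q * (q - 1) / 2) * q.factorial * (Matrix.of fun i j => l (x i) j).det := by
  have h1 : ∀ j : Fin q → Fin q, berezinAt x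
      (tens (ExteriorAlgebra.ιMulti ℝ q fun i => coordForm l (j i))
        (ExteriorAlgebra.ιMulti ℝ q fun i => stdBasis q (j i))) =
      (stdBasis q).det (fun i => stdBasis q (j i)) * (Matrix.of fun i m => l (x i) (j m)).det := by
    intro j
    rw [berezinAt_tens, berezinZ_ιMulti, toForm_ιMulti]
    simp_rw [coordForm_apply]
  rw [biOfOneForm_pow, map_smul, map_sum, smul_eq_mul, mul_assoc]
  congr 1
  simp_rw [h1]
  have h2 : ∀ j : Fin q → Fin q, ¬ Function.Bijective j →
      (stdBasis q).det (fun i => stdBasis q (j i)) = 0 := by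
    intro j hj
    apply AlternatingMap.map_eq_zero_of_not_injective
    intro hinj
    apply hj
    rw [Finite.injective_iff_bijective.symm]
    exact fun a b hab => hinj (by simp [hab])
  have h3 : ∀ σ : Equiv.Perm (Fin q), (stdBasis q).det (fun i => stdBasis q (σ i)) *
      (Matrix.of fun i m => l (x i) (σ m)).det = (Matrix.of fun i j => l (x i) j).det := by
    intro σ
    have e1 : (stdBasis q).det (fun i => stdBasis q (σ i)) = (Equiv.Perm.sign σ : ℤ) := by
      have := (stdBasis q).det.map_perm (stdBasis q) σ
      rw [Basis.det_self] at this
      refine Eq.trans ?_ (this.trans ?_)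
      · rfl
      · rw [Units.smul_def]; simp
    have e2 : (Matrix.of fun i m => l (x i) (σ m)).det =
        (Equiv.Perm.sign σ : ℤ) * (Matrix.of fun i j => l (x i) j).det := by
      exact Matrix.det_permute' σ (Matrix.of fun i j => l (x i) j)
    rw [e1, e2, ← mul_assoc, ← Int.cast_mul, ← Units.val_mul, Int.units_mul_self]
    simp
  calc ∑ j : Fin q → Fin q, (stdBasis q).det (fun i => stdBasis q (j i)) *
        (Matrix.of fun i m => l (x i) (j m)).det
      = ∑ j : Fin q → Fin q with Function.Bijective j,
          (stdBasis q).det (fun i => stdBasis q (j i)) *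
            (Matrix.of fun i m => l (x i) (j m)).det := by
        rw [Finset.sum_filter]
        refine Finset.sum_congr rfl fun j _ => ?_
        split_ifs with h
        · rfl
        · rw [h2 j h, zero_mul]
    _ = ∑ σ : Equiv.Perm (Fin q), (stdBasis q).det (fun i => stdBasis q (σ i)) *
          (Matrix.of fun i m => l (x i) (σ m)).det := by
        symm
        refine Finset.sum_bij (fun (σ : Equiv.Perm (Fin q)) _ => (σ : Fin q → Fin q)) ?_ ?_ ?_ ?_
        · intro σ _
          exact Finset.mem_filter.2 ⟨Finset.mem_univ _, σ.bijective⟩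
        · intro a _ b _ h
          exact Equiv.coe_fn_injective h
        · intro j hj
          exact ⟨Equiv.ofBijective j (Finset.mem_filter.1 hj).2, Finset.mem_univ _, rfl⟩
        · intro σ _
          rfl
    _ = _ := by
        simp_rw [h3]
        simp [Fintype.card_perm]

end BiFormsAlgebra

/-! ### The curvature as a sum of squares, and the Berezin integral as a mean of determinants. -/

section Linearization

variable {p q : ℕ} {T : Type} [NormedAddCommGroup T] [NormedSpace ℝ T]

theorem scalarPart_tens (a : ExteriorAlgebra ℝ (Dual ℝ T)) (b : ExteriorAlgebra ℝ (Neg q)) :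
    scalarPart (tens a b) =
      ExteriorAlgebra.algebraMapInv a * ExteriorAlgebra.algebraMapInv b := rfl

theorem scalarPart_algebraMap (c : ℝ) :
    scalarPart (algebraMap ℝ (BiForms T q) c) = c := by
  have h : algebraMap ℝ (BiForms T q) c = tens (algebraMap ℝ _ c) 1 := rfl
  rw [h, scalarPart_tens, map_one, mul_one]
  exact ExteriorAlgebra.algebraMap_leftInverse (R := ℝ) (Dual ℝ T) c

theorem algebraMapInv_ι {M : Type*} [AddCommGroup M] [Module ℝ M] (m : M) :
    ExteriorAlgebra.algebraMapInv (ExteriorAlgebra.ι ℝ m) = 0 := by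
  simp [ExteriorAlgebra.algebraMapInv]

theorem scalarPart_biOfOneForm (l : T →L[ℝ] Neg q) : scalarPart (biOfOneForm l) = 0 := by
  rw [biOfOneForm_eq, map_sum]
  refine Finset.sum_eq_zero fun j _ => ?_
  rw [scalarPart_tens, algebraMapInv_ι, zero_mul]

theorem scalarPart_biOfTwoForm [FiniteDimensional ℝ T] (B : T → T → (Neg q →L[ℝ] Neg q)) :
    scalarPart (biOfTwoForm B) = 0 := by
  rw [biOfTwoForm, map_sum]
  refine Finset.sum_eq_zero fun i _ => ?_
  rw [map_sum]
  refine Finset.sum_eq_zero fun j _ => ?_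
  split_ifs
  · rw [scalarPart_tens, map_mul, algebraMapInv_ι, zero_mul, mul_zero]
  · exact map_zero _

/-- The span of the pure tensors whose second factor has degree at least `k`. -/
def degGE (T : Type) [NormedAddCommGroup T] [NormedSpace ℝ T] (q k : ℕ) :
    Submodule ℝ (BiForms T q) :=
  Submodule.span ℝ {z | ∃ (a : ExteriorAlgebra ℝ (Dual ℝ T)) (j : ℕ) (b : ExteriorAlgebra ℝ (Neg q)),
    k ≤ j ∧ b ∈ gradZ q j ∧ z = tens a b}

theorem degGE_mono {k k' : ℕ} (h : k ≤ k') : degGE T q k' ≤ degGE T q k := by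
  apply Submodule.span_mono
  rintro z ⟨a, j, b, hj, hb, rfl⟩
  exact ⟨a, j, b, h.trans hj, hb, rfl⟩

theorem one_mem_degGE : (1 : BiForms T q) ∈ degGE T q 0 := by
  refine Submodule.subset_span ⟨1, 0, 1, le_rfl, ?_, rfl⟩
  exact SetLike.GradedOne.one_mem

theorem degGE_eq_bot {k : ℕ} (hk : q < k) : degGE T q k = ⊥ := by
  rw [degGE, Submodule.span_eq_bot]
  rintro z ⟨a, j, b, hj, hb, rfl⟩
  have h : finrank ℝ (⋀[ℝ]^j (Neg q)) = 0 := by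
    rw [exteriorPower.finrank_eq, finrank_euclideanSpace_fin, Nat.choose_eq_zero_of_lt (by omega)]
  have h2 : (⟨b, hb⟩ : ⋀[ℝ]^j (Neg q)) = 0 := finrank_zero_iff_forall_zero.1 h _
  have h3 : b = 0 := congrArg Subtype.val h2
  rw [h3, tens_zero_right]

theorem mul_biOfOneForm_mem {k : ℕ} (l : T →L[ℝ] Neg q) {z : BiForms T q} (hz : z ∈ degGE T q k) :
    z * biOfOneForm l ∈ degGE T q (k + 1) := by
  induction hz using Submodule.span_induction with
  | mem z hz =>
    obtain ⟨a, j, b, hj, hb, rfl⟩ := hz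
    rw [biOfOneForm_eq, Finset.mul_sum]
    refine Submodule.sum_mem _ fun i _ => ?_
    rw [tens_mul_tens _ hb (ι_mem_gradT _)]
    refine Submodule.smul_mem _ _ (Submodule.subset_span ⟨_, j + 1, _, by omega, ?_, rfl⟩)
    exact SetLike.GradedMul.mul_mem hb (ι_mem_gradZ _)
  | zero => simp
  | add x y _ _ hx hy =>
    rw [add_mul]
    exact add_mem hx hy
  | smul c x _ hx =>
    rw [smul_mul_assoc]
    exact Submodule.smul_mem _ _ hx

/-- Nilpotency is read off the degree in `⋀ z₀` alone, which cannot exceed `q`. No bound on the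
degree in `⋀ T^*` is needed. -/
theorem pow_eq_zero_of_raises {n : BiForms T q}
    (hn : ∀ k, ∀ z ∈ degGE T q k, z * n ∈ degGE T q (k + 1)) {k : ℕ} (hk : q < k) : n ^ k = 0 := by
  have h : ∀ k, n ^ k ∈ degGE T q k := by
    intro k
    induction k with
    | zero => simpa using one_mem_degGE
    | succ k ih => exact pow_succ n k ▸ hn k _ ih
  have := h k
  rwa [degGE_eq_bot hk, Submodule.mem_bot] at this

/-- The operator-valued form `B` is the sum of the squares of the `z₀`-valued `1`-forms `r α`. -/
def IsSumSq (r : Fin p → T →L[ℝ] Neg q) (B : T → T → (Neg q →L[ℝ] Neg q)) : Prop :=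
  ∀ x y i j, ⟪B x y (stdBasis q i), stdBasis q j⟫ =
    ∑ α, (r α x i * r α y j - r α y i * r α x j)

variable [FiniteDimensional ℝ T]

theorem dual_eq_sum (a : Dual ℝ T) :
    a = ∑ i, a (finBasis ℝ T i) • (finBasis ℝ T).coord i := by
  apply (finBasis ℝ T).ext
  intro j
  simp

/-- The factor `1/2` in `extOfTwoForm` is the one in `a ∧ b = (a ∧ b - b ∧ a) / 2`. -/
theorem extOfTwoForm_wedge (a b : Fin p → Dual ℝ T) :
    extOfTwoForm (fun x y => ∑ α, (a α x * b α y - a α y * b α x)) =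
      ∑ α, ExteriorAlgebra.ι ℝ (a α) * ExteriorAlgebra.ι ℝ (b α) := by
  have key : ∀ a b : Dual ℝ T, ExteriorAlgebra.ι ℝ a * ExteriorAlgebra.ι ℝ b =
      ∑ i, ∑ j, (a (finBasis ℝ T i) * b (finBasis ℝ T j)) •
        (ExteriorAlgebra.ι ℝ ((finBasis ℝ T).coord i) *
          ExteriorAlgebra.ι ℝ ((finBasis ℝ T).coord j)) := by
    intro a b
    conv_lhs => rw [dual_eq_sum a, dual_eq_sum b]
    simp_rw [map_sum, map_smul, Finset.sum_mul, Finset.mul_sum, smul_mul_smul_comm]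
  have h : ∀ α, ExteriorAlgebra.ι ℝ (a α) * ExteriorAlgebra.ι ℝ (b α) = (2⁻¹ : ℝ) •
      (ExteriorAlgebra.ι ℝ (a α) * ExteriorAlgebra.ι ℝ (b α) -
        ExteriorAlgebra.ι ℝ (b α) * ExteriorAlgebra.ι ℝ (a α)) := by
    intro α
    rw [ι_mul_ι_comm (b α), sub_neg_eq_add, ← two_smul ℝ, smul_smul]
    norm_num
  rw [Finset.sum_congr rfl fun α _ => h α, extOfTwoForm, ← Finset.smul_sum]
  congr 1
  have hk : ∀ α, ExteriorAlgebra.ι ℝ (a α) * ExteriorAlgebra.ι ℝ (b α) -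
      ExteriorAlgebra.ι ℝ (b α) * ExteriorAlgebra.ι ℝ (a α) =
      ∑ i, ∑ j, (a α (finBasis ℝ T i) * b α (finBasis ℝ T j) -
        b α (finBasis ℝ T i) * a α (finBasis ℝ T j)) •
        (ExteriorAlgebra.ι ℝ ((finBasis ℝ T).coord i) *
          ExteriorAlgebra.ι ℝ ((finBasis ℝ T).coord j)) := by
    intro α
    rw [key (a α), key (b α)]
    simp only [← Finset.sum_sub_distrib, ← sub_smul]
  rw [Finset.sum_congr rfl fun α _ => hk α, Finset.sum_comm (s := (Finset.univ : Finset (Fin p)))]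
  refine Finset.sum_congr rfl fun i _ => ?_
  rw [Finset.sum_comm (s := (Finset.univ : Finset (Fin p)))]
  refine Finset.sum_congr rfl fun j _ => ?_
  rw [Finset.sum_smul]
  refine Finset.sum_congr rfl fun α _ => ?_
  congr 1
  ring

theorem sum_sum_eq_two_smul {M : Type*} [AddCommGroup M] [Module ℝ M] (f : Fin q → Fin q → M)
    (hs : ∀ i j, f i j = f j i) (hd : ∀ i, f i i = 0) :
    ∑ i, ∑ j, f i j = (2 : ℝ) • ∑ i, ∑ j, if i < j then f i j else 0 := by
  have h1 : ∀ i j, f i j = (if i < j then f i j else 0) + (if j < i then f j i else 0) := by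
    intro i j
    rcases lt_trichotomy i j with h | h | h
    · simp [h, h.not_gt]
    · subst h; simp [hd]
    · simp [h, h.not_gt, hs i j]
  calc ∑ i, ∑ j, f i j = ∑ i, ∑ j, ((if i < j then f i j else 0) + (if j < i then f j i else 0)) :=
        Finset.sum_congr rfl fun i _ => Finset.sum_congr rfl fun j _ => h1 i j
    _ = _ := by
        simp_rw [Finset.sum_add_distrib]
        rw [two_smul]
        congr 1
        exact Finset.sum_comm

/-- The square of `∑ rʲ ⊗ e_j` is `-∑ (rⁱ ∧ rʲ) ⊗ (e_i ∧ e_j)`, with the sign of the graded product.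
Its terms are symmetric in `i` and `j`, hence twice the sum over `i < j`. The sign obtained is the
one that calls for imaginary Gaussian variables. -/
theorem biOfTwoForm_eq {r : Fin p → T →L[ℝ] Neg q} {B : T → T → (Neg q →L[ℝ] Neg q)}
    (hB : IsSumSq r B) : biOfTwoForm B = -((1 / 2 : ℝ) • ∑ α, biOfOneForm (r α) ^ 2) := by
  have h1 : ∀ α, biOfOneForm (r α) ^ 2 = -((2 : ℝ) • ∑ i, ∑ j, if i < j then
      tens (ExteriorAlgebra.ι ℝ (coordForm (r α) i) * ExteriorAlgebra.ι ℝ (coordForm (r α) j))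
        (ExteriorAlgebra.ι ℝ (stdBasis q i) * ExteriorAlgebra.ι ℝ (stdBasis q j)) else 0) := by
    intro α
    rw [pow_two, biOfOneForm_eq, Finset.sum_mul]
    simp_rw [Finset.mul_sum, tens_ι_mul, Finset.sum_neg_distrib]
    rw [sum_sum_eq_two_smul]
    · intro i j
      rw [ι_mul_ι_comm (coordForm (r α) i), ι_mul_ι_comm (stdBasis q i), tens_neg_neg]
    · intro i
      rw [ExteriorAlgebra.ι_sq_zero (stdBasis q i), tens_zero_right]
  have h2 : ∀ i j, extOfTwoForm (fun x y => ⟪B x y (stdBasis q i), stdBasis q j⟫) =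
      ∑ α, ExteriorAlgebra.ι ℝ (coordForm (r α) i) * ExteriorAlgebra.ι ℝ (coordForm (r α) j) := by
    intro i j
    rw [← extOfTwoForm_wedge]
    congr 1
    funext x y
    rw [hB x y i j]
    simp_rw [coordForm_apply]
  simp_rw [h1, Finset.sum_neg_distrib, ← Finset.smul_sum]
  rw [smul_neg, neg_neg, smul_smul]
  norm_num only [one_smul]
  rw [biOfTwoForm, Finset.sum_comm (s := (Finset.univ : Finset (Fin p)))]
  refine Finset.sum_congr rfl fun i _ => ?_
  rw [Finset.sum_comm (s := (Finset.univ : Finset (Fin p)))]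
  refine Finset.sum_congr rfl fun j _ => ?_
  split_ifs with hij
  · rw [h2, tens_sum_left]
  · simp

theorem mul_biOfTwoForm_mem {r : Fin p → T →L[ℝ] Neg q} {B : T → T → (Neg q →L[ℝ] Neg q)}
    (hB : IsSumSq r B) {k : ℕ} {z : BiForms T q} (hz : z ∈ degGE T q k) :
    z * biOfTwoForm B ∈ degGE T q (k + 1) := by
  rw [biOfTwoForm_eq hB, mul_neg, mul_smul_comm, Finset.mul_sum]
  refine neg_mem (Submodule.smul_mem _ _ (Submodule.sum_mem _ fun α _ => ?_))
  rw [pow_two, ← mul_assoc]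
  exact degGE_mono (by omega) (mul_biOfOneForm_mem _ (mul_biOfOneForm_mem _ hz))

/-- The Berezin integral of the exponential, as a combination of determinants. -/
theorem toForm_berezin_expB (c : ℝ) (l : T →L[ℝ] Neg q) {r : Fin p → T →L[ℝ] Neg q}
    {B : T → T → (Neg q →L[ℝ] Neg q)} (hB : IsSumSq r B) (x : Fin q → T) :
    toForm q (berezin (expB (algebraMap ℝ (BiForms T q) c + biOfOneForm l + biOfTwoForm B))) x =
      Real.exp c * (-1) ^ (q * (q - 1) / 2) * quadE (q + 1) p fun t =>
        (Matrix.of fun i j => l (x i) j + ∑ α, t α * r α (x i) j).det := by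
  -- `IsNilpotent.exp` is defined over a `ℚ`-module.
  let _ : Module ℚ (BiForms T q) := Module.compHom _ (algebraMap ℚ ℝ)
  have hs : scalarPart (algebraMap ℝ (BiForms T q) c + biOfOneForm l + biOfTwoForm B) = c := by
    rw [map_add, map_add, scalarPart_algebraMap, scalarPart_biOfOneForm, scalarPart_biOfTwoForm]
    simp
  have hnil : ∀ k, q < k → (biOfOneForm l + biOfTwoForm B) ^ k = 0 := by
    intro k hk
    refine pow_eq_zero_of_raises (fun k z hz => ?_) hk
    rw [mul_add]
    exact add_mem (mul_biOfOneForm_mem _ hz) (mul_biOfTwoForm_mem hB hz)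
  have hexp : expB (algebraMap ℝ (BiForms T q) c + biOfOneForm l + biOfTwoForm B) =
      Real.exp c • IsNilpotent.exp (biOfOneForm l + biOfTwoForm B) := by
    rw [expB, hs, nilExp_eq_sum (hnil (finrank ℝ T + q + 1) (by omega))]
    congr 1
    refine Finset.sum_congr rfl fun k _ => ?_
    congr 2
    abel
  -- For a single linear form, the Berezin integral keeps only the term of order `q` of the
  -- exponential, and its `1 / q!` cancels the number of permutations.
  have hone : ∀ l' : T →L[ℝ] Neg q, berezinAt x (IsNilpotent.exp (biOfOneForm l')) =
      (-1) ^ (q * (q - 1) / 2) * (Matrix.of fun i j => l' (x i) j).det := by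
    intro l'
    rw [nilExp_eq_sum (biOfOneForm_pow_eq_zero l' (Nat.lt_succ_self q)), map_sum,
      Finset.sum_eq_single q]
    · rw [map_smul, berezinAt_pow, smul_eq_mul]
      have : (q.factorial : ℝ) ≠ 0 := by positivity
      field_simp
    · intro k _ hk
      rw [map_smul, berezinAt_pow_of_ne x l' hk, smul_zero]
    · intro h
      simp at h
  -- Order `q` would be enough here. Order `q + 1` leaves room for the integration by parts against
  -- determinants, which are polynomials of degree at most `q`.
  rw [← berezinAt_apply, hexp, biOfTwoForm_eq hB, ← sub_eq_add_neg, quad_nilExp (N := q + 1)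
    (fun i => commute_biOfOneForm _ _) (fun i j => commute_biOfOneForm _ _)
    ⟨q + 1, biOfOneForm_pow_eq_zero l (Nat.lt_succ_self q)⟩
    (fun i => biOfOneForm_pow_eq_zero _ (by omega)), map_smul, smul_eq_mul,
    mul_assoc]
  congr 1
  rw [map_sum, quadE, Finset.mul_sum]
  refine Finset.sum_congr rfl fun s _ => ?_
  simp_rw [← biOfOneForm_smul]
  rw [← biOfOneForm_sum, ← biOfOneForm_add, map_smul, hone, smul_eq_mul, mul_left_comm]
  congr 4
  ext i j
  simp

end Linearization

/-! ### Forms on a finite-dimensional space and their smooth dependence on parameters. -/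

section Forms

variable {T : Type*} [NormedAddCommGroup T] [NormedSpace ℝ T] [FiniteDimensional ℝ T]

theorem multilinear_expand {n : ℕ} (f : MultilinearMap ℝ (fun _ : Fin n => T) ℝ) (x : Fin n → T) :
    f x = ∑ j : Fin n → Fin (finrank ℝ T),
      (∏ i, (finBasis ℝ T).coord (j i) (x i)) * f fun i => finBasis ℝ T (j i) := by
  conv_lhs => rw [show x = fun i => ∑ k, (finBasis ℝ T).coord k (x i) • finBasis ℝ T k from
    funext fun i => ((finBasis ℝ T).sum_repr (x i)).symm]
  rw [MultilinearMap.map_sum]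
  refine Finset.sum_congr rfl fun j _ => ?_
  rw [MultilinearMap.map_smul_univ, smul_eq_mul]

theorem contDiff_coord (k : Fin (finrank ℝ T)) (n : WithTop ℕ∞) :
    ContDiff ℝ n ((finBasis ℝ T).coord k) :=
  ((finBasis ℝ T).coord k).toContinuousLinearMap.contDiff

/-- An alternating map on a finite dimensional space, as a continuous alternating map. -/
def altToCont {n : ℕ} (f : T [⋀^Fin n]→ₗ[ℝ] ℝ) : T [⋀^Fin n]→L[ℝ] ℝ :=
  { f with
    cont := by
      have h : (f : (Fin n → T) → ℝ) = fun x => ∑ j : Fin n → Fin (finrank ℝ T),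
          (∏ i, (finBasis ℝ T).coord (j i) (x i)) * f fun i => finBasis ℝ T (j i) := by
        funext x
        exact multilinear_expand f.toMultilinearMap x
      change Continuous (f : (Fin n → T) → ℝ)
      rw [h]
      refine continuous_finsetSum _ fun j _ => Continuous.mul (continuous_finsetProd _
        fun i _ => ?_) continuous_const
      exact ((contDiff_coord (j i) 0).continuous).comp (continuous_apply i) }

@[simp]
theorem altToCont_apply {n : ℕ} (f : T [⋀^Fin n]→ₗ[ℝ] ℝ) (x : Fin n → T) :
    altToCont f x = f x := rfl

/-- The values of a form on the tuples of vectors of a basis. -/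
def basisEval (T : Type*) [NormedAddCommGroup T] [NormedSpace ℝ T] [FiniteDimensional ℝ T] (n : ℕ) :
    (T [⋀^Fin n]→L[ℝ] ℝ) →ₗ[ℝ] ((Fin n → Fin (finrank ℝ T)) → ℝ) where
  toFun f j := f fun i => finBasis ℝ T (j i)
  map_add' _ _ := rfl
  map_smul' _ _ := rfl

theorem basisEval_injective (n : ℕ) : Function.Injective (basisEval T n) := by
  intro f g h
  ext x
  have hf := multilinear_expand f.toMultilinearMap x
  have hg := multilinear_expand g.toMultilinearMap x
  refine hf.trans (Eq.trans ?_ hg.symm)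
  refine Finset.sum_congr rfl fun j _ => ?_
  congr 1
  exact congrFun h j

instance finiteDimensional_form (n : ℕ) : FiniteDimensional ℝ (T [⋀^Fin n]→L[ℝ] ℝ) :=
  Module.Finite.of_injective (basisEval T n) (basisEval_injective n)

variable {E : Type*} [NormedAddCommGroup E] [NormedSpace ℝ E]

/-- The values on tuples of basis vectors embed the space of forms in a finite product of lines, and
this linear embedding has a linear left inverse. -/
theorem contDiffOn_form_of_eval {n : ℕ} {m : WithTop ℕ∞} {η : E → T [⋀^Fin n]→L[ℝ] ℝ} {s : Set E}
    (h : ∀ x : Fin n → T, ContDiffOn ℝ m (fun e => η e x) s) : ContDiffOn ℝ m η s := by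
  obtain ⟨g, hg⟩ := (basisEval T n).exists_leftInverse_of_injective
    (LinearMap.ker_eq_bot.2 (basisEval_injective n))
  have h1 : η = fun e => g.toContinuousLinearMap (fun j => η e fun i => finBasis ℝ T (j i)) := by
    funext e
    exact (congrArg (fun f => f (η e)) hg).symm
  rw [h1]
  exact g.toContinuousLinearMap.contDiff.comp_contDiffOn (contDiffOn_pi.2 fun j => h _)

theorem contDiffOn_form_apply {n : ℕ} {m : WithTop ℕ∞} {η : E → T [⋀^Fin n]→L[ℝ] ℝ} {s : Set E}
    {x : E → Fin n → T} (hη : ContDiffOn ℝ m η s) (hx : ∀ i, ContDiffOn ℝ m (fun e => x e i) s) :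
    ContDiffOn ℝ m (fun e => η e (x e)) s := by
  have h : (fun e => η e (x e)) = fun e => ∑ j : Fin n → Fin (finrank ℝ T),
      (∏ i, (finBasis ℝ T).coord (j i) (x e i)) * η e fun i => finBasis ℝ T (j i) := by
    funext e
    exact multilinear_expand (η e).toMultilinearMap (x e)
  rw [h]
  refine ContDiffOn.sum fun j _ => ContDiffOn.mul (contDiffOn_prod fun i _ => ?_) ?_
  · exact (contDiff_coord (j i) m).comp_contDiffOn (hx i)
  · let ev : (T [⋀^Fin n]→L[ℝ] ℝ) →ₗ[ℝ] ℝ :=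
      ⟨⟨fun f => f fun i => finBasis ℝ T (j i), fun _ _ => rfl⟩, fun _ _ => rfl⟩
    exact ev.toContinuousLinearMap.contDiff.comp_contDiffOn hη

theorem contDiffOn_form_comp {T' : Type*} [NormedAddCommGroup T'] [NormedSpace ℝ T']
    [FiniteDimensional ℝ T'] {n : ℕ} {m : WithTop ℕ∞}
    {η : E → T [⋀^Fin n]→L[ℝ] ℝ} {s : Set E} {A : E → T' →L[ℝ] T}
    (hη : ContDiffOn ℝ m η s) (hA : ContDiffOn ℝ m A s) :
    ContDiffOn ℝ m (fun e => (η e).compContinuousLinearMap (A e)) s := by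
  refine contDiffOn_form_of_eval fun x => ?_
  exact contDiffOn_form_apply (x := fun e i => A e (x i)) hη
    fun i => hA.clm_apply contDiffOn_const

end Forms

/-! ### The Berezin integral as a smooth function of the exponent. -/

section BerezinForm

variable {p q : ℕ} {T : Type} [NormedAddCommGroup T] [NormedSpace ℝ T] [FiniteDimensional ℝ T]

/-- `∫^B exp(l + B)` as a `q`-form on `T`. -/
def mqForm (l : T →L[ℝ] Neg q) (B : T →L[ℝ] T →L[ℝ] (Neg q →L[ℝ] Neg q)) : T [⋀^Fin q]→L[ℝ] ℝ :=
  altToCont (toForm q (berezin (expB (algebraMap ℝ (BiForms T q) 0 + biOfOneForm l +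
    biOfTwoForm fun x y => B x y))))

theorem mqForm_apply (l : T →L[ℝ] Neg q) {B : T →L[ℝ] T →L[ℝ] (Neg q →L[ℝ] Neg q)}
    {r : Fin p → T →L[ℝ] Neg q} (hB : IsSumSq r fun x y => B x y) (x : Fin q → T) :
    mqForm l B x = (-1) ^ (q * (q - 1) / 2) * quadE (q + 1) p fun t =>
      (Matrix.of fun i j => l (x i) j + ∑ α, t α * r α (x i) j).det := by
  rw [mqForm, altToCont_apply, toForm_berezin_expB 0 l hB, Real.exp_zero, one_mul]

/-- The exponent `l + B` as a linear function of `(l, B)`. -/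
def expoₗ : ((T →L[ℝ] Neg q) × (T →L[ℝ] T →L[ℝ] (Neg q →L[ℝ] Neg q))) →ₗ[ℝ] BiForms T q where
  toFun a := biOfOneForm a.1 + biOfTwoForm fun x y => a.2 x y
  map_add' a b := by
    have h : ∀ B B' : T →L[ℝ] T →L[ℝ] (Neg q →L[ℝ] Neg q),
        biOfTwoForm (fun x y => (B + B') x y) =
          biOfTwoForm (fun x y => B x y) + biOfTwoForm fun x y => B' x y := by
      intro B B'
      simp only [biOfTwoForm, ← Finset.sum_add_distrib]
      refine Finset.sum_congr rfl fun i _ => Finset.sum_congr rfl fun j _ => ?_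
      split_ifs
      · rw [← tens_add_left]
        congr 1
        simp only [extOfTwoForm, ← smul_add, ← Finset.sum_add_distrib, ← add_smul, add_apply,
          inner_add_left]
      · simp
    rw [Prod.fst_add, Prod.snd_add, biOfOneForm_add, h]
    abel
  map_smul' c a := by
    have h : ∀ B : T →L[ℝ] T →L[ℝ] (Neg q →L[ℝ] Neg q),
        biOfTwoForm (fun x y => (c • B) x y) = c • biOfTwoForm (fun x y => B x y) := by
      intro B
      simp only [biOfTwoForm, Finset.smul_sum]
      refine Finset.sum_congr rfl fun i _ => Finset.sum_congr rfl fun j _ => ?_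
      split_ifs
      · rw [← tens_smul_left]
        congr 1
        simp only [extOfTwoForm, Finset.smul_sum, smul_smul, smul_apply,
          real_inner_smul_left]
        refine Finset.sum_congr rfl fun i _ => Finset.sum_congr rfl fun j _ => ?_
        congr 1
        ring
      · simp
    rw [Prod.smul_fst, Prod.smul_snd, biOfOneForm_smul, h, RingHom.id_apply, smul_add]

/-- The algebra `A` carries no topology. The `k`-linear map behind the power is expanded in a basis
of `M`, which exhibits a polynomial in the coordinates. -/
theorem contDiff_linear_pow {M A : Type*} [NormedAddCommGroup M] [NormedSpace ℝ M]
    [FiniteDimensional ℝ M] [Ring A] [Algebra ℝ A] (n : M →ₗ[ℝ] A) (φ : A →ₗ[ℝ] ℝ) (k : ℕ)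
    (m : WithTop ℕ∞) : ContDiff ℝ m fun a => φ (n a ^ k) := by
  let f : MultilinearMap ℝ (fun _ : Fin k => M) ℝ :=
    φ.compMultilinearMap ((MultilinearMap.mkPiAlgebraFin ℝ k A).compLinearMap fun _ => n)
  have h : (fun a => φ (n a ^ k)) = fun a => ∑ j : Fin k → Fin (finrank ℝ M),
      (∏ i, (finBasis ℝ M).coord (j i) a) * f fun i => finBasis ℝ M (j i) := by
    funext a
    rw [← multilinear_expand f fun _ => a]
    simp [f]
  rw [h]
  exact ContDiff.sum fun j _ => (contDiff_prod fun i _ => contDiff_coord _ _).mul contDiff_const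

theorem contDiff_mqForm (m : WithTop ℕ∞) : ContDiff ℝ m
    fun a : (T →L[ℝ] Neg q) × (T →L[ℝ] T →L[ℝ] (Neg q →L[ℝ] Neg q)) => mqForm a.1 a.2 := by
  rw [← contDiffOn_univ]
  refine contDiffOn_form_of_eval fun x => ?_
  rw [contDiffOn_univ]
  have h : ∀ a : (T →L[ℝ] Neg q) × (T →L[ℝ] T →L[ℝ] (Neg q →L[ℝ] Neg q)), mqForm a.1 a.2 x =
      ∑ k ∈ Finset.range (finrank ℝ T + q + 1),
        (k.factorial : ℝ)⁻¹ * berezinAt x (expoₗ a ^ k) := by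
    intro a
    have hs : scalarPart (algebraMap ℝ (BiForms T q) 0 + biOfOneForm a.1 +
        biOfTwoForm fun x y => a.2 x y) = 0 := by
      rw [map_add, map_add, scalarPart_algebraMap, scalarPart_biOfOneForm, scalarPart_biOfTwoForm]
      simp
    rw [mqForm, altToCont_apply, ← berezinAt_apply, expB, hs, Real.exp_zero, one_smul, map_sum]
    refine Finset.sum_congr rfl fun k _ => ?_
    rw [map_smul, smul_eq_mul, map_zero, sub_zero, zero_add]
    rfl
  simp_rw [h]
  exact ContDiff.sum fun k _ => contDiff_const.mul (contDiff_linear_pow _ _ _ _)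

end BerezinForm

open scoped InnerProduct

/-! ### Shortcut instances -/

scoped instance : FiniteDimensional ℝ (HomZ p q) := inferInstance
scoped instance : T2Space (HomZ p q) := TopologicalSpace.t2Space_of_metrizableSpace
scoped instance : CompleteSpace (HomZ p q) := FiniteDimensional.complete ℝ _
scoped instance : ContinuousSMul ℝ (HomZ p q) := IsBoundedSMul.continuousSMul
scoped instance : IsTopologicalAddGroup (HomZ p q) := inferInstance
scoped instance : FiniteDimensional ℝ (Neg q →L[ℝ] Neg q) := inferInstance
scoped instance : T2Space (Neg q →L[ℝ] Neg q) := TopologicalSpace.t2Space_of_metrizableSpace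
scoped instance : CompleteSpace (Neg q →L[ℝ] Neg q) := FiniteDimensional.complete ℝ _
scoped instance : ContinuousSMul ℝ (Neg q →L[ℝ] Neg q) := IsBoundedSMul.continuousSMul
scoped instance : IsTopologicalAddGroup (Neg q →L[ℝ] Neg q) := inferInstance
scoped instance : HasSummableGeomSeries (Neg q →L[ℝ] Neg q) := inferInstance
scoped instance : FiniteDimensional ℝ (Pos p →L[ℝ] Pos p) := inferInstance
scoped instance : T2Space (Pos p →L[ℝ] Pos p) := TopologicalSpace.t2Space_of_metrizableSpace
scoped instance : CompleteSpace (Pos p →L[ℝ] Pos p) := FiniteDimensional.complete ℝ _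
scoped instance : ContinuousSMul ℝ (Pos p →L[ℝ] Pos p) := IsBoundedSMul.continuousSMul
scoped instance : IsTopologicalAddGroup (Pos p →L[ℝ] Pos p) := inferInstance
scoped instance : HasSummableGeomSeries (Pos p →L[ℝ] Pos p) := inferInstance
scoped instance : FiniteDimensional ℝ (Pos p →L[ℝ] Neg q) := inferInstance
scoped instance : T2Space (Pos p →L[ℝ] Neg q) := TopologicalSpace.t2Space_of_metrizableSpace
scoped instance : CompleteSpace (Pos p →L[ℝ] Neg q) := FiniteDimensional.complete ℝ _
scoped instance : ContinuousSMul ℝ (Pos p →L[ℝ] Neg q) := IsBoundedSMul.continuousSMul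
scoped instance : IsTopologicalAddGroup (Pos p →L[ℝ] Neg q) := inferInstance
scoped instance : FiniteDimensional ℝ (EndV p q) := inferInstance
scoped instance : T2Space (EndV p q) := TopologicalSpace.t2Space_of_metrizableSpace
scoped instance : CompleteSpace (EndV p q) := FiniteDimensional.complete ℝ _
scoped instance : ContinuousSMul ℝ (EndV p q) := IsBoundedSMul.continuousSMul
scoped instance : IsTopologicalAddGroup (EndV p q) := inferInstance
scoped instance : HasSummableGeomSeries (EndV p q) := inferInstance
scoped instance : NormedSpace ℝ (HomZ p q) := inferInstance
scoped instance : NormedSpace ℝ (EndV p q) := inferInstance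
scoped instance : NormedAlgebra ℝ (EndV p q) := inferInstance
scoped instance : NormedSpace ℝ (HomZ p q × Neg q) := inferInstance
scoped instance : NormedSpace ℝ (lieG p q × Neg q) := inferInstance
scoped instance : FiniteDimensional ℝ (HomZ p q × Neg q) := inferInstance
scoped instance : FiniteDimensional ℝ (lieG p q × Neg q) := inferInstance
scoped instance : NormedAddCommGroup ((HomZ p q × Neg q) →L[ℝ] Neg q) := inferInstance
scoped instance : NormedSpace ℝ ((HomZ p q × Neg q) →L[ℝ] Neg q) := inferInstance
scoped instance : NormedAddCommGroup
    ((HomZ p q × Neg q) →L[ℝ] (HomZ p q × Neg q) →L[ℝ] (Neg q →L[ℝ] Neg q)) := inferInstance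
scoped instance : NormedSpace ℝ
    ((HomZ p q × Neg q) →L[ℝ] (HomZ p q × Neg q) →L[ℝ] (Neg q →L[ℝ] Neg q)) := inferInstance
scoped instance : IsBoundedSMul ℝ
    ((HomZ p q × Neg q) →L[ℝ] (HomZ p q × Neg q) →L[ℝ] (Neg q →L[ℝ] Neg q)) := inferInstance
scoped instance {k : ℕ} : NormedSpace ℝ ((HomZ p q × Neg q) [⋀^Fin k]→L[ℝ] ℝ) := inferInstance
scoped instance {k : ℕ} : IsBoundedSMul ℝ ((HomZ p q × Neg q) [⋀^Fin k]→L[ℝ] ℝ) := inferInstance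
scoped instance {k : ℕ} : NormedSpace ℝ (HomZ p q [⋀^Fin k]→L[ℝ] ℝ) := inferInstance
scoped instance {k : ℕ} : IsBoundedSMul ℝ (HomZ p q [⋀^Fin k]→L[ℝ] ℝ) := inferInstance

/-! ### Blocks of endomorphisms of `V` -/

/-- The block `z₀^⊥ → z₀^⊥`. -/
def b11 : EndV p q →L[ℝ] (Pos p →L[ℝ] Pos p) :=
  (ContinuousLinearMap.compL ℝ (Pos p) (V p q) (Pos p)
      (ContinuousLinearMap.fst ℝ (Pos p) (Neg q))).comp
    ((ContinuousLinearMap.compL ℝ (Pos p) (V p q) (V p q)).flip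
      (ContinuousLinearMap.inl ℝ (Pos p) (Neg q)))

/-- The block `z₀ → z₀^⊥`. -/
def b12 : EndV p q →L[ℝ] HomZ p q :=
  (ContinuousLinearMap.compL ℝ (Neg q) (V p q) (Pos p)
      (ContinuousLinearMap.fst ℝ (Pos p) (Neg q))).comp
    ((ContinuousLinearMap.compL ℝ (Neg q) (V p q) (V p q)).flip
      (ContinuousLinearMap.inr ℝ (Pos p) (Neg q)))

/-- The block `z₀^⊥ → z₀`. -/
def b21 : EndV p q →L[ℝ] (Pos p →L[ℝ] Neg q) :=
  (ContinuousLinearMap.compL ℝ (Pos p) (V p q) (Neg q)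
      (ContinuousLinearMap.snd ℝ (Pos p) (Neg q))).comp
    ((ContinuousLinearMap.compL ℝ (Pos p) (V p q) (V p q)).flip
      (ContinuousLinearMap.inl ℝ (Pos p) (Neg q)))

theorem b11_apply (g : EndV p q) (x : Pos p) : b11 g x = (g (x, 0)).1 := rfl

theorem b12_apply (g : EndV p q) (w : Neg q) : b12 g w = (g (0, w)).1 := rfl

theorem b21_apply (g : EndV p q) (x : Pos p) : b21 g x = (g (x, 0)).2 := rfl

theorem rho_apply (g : EndV p q) (w : Neg q) : rho g w = (g (0, w)).2 := rfl

theorem endV_apply (g : EndV p q) (x : Pos p) (w : Neg q) :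
    g (x, w) = (b11 g x + b12 g w, b21 g x + rho g w) := by
  have h : ((x, w) : V p q) = (x, 0) + (0, w) := by simp
  rw [h, map_add]
  rfl

theorem endV_apply_fst (g : EndV p q) (v : V p q) : (g v).1 = b11 g v.1 + b12 g v.2 := by
  rw [← Prod.mk.eta (p := v), endV_apply]

theorem endV_apply_snd (g : EndV p q) (v : V p q) : (g v).2 = b21 g v.1 + rho g v.2 := by
  rw [← Prod.mk.eta (p := v), endV_apply]

theorem b11_mul (g k : EndV p q) : b11 (g * k) = b11 g ∘L b11 k + b12 g ∘L b21 k := by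
  ext1 x
  simp only [b11_apply, mul_apply_eq_comp, add_apply, ContinuousLinearMap.comp_apply]
  rw [endV_apply_fst]
  rfl

theorem b12_mul (g k : EndV p q) : b12 (g * k) = b11 g ∘L b12 k + b12 g ∘L rho k := by
  ext1 x
  simp only [b12_apply, mul_apply_eq_comp, add_apply, ContinuousLinearMap.comp_apply]
  rw [endV_apply_fst]
  rfl

theorem b21_mul (g k : EndV p q) : b21 (g * k) = b21 g ∘L b11 k + rho g ∘L b21 k := by
  ext1 x
  simp only [b21_apply, mul_apply_eq_comp, add_apply, ContinuousLinearMap.comp_apply]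
  rw [endV_apply_snd]
  rfl

theorem rho_mul (g k : EndV p q) : rho (g * k) = b21 g ∘L b12 k + rho g ∘L rho k := by
  ext1 x
  simp only [rho_apply, mul_apply_eq_comp, add_apply, ContinuousLinearMap.comp_apply]
  rw [endV_apply_snd]
  rfl

theorem inv_apply_apply (g : (EndV p q)ˣ) (x : V p q) :
    ((g⁻¹ : (EndV p q)ˣ) : EndV p q) ((g : EndV p q) x) = x :=
  congrArg (fun f : EndV p q => f x) g.inv_mul

theorem apply_inv_apply (g : (EndV p q)ˣ) (x : V p q) :
    (g : EndV p q) (((g⁻¹ : (EndV p q)ˣ) : EndV p q) x) = x :=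
  congrArg (fun f : EndV p q => f x) g.mul_inv

theorem Q_inv_left {g : (EndV p q)ˣ} (hg : g ∈ orthGroup p q) (x y : V p q) :
    Q (((g⁻¹ : (EndV p q)ˣ) : EndV p q) x) y = Q x ((g : EndV p q) y) := by
  rw [← hg, apply_inv_apply]

/-- The inverse of an isometry is its `Q`-adjoint, which in blocks is the Euclidean adjoint with the
sign of the off-diagonal blocks changed. -/
theorem b11_inv {g : (EndV p q)ˣ} (hg : g ∈ orthGroup p q) :
    b11 ((g⁻¹ : (EndV p q)ˣ) : EndV p q) = (b11 (g : EndV p q))† := by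
  rw [ContinuousLinearMap.eq_adjoint_iff]
  intro x y
  simpa [Q, b11_apply] using Q_inv_left hg (x, 0) (y, 0)

theorem b21_inv {g : (EndV p q)ˣ} (hg : g ∈ orthGroup p q) :
    b21 ((g⁻¹ : (EndV p q)ˣ) : EndV p q) = -(b12 (g : EndV p q))† := by
  rw [← map_neg, ContinuousLinearMap.eq_adjoint_iff]
  intro x y
  have := Q_inv_left hg (x, 0) (0, y)
  simp only [Q, inner_zero_left, inner_zero_right, sub_zero, zero_sub] at this
  rw [neg_apply, inner_neg_right, b21_apply, b12_apply, ← this, neg_neg]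

theorem rho_inv {g : (EndV p q)ˣ} (hg : g ∈ orthGroup p q) :
    rho ((g⁻¹ : (EndV p q)ˣ) : EndV p q) = (rho (g : EndV p q))† := by
  rw [ContinuousLinearMap.eq_adjoint_iff]
  intro x y
  simpa [Q, rho_apply] using Q_inv_left hg (0, x) (0, y)

/-- This identity and the next two are blocks of `g g⁻¹ = 1` and `g⁻¹ g = 1`. -/
theorem b11_b11_adjoint {g : (EndV p q)ˣ} (hg : g ∈ orthGroup p q) :
    b11 (g : EndV p q) ∘L (b11 (g : EndV p q))† =
    1 + b12 (g : EndV p q) ∘L (b12 (g : EndV p q))† := by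
  have h := b11_mul (g : EndV p q) ((g⁻¹ : (EndV p q)ˣ) : EndV p q)
  rw [g.mul_inv, b11_inv hg, b21_inv hg, ContinuousLinearMap.comp_neg] at h
  rw [← sub_eq_iff_eq_add, sub_eq_add_neg, ← h]
  rfl

theorem b21_b11_adjoint {g : (EndV p q)ˣ} (hg : g ∈ orthGroup p q) :
    b21 (g : EndV p q) ∘L (b11 (g : EndV p q))† =
    rho (g : EndV p q) ∘L (b12 (g : EndV p q))† := by
  have h := b21_mul (g : EndV p q) ((g⁻¹ : (EndV p q)ˣ) : EndV p q)
  rw [g.mul_inv, b11_inv hg, b21_inv hg, ContinuousLinearMap.comp_neg] at h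
  rw [← sub_eq_zero, sub_eq_add_neg, ← h]
  rfl

theorem rho_adjoint_rho {g : (EndV p q)ˣ} (hg : g ∈ orthGroup p q) :
    (rho (g : EndV p q))† ∘L rho (g : EndV p q) =
    1 + (b12 (g : EndV p q))† ∘L b12 (g : EndV p q) := by
  have h := rho_mul ((g⁻¹ : (EndV p q)ˣ) : EndV p q) (g : EndV p q)
  rw [g.inv_mul, b21_inv hg, rho_inv hg, ContinuousLinearMap.neg_comp] at h
  have h1 : rho (1 : EndV p q) = 1 := rfl
  rw [h1] at h
  rw [h]
  abel

/-! ### The metric of the tautological bundle -/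

theorem isUnit_of_injective {E : Type*} [NormedAddCommGroup E] [NormedSpace ℝ E]
    [FiniteDimensional ℝ E] {f : E →L[ℝ] E} (hf : Function.Injective f) : IsUnit f := by
  let e : E ≃L[ℝ] E := (LinearEquiv.ofInjectiveEndo f.toLinearMap hf).toContinuousLinearEquiv
  refine ⟨⟨f, e.symm, ?_, ?_⟩, rfl⟩
  · ext1 x
    exact e.apply_symm_apply x
  · ext1 x
    exact e.symm_apply_apply x

theorem mul_eq_one_comm_clm {E : Type*} [NormedAddCommGroup E] [NormedSpace ℝ E]
    [FiniteDimensional ℝ E] {f g : E →L[ℝ] E} (h : f * g = 1) : g * f = 1 := by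
  have h1 : f.toLinearMap * g.toLinearMap = 1 := congrArg ContinuousLinearMap.toLinearMap h
  have h2 := mul_eq_one_comm.1 h1
  ext1 x
  exact congrArg (fun f : E →ₗ[ℝ] E => f x) h2

theorem mem_Dplus_iff (X : HomZ p q) : X ∈ Dplus p q ↔ ∀ w, w ≠ 0 → ‖X w‖ < ‖w‖ := by
  have hQ : ∀ w, Q (graph X w) (graph X w) = ‖X w‖ ^ 2 - ‖w‖ ^ 2 := by
    intro w
    simp [Q, graph]
  constructor
  · intro h w hw
    have := h (graph X w) ⟨w, rfl⟩ fun h => hw (congrArg Prod.snd h)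
    rw [hQ] at this
    exact lt_of_pow_lt_pow_left₀ 2 (norm_nonneg _) (by linarith)
  · rintro h _ ⟨w, rfl⟩ hne
    have hw : w ≠ 0 := by
      rintro rfl
      exact hne (map_zero _)
    change Q (graph X w) (graph X w) < 0
    rw [hQ]
    have := pow_lt_pow_left₀ (h w hw) (norm_nonneg _) two_ne_zero
    linarith

/-- In finite dimension the operator norm is attained on the unit ball, so a pointwise strict
inequality is a uniform one. Thus `𝔻⁺` is an open ball: it is convex, and exhausted by compact
balls. -/
theorem mem_Dplus_iff_norm (X : HomZ p q) : X ∈ Dplus p q ↔ ‖X‖ < 1 := by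
  rw [mem_Dplus_iff]
  constructor
  · intro h
    obtain ⟨w, hw, hmax⟩ := (isCompact_closedBall (0 : Neg q) 1).exists_isMaxOn
      ⟨0, by simp⟩ (X.continuous.norm.continuousOn)
    have hle : ‖X‖ ≤ ‖X w‖ := by
      refine X.opNorm_le_of_unit_norm (norm_nonneg _) fun u hu => hmax (by simp [hu])
    by_cases h0 : w = 0
    · rw [h0] at hle
      simp at hle
      rw [hle]
      simp
    · have h1 := h w h0
      have h2 : ‖w‖ ≤ 1 := by simpa using hw
      linarith
  · intro h w hw
    calc ‖X w‖ ≤ ‖X‖ * ‖w‖ := X.le_opNorm w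
      _ < 1 * ‖w‖ := by
        have : 0 < ‖w‖ := norm_pos_iff.2 hw
        gcongr
      _ = ‖w‖ := one_mul _

theorem Dplus_eq_ball : Dplus p q = Metric.ball 0 1 := by
  ext X
  rw [mem_Dplus_iff_norm, mem_ball_zero_iff]

theorem isOpen_Dplus : IsOpen (Dplus p q) := Dplus_eq_ball ▸ Metric.isOpen_ball

theorem zero_mem_Dplus : (0 : HomZ p q) ∈ Dplus p q := by
  rw [mem_Dplus_iff_norm]
  simp

/-- The Gram operator `1 - X* X` of the plane of `X`. -/
def gram (X : HomZ p q) : Neg q →L[ℝ] Neg q := 1 - X† ∘L X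

theorem inner_gram (X : HomZ p q) (u w : Neg q) : ⟪gram X u, w⟫ = ⟪u, w⟫ - ⟪X u, X w⟫ := by
  simp [gram, inner_sub_left, ContinuousLinearMap.adjoint_inner_left]

theorem isUnit_gram {X : HomZ p q} (hX : X ∈ Dplus p q) : IsUnit (gram X) := by
  refine isUnit_of_injective ((injective_iff_map_eq_zero _).2 fun w hw => ?_)
  by_contra h
  have h1 := (mem_Dplus_iff X).1 hX w h
  have h2 := inner_gram X w w
  rw [hw, inner_zero_left, real_inner_self_eq_norm_sq, real_inner_self_eq_norm_sq] at h2
  have := pow_lt_pow_left₀ h1 (norm_nonneg _) two_ne_zero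
  linarith

/-- The inverse of the Gram operator. -/
def gramInv (X : HomZ p q) : Neg q →L[ℝ] Neg q := Ring.inverse (gram X)

theorem gram_gramInv {X : HomZ p q} (hX : X ∈ Dplus p q) (y : Neg q) :
    gram X (gramInv X y) = y :=
  congrArg (fun f : Neg q →L[ℝ] Neg q => f y) (Ring.mul_inverse_cancel _ (isUnit_gram hX))

theorem gramInv_gram {X : HomZ p q} (hX : X ∈ Dplus p q) (y : Neg q) :
    gramInv X (gram X y) = y :=
  congrArg (fun f : Neg q →L[ℝ] Neg q => f y) (Ring.inverse_mul_cancel _ (isUnit_gram hX))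

/-- The operator `(1 - X X*)⁻¹`. -/
def gramInv' (X : HomZ p q) : Pos p →L[ℝ] Pos p := 1 + X ∘L gramInv X ∘L X†

/-- With `u = (1 - X* X)⁻¹ y`, the difference of the two sides is `‖X u‖² - ‖X* X u‖²`. The
inequality gives a Gaussian bound uniform in `X` for Laplace's method. -/
theorem norm_sq_le_inner_gramInv {X : HomZ p q} (hX : X ∈ Dplus p q) (y : Neg q) :
    ‖y‖ ^ 2 ≤ ⟪gramInv X y, y⟫ := by
  set u := gramInv X y with hu
  have hy : y = gram X u := (gram_gramInv hX y).symm
  have h1 : y = u - (X†) (X u) := by rw [hy]; rfl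
  have h2 : ⟪u, y⟫ = ‖u‖ ^ 2 - ‖X u‖ ^ 2 := by
    rw [real_inner_comm, hy, inner_gram, real_inner_self_eq_norm_sq, real_inner_self_eq_norm_sq]
  have h3 : ‖y‖ ^ 2 = ‖u‖ ^ 2 - 2 * ‖X u‖ ^ 2 + ‖(X†) (X u)‖ ^ 2 := by
    rw [h1, norm_sub_sq_real, ContinuousLinearMap.adjoint_inner_right, real_inner_self_eq_norm_sq]
  have h4 : ‖(X†) (X u)‖ ≤ ‖X u‖ := by
    have h5 : ‖X†‖ < 1 := by
      rw [LinearIsometryEquiv.norm_map]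
      exact (mem_Dplus_iff_norm X).1 hX
    calc ‖(X†) (X u)‖ ≤ ‖X†‖ * ‖X u‖ := (X†).le_opNorm _
      _ ≤ 1 * ‖X u‖ := by gcongr
      _ = ‖X u‖ := one_mul _
  have := pow_le_pow_left₀ (norm_nonneg _) h4 2
  linarith

theorem det_adjoint_clm {E : Type*} [NormedAddCommGroup E] [InnerProductSpace ℝ E]
    [FiniteDimensional ℝ E] (f : E →L[ℝ] E) : (f†).det = f.det := by
  have h : (f†).toLinearMap = LinearMap.adjoint f.toLinearMap := rfl
  change LinearMap.det (f†).toLinearMap = LinearMap.det f.toLinearMap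
  rw [h, ← LinearMap.det_toMatrix (stdOrthonormalBasis ℝ E).toBasis,
    ← LinearMap.det_toMatrix (stdOrthonormalBasis ℝ E).toBasis f.toLinearMap,
    LinearMap.toMatrix_adjoint, Matrix.det_conjTranspose]
  simp

/-! ### The action on planes -/

theorem plane_injective {X Y : HomZ p q} (h : plane X = plane Y) : X = Y := by
  ext1 w
  have h1 : (X w, w) ∈ plane X := (mem_plane_iff X _).2 rfl
  rw [h] at h1
  exact (mem_plane_iff Y _).1 h1

theorem actD_mem_Dplus {g : (EndV p q)ˣ} (hg : g ∈ orthGroup p q) {X : HomZ p q}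
    (hX : X ∈ Dplus p q) : actD (g : EndV p q) X ∈ Dplus p q := by
  intro y hy hne
  rw [plane_actD g hg X hX] at hy
  obtain ⟨x, hx, rfl⟩ := hy
  change Q ((g : EndV p q) x) ((g : EndV p q) x) < 0
  rw [hg]
  refine hX x hx ?_
  rintro rfl
  exact hne (map_zero _)

theorem actD_mul {g h : (EndV p q)ˣ} (hg : g ∈ orthGroup p q) (hh : h ∈ orthGroup p q)
    {X : HomZ p q} (hX : X ∈ Dplus p q) :
    actD ((g * h : (EndV p q)ˣ) : EndV p q) X = actD (g : EndV p q) (actD (h : EndV p q) X) := by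
  apply plane_injective
  rw [plane_actD _ (mul_mem hg hh) X hX, plane_actD g hg _ (actD_mem_Dplus hh hX),
    plane_actD h hh X hX, ← Submodule.map_comp]
  rfl

theorem actD_one (X : HomZ p q) : actD (1 : EndV p q) X = X := by
  have h1 : ((ContinuousLinearMap.snd ℝ (Pos p) (Neg q)).comp ((1 : EndV p q).comp (graph X))) =
      ContinuousLinearMap.id ℝ (Neg q) := rfl
  have h2 : ((ContinuousLinearMap.fst ℝ (Pos p) (Neg q)).comp ((1 : EndV p q).comp (graph X))) =
      X := rfl
  rw [actD, h1, h2, ContinuousLinearMap.inverse_id, ContinuousLinearMap.comp_id]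

theorem actD_inv_actD {g : (EndV p q)ˣ} (hg : g ∈ orthGroup p q) {X : HomZ p q}
    (hX : X ∈ Dplus p q) :
    actD ((g⁻¹ : (EndV p q)ˣ) : EndV p q) (actD (g : EndV p q) X) = X := by
  rw [← actD_mul (inv_mem hg) hg hX, inv_mul_cancel]
  exact actD_one X

/-- The numerator of the action. -/
def numer (g : EndV p q) (X : HomZ p q) : HomZ p q := b11 g ∘L X + b12 g

/-- The automorphy factor of the action. -/
def autFac (g : EndV p q) (X : HomZ p q) : Neg q →L[ℝ] Neg q := b21 g ∘L X + rho g

theorem apply_graph (g : EndV p q) (X : HomZ p q) (w : Neg q) :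
    g (X w, w) = (numer g X w, autFac g X w) := endV_apply g (X w) w

theorem actD_eq (g : EndV p q) (X : HomZ p q) :
    actD g X = numer g X ∘L Ring.inverse (autFac g X) := by
  rw [ContinuousLinearMap.ringInverse_eq_inverse]
  have h1 : ((ContinuousLinearMap.snd ℝ (Pos p) (Neg q)).comp (g.comp (graph X))) = autFac g X := by
    ext1 w
    exact congrArg Prod.snd (apply_graph g X w)
  have h2 : ((ContinuousLinearMap.fst ℝ (Pos p) (Neg q)).comp (g.comp (graph X))) = numer g X := by
    ext1 w
    exact congrArg Prod.fst (apply_graph g X w)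
  rw [actD, h1, h2]

/-- A nonzero vector of a negative plane cannot be sent by an isometry into `z₀^⊥`, where `Q` is
nonnegative. -/
theorem isUnit_autFac {g : (EndV p q)ˣ} (hg : g ∈ orthGroup p q) {X : HomZ p q}
    (hX : X ∈ Dplus p q) : IsUnit (autFac (g : EndV p q) X) := by
  refine isUnit_of_injective ((injective_iff_map_eq_zero _).2 fun w hw => ?_)
  by_contra hne
  have h1 := hX (X w, w) ⟨w, rfl⟩ (fun h => hne (congrArg Prod.snd h))
  have h2 := Q_self_nonneg_of_snd_eq_zero ((g : EndV p q) (X w, w))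
    ((congrArg Prod.snd (apply_graph _ X w)).trans hw)
  rw [hg] at h2
  linarith

theorem actD_autFac {g : EndV p q} {X : HomZ p q} (h : IsUnit (autFac g X)) :
    actD g X ∘L autFac g X = numer g X := by
  rw [actD_eq, ContinuousLinearMap.comp_assoc]
  change numer g X ∘L (Ring.inverse (autFac g X) * autFac g X) = _
  rw [Ring.inverse_mul_cancel _ h]
  rfl

section Quot

variable {E F : Type*} [NormedAddCommGroup E] [NormedSpace ℝ E] [CompleteSpace E]
  [NormedAddCommGroup F] [NormedSpace ℝ F]

theorem contDiffAt_quot {N : E →L[ℝ] F} {D : E →L[ℝ] E} (h : IsUnit D) (m : WithTop ℕ∞) :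
    ContDiffAt ℝ m (fun P : (E →L[ℝ] F) × (E →L[ℝ] E) => P.1 ∘L Ring.inverse P.2) (N, D) := by
  obtain ⟨u, rfl⟩ := h
  exact contDiffAt_fst.clm_comp
    (ContDiffAt.comp (g := Ring.inverse) (N, (u : E →L[ℝ] E)) (contDiffAt_ringInverse ℝ u)
      contDiffAt_snd)

theorem fderiv_quot {N : E →L[ℝ] F} {D : E →L[ℝ] E} (h : IsUnit D)
    (n : E →L[ℝ] F) (δ : E →L[ℝ] E) :
    fderiv ℝ (fun P : (E →L[ℝ] F) × (E →L[ℝ] E) => P.1 ∘L Ring.inverse P.2) (N, D) (n, δ) =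
      (n - (N ∘L Ring.inverse D) ∘L δ) ∘L Ring.inverse D := by
  obtain ⟨u, rfl⟩ := h
  have h1 := hasFDerivAt_ringInverse (𝕜 := ℝ) u
  have h2 : HasFDerivAt (fun P : (E →L[ℝ] F) × (E →L[ℝ] E) => P.1 ∘L Ring.inverse P.2) _
      (N, (u : E →L[ℝ] E)) := (hasFDerivAt_fst (𝕜 := ℝ) (p := (N, (u : E →L[ℝ] E)))).clm_comp
    (HasFDerivAt.comp (g := Ring.inverse) (N, (u : E →L[ℝ] E)) h1
      (hasFDerivAt_snd (𝕜 := ℝ) (p := (N, (u : E →L[ℝ] E)))))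
  rw [h2.fderiv]
  ext1 w
  simp
  abel

end Quot

theorem contDiff_numer_autFac (m : WithTop ℕ∞) : ContDiff ℝ m
    fun a : EndV p q × HomZ p q => (numer a.1 a.2, autFac a.1 a.2) := by
  refine ContDiff.prodMk ?_ ?_
  · exact ((b11.contDiff.comp contDiff_fst).clm_comp contDiff_snd).add
      (b12.contDiff.comp contDiff_fst)
  · exact ((b21.contDiff.comp contDiff_fst).clm_comp contDiff_snd).add
      (rho.contDiff.comp contDiff_fst)

theorem contDiffAt_actD {g : EndV p q} {X : HomZ p q} (h : IsUnit (autFac g X)) (m : WithTop ℕ∞) :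
    ContDiffAt ℝ m (fun a : EndV p q × HomZ p q => actD a.1 a.2) (g, X) := by
  simp_rw [actD_eq]
  exact ContDiffAt.comp (g, X) (contDiffAt_quot h m)
    (contDiff_numer_autFac m).contDiffAt

theorem fderiv_actD_left {g : EndV p q} {X : HomZ p q} (h : IsUnit (autFac g X)) (A : EndV p q) :
    fderiv ℝ (fun g : EndV p q => actD g X) g A =
      (numer A X - actD g X ∘L autFac A X) ∘L Ring.inverse (autFac g X) := by
  have h1 : (fun g : EndV p q => actD g X) =
      (fun P : HomZ p q × (Neg q →L[ℝ] Neg q) => P.1 ∘L Ring.inverse P.2) ∘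
        fun g => (numer g X, autFac g X) := by
    funext g
    exact actD_eq g X
  let Λ : EndV p q →L[ℝ] HomZ p q × (Neg q →L[ℝ] Neg q) :=
    LinearMap.toContinuousLinearMap
      { toFun := fun g => (numer g X, autFac g X)
        map_add' := fun a b => by
          simp only [numer, autFac, map_add, ContinuousLinearMap.add_comp, Prod.mk_add_mk]
          congr 1 <;> abel
        map_smul' := fun c a => by
          simp [numer, autFac, map_smul, ContinuousLinearMap.smul_comp] }
  have h2 : HasFDerivAt (fun g => (numer g X, autFac g X)) Λ g := Λ.hasFDerivAt
  have h3 : DifferentiableAt ℝ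
      (fun P : HomZ p q × (Neg q →L[ℝ] Neg q) => P.1 ∘L Ring.inverse P.2)
        (numer g X, autFac g X) :=
    (contDiffAt_quot h 1).differentiableAt one_ne_zero
  rw [h1, fderiv_comp g h3 h2.differentiableAt, h2.fderiv, ContinuousLinearMap.comp_apply]
  have h4 : Λ A = (numer A X, autFac A X) := rfl
  rw [h4, fderiv_quot h, actD_eq]

theorem contDiffAt_actD_right {g : EndV p q} {X : HomZ p q} (h : IsUnit (autFac g X))
    (m : WithTop ℕ∞) : ContDiffAt ℝ m (actD g) X :=
  ContDiffAt.comp X (contDiffAt_actD h m) (contDiffAt_const.prodMk contDiffAt_id)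

theorem contDiffOn_actD {g : (EndV p q)ˣ} (hg : g ∈ orthGroup p q) (m : WithTop ℕ∞) :
    ContDiffOn ℝ m (actD (g : EndV p q)) (Dplus p q) := fun _ hX =>
  (contDiffAt_actD_right (isUnit_autFac hg hX) m).contDiffWithinAt

/-! ### The base point -/

theorem ringInverse_eq {E : Type*} [NormedAddCommGroup E] [NormedSpace ℝ E]
    [FiniteDimensional ℝ E] {f g : E →L[ℝ] E} (h : f * g = 1) : Ring.inverse f = g :=
  Ring.inverse_unit (⟨f, g, h, mul_eq_one_comm_clm h⟩ : (E →L[ℝ] E)ˣ)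

theorem autFac_zero (g : EndV p q) : autFac g 0 = rho g := by simp [autFac]

theorem numer_zero (g : EndV p q) : numer g 0 = b12 g := by simp [numer]

theorem isUnit_rho {g : (EndV p q)ˣ} (hg : g ∈ orthGroup p q) : IsUnit (rho (g : EndV p q)) := by
  rw [← autFac_zero]
  exact isUnit_autFac hg zero_mem_Dplus

theorem projD_mem_Dplus {g : (EndV p q)ˣ} (hg : g ∈ orthGroup p q) :
    projD (g : EndV p q) ∈ Dplus p q := actD_mem_Dplus hg zero_mem_Dplus

theorem projD_comp_rho {g : (EndV p q)ˣ} (hg : g ∈ orthGroup p q) :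
    projD (g : EndV p q) ∘L rho (g : EndV p q) = b12 (g : EndV p q) := by
  have h := actD_autFac (g := (g : EndV p q)) (X := 0) (by
    rw [autFac_zero]
    exact isUnit_rho hg)
  rwa [autFac_zero, numer_zero] at h

/-- For `X = g z₀` the isometry `w ↦ g w` from `z₀` to the plane of `X` reads `ρ(g)` in the graph
coordinates, where the metric of the plane is `gram X`. -/
theorem rho_adjoint_gram_rho {g : (EndV p q)ˣ} (hg : g ∈ orthGroup p q) :
    (rho (g : EndV p q))† * gram (projD (g : EndV p q)) * rho (g : EndV p q) = 1 := by
  have h := rho_adjoint_rho hg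
  rw [← projD_comp_rho hg, ContinuousLinearMap.adjoint_comp] at h
  rw [← sub_eq_iff_eq_add] at h
  rw [← h]
  ext1 w
  simp [gram]

theorem gramInv_eq {g : (EndV p q)ˣ} (hg : g ∈ orthGroup p q) :
    gramInv (projD (g : EndV p q)) = rho (g : EndV p q) * (rho (g : EndV p q))† := by
  have h1 := mul_eq_one_comm_clm (rho_adjoint_gram_rho hg)
  rw [← mul_assoc] at h1
  exact ringInverse_eq (mul_eq_one_comm_clm h1)

theorem gramInv'_eq {g : (EndV p q)ˣ} (hg : g ∈ orthGroup p q) :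
    gramInv' (projD (g : EndV p q)) = b11 (g : EndV p q) ∘L (b11 (g : EndV p q))† := by
  rw [b11_b11_adjoint hg, gramInv', gramInv_eq hg, ← projD_comp_rho hg,
    ContinuousLinearMap.adjoint_comp]
  rfl

theorem b21_b11_adjoint' {g : (EndV p q)ˣ} (hg : g ∈ orthGroup p q) :
    b21 (g : EndV p q) ∘L (b11 (g : EndV p q))† =
      gramInv (projD (g : EndV p q)) ∘L (projD (g : EndV p q))† := by
  rw [b21_b11_adjoint hg, gramInv_eq hg, ← projD_comp_rho hg, ContinuousLinearMap.adjoint_comp]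
  rfl

/-- `b11 - X b21` is the left factor of the differential of `projD` (`dProjD_apply`). That its
inverse is the adjoint of `b11` lets pairings with `b11 t` on the base be read on the group. -/
theorem b11_sub_mul_adjoint {g : (EndV p q)ˣ} (hg : g ∈ orthGroup p q) :
    (b11 (g : EndV p q) - projD (g : EndV p q) ∘L b21 (g : EndV p q)) *
      (b11 (g : EndV p q))† = 1 := by
  have h1 := gramInv'_eq hg
  have h2 := b21_b11_adjoint' hg
  rw [sub_mul]
  change b11 (g : EndV p q) ∘L (b11 (g : EndV p q))† -
    projD (g : EndV p q) ∘L b21 (g : EndV p q) ∘L (b11 (g : EndV p q))† = 1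
  rw [← h1, h2, gramInv']
  simp

theorem adjoint_mul_b11_sub {g : (EndV p q)ˣ} (hg : g ∈ orthGroup p q) :
    (b11 (g : EndV p q))† *
      (b11 (g : EndV p q) - projD (g : EndV p q) ∘L b21 (g : EndV p q)) = 1 :=
  mul_eq_one_comm_clm (b11_sub_mul_adjoint hg)

theorem rho_inverse {g : (EndV p q)ˣ} (hg : g ∈ orthGroup p q) :
    Ring.inverse (rho (g : EndV p q)) =
      (rho (g : EndV p q))† * gram (projD (g : EndV p q)) :=
  ringInverse_eq (mul_eq_one_comm_clm (rho_adjoint_gram_rho hg))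

/-! ### The identity component -/

theorem Gplus_le : Gplus p q ≤ orthGroup p q := by
  rintro _ ⟨k, -, rfl⟩
  exact k.2

/-- A continuous function without zeros on the orthogonal group keeps its sign on the identity
component. This yields the positivity of the automorphy factor and of the Jacobian of the action. -/
theorem pos_of_mem_Gplus {f : (EndV p q)ˣ → ℝ} (hf : ContinuousOn f (orthGroup p q))
    (h0 : ∀ g ∈ orthGroup p q, f g ≠ 0) (h1 : 0 < f 1) {g : (EndV p q)ˣ} (hg : g ∈ Gplus p q) :
    0 < f g := by
  obtain ⟨k, hk, rfl⟩ := hg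
  have hc : Continuous fun k : orthGroup p q => f k := continuousOn_iff_continuous_domRestrict.1 hf
  have hpre : IsPreconnected (connectedComponent (1 : orthGroup p q)) :=
    isPreconnected_connectedComponent
  by_contra hle
  have hmem : (0 : ℝ) ∈ (fun k : orthGroup p q => f k) '' connectedComponent 1 :=
    hpre.intermediate_value (a := k) (b := 1) hk mem_connectedComponent hc.continuousOn
      ⟨not_lt.1 hle, h1.le⟩
  obtain ⟨k', -, hk'⟩ := hmem
  exact h0 k' k'.2 hk'

theorem mem_Gplus_of_path {f : Set.Icc (0 : ℝ) 1 → (EndV p q)ˣ} (hf : Continuous f)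
    (hO : ∀ s, f s ∈ orthGroup p q) (h0 : f 0 = 1) : f 1 ∈ Gplus p q := by
  let F : Set.Icc (0 : ℝ) 1 → orthGroup p q := fun s => ⟨f s, hO s⟩
  have hF : Continuous F := hf.subtype_mk _
  have hpre : IsPreconnected (Set.range F) := isPreconnected_range hF
  have hsub : Set.range F ⊆ connectedComponent 1 :=
    hpre.subset_connectedComponent ⟨0, Subtype.ext h0⟩
  exact ⟨F 1, hsub ⟨1, rfl⟩, rfl⟩

theorem det_ne_zero_of_isUnit {E : Type*} [NormedAddCommGroup E] [NormedSpace ℝ E]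
    {f : E →L[ℝ] E} (h : IsUnit f) : f.det ≠ 0 := by
  obtain ⟨u, rfl⟩ := h
  have : (u : E →L[ℝ] E).det * ((u⁻¹ : (E →L[ℝ] E)ˣ) : E →L[ℝ] E).det = 1 := by
    have h1 : LinearMap.det ((u : E →L[ℝ] E).toLinearMap *
        ((u⁻¹ : (E →L[ℝ] E)ˣ) : E →L[ℝ] E).toLinearMap) = 1 := by
      have : (u : E →L[ℝ] E).toLinearMap * ((u⁻¹ : (E →L[ℝ] E)ˣ) : E →L[ℝ] E).toLinearMap = 1 :=
        congrArg ContinuousLinearMap.toLinearMap u.mul_inv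
      rw [this, map_one]
    rwa [map_mul] at h1
  exact left_ne_zero_of_mul_eq_one this

theorem continuous_clm_det {E : Type*} [NormedAddCommGroup E] [NormedSpace ℝ E]
    [FiniteDimensional ℝ E] : Continuous fun f : E →L[ℝ] E => f.det :=
  ContinuousLinearMap.continuous_det

theorem continuous_det_autFac (X : HomZ p q) :
    Continuous fun g : (EndV p q)ˣ => (autFac (g : EndV p q) X).det := by
  have h : Continuous fun g : EndV p q => autFac g X :=
    (b21.continuous.clm_comp continuous_const).add rho.continuous
  have h2 : Continuous fun g : (EndV p q)ˣ => autFac (g : EndV p q) X :=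
    h.comp Units.continuous_val
  exact Continuous.comp (g := fun f : Neg q →L[ℝ] Neg q => f.det) continuous_clm_det h2

theorem det_autFac_pos {g : (EndV p q)ˣ} (hg : g ∈ Gplus p q) {X : HomZ p q}
    (hX : X ∈ Dplus p q) : 0 < (autFac (g : EndV p q) X).det := by
  refine pos_of_mem_Gplus (p := p) (q := q)
    (f := fun g : (EndV p q)ˣ => (autFac (g : EndV p q) X).det) ?_
    (fun g hg => det_ne_zero_of_isUnit (isUnit_autFac hg hX)) ?_ hg
  · exact (continuous_det_autFac X).continuousOn
  · have : autFac ((1 : (EndV p q)ˣ) : EndV p q) X = ContinuousLinearMap.id ℝ (Neg q) := by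
      ext1 w
      exact (congrArg Prod.snd (apply_graph (1 : EndV p q) X w)).symm
    rw [this, ContinuousLinearMap.det]
    simp

theorem det_rho_pos {g : (EndV p q)ˣ} (hg : g ∈ Gplus p q) : 0 < (rho (g : EndV p q)).det := by
  rw [← autFac_zero]
  exact det_autFac_pos hg zero_mem_Dplus

/-- The off-diagonal element of the Lie algebra with upper right block `B`. -/
def offDiag : HomZ p q →L[ℝ] lieG p q :=
  LinearMap.toContinuousLinearMap
    { toFun := fun B => ⟨(B ∘L ContinuousLinearMap.snd ℝ (Pos p) (Neg q)).prod
          ((B†) ∘L ContinuousLinearMap.fst ℝ (Pos p) (Neg q)), by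
            intro x y
            simp [Q, ContinuousLinearMap.adjoint_inner_left, ContinuousLinearMap.adjoint_inner_right]⟩
      map_add' := fun B C => by
        refine Subtype.ext (ContinuousLinearMap.ext fun x => ?_)
        simp
      map_smul' := fun c B => by
        refine Subtype.ext (ContinuousLinearMap.ext fun x => ?_)
        simp }

theorem offDiag_apply (B : HomZ p q) (v : V p q) :
    (offDiag B : EndV p q) v = (B v.2, (B†) v.1) := rfl

theorem b12_offDiag (B : HomZ p q) : b12 (offDiag B : EndV p q) = B := rfl

theorem b11_offDiag (B : HomZ p q) : b11 (offDiag B : EndV p q) = 0 := by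
  ext1 x
  simp [b11_apply, offDiag_apply]

theorem b21_offDiag (B : HomZ p q) : b21 (offDiag B : EndV p q) = B† := rfl

theorem rho_offDiag (B : HomZ p q) : rho (offDiag B : EndV p q) = 0 := by
  ext1 x
  simp [rho_apply, offDiag_apply]

/-- The Cayley transform. -/
def cayley (A : EndV p q) : EndV p q := (1 + A) * Ring.inverse (1 - A)

theorem cayley_mul_cayley_neg {A : EndV p q} (h : ‖A‖ < 1) : cayley A * cayley (-A) = 1 := by
  have h1 : IsUnit (1 - A) := isUnit_one_sub_of_norm_lt_one h
  have h2 : IsUnit (1 + A) := by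
    have := isUnit_one_sub_of_norm_lt_one (x := -A) (by rwa [norm_neg])
    rwa [sub_neg_eq_add] at this
  have hc : Commute (1 + A) (1 - A) := by
    change _ * _ = _ * _
    noncomm_ring
  rw [cayley, cayley, sub_neg_eq_add, ← sub_eq_add_neg]
  rw [mul_assoc, ← mul_assoc (Ring.inverse (1 - A)), Ring.inverse_mul_cancel _ h1, one_mul,
    Ring.mul_inverse_cancel _ h2]

/-- The Cayley transform of a small element, as a unit. -/
def cayleyUnit {A : EndV p q} (h : ‖A‖ < 1) : (EndV p q)ˣ where
  val := cayley A
  inv := cayley (-A)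
  val_inv := cayley_mul_cayley_neg h
  inv_val := by
    have := cayley_mul_cayley_neg (A := -A) (by rwa [norm_neg])
    rwa [neg_neg] at this

/-- `Q((1 + A) a, (1 + A) b) - Q((1 - A) a, (1 - A) b)` is twice `Q(A a, b) + Q(a, A b)`, which
vanishes on the Lie algebra. -/
theorem cayleyUnit_mem_orthGroup {A : EndV p q} (h : ‖A‖ < 1) (hA : A ∈ lieG p q) :
    cayleyUnit h ∈ orthGroup p q := by
  have h1 : IsUnit (1 - A) := isUnit_one_sub_of_norm_lt_one h
  intro x y
  have key : ∀ x, (cayleyUnit h : EndV p q) ((1 - A) x) = (1 + A) x := by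
    intro x
    change (cayley A * (1 - A)) x = _
    rw [cayley, mul_assoc, Ring.inverse_mul_cancel _ h1, mul_one]
  have hs : ∀ x, (1 - A) (Ring.inverse (1 - A) x) = x := fun x =>
    congrArg (fun f : EndV p q => f x) (Ring.mul_inverse_cancel _ h1)
  rw [← hs x, ← hs y, key, key]
  set a := Ring.inverse (1 - A) x
  set b := Ring.inverse (1 - A) y
  have h2 := hA a b
  change Q (a + A a) (b + A b) = Q (a - A a) (b - A b)
  simp only [Q, Prod.fst_add, Prod.snd_add, Prod.fst_sub, Prod.snd_sub, inner_add_left,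
    inner_add_right, inner_sub_left, inner_sub_right] at h2 ⊢
  linarith

theorem continuousAt_cayley {A : EndV p q} (h : ‖A‖ < 1) : ContinuousAt cayley A := by
  obtain ⟨u, hu⟩ := isUnit_one_sub_of_norm_lt_one h
  have h1 : ContinuousAt (Ring.inverse : EndV p q → EndV p q) (1 - A) :=
    hu ▸ NormedRing.inverse_continuousAt u
  exact (continuousAt_const.add continuousAt_id).mul
    (ContinuousAt.comp (f := fun A : EndV p q => 1 - A) h1 (continuousAt_const.sub continuousAt_id))

/-- The path `s ↦ cayley (s • A)` joins `1` to the given element inside the orthogonal group. -/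
theorem cayleyUnit_mem_Gplus {A : EndV p q} (h : ‖A‖ < 1) (hA : A ∈ lieG p q) :
    cayleyUnit h ∈ Gplus p q := by
  have hs : ∀ s : Set.Icc (0 : ℝ) 1, ‖(s : ℝ) • A‖ < 1 := by
    intro s
    rw [norm_smul, Real.norm_of_nonneg s.2.1]
    exact (mul_le_of_le_one_left (norm_nonneg _) s.2.2).trans_lt h
  have hcont : Continuous fun s : Set.Icc (0 : ℝ) 1 => (s : ℝ) • A :=
    continuous_subtype_val.smul continuous_const
  have h1 := mem_Gplus_of_path (f := fun s => cayleyUnit (hs s)) ?_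
    (fun s => cayleyUnit_mem_orthGroup _ ((lieG p q).smul_mem _ hA)) ?_
  · convert h1 using 1
    apply Units.ext
    change cayley A = cayley (((1 : Set.Icc (0 : ℝ) 1) : ℝ) • A)
    rw [Set.Icc.coe_one, one_smul]
  · rw [Units.continuous_iff]
    constructor
    · refine continuous_iff_continuousAt.2 fun s => ?_
      exact ContinuousAt.comp (f := fun s : Set.Icc (0 : ℝ) 1 => (s : ℝ) • A)
        (continuousAt_cayley (hs s)) hcont.continuousAt
    · refine continuous_iff_continuousAt.2 fun s => ?_
      exact ContinuousAt.comp (f := fun s : Set.Icc (0 : ℝ) 1 => -((s : ℝ) • A))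
        (continuousAt_cayley (by rw [norm_neg]; exact hs s)) hcont.neg.continuousAt
  · apply Units.ext
    change cayley (((0 : Set.Icc (0 : ℝ) 1) : ℝ) • A) = 1
    rw [Set.Icc.coe_zero, zero_smul, cayley]
    simp

theorem hasStrictFDerivAt_cayley_zero {R : Type*} [NormedRing R] [NormedAlgebra ℝ R]
    [HasSummableGeomSeries R] :
    HasStrictFDerivAt (fun A : R => (1 + A) * Ring.inverse (1 - A))
      ((2 : ℝ) • ContinuousLinearMap.id ℝ R) 0 := by
  have h1 : HasStrictFDerivAt (fun A : R => 1 - A) (-ContinuousLinearMap.id ℝ R) 0 := by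
    simpa using (hasStrictFDerivAt_id (𝕜 := ℝ) (0 : R)).const_sub 1
  have h2 : HasStrictFDerivAt (fun A : R => 1 + A) (ContinuousLinearMap.id ℝ R) 0 :=
    (hasStrictFDerivAt_id (𝕜 := ℝ) (0 : R)).const_add 1
  have h3 := hasStrictFDerivAt_ringInverse (𝕜 := ℝ) (1 : Rˣ)
  have h4 : HasStrictFDerivAt (fun A : R => Ring.inverse (1 - A)) _ 0 :=
    HasStrictFDerivAt.comp (g := Ring.inverse) 0 (by simpa using h3) h1
  have h5 := h2.mul' h4
  refine HasStrictFDerivAt.congr_fderiv h5 ?_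
  ext1 A
  simp [two_smul]

theorem hasStrictFDerivAt_cayley :
    HasStrictFDerivAt (cayley (p := p) (q := q))
      ((2 : ℝ) • ContinuousLinearMap.id ℝ (EndV p q)) 0 :=
  hasStrictFDerivAt_cayley_zero

/-- The group acts locally transitively. -/
theorem eventually_exists_actD {X : HomZ p q} (hX : X ∈ Dplus p q) :
    ∀ᶠ Y in 𝓝 X, ∃ g ∈ Gplus p q, actD (g : EndV p q) X = Y := by
  have hu : IsUnit (autFac (1 : EndV p q) X) :=
    isUnit_autFac (g := (1 : (EndV p q)ˣ)) (one_mem _) hX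
  have hc1 : ContDiffAt ℝ 1 (fun g : EndV p q => actD g X) 1 :=
    ContDiffAt.comp (1 : EndV p q) (contDiffAt_actD hu 1) (contDiffAt_id.prodMk contDiffAt_const)
  have hs1 : HasStrictFDerivAt (fun g : EndV p q => actD g X)
      (fderiv ℝ (fun g : EndV p q => actD g X) 1) 1 := hc1.hasStrictFDerivAt one_ne_zero
  let O : HomZ p q →L[ℝ] EndV p q := (lieG p q).subtypeL ∘L offDiag
  have hO : ∀ B, O B = (offDiag B : EndV p q) := fun _ => rfl
  have hcay : HasStrictFDerivAt (fun B : HomZ p q => cayley (O B))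
      (((2 : ℝ) • ContinuousLinearMap.id ℝ (EndV p q)) ∘L O) 0 :=
    HasStrictFDerivAt.comp (g := cayley) 0 (by rw [map_zero]; exact hasStrictFDerivAt_cayley)
      O.hasStrictFDerivAt
  have hcay0 : cayley (O (0 : HomZ p q)) = 1 := by simp [cayley]
  have hΦ : HasStrictFDerivAt (fun B : HomZ p q => actD (cayley (O B)) X)
      ((fderiv ℝ (fun g : EndV p q => actD g X) 1) ∘L
        (((2 : ℝ) • ContinuousLinearMap.id ℝ (EndV p q)) ∘L O)) 0 :=
    HasStrictFDerivAt.comp (g := fun g : EndV p q => actD g X) 0 (by rw [hcay0]; exact hs1) hcay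
  set Lin := (fderiv ℝ (fun g : EndV p q => actD g X) 1) ∘L
        (((2 : ℝ) • ContinuousLinearMap.id ℝ (EndV p q)) ∘L O) with hLin
  -- The infinitesimal action of `offDiag B` at `X` is `B - X B* X`; the factor `2` is the
  -- derivative of the Cayley transform at `0`.
  have hLin_apply : ∀ B, Lin B = (2 : ℝ) • (B - X ∘L (B†) ∘L X) := by
    intro B
    have hone : autFac (1 : EndV p q) X = 1 := by
      ext1 w
      exact (congrArg Prod.snd (apply_graph (1 : EndV p q) X w)).symm
    have h1 : Lin B = fderiv ℝ (fun g : EndV p q => actD g X) 1 ((2 : ℝ) • (O B)) := rfl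
    rw [h1, map_smul, fderiv_actD_left hu, actD_one, hone, Ring.inverse_one, hO, numer, autFac,
      b11_offDiag, b12_offDiag, b21_offDiag, rho_offDiag]
    congr 1
    ext1 w
    simp
  -- `B = X B* X` implies `‖B‖ ≤ ‖X‖² ‖B‖`, so `B = 0` because `‖X‖ < 1`.
  have hinj : Function.Injective Lin := by
    refine (injective_iff_map_eq_zero _).2 fun B hB => ?_
    rw [hLin_apply, smul_eq_zero, or_iff_right two_ne_zero, sub_eq_zero] at hB
    have hXn := (mem_Dplus_iff_norm X).1 hX
    by_contra hne
    have hpos : 0 < ‖B‖ := norm_pos_iff.2 hne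
    have h1 : ‖B‖ ≤ ‖X‖ * (‖B‖ * ‖X‖) := by
      conv_lhs => rw [hB]
      refine (ContinuousLinearMap.opNorm_comp_le _ _).trans ?_
      gcongr
      refine (ContinuousLinearMap.opNorm_comp_le _ _).trans ?_
      rw [LinearIsometryEquiv.norm_map]
    have h2 : ‖X‖ * (‖B‖ * ‖X‖) < ‖B‖ := by
      have h3 : 0 ≤ ‖X‖ := norm_nonneg X
      nlinarith [mul_nonneg h3 hpos.le]
    linarith
  have hsurj : Lin.range = ⊤ :=
    LinearMap.range_eq_top.2 (LinearMap.surjective_of_injective (f := Lin.toLinearMap) hinj)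
  -- A map with surjective strict derivative is open at the point, so the orbit contains a
  -- neighbourhood of `X`.
  have hmap := hΦ.map_nhds_eq_of_surj hsurj
  rw [hcay0, actD_one] at hmap
  rw [← hmap, Filter.eventually_map]
  have hnear : ∀ᶠ B in 𝓝 (0 : HomZ p q), ‖O B‖ < 1 := by
    have : Filter.Tendsto (fun B : HomZ p q => ‖O B‖) (𝓝 0) (𝓝 0) := by
      simpa using (O.continuous.norm.tendsto (0 : HomZ p q))
    exact this.eventually_lt_const one_pos
  filter_upwards [hnear] with B hB
  exact ⟨cayleyUnit hB, cayleyUnit_mem_Gplus hB (offDiag B).2, rfl⟩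

/-- The identity component acts transitively on the symmetric space. -/
theorem exists_projD_eq {X : HomZ p q} (hX : X ∈ Dplus p q) :
    ∃ g ∈ Gplus p q, projD (g : EndV p q) = X := by
  -- The orbit of the base point and its complement in `𝔻⁺` are both open, and the ball `𝔻⁺` is
  -- connected.
  let O : Set (HomZ p q) := {Y | Y ∈ Dplus p q ∧ ∃ g ∈ Gplus p q, projD (g : EndV p q) = Y}
  let O' : Set (HomZ p q) := {Y | Y ∈ Dplus p q ∧ ¬ ∃ g ∈ Gplus p q, projD (g : EndV p q) = Y}
  have hmove : ∀ {Y : HomZ p q} {g k : (EndV p q)ˣ}, g ∈ Gplus p q → k ∈ Gplus p q →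
      projD (k : EndV p q) = Y →
      projD ((g * k : (EndV p q)ˣ) : EndV p q) = actD (g : EndV p q) Y := by
    rintro Y g k hg hk rfl
    exact actD_mul (Gplus_le hg) (Gplus_le hk) zero_mem_Dplus
  have hO : IsOpen O := by
    rw [isOpen_iff_mem_nhds]
    rintro Y ⟨hY, k, hk, hkY⟩
    filter_upwards [eventually_exists_actD hY, isOpen_Dplus.mem_nhds hY] with Z ⟨g, hg, hgZ⟩ hZ
    exact ⟨hZ, g * k, mul_mem hg hk, (hmove hg hk hkY).trans hgZ⟩
  have hO' : IsOpen O' := by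
    rw [isOpen_iff_mem_nhds]
    rintro Y ⟨hY, hno⟩
    filter_upwards [eventually_exists_actD hY, isOpen_Dplus.mem_nhds hY] with Z ⟨g, hg, hgZ⟩ hZ
    refine ⟨hZ, fun ⟨k, hk, hkZ⟩ => hno ⟨g⁻¹ * k, mul_mem (inv_mem hg) hk, ?_⟩⟩
    rw [hmove (inv_mem hg) hk hkZ, ← hgZ, actD_inv_actD (Gplus_le hg) hY]
  have hpre : IsPreconnected (Dplus p q) := by
    rw [Dplus_eq_ball]
    exact (convex_ball _ _).isPreconnected
  have hsub : Dplus p q ⊆ O := by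
    refine hpre.subset_left_of_subset_union hO hO' ?_ ?_ ⟨0, zero_mem_Dplus, zero_mem_Dplus, 1,
      one_mem _, actD_one 0⟩
    · exact Set.disjoint_left.2 fun Y h h' => h'.2 h.2
    · intro Y hY
      by_cases h : ∃ g ∈ Gplus p q, projD (g : EndV p q) = Y
      · exact Or.inl ⟨hY, h⟩
      · exact Or.inr ⟨hY, h⟩
  exact (hsub hX).2

/-! ### Differentials of the projections -/

theorem leftTriv_apply (g : EndV p q) (A : lieG p q) : leftTriv g A = g * (A : EndV p q) := rfl

/-- Only the block `b12 A` enters: the directions of `𝔨` are vertical. -/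
theorem dProjD_apply {g : (EndV p q)ˣ} (hg : g ∈ orthGroup p q) (A : lieG p q) :
    dProjD (g : EndV p q) A =
      (b11 (g : EndV p q) - projD (g : EndV p q) ∘L b21 (g : EndV p q)) ∘L
        b12 (A : EndV p q) ∘L Ring.inverse (rho (g : EndV p q)) := by
  have hu : IsUnit (autFac (g : EndV p q) 0) := isUnit_autFac hg zero_mem_Dplus
  have h : dProjD (g : EndV p q) A =
      fderiv ℝ (fun g : EndV p q => actD g 0) g (g * (A : EndV p q)) := rfl
  rw [h, fderiv_actD_left hu, autFac_zero, autFac_zero, numer_zero, b12_mul, rho_mul,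
    ← projD_comp_rho hg]
  ext1 w
  simp [projD]

theorem differentiableAt_projD {g : (EndV p q)ˣ} (hg : g ∈ orthGroup p q) :
    DifferentiableAt ℝ (projD (p := p) (q := q)) (g : EndV p q) :=
  (ContDiffAt.comp (g : EndV p q) (contDiffAt_actD (isUnit_autFac hg zero_mem_Dplus) 1)
    (contDiffAt_id.prodMk contDiffAt_const)).differentiableAt one_ne_zero

theorem dProjE_apply {g : (EndV p q)ˣ} (hg : g ∈ orthGroup p q) (w : Neg q) (A : lieG p q)
    (w' : Neg q) : dProjE (g : EndV p q) w (A, w') = (dProjD (g : EndV p q) A,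
      b21 (g : EndV p q) (b12 (A : EndV p q) w) +
        rho (g : EndV p q) (w' + rho (A : EndV p q) w)) := by
  have h1 : HasFDerivAt (fun x : EndV p q × Neg q => projD x.1)
      ((fderiv ℝ projD (g : EndV p q)) ∘L ContinuousLinearMap.fst ℝ (EndV p q) (Neg q))
        ((g : EndV p q), w) :=
    HasFDerivAt.comp (g := projD) _ (differentiableAt_projD hg).hasFDerivAt hasFDerivAt_fst
  have h2 : HasFDerivAt (fun x : EndV p q × Neg q => rho x.1 x.2) _ ((g : EndV p q), w) :=
    HasFDerivAt.clm_apply (rho.hasFDerivAt.comp ((g : EndV p q), w) hasFDerivAt_fst)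
      hasFDerivAt_snd
  have h3 : HasFDerivAt (projE (p := p) (q := q)) _ ((g : EndV p q), w) := h1.prodMk h2
  rw [dProjE, h3.fderiv]
  refine Prod.ext rfl ?_
  change rho (g : EndV p q) w' + rho ((g : EndV p q) * (A : EndV p q)) w = _
  rw [rho_mul, map_add]
  simp
  abel

/-! ### Berezin integrals for curvatures in the image of `R ↦ R(y)* R(x) - R(x)* R(y)` -/

theorem det_rows (M : Neg q →L[ℝ] Neg q) (z : Fin q → Neg q) :
    (Matrix.of fun i j => M (z i) j).det = M.det * (Matrix.of fun i j => z i j).det := by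
  have h : ∀ z : Fin q → Neg q, (Matrix.of fun i j => z i j).det = (stdBasis q).det z := by
    intro z
    rw [Basis.det_apply, ← Matrix.det_transpose]
    congr 1
  rw [h (fun i => M (z i)), h z]
  exact (stdBasis q).det_comp M.toLinearMap z

theorem quadE_const_mul (N p : ℕ) (c : ℝ) (f : (Fin p → ℝ) → ℝ) :
    quadE N p (fun t => c * f t) = c * quadE N p f := by
  rw [quadE, quadE, Finset.mul_sum]
  refine Finset.sum_congr rfl fun s _ => ?_
  ring

theorem quadE_det_rows (N : ℕ) (M : Neg q →L[ℝ] Neg q) (z : (Fin p → ℝ) → Fin q → Neg q) :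
    quadE N p (fun t => (Matrix.of fun i j => M (z t i) j).det) =
      M.det * quadE N p fun t => (Matrix.of fun i j => z t i j).det := by
  rw [← quadE_const_mul]
  simp_rw [det_rows]

/-- The adjoint, as a linear map. -/
def adjL : HomZ p q →L[ℝ] (Pos p →L[ℝ] Neg q) :=
  LinearMap.toContinuousLinearMap
    { toFun := fun x => x†
      map_add' := fun x y => map_add _ x y
      map_smul' := fun c x => by simp }

theorem adjL_apply (x : HomZ p q) : adjL x = x† := rfl

section MqFormEval

variable {T : Type} [NormedAddCommGroup T] [NormedSpace ℝ T]

/-- The `α`-th row `x ↦ R(x)* e_α` of a `Hom(z₀, z₀^⊥)`-valued form. -/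
def rowForm (R : T →L[ℝ] HomZ p q) (α : Fin p) : T →L[ℝ] Neg q :=
  (ContinuousLinearMap.apply ℝ (Neg q) (EuclideanSpace.single α (1 : ℝ))) ∘L adjL ∘L R

theorem rowForm_apply (R : T →L[ℝ] HomZ p q) (α : Fin p) (x : T) :
    rowForm R α x = ((R x)†) (EuclideanSpace.single α 1) := rfl

theorem stdBasis_apply (i : Fin q) : stdBasis q i = EuclideanSpace.single i 1 := by
  simp [stdBasis]

theorem rowForm_coord (R : T →L[ℝ] HomZ p q) (α : Fin p) (x : T) (i : Fin q) :
    rowForm R α x i = R x (stdBasis q i) α := by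
  rw [rowForm_apply, stdBasis_apply]
  have h := ContinuousLinearMap.adjoint_inner_left (R x) (EuclideanSpace.single i 1)
    (EuclideanSpace.single α 1)
  simpa [EuclideanSpace.inner_single_right, EuclideanSpace.inner_single_left] using h

/-- The inner products of `z₀^⊥` are expanded in its standard basis, with one square for each basis
vector. -/
theorem isSumSq_of_eq {R : T →L[ℝ] HomZ p q} {B : T → T → (Neg q →L[ℝ] Neg q)}
    (hB : ∀ x y, B x y = (R y)† ∘L R x - (R x)† ∘L R y) : IsSumSq (rowForm R) B := by
  intro x y i j
  rw [hB]
  simp only [sub_apply, ContinuousLinearMap.comp_apply, inner_sub_left,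
    ContinuousLinearMap.adjoint_inner_left, rowForm_coord, Finset.sum_sub_distrib]
  rw [PiLp.inner_apply, PiLp.inner_apply]
  simp [mul_comm]

theorem sum_rowForm (R : T →L[ℝ] HomZ p q) (t : Fin p → ℝ) (x : T) (j : Fin q) :
    ∑ α, t α * rowForm R α x j = ((R x)†) (WithLp.toLp 2 t) j := by
  have h : (WithLp.toLp 2 t : Pos p) = ∑ α, t α • EuclideanSpace.single α (1 : ℝ) := by
    ext β
    simp [Finset.sum_apply, Pi.single_apply]
  rw [h, map_sum]
  simp [rowForm_apply]

theorem algebraMap_neg_add_biOfOneForm_neg (c k : ℝ) (l : T →L[ℝ] Neg q) (b : BiForms T q) :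
    algebraMap ℝ (BiForms T q) (-c) + biOfOneForm (-k • l) + b =
      -algebraMap ℝ (BiForms T q) c - k • biOfOneForm l + b := by
  rw [biOfOneForm_smul, map_neg, neg_smul, ← sub_eq_add_neg]

variable [FiniteDimensional ℝ T]

theorem toForm_berezin_expB_of_eq (c : ℝ) (l : T →L[ℝ] Neg q) {R : T →L[ℝ] HomZ p q}
    {B : T → T → (Neg q →L[ℝ] Neg q)} (hB : ∀ x y, B x y = (R y)† ∘L R x - (R x)† ∘L R y)
    (x : Fin q → T) :
    toForm q (berezin (expB (algebraMap ℝ (BiForms T q) c + biOfOneForm l + biOfTwoForm B))) x =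
      Real.exp c * (-1) ^ (q * (q - 1) / 2) * quadE (q + 1) p fun t =>
        (Matrix.of fun i j => (l (x i) + ((R (x i))†) (WithLp.toLp 2 t)) j).det := by
  rw [toForm_berezin_expB c l (isSumSq_of_eq hB)]
  simp_rw [sum_rowForm]
  rfl

theorem toForm_berezin_expB_neg (c k : ℝ) (l : T →L[ℝ] Neg q) {R : T →L[ℝ] HomZ p q}
    {B : T → T → (Neg q →L[ℝ] Neg q)} (hB : ∀ x y, B x y = (R y)† ∘L R x - (R x)† ∘L R y)
    (x : Fin q → T) :
    toForm q (berezin (expB (-algebraMap ℝ (BiForms T q) c - k • biOfOneForm l +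
      biOfTwoForm B))) x =
      Real.exp (-c) * (-1) ^ (q * (q - 1) / 2) * quadE (q + 1) p fun t =>
        (Matrix.of fun i j => (-k • l (x i) + ((R (x i))†) (WithLp.toLp 2 t)) j).det := by
  rw [← algebraMap_neg_add_biOfOneForm_neg, toForm_berezin_expB_of_eq _ _ hB]
  rfl

theorem toForm_berezin_expB_neg_zero (k : ℝ) (l : T →L[ℝ] Neg q) {R : T →L[ℝ] HomZ p q}
    {B : T → T → (Neg q →L[ℝ] Neg q)} (hB : ∀ x y, B x y = (R y)† ∘L R x - (R x)† ∘L R y)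
    (x : Fin q → T) :
    toForm q (berezin (expB (-k • biOfOneForm l + biOfTwoForm B))) x =
      (-1) ^ (q * (q - 1) / 2) * quadE (q + 1) p fun t =>
        (Matrix.of fun i j => (-k • l (x i) + ((R (x i))†) (WithLp.toLp 2 t)) j).det := by
  have h := toForm_berezin_expB_neg 0 k l hB x
  rw [map_zero, neg_zero, zero_sub, ← neg_smul, neg_zero, Real.exp_zero, one_mul] at h
  exact h

theorem mqForm_apply_of_eq (l : T →L[ℝ] Neg q) {R : T →L[ℝ] HomZ p q}
    {B : T →L[ℝ] T →L[ℝ] (Neg q →L[ℝ] Neg q)}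
    (hB : ∀ x y, B x y = (R y)† ∘L R x - (R x)† ∘L R y) (x : Fin q → T) :
    mqForm l B x = (-1) ^ (q * (q - 1) / 2) * quadE (q + 1) p fun t =>
      (Matrix.of fun i j => (l (x i) + ((R (x i))†) (WithLp.toLp 2 t)) j).det := by
  rw [mqForm_apply l (isSumSq_of_eq (B := fun x y => B x y) hB)]
  simp_rw [sum_rowForm]
  rfl

end MqFormEval

/-! ### The curvature -/

theorem b21_eq_adjoint (A : lieG p q) : b21 (A : EndV p q) = (b12 (A : EndV p q))† := by
  rw [ContinuousLinearMap.eq_adjoint_iff]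
  intro x y
  have h := A.2 (x, 0) (0, y)
  simp only [Q, inner_zero_left, inner_zero_right, zero_sub, sub_zero] at h
  rw [b21_apply, b12_apply]
  linarith

/-- The block-diagonal parts cancel between `[θ A, θ B]` and `θ [A, B]`. What is left comes from the
off-diagonal blocks and has the shape that `isSumSq_of_eq` asks for, with `R` the block `b12`. -/
theorem rho_curv (A B : lieG p q) : rho (curv (A : EndV p q) (B : EndV p q)) =
    (b12 (B : EndV p q))† ∘L b12 (A : EndV p q) - (b12 (A : EndV p q))† ∘L b12 (B : EndV p q) := by
  have h1 : ∀ A B : EndV p q, b21 (theta A) = 0 := fun A B => by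
    ext1 x
    rw [b21_apply]
    change rho A 0 = 0
    rw [map_zero]
  rw [curv, Ring.lie_def, Ring.lie_def, map_sub, map_sub, rho_theta, map_sub, rho_mul, rho_mul,
    rho_mul, rho_mul, h1 _ 0, h1 _ 0, rho_theta, rho_theta, b21_eq_adjoint, b21_eq_adjoint,
    ContinuousLinearMap.zero_comp, ContinuousLinearMap.zero_comp]
  abel

/-- The row form of the lift of the curvature. -/
def b12L : lieG p q →L[ℝ] HomZ p q := b12 ∘L (lieG p q).subtypeL

theorem nablaTaut_apply (w : Neg q) (A : lieG p q) (w' : Neg q) :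
    nablaTaut w (A, w') = w' + rho (A : EndV p q) w := rfl

theorem mqLift_apply (w : Neg q) (x : Fin q → lieG p q × Neg q) :
    mqLift p w x = cst q * (Real.exp (-(2 * Real.pi * ‖w‖ ^ 2)) * (-1) ^ (q * (q - 1) / 2) *
      quadE (q + 1) p fun t => (Matrix.of fun i j =>
        (-(2 * √Real.pi) • (nablaTaut w (x i)) + ((b12 ((x i).1 : EndV p q))†) (WithLp.toLp 2 t)) j).det) := by
  exact congrArg (cst q * ·) (toForm_berezin_expB_neg (T := lieG p q × Neg q)
    (2 * Real.pi * ‖w‖ ^ 2) (2 * √Real.pi) (nablaTaut w)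
    (R := b12L ∘L ContinuousLinearMap.fst ℝ (lieG p q) (Neg q)) (fun x y => rho_curv x.1 y.1) x)

/-! ### The explicit form -/

/-- The lift of the covariant derivative of the tautological section, in the chart. -/
def lU (X : HomZ p q) (u : Neg q) : (HomZ p q × Neg q) →L[ℝ] Neg q :=
  -(2 * √Real.pi) • (gram X ∘L ContinuousLinearMap.snd ℝ (HomZ p q) (Neg q) -
    (adjL X) ∘L (ContinuousLinearMap.apply ℝ (Pos p) u) ∘L
      ContinuousLinearMap.fst ℝ (HomZ p q) (Neg q))

theorem lU_apply (X : HomZ p q) (u : Neg q) (x : HomZ p q) (η : Neg q) :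
    lU X u (x, η) = -(2 * √Real.pi) • (gram X η - (X†) (x u)) := rfl

/-- The bilinear map `(x, y) ↦ y* S x`. -/
def compBil (S : Pos p →L[ℝ] Pos p) :
    (HomZ p q × Neg q) →L[ℝ] (HomZ p q × Neg q) →L[ℝ] (Neg q →L[ℝ] Neg q) :=
  (ContinuousLinearMap.compL ℝ (Neg q) (Pos p) (Neg q)).flip.bilinearComp
    ((ContinuousLinearMap.compL ℝ (Neg q) (Pos p) (Pos p) S) ∘L
      ContinuousLinearMap.fst ℝ (HomZ p q) (Neg q))
    (adjL ∘L ContinuousLinearMap.fst ℝ (HomZ p q) (Neg q))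

/-- The curvature in the chart. -/
def bU (S : Pos p →L[ℝ] Pos p) :
    (HomZ p q × Neg q) →L[ℝ] (HomZ p q × Neg q) →L[ℝ] (Neg q →L[ℝ] Neg q) :=
  compBil S - (compBil S).flip

theorem bU_apply (S : Pos p →L[ℝ] Pos p) (x y : HomZ p q × Neg q) :
    bU S x y = (y.1†) ∘L (S ∘L x.1) - (x.1†) ∘L (S ∘L y.1) := rfl

/-- The Mathai-Quillen form in the chart. -/
def Uex (a : HomZ p q × Neg q) : (HomZ p q × Neg q) [⋀^Fin q]→L[ℝ] ℝ :=
  (cst q * (gram a.1).det ^ (-(1 / 2) : ℝ) * Real.exp (-(2 * Real.pi * ⟪gram a.1 a.2, a.2⟫))) •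
    mqForm (lU a.1 a.2) (bU (gramInv' a.1))

theorem Uex_apply {g : (EndV p q)ˣ} (hg : g ∈ orthGroup p q) (u : Neg q)
    (x : Fin q → HomZ p q × Neg q) :
    Uex (projD (g : EndV p q), u) x = (cst q * (gram (projD (g : EndV p q))).det ^ (-(1 / 2) : ℝ) *
      Real.exp (-(2 * Real.pi * ⟪gram (projD (g : EndV p q)) u, u⟫))) *
      ((-1) ^ (q * (q - 1) / 2) * quadE (q + 1) p fun t => (Matrix.of fun i j =>
        (lU (projD (g : EndV p q)) u (x i) +
          ((x i).1†) (b11 (g : EndV p q) (WithLp.toLp 2 t))) j).det) := by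
  have h := mqForm_apply_of_eq (lU (projD (g : EndV p q)) u)
    (R := (ContinuousLinearMap.compL ℝ (Neg q) (Pos p) (Pos p) ((b11 (g : EndV p q))†)) ∘L
      ContinuousLinearMap.fst ℝ (HomZ p q) (Neg q)) (B := bU (gramInv' (projD (g : EndV p q))))
    (fun x y => by
      rw [bU_apply, gramInv'_eq hg]
      have hR : ∀ z : HomZ p q × Neg q, ((ContinuousLinearMap.compL ℝ (Neg q) (Pos p) (Pos p)
          ((b11 (g : EndV p q))†)) ∘L ContinuousLinearMap.fst ℝ (HomZ p q) (Neg q)) z =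
          ((b11 (g : EndV p q))†) ∘L z.1 := fun z => rfl
      rw [hR, hR, ContinuousLinearMap.adjoint_comp, ContinuousLinearMap.adjoint_comp,
        ContinuousLinearMap.adjoint_adjoint]
      rfl) x
  have hs : ∀ (c : ℝ) (f : (HomZ p q × Neg q) [⋀^Fin q]→L[ℝ] ℝ), (c • f) x = c * f x :=
    fun _ _ => rfl
  rw [Uex, hs, h]
  have hrow : ∀ (i : Fin q) (t : Pos p), (ContinuousLinearMap.adjoint
      (((ContinuousLinearMap.compL ℝ (Neg q) (Pos p) (Pos p) ((b11 (g : EndV p q))†)) ∘L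
        ContinuousLinearMap.fst ℝ (HomZ p q) (Neg q)) (x i))) t =
      ((x i).1†) (b11 (g : EndV p q) t) := by
    intro i t
    have h3 : ((ContinuousLinearMap.compL ℝ (Neg q) (Pos p) (Pos p)
          ((b11 (g : EndV p q))†)) ∘L ContinuousLinearMap.fst ℝ (HomZ p q) (Neg q)) (x i) =
          ((b11 (g : EndV p q))†) ∘L (x i).1 := rfl
    rw [h3, ContinuousLinearMap.adjoint_comp, ContinuousLinearMap.adjoint_adjoint]
    rfl
  simp_rw [hrow]

/-- The orthonormal frame transported by `g` differs from the graph coordinates by `ρ(g)`. Its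
determinant is positive on the identity component, hence equal to the square root `det (gram X) ^
(-1/2)`, which depends only on the plane. This explains the power of the determinant in `Uex`. -/
theorem det_inverse_rho_adjoint {g : (EndV p q)ˣ} (hg : g ∈ Gplus p q) :
    (gram (projD (g : EndV p q))).det ^ (-(1 / 2) : ℝ) *
      ((Ring.inverse (rho (g : EndV p q)))†).det = 1 := by
  have hpos := det_rho_pos hg
  have hmul : ∀ a b : Neg q →L[ℝ] Neg q, (a * b).det = a.det * b.det := fun a b =>
    LinearMap.det_comp a.toLinearMap b.toLinearMap
  have hone : (1 : Neg q →L[ℝ] Neg q).det = 1 := LinearMap.det_id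
  have h1 : (Ring.inverse (rho (g : EndV p q))).det = ((rho (g : EndV p q)).det)⁻¹ := by
    refine eq_inv_of_mul_eq_one_left ?_
    rw [← hmul, Ring.inverse_mul_cancel _ (isUnit_rho (Gplus_le hg)), hone]
  have h2 : (gram (projD (g : EndV p q))).det = ((rho (g : EndV p q)).det ^ 2)⁻¹ := by
    have h3 := congrArg ContinuousLinearMap.det (rho_inverse (Gplus_le hg))
    rw [hmul, det_adjoint_clm, h1] at h3
    field_simp
    field_simp at h3
    linarith
  rw [det_adjoint_clm, h1, h2, Real.inv_rpow (by positivity), Real.rpow_neg (by positivity), inv_inv,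
    ← Real.sqrt_eq_rpow, Real.sqrt_sq hpos.le, mul_inv_cancel₀ hpos.ne']

theorem inner_gram_rho {g : (EndV p q)ˣ} (hg : g ∈ orthGroup p q) (w : Neg q) :
    ⟪gram (projD (g : EndV p q)) (rho (g : EndV p q) w), rho (g : EndV p q) w⟫ = ‖w‖ ^ 2 := by
  have h : ((rho (g : EndV p q))†) (gram (projD (g : EndV p q)) (rho (g : EndV p q) w)) = w := by
    have h1 := congrArg (fun f : Neg q →L[ℝ] Neg q => f (rho (g : EndV p q) w)) (rho_inverse hg)
    have h2 : (Ring.inverse (rho (g : EndV p q)) * rho (g : EndV p q)) w = w := by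
      rw [Ring.inverse_mul_cancel _ (isUnit_rho hg)]
      rfl
    exact h1.symm.trans h2
  rw [← ContinuousLinearMap.adjoint_inner_left, h, real_inner_self_eq_norm_sq]

/-- `lU` is the covariant derivative of the tautological section, up to the frame change
`(ρ(g)⁻¹)†`. The same frame change occurs in `adjoint_dProjD_b11`, so that `quadE_det_rows` extracts
a single determinant. -/
theorem lU_dProjE {g : (EndV p q)ˣ} (hg : g ∈ orthGroup p q) (w w' : Neg q) (A : lieG p q) :
    lU (projD (g : EndV p q)) (rho (g : EndV p q) w) (dProjE (g : EndV p q) w (A, w')) =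
      ((Ring.inverse (rho (g : EndV p q)))†) (-(2 * √Real.pi) • nablaTaut w (A, w')) := by
  have hu := isUnit_rho hg
  set r := rho (g : EndV p q) with hr
  set X := projD (g : EndV p q) with hX
  have h1 : ∀ z, Ring.inverse r (r z) = z := fun z =>
    congrArg (fun f : Neg q →L[ℝ] Neg q => f z) (Ring.inverse_mul_cancel _ hu)
  have h2 : ∀ z, ((Ring.inverse r)†) ((r†) z) = z := fun z => by
    have : (Ring.inverse r)† ∘L r† = 1 := by
      rw [← ContinuousLinearMap.adjoint_comp]
      have : r ∘L Ring.inverse r = 1 := Ring.mul_inverse_cancel _ hu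
      rw [this, ContinuousLinearMap.one_def, ContinuousLinearMap.adjoint_id]
    exact congrArg (fun f : Neg q →L[ℝ] Neg q => f z) this
  have h3 : ∀ z, (r†) (gram X z) = Ring.inverse r z := fun z =>
    (congrArg (fun f : Neg q →L[ℝ] Neg q => f z) (rho_inverse hg)).symm
  have h4 : ∀ z, (r†) ((X†) z) = ((b12 (g : EndV p q))†) z := fun z => by
    have := projD_comp_rho hg
    rw [← this, ContinuousLinearMap.adjoint_comp]
    rfl
  have h5 : ∀ z, r (((b12 (g : EndV p q))†) z) = b21 (g : EndV p q) (((b11 (g : EndV p q))†) z) :=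
    fun z => (congrArg (fun f : Pos p →L[ℝ] Neg q => f z) (b21_b11_adjoint hg)).symm
  have h6 : ∀ z, ((b11 (g : EndV p q))†) ((b11 (g : EndV p q) - X ∘L b21 (g : EndV p q)) z) = z :=
    fun z => congrArg (fun f : Pos p →L[ℝ] Pos p => f z) (adjoint_mul_b11_sub hg)
  rw [dProjE_apply hg, lU_apply, map_smul, nablaTaut_apply, dProjD_apply hg]
  congr 1
  rw [← h2 (gram X _ - _), map_sub, h3, h4, map_add, h1]
  congr 1
  rw [add_comm, add_sub_assoc]
  refine (add_eq_left.2 ?_)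
  rw [sub_eq_zero]
  have h7 : ∀ a b, r b = a → Ring.inverse r a = b := fun a b h => by rw [← h, h1]
  apply h7
  rw [h5]
  simp only [ContinuousLinearMap.comp_apply]
  rw [h6, h1]

theorem adjoint_dProjD_b11 {g : (EndV p q)ˣ} (hg : g ∈ orthGroup p q) (A : lieG p q) (t : Pos p) :
    ((dProjD (g : EndV p q) A)†) (b11 (g : EndV p q) t) =
      ((Ring.inverse (rho (g : EndV p q)))†) (((b12 (A : EndV p q))†) t) := by
  have h := congrArg ContinuousLinearMap.adjoint (adjoint_mul_b11_sub hg)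
  rw [ContinuousLinearMap.mul_def, ContinuousLinearMap.adjoint_comp,
    ContinuousLinearMap.adjoint_adjoint, ContinuousLinearMap.one_def,
    ContinuousLinearMap.adjoint_id] at h
  rw [dProjD_apply hg, ContinuousLinearMap.adjoint_comp, ContinuousLinearMap.adjoint_comp]
  simp only [ContinuousLinearMap.comp_apply]
  congr 2
  exact congrArg (fun f : Pos p →L[ℝ] Pos p => f t) h

/-- All rows of all determinants are transformed by the operator `(ρ(g)⁻¹)†`, whose determinant
cancels the power of `det (gram X)`. In particular the lift is basic. -/
theorem Uex_dProjE {g : (EndV p q)ˣ} (hg : g ∈ Gplus p q) (w : Neg q) :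
    ((Uex (projE ((g : EndV p q), w))).compContinuousLinearMap
      (dProjE (g : EndV p q) w)).toAlternatingMap = mqLift p w := by
  ext x
  have hgO := Gplus_le hg
  change Uex (projD (g : EndV p q), rho (g : EndV p q) w)
    (fun i => dProjE (g : EndV p q) w (x i)) = _
  rw [Uex_apply hgO, mqLift_apply, inner_gram_rho hgO]
  have hrow : ∀ (t : Fin p → ℝ) i, lU (projD (g : EndV p q)) (rho (g : EndV p q) w)
      (dProjE (g : EndV p q) w (x i)) + ((dProjE (g : EndV p q) w (x i)).1†)
        (b11 (g : EndV p q) (WithLp.toLp 2 t)) = ((Ring.inverse (rho (g : EndV p q)))†)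
      (-(2 * √Real.pi) • nablaTaut w (x i) + ((b12 ((x i).1 : EndV p q))†) (WithLp.toLp 2 t)) := by
    intro t i
    rw [map_add, ← adjoint_dProjD_b11 hgO, ← lU_dProjE hgO]
    congr 3
    rw [dProjE_apply hgO]
  simp_rw [hrow]
  rw [quadE_det_rows]
  linear_combination (cst q * Real.exp (-(2 * Real.pi * ‖w‖ ^ 2)) * (-1) ^ (q * (q - 1) / 2) *
      quadE (q + 1) p fun t => (Matrix.of fun i j =>
        (-(2 * √Real.pi) • (nablaTaut w (x i)) +
          ((b12 ((x i).1 : EndV p q))†) (WithLp.toLp 2 t)) j).det) * det_inverse_rho_adjoint hg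

/-- A form is determined by its pullback along a submersion, so the form chosen in `descend` is
unique. -/
theorem dProjE_surjective {g : (EndV p q)ˣ} (hg : g ∈ orthGroup p q) (w : Neg q) :
    Function.Surjective (dProjE (g : EndV p q) w) := by
  have hu := isUnit_rho hg
  rintro ⟨x, η⟩
  have h1 : ∀ z, rho (g : EndV p q) (Ring.inverse (rho (g : EndV p q)) z) = z := fun z =>
    congrArg (fun f : Neg q →L[ℝ] Neg q => f z) (Ring.mul_inverse_cancel _ hu)
  have h6 : ∀ z, (b11 (g : EndV p q) - projD (g : EndV p q) ∘L b21 (g : EndV p q))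
      (((b11 (g : EndV p q))†) z) = z :=
    fun z => congrArg (fun f : Pos p →L[ℝ] Pos p => f z) (b11_sub_mul_adjoint hg)
  -- `B` inverts the two outer factors of `dProjD_apply`; the second component then corrects the
  -- fibre direction.
  let B : HomZ p q := ((b11 (g : EndV p q))†) ∘L x ∘L rho (g : EndV p q)
  refine ⟨(offDiag B, Ring.inverse (rho (g : EndV p q)) (η - b21 (g : EndV p q) (B w))), ?_⟩
  rw [dProjE_apply hg, dProjD_apply hg, b12_offDiag, rho_offDiag]
  refine Prod.ext ?_ ?_
  · refine ContinuousLinearMap.ext fun z => ?_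
    change (b11 (g : EndV p q) - projD (g : EndV p q) ∘L b21 (g : EndV p q))
      (((b11 (g : EndV p q))†) (x (rho (g : EndV p q) (Ring.inverse (rho (g : EndV p q)) z)))) = x z
    rw [h6, h1]
  · change b21 (g : EndV p q) (B w) + rho (g : EndV p q) (Ring.inverse (rho (g : EndV p q))
      (η - b21 (g : EndV p q) (B w)) + 0) = η
    rw [add_zero, h1]
    abel

/-- The Mathai-Quillen form is the explicit form. -/
theorem UMQ_eq {X : HomZ p q} (hX : X ∈ Dplus p q) (u : Neg q) : UMQ p q (X, u) = Uex (X, u) := by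
  have hex : ∃ β : (HomZ p q × Neg q) [⋀^Fin q]→L[ℝ] ℝ,
      ∀ x ∈ {x : (EndV p q)ˣ × Neg q | x.1 ∈ Gplus p q},
        projE ((x.1 : EndV p q), x.2) = (X, u) →
        (β.compContinuousLinearMap (dProjE (x.1 : EndV p q) x.2)).toAlternatingMap =
          mqLift p x.2 := by
    refine ⟨Uex (X, u), fun x hx h => ?_⟩
    rw [← h]
    exact Uex_dProjE hx x.2
  have h := hex.choose_spec
  have hU : UMQ p q (X, u) = hex.choose := dif_pos hex
  rw [hU]
  obtain ⟨g, hg, rfl⟩ := exists_projD_eq hX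
  have hu := isUnit_rho (Gplus_le hg)
  set w := Ring.inverse (rho (g : EndV p q)) u with hw
  have h1 : rho (g : EndV p q) w = u :=
    congrArg (fun f : Neg q →L[ℝ] Neg q => f u) (Ring.mul_inverse_cancel _ hu)
  have hproj : projE ((g : EndV p q), w) = (projD (g : EndV p q), u) := by
    rw [← h1]
    rfl
  have h2 := (h (g, w) hg hproj).trans (Uex_dProjE hg w).symm
  rw [hproj] at h2
  ext x
  choose y hy using fun i => dProjE_surjective (Gplus_le hg) w (x i)
  have h3 := congrArg (fun f : (lieG p q × Neg q) [⋀^Fin q]→ₗ[ℝ] ℝ => f y) h2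
  have h4 : ∀ β : (HomZ p q × Neg q) [⋀^Fin q]→L[ℝ] ℝ,
      (β.compContinuousLinearMap (dProjE (g : EndV p q) w)).toAlternatingMap y = β x := by
    intro β
    change β (fun i => dProjE (g : EndV p q) w (y i)) = _
    simp_rw [hy]
  simpa only [h4] using h3

/-! ### The section -/

/-- The section `s_v` in the chart. -/
def secF (v : V p q) (X : HomZ p q) : Neg q := gramInv X (v.2 - (X†) v.1)

theorem inv_apply_snd {g : (EndV p q)ˣ} (hg : g ∈ orthGroup p q) (v : V p q) :
    (((g⁻¹ : (EndV p q)ˣ) : EndV p q) v).2 =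
      ((rho (g : EndV p q))†) (v.2 - ((projD (g : EndV p q))†) v.1) := by
  have h : (b12 (g : EndV p q))† = (rho (g : EndV p q))† ∘L (projD (g : EndV p q))† := by
    rw [← projD_comp_rho hg, ContinuousLinearMap.adjoint_comp]
  rw [endV_apply_snd, b21_inv hg, rho_inv hg, h, map_sub]
  simp
  abel

theorem projE_inv_apply {g : (EndV p q)ˣ} (hg : g ∈ orthGroup p q) (v : V p q) :
    projE ((g : EndV p q), (((g⁻¹ : (EndV p q)ˣ) : EndV p q) v).2) =
      (projD (g : EndV p q), secF v (projD (g : EndV p q))) := by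
  refine Prod.ext rfl ?_
  rw [inv_apply_snd hg, secF, gramInv_eq hg]
  rfl

/-- By `projE_inv_apply` the point `[g, pr(g⁻¹ v)]` depends on `g` only through `g z₀`, so the
choice made in `gz` disappears. -/
theorem sec_eq {X : HomZ p q} (hX : X ∈ Dplus p q) (v : V p q) : sec v X = (X, secF v X) := by
  have hex := exists_projD_eq hX
  have h : gz X = hex.choose := dif_pos hex
  have h1 := hex.choose_spec
  rw [← h] at h1
  rw [sec, projE_inv_apply (Gplus_le h1.1), h1.2]

theorem sec_projD {g : (EndV p q)ˣ} (hg : g ∈ orthGroup p q) (v : V p q) :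
    sec v (projD (g : EndV p q)) =
      projE ((g : EndV p q), (((g⁻¹ : (EndV p q)ˣ) : EndV p q) v).2) := by
  rw [projE_inv_apply hg, sec_eq (projD_mem_Dplus hg)]

theorem sec_eventuallyEq {X : HomZ p q} (hX : X ∈ Dplus p q) (v : V p q) :
    sec v =ᶠ[𝓝 X] fun Y => (Y, secF v Y) := by
  filter_upwards [isOpen_Dplus.mem_nhds hX] with Y hY using sec_eq hY v

theorem fv_unit (g : (EndV p q)ˣ) (v : V p q) :
    fv v (g : EndV p q) = (((g⁻¹ : (EndV p q)ˣ) : EndV p q) v).2 := by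
  rw [fv, Ring.inverse_unit]

theorem contDiff_gram (m : WithTop ℕ∞) : ContDiff ℝ m (gram (p := p) (q := q)) :=
  contDiff_const.sub ((adjL (p := p) (q := q)).contDiff.clm_comp contDiff_id)

theorem contDiffAt_gramInv {X : HomZ p q} (hX : X ∈ Dplus p q) (m : WithTop ℕ∞) :
    ContDiffAt ℝ m (gramInv (p := p) (q := q)) X := by
  obtain ⟨u, hu⟩ := isUnit_gram hX
  have h : ContDiffAt ℝ m (Ring.inverse : (Neg q →L[ℝ] Neg q) → _) (gram X) :=
    hu ▸ contDiffAt_ringInverse ℝ u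
  exact ContDiffAt.comp (g := Ring.inverse) X h (contDiff_gram m).contDiffAt

theorem contDiffAt_secF {a : V p q × HomZ p q} (hX : a.2 ∈ Dplus p q) (m : WithTop ℕ∞) :
    ContDiffAt ℝ m (fun a : V p q × HomZ p q => secF a.1 a.2) a := by
  have h1 : ContDiffAt ℝ m (fun a : V p q × HomZ p q => gramInv a.2) a :=
    ContDiffAt.comp (g := gramInv) a (contDiffAt_gramInv hX m) contDiffAt_snd
  have h2 : ContDiff ℝ m (fun a : V p q × HomZ p q => a.1.2 - adjL a.2 a.1.1) :=
    (contDiff_snd.comp contDiff_fst).sub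
      (((adjL (p := p) (q := q)).contDiff.comp contDiff_snd).clm_apply
        (contDiff_fst.comp contDiff_fst))
  exact h1.clm_apply h2.contDiffAt

theorem contDiffAt_secF_right {X : HomZ p q} (hX : X ∈ Dplus p q) (v : V p q) (m : WithTop ℕ∞) :
    ContDiffAt ℝ m (secF v) X := by
  have h2 : ContDiff ℝ m (fun X : HomZ p q => v.2 - adjL X v.1) :=
    contDiff_const.sub ((adjL (p := p) (q := q)).contDiff.clm_apply contDiff_const)
  exact (contDiffAt_gramInv hX m).clm_apply h2.contDiffAt

theorem contDiffAt_sec {X : HomZ p q} (hX : X ∈ Dplus p q) (v : V p q) (m : WithTop ℕ∞) :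
    ContDiffAt ℝ m (sec v) X :=
  (contDiffAt_id.prodMk (contDiffAt_secF_right hX v m)).congr_of_eventuallyEq
    (sec_eventuallyEq hX v)

/-! ### Curves in the group -/

theorem hasDerivAt_mul_const_left {R : Type*} [NormedRing R] [NormedAlgebra ℝ R] {c : ℝ → R}
    {c' : R} {s : ℝ} (g : R) (hc : HasDerivAt c c' s) : HasDerivAt (fun s => g * c s) (g * c') s :=
  hc.const_mul g

theorem hasDerivAt_mul_cayley {R : Type*} [NormedRing R] [NormedAlgebra ℝ R]
    [HasSummableGeomSeries R] (g A : R) : HasDerivAt (fun s : ℝ =>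
      g * ((1 + s • (2⁻¹ : ℝ) • A) * Ring.inverse (1 - s • (2⁻¹ : ℝ) • A))) (g * A) 0 := by
  have h1 : HasDerivAt (fun s : ℝ => s • (2⁻¹ : ℝ) • A) ((2⁻¹ : ℝ) • A) 0 := by
    simpa using (hasDerivAt_id (0 : ℝ)).smul_const ((2⁻¹ : ℝ) • A)
  have h2 : HasFDerivAt (fun A : R => (1 + A) * Ring.inverse (1 - A))
      ((2 : ℝ) • ContinuousLinearMap.id ℝ R) ((0 : ℝ) • (2⁻¹ : ℝ) • A) := by
    rw [zero_smul]
    exact hasStrictFDerivAt_cayley_zero.hasFDerivAt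
  have h3 := HasFDerivAt.comp_hasDerivAt (0 : ℝ) h2 h1
  have h4 : ((2 : ℝ) • ContinuousLinearMap.id ℝ R) ((2⁻¹ : ℝ) • A) = A := by
    simp [smul_smul]
  rw [h4] at h3
  exact h3.const_mul g

/-- Identities between lifts hold only along the group, which is not open in `EndV p q`. Their
derivatives are compared along curves inside the group, and the Cayley transform of `s A / 2` has
velocity `A` because its derivative at `0` is twice the identity. -/
theorem exists_curve {g : (EndV p q)ˣ} (hg : g ∈ Gplus p q) (A : lieG p q) :
    ∃ c : ℝ → EndV p q, c 0 = g ∧ HasDerivAt c (leftTriv (g : EndV p q) A) 0 ∧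
      ∀ᶠ s in 𝓝 (0 : ℝ), ∃ k ∈ Gplus p q, (k : EndV p q) = c s := by
  let B : EndV p q := (2⁻¹ : ℝ) • (A : EndV p q)
  have hB : B ∈ lieG p q := (lieG p q).smul_mem _ A.2
  have h0 : (0 : ℝ) • B = 0 := zero_smul ℝ B
  refine ⟨fun s => (g : EndV p q) * cayley (s • B), ?_, ?_, ?_⟩
  · simp only [h0]
    simp [cayley]
  · exact hasDerivAt_mul_cayley (g : EndV p q) (A : EndV p q)
  · have hc : Filter.Tendsto (fun s : ℝ => ‖s • B‖) (𝓝 0) (𝓝 0) := by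
      have h : Continuous fun s : ℝ => ‖s • B‖ := (continuous_id.smul continuous_const).norm
      simpa using h.tendsto 0
    filter_upwards [hc.eventually_lt_const one_pos] with s hs
    exact ⟨g * cayleyUnit hs, mul_mem hg (cayleyUnit_mem_Gplus hs ((lieG p q).smul_mem _ hB)), rfl⟩

theorem differentiableAt_projE {g : (EndV p q)ˣ} (hg : g ∈ orthGroup p q) (w : Neg q) :
    DifferentiableAt ℝ (projE (p := p) (q := q)) ((g : EndV p q), w) := by
  have h1 : DifferentiableAt ℝ (fun x : EndV p q × Neg q => projD x.1) ((g : EndV p q), w) :=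
    DifferentiableAt.comp (g := projD) _ (differentiableAt_projD hg) differentiableAt_fst
  have h2 : DifferentiableAt ℝ (fun x : EndV p q × Neg q => rho x.1 x.2) ((g : EndV p q), w) :=
    DifferentiableAt.clm_apply (rho.differentiableAt.comp ((g : EndV p q), w) differentiableAt_fst)
      differentiableAt_snd
  exact h1.prodMk h2

theorem differentiableAt_fv (g : (EndV p q)ˣ) (v : V p q) :
    DifferentiableAt ℝ (fv v) (g : EndV p q) := by
  have h1 : DifferentiableAt ℝ (Ring.inverse : EndV p q → EndV p q) (g : EndV p q) :=
    (hasFDerivAt_ringInverse (𝕜 := ℝ) g).differentiableAt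
  have h2 : DifferentiableAt ℝ (fun g : EndV p q => Ring.inverse g v) (g : EndV p q) :=
    h1.clm_apply (differentiableAt_const v)
  exact DifferentiableAt.comp (g := fun v : V p q => v.2) _ differentiableAt_snd h2

/-- The identity `sec v ∘ projD = projE ∘ (id, fv v)` on the group is differentiated along a curve
with velocity `g A`. -/
theorem fderiv_sec_dProjD {g : (EndV p q)ˣ} (hg : g ∈ Gplus p q) (v : V p q) (A : lieG p q) :
    fderiv ℝ (sec v) (projD (g : EndV p q)) (dProjD (g : EndV p q) A) =
      dProjE (g : EndV p q) (fv v (g : EndV p q))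
        (A, fderiv ℝ (fv v) (g : EndV p q) (leftTriv (g : EndV p q) A)) := by
  have hgO := Gplus_le hg
  obtain ⟨c, hc0, hc, hcG⟩ := exists_curve hg A
  have h1 : HasDerivAt (fun s => sec v (projD (c s)))
      (fderiv ℝ (sec v) (projD (g : EndV p q)) (dProjD (g : EndV p q) A)) 0 := by
    have h2 : HasDerivAt (fun s => projD (c s)) (dProjD (g : EndV p q) A) 0 :=
      HasFDerivAt.comp_hasDerivAt (l := projD) 0
        (by rw [hc0]; exact (differentiableAt_projD hgO).hasFDerivAt) hc
    exact HasFDerivAt.comp_hasDerivAt (l := sec v) 0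
      (by
        rw [hc0]
        exact ((contDiffAt_sec (projD_mem_Dplus hgO) v 1).differentiableAt one_ne_zero).hasFDerivAt)
      h2
  have h3 : HasDerivAt (fun s => projE (c s, fv v (c s)))
      (dProjE (g : EndV p q) (fv v (g : EndV p q))
        (A, fderiv ℝ (fv v) (g : EndV p q) (leftTriv (g : EndV p q) A))) 0 := by
    have h4 : HasDerivAt (fun s => fv v (c s))
        (fderiv ℝ (fv v) (g : EndV p q) (leftTriv (g : EndV p q) A)) 0 :=
      HasFDerivAt.comp_hasDerivAt (l := fv v) 0
        (by rw [hc0]; exact (differentiableAt_fv g v).hasFDerivAt) hc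
    exact HasFDerivAt.comp_hasDerivAt (l := projE) 0
      (by rw [hc0]; exact (differentiableAt_projE hgO _).hasFDerivAt) (hc.prodMk h4)
  refine h1.unique (h3.congr_of_eventuallyEq ?_)
  filter_upwards [hcG] with s ⟨k, hk, hks⟩
  rw [← hks, sec_projD (Gplus_le hk), fv_unit]

/-- The lifted section `g ↦ (g, f_v(g))` pulls the covariant derivative of the tautological section
back to that of `s_v`. The Gaussian factors agree because `Q` on the plane is `-‖f_v(g)‖²`. -/
theorem phi0_dProjD (v : V p q) {g : (EndV p q)ˣ} (hg : g ∈ Gplus p q) :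
    ((phi0 v (projD (g : EndV p q))).compContinuousLinearMap
      (dProjD (g : EndV p q))).toAlternatingMap = berezinFormula v (g : EndV p q) := by
  have hgO := Gplus_le hg
  have hsec : sec v (projD (g : EndV p q)) = projE ((g : EndV p q), fv v (g : EndV p q)) := by
    rw [sec_projD hgO, fv_unit]
  ext A
  change UMQ p q (sec v (projD (g : EndV p q)))
    (fun i => fderiv ℝ (sec v) (projD (g : EndV p q)) (dProjD (g : EndV p q) (A i))) = _
  have hU : UMQ p q (sec v (projD (g : EndV p q))) =
      Uex (projE ((g : EndV p q), fv v (g : EndV p q))) := by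
    rw [hsec]
    exact UMQ_eq (projD_mem_Dplus hgO) _
  rw [hU]
  simp_rw [fderiv_sec_dProjD hg]
  have h := congrArg (fun f : (lieG p q × Neg q) [⋀^Fin q]→ₗ[ℝ] ℝ => f fun i =>
    (A i, fderiv ℝ (fv v) (g : EndV p q) (leftTriv (g : EndV p q) (A i))))
    (Uex_dProjE hg (fv v (g : EndV p q)))
  refine h.trans ?_
  have hB := toForm_berezin_expB_neg_zero (T := lieG p q) (2 * √Real.pi)
    (nablaSec v (g : EndV p q)) (R := b12L) (fun x y => rho_curv x y) A
  change mqLift p _ _ = _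
  rw [mqLift_apply, berezinFormula, AlternatingMap.smul_apply, hB]
  have hQ : Q ((0, fv v (g : EndV p q)) : V p q) (0, fv v (g : EndV p q)) =
      -‖fv v (g : EndV p q)‖ ^ 2 := by
    simp [Q]
  rw [hQ, smul_eq_mul, mul_neg, mul_assoc (Real.exp _), ← mul_assoc (cst q)]
  rfl

/-! ### Equivariance -/

/-- The action of the group on the total space of `E`. -/
def actE (g : EndV p q) (a : HomZ p q × Neg q) : HomZ p q × Neg q :=
  (actD g a.1, autFac g a.1 a.2)

theorem actE_projE {g k : (EndV p q)ˣ} (hg : g ∈ orthGroup p q) (hk : k ∈ orthGroup p q)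
    (w : Neg q) : actE (g : EndV p q) (projE ((k : EndV p q), w)) =
      projE (((g * k : (EndV p q)ˣ) : EndV p q), w) := by
  refine Prod.ext ?_ ?_
  · exact (actD_mul hg hk zero_mem_Dplus).symm
  · change autFac (g : EndV p q) (projD (k : EndV p q)) (rho (k : EndV p q) w) =
      rho ((g : EndV p q) * (k : EndV p q)) w
    rw [rho_mul, ← projD_comp_rho hk, autFac]
    rfl

theorem contDiffAt_actE {g : (EndV p q)ˣ} (hg : g ∈ orthGroup p q) {a : HomZ p q × Neg q}
    (ha : a.1 ∈ Dplus p q) (m : WithTop ℕ∞) : ContDiffAt ℝ m (actE (g : EndV p q)) a := by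
  have h1 : ContDiffAt ℝ m (fun a : HomZ p q × Neg q => actD (g : EndV p q) a.1) a :=
    ContDiffAt.comp (g := actD (g : EndV p q)) a
      (contDiffAt_actD_right (isUnit_autFac hg ha) m) contDiffAt_fst
  have h2 : ContDiff ℝ m (fun a : HomZ p q × Neg q => autFac (g : EndV p q) a.1 a.2) :=
    ((contDiff_const.clm_comp contDiff_fst).add contDiff_const).clm_apply contDiff_snd
  exact h1.prodMk h2.contDiffAt

theorem differentiableAt_actE {g : (EndV p q)ˣ} (hg : g ∈ orthGroup p q) {a : HomZ p q × Neg q}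
    (ha : a.1 ∈ Dplus p q) : DifferentiableAt ℝ (actE (g : EndV p q)) a :=
  (contDiffAt_actE hg ha 1).differentiableAt one_ne_zero

theorem hasDerivAt_projE_curve {k : (EndV p q)ˣ} (hk : k ∈ orthGroup p q) {A : lieG p q}
    {c : ℝ → EndV p q} (hc0 : c 0 = k) (hc : HasDerivAt c (leftTriv (k : EndV p q) A) 0)
    (w w' : Neg q) : HasDerivAt (fun s => projE (c s, w + s • w'))
      (dProjE (k : EndV p q) w (A, w')) 0 := by
  have hw : HasDerivAt (fun s : ℝ => w + s • w') w' 0 := by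
    simpa using ((hasDerivAt_id (0 : ℝ)).smul_const w').const_add w
  have hw0 : w + (0 : ℝ) • w' = w := by simp
  exact HasFDerivAt.comp_hasDerivAt (l := projE) 0
    (by rw [hc0, hw0]; exact (differentiableAt_projE hk w).hasFDerivAt) (hc.prodMk hw)

theorem leftTriv_mul (g k : (EndV p q)ˣ) (A : lieG p q) :
    leftTriv ((g * k : (EndV p q)ˣ) : EndV p q) A =
      (g : EndV p q) * leftTriv (k : EndV p q) A := by
  rw [leftTriv_apply, leftTriv_apply, Units.val_mul, mul_assoc]

/-- Left translation by `g` leaves the left trivialisation unchanged; the two sides are velocities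
of the same curve in `E`. -/
theorem fderiv_actE_dProjE {g k : (EndV p q)ˣ} (hg : g ∈ Gplus p q) (hk : k ∈ Gplus p q)
    (w : Neg q) (A : lieG p q) (w' : Neg q) :
    fderiv ℝ (actE (g : EndV p q)) (projE ((k : EndV p q), w)) (dProjE (k : EndV p q) w (A, w')) =
      dProjE ((g * k : (EndV p q)ˣ) : EndV p q) w (A, w') := by
  have hgO := Gplus_le hg
  have hkO := Gplus_le hk
  obtain ⟨c, hc0, hc, hcG⟩ := exists_curve hk A
  have hmem : (projE ((k : EndV p q), w)).1 ∈ Dplus p q := projD_mem_Dplus hkO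
  have hE := (differentiableAt_actE hgO hmem).hasFDerivAt
  have hp : projE (c 0, w + (0 : ℝ) • w') = projE ((k : EndV p q), w) := by
    rw [hc0, zero_smul, add_zero]
  have h1 := HasFDerivAt.comp_hasDerivAt_of_eq (l := actE (g : EndV p q)) 0 hE
    (hasDerivAt_projE_curve hkO hc0 hc w w') hp.symm
  have h4 : HasDerivAt (fun s => (g : EndV p q) * c s)
      (leftTriv ((g * k : (EndV p q)ˣ) : EndV p q) A) 0 := by
    rw [leftTriv_mul]
    exact hasDerivAt_mul_const_left (g : EndV p q) hc
  have h3 := hasDerivAt_projE_curve (mul_mem hgO hkO) (by rw [hc0, Units.val_mul]) h4 w w'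
  have hev : (fun s => actE (g : EndV p q) (projE (c s, w + s • w'))) =ᶠ[𝓝 0]
      fun s => projE ((g : EndV p q) * c s, w + s • w') := by
    filter_upwards [hcG] with s ⟨m, hm, hms⟩
    rw [← hms, actE_projE hgO (Gplus_le hm), Units.val_mul]
  exact HasDerivAt.unique h1 (h3.congr_of_eventuallyEq hev)

theorem exists_projE_eq {X : HomZ p q} (hX : X ∈ Dplus p q) (u : Neg q) :
    ∃ g ∈ Gplus p q, ∃ w, projE ((g : EndV p q), w) = (X, u) := by
  obtain ⟨g, hg, rfl⟩ := exists_projD_eq hX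
  refine ⟨g, hg, Ring.inverse (rho (g : EndV p q)) u, Prod.ext rfl ?_⟩
  exact congrArg (fun f : Neg q →L[ℝ] Neg q => f u)
    (Ring.mul_inverse_cancel _ (isUnit_rho (Gplus_le hg)))

/-- The Mathai-Quillen form is invariant. -/
theorem Uex_actE {g : (EndV p q)ˣ} (hg : g ∈ Gplus p q) {a : HomZ p q × Neg q}
    (ha : a.1 ∈ Dplus p q) :
    (Uex (actE (g : EndV p q) a)).compContinuousLinearMap (fderiv ℝ (actE (g : EndV p q)) a) =
      Uex a := by
  obtain ⟨k, hk, w, hkw⟩ := exists_projE_eq ha a.2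
  have hkw : projE ((k : EndV p q), w) = a := hkw
  ext x
  -- Tangent vectors are lifted to the group, where both sides become `mqLift`, the same form at `k`
  -- and at `g k`.
  choose y hy using fun i => dProjE_surjective (Gplus_le hk) w (x i)
  obtain rfl : (fun i => dProjE (k : EndV p q) w (y i)) = x := funext hy
  subst hkw
  change Uex (actE (g : EndV p q) (projE ((k : EndV p q), w)))
    (fun i => fderiv ℝ (actE (g : EndV p q)) (projE ((k : EndV p q), w))
      (dProjE (k : EndV p q) w (y i))) = Uex (projE ((k : EndV p q), w)) _
  have hd : ∀ i, fderiv ℝ (actE (g : EndV p q)) (projE ((k : EndV p q), w))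
      (dProjE (k : EndV p q) w (y i)) = dProjE ((g * k : (EndV p q)ˣ) : EndV p q) w (y i) :=
    fun i => fderiv_actE_dProjE hg hk w (y i).1 (y i).2
  simp_rw [hd]
  rw [actE_projE (Gplus_le hg) (Gplus_le hk)]
  exact (congrArg (fun f : (lieG p q × Neg q) [⋀^Fin q]→ₗ[ℝ] ℝ => f y)
    (Uex_dProjE (mul_mem hg hk) w)).trans (congrArg
      (fun f : (lieG p q × Neg q) [⋀^Fin q]→ₗ[ℝ] ℝ => f y) (Uex_dProjE hk w)).symm

theorem sec_actD {g : (EndV p q)ˣ} (hg : g ∈ Gplus p q) {X : HomZ p q} (hX : X ∈ Dplus p q)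
    (v : V p q) : sec v (actD (g : EndV p q) X) =
      actE (g : EndV p q) (sec (((g⁻¹ : (EndV p q)ˣ) : EndV p q) v) X) := by
  obtain ⟨k, hk, rfl⟩ := exists_projD_eq hX
  have hgO := Gplus_le hg
  have hkO := Gplus_le hk
  have h1 : actD (g : EndV p q) (projD (k : EndV p q)) =
      projD ((g * k : (EndV p q)ˣ) : EndV p q) := (actD_mul hgO hkO zero_mem_Dplus).symm
  rw [h1, sec_projD (mul_mem hgO hkO), sec_projD hkO, actE_projE hgO hkO, mul_inv_rev]
  rfl

theorem phi0_eq {X : HomZ p q} (hX : X ∈ Dplus p q) (v : V p q) :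
    phi0 v X = (Uex (sec v X)).compContinuousLinearMap (fderiv ℝ (sec v) X) := by
  rw [phi0, sec_eq hX, UMQ_eq hX]

/-- The section satisfies `s_v ∘ L_g = g ∘ s_{g⁻¹ v}` (`sec_actD`), and the form on `E` is invariant
(`Uex_actE`). -/
theorem pullD_phi0 (v : V p q) {g : (EndV p q)ˣ} (hg : g ∈ Gplus p q) {X : HomZ p q}
    (hX : X ∈ Dplus p q) : pullD (g : EndV p q) (phi0 v) X =
      phi0 (((g⁻¹ : (EndV p q)ˣ) : EndV p q) v) X := by
  have hgO := Gplus_le hg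
  set v' := ((g⁻¹ : (EndV p q)ˣ) : EndV p q) v with hv'
  have hD := actD_mem_Dplus hgO hX
  have hs : (sec v' X).1 ∈ Dplus p q := by rw [sec_eq hX]; exact hX
  rw [pullD, phi0_eq hD, phi0_eq hX]
  have h1 : HasFDerivAt (fun Y => sec v (actD (g : EndV p q) Y))
      ((fderiv ℝ (sec v) (actD (g : EndV p q) X)) ∘L fderiv ℝ (actD (g : EndV p q)) X) X :=
    HasFDerivAt.comp (g := sec v) X
      ((contDiffAt_sec hD v 1).differentiableAt one_ne_zero).hasFDerivAt
      ((contDiffAt_actD_right (isUnit_autFac hgO hX) 1).differentiableAt one_ne_zero).hasFDerivAt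
  have h2 : HasFDerivAt (fun Y => actE (g : EndV p q) (sec v' Y))
      ((fderiv ℝ (actE (g : EndV p q)) (sec v' X)) ∘L fderiv ℝ (sec v') X) X :=
    HasFDerivAt.comp (g := actE (g : EndV p q)) X
      (differentiableAt_actE hgO hs).hasFDerivAt
      ((contDiffAt_sec hX v' 1).differentiableAt one_ne_zero).hasFDerivAt
  have h3 : (fun Y => sec v (actD (g : EndV p q) Y)) =ᶠ[𝓝 X]
      fun Y => actE (g : EndV p q) (sec v' Y) := by
    filter_upwards [isOpen_Dplus.mem_nhds hX] with Y hY using sec_actD hg hY v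
  have h4 := h1.unique (h2.congr_of_eventuallyEq h3)
  have h5 := Uex_actE hg hs
  rw [sec_actD hg hX v]
  ext x
  have h6 := congrArg (fun f : (HomZ p q × Neg q) [⋀^Fin q]→L[ℝ] ℝ =>
    f fun i => fderiv ℝ (sec v') X (x i)) h5
  have h7 : ∀ y, fderiv ℝ (sec v) (actD (g : EndV p q) X) (fderiv ℝ (actD (g : EndV p q)) X y) =
      fderiv ℝ (actE (g : EndV p q)) (sec v' X) (fderiv ℝ (sec v') X y) := fun y =>
    congrArg (fun f : HomZ p q →L[ℝ] HomZ p q × Neg q => f y) h4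
  refine Eq.trans ?_ h6
  change Uex _ (fun i => fderiv ℝ (sec v) (actD (g : EndV p q) X)
    (fderiv ℝ (actD (g : EndV p q)) X (x i))) = _
  simp_rw [h7]
  rfl

/-! ### Smoothness -/

theorem contDiff_clm_det {E : Type*} [NormedAddCommGroup E] [NormedSpace ℝ E]
    [FiniteDimensional ℝ E] (m : WithTop ℕ∞) : ContDiff ℝ m fun f : E →L[ℝ] E => f.det := by
  have h : (fun f : E →L[ℝ] E => f.det) = fun f : E →L[ℝ] E =>
      ∑ σ : Equiv.Perm (Fin (finrank ℝ E)), ((Equiv.Perm.sign σ : ℤ) : ℝ) *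
        ∏ i, (finBasis ℝ E).coord (σ i) (f (finBasis ℝ E i)) := by
    funext f
    change LinearMap.det f.toLinearMap = _
    rw [← LinearMap.det_toMatrix (finBasis ℝ E), Matrix.det_apply']
    refine Finset.sum_congr rfl fun σ _ => ?_
    congr 1
    refine Finset.prod_congr rfl fun i _ => ?_
    rw [LinearMap.toMatrix_apply]
    rfl
  rw [h]
  refine ContDiff.sum fun σ _ => contDiff_const.mul (contDiff_prod fun i _ => ?_)
  exact (contDiff_coord (T := E) (σ i) m).comp
    (ContinuousLinearMap.apply ℝ E (finBasis ℝ E i)).contDiff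

/-- `det (gram X) · det (ρ(g))² = 1` when `X = g z₀`. Positivity makes the real powers of this
determinant smooth on `𝔻⁺`. -/
theorem det_gram_pos {X : HomZ p q} (hX : X ∈ Dplus p q) : 0 < (gram X).det := by
  obtain ⟨g, hg, rfl⟩ := exists_projD_eq hX
  have h := det_inverse_rho_adjoint hg
  have h2 : 0 < (gram (projD (g : EndV p q))).det ^ 2 := by
    have := det_ne_zero_of_isUnit (isUnit_gram hX)
    positivity
  have h3 := congrArg ContinuousLinearMap.det (rho_inverse (Gplus_le hg))
  have hmul : ∀ a b : Neg q →L[ℝ] Neg q, (a * b).det = a.det * b.det := fun a b =>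
    LinearMap.det_comp a.toLinearMap b.toLinearMap
  have hone : (1 : Neg q →L[ℝ] Neg q).det = 1 := LinearMap.det_id
  have h4 : (Ring.inverse (rho (g : EndV p q))).det * (rho (g : EndV p q)).det = 1 := by
    rw [← hmul, Ring.inverse_mul_cancel _ (isUnit_rho (Gplus_le hg)), hone]
  have h5 := det_rho_pos hg
  rw [h3, hmul, det_adjoint_clm] at h4
  by_contra hneg
  nlinarith [mul_nonneg (not_lt.1 hneg |> neg_nonneg.2) (mul_pos h5 h5).le]

theorem contDiff_lU (m : WithTop ℕ∞) :
    ContDiff ℝ m fun a : HomZ p q × Neg q => lU a.1 a.2 := by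
  refine ContDiff.const_smul _ (ContDiff.sub ?_ ?_)
  · exact ((contDiff_gram m).comp contDiff_fst).clm_comp contDiff_const
  · refine ((adjL (p := p) (q := q)).contDiff.comp contDiff_fst).clm_comp (ContDiff.clm_comp ?_
      contDiff_const)
    exact (ContinuousLinearMap.apply ℝ (Pos p) (E := Neg q)).contDiff.comp contDiff_snd

theorem contDiff_bU (m : WithTop ℕ∞) : ContDiff ℝ m (bU (p := p) (q := q)) := by
  rw [contDiff_clm_apply_iff]
  intro x
  rw [contDiff_clm_apply_iff]
  intro y
  simp_rw [bU_apply]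
  exact (contDiff_const.clm_comp (contDiff_id.clm_comp contDiff_const)).sub
    (contDiff_const.clm_comp (contDiff_id.clm_comp contDiff_const))

theorem contDiffAt_gramInv' {X : HomZ p q} (hX : X ∈ Dplus p q) (m : WithTop ℕ∞) :
    ContDiffAt ℝ m (gramInv' (p := p) (q := q)) X :=
  contDiffAt_const.add (contDiffAt_id.clm_comp ((contDiffAt_gramInv hX m).clm_comp
    (adjL (p := p) (q := q)).contDiff.contDiffAt))

/-- The scalar factor of the Mathai-Quillen form in the chart. -/
def scalU (a : HomZ p q × Neg q) : ℝ :=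
  cst q * (gram a.1).det ^ (-(1 / 2) : ℝ) * Real.exp (-(2 * Real.pi * ⟪gram a.1 a.2, a.2⟫))

theorem contDiffAt_scalU {a : HomZ p q × Neg q} (ha : a.1 ∈ Dplus p q) (m : WithTop ℕ∞) :
    ContDiffAt ℝ m (scalU (p := p) (q := q)) a := by
  have hg : ContDiff ℝ m fun a : HomZ p q × Neg q => gram a.1 := (contDiff_gram m).comp contDiff_fst
  have h1 : ContDiff ℝ m fun a : HomZ p q × Neg q => (gram a.1).det :=
    ContDiff.comp (g := fun f : Neg q →L[ℝ] Neg q => f.det) (contDiff_clm_det m) hg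
  have h2 : ContDiff ℝ m fun a : HomZ p q × Neg q => ⟪gram a.1 a.2, a.2⟫ :=
    (hg.clm_apply contDiff_snd).inner ℝ contDiff_snd
  exact (contDiffAt_const.mul (h1.contDiffAt.rpow_const_of_ne (det_gram_pos ha).ne')).mul
    (contDiff_const.mul h2).neg.exp.contDiffAt

theorem contDiffAt_comp₂ {E A B F : Type*} [NormedAddCommGroup E] [NormedSpace ℝ E]
    [NormedAddCommGroup A] [NormedSpace ℝ A] [NormedAddCommGroup B] [NormedSpace ℝ B]
    [NormedAddCommGroup F] [NormedSpace ℝ F] {m : WithTop ℕ∞} {f : A → B → F}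
    (hf : ContDiff ℝ m fun x : A × B => f x.1 x.2) {g : E → A} {h : E → B} {a : E}
    (hg : ContDiffAt ℝ m g a) (hh : ContDiffAt ℝ m h a) :
    ContDiffAt ℝ m (fun e => f (g e) (h e)) a :=
  hf.contDiffAt.comp a (hg.prodMk hh)

theorem contDiffAt_mqForm {E T : Type} [NormedAddCommGroup E] [NormedSpace ℝ E]
    [NormedAddCommGroup T] [NormedSpace ℝ T] [FiniteDimensional ℝ T] {m : WithTop ℕ∞}
    {l : E → T →L[ℝ] Neg q} {B : E → T →L[ℝ] T →L[ℝ] (Neg q →L[ℝ] Neg q)} {a : E}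
    (hl : ContDiffAt ℝ m l a) (hB : ContDiffAt ℝ m B a) :
    ContDiffAt ℝ m (fun a => mqForm (l a) (B a)) a :=
  contDiffAt_comp₂ (contDiff_mqForm m) hl hB

theorem contDiffAt_Uex {a : HomZ p q × Neg q} (ha : a.1 ∈ Dplus p q) (m : WithTop ℕ∞) :
    ContDiffAt ℝ m (Uex (p := p) (q := q)) a := by
  have h1 : ContDiffAt ℝ m (fun a : HomZ p q × Neg q => gramInv' a.1) a :=
    ContDiffAt.comp (g := gramInv') a (contDiffAt_gramInv' ha m) contDiffAt_fst
  have h2 : ContDiffAt ℝ m (fun a : HomZ p q × Neg q => bU (q := q) (gramInv' a.1)) a :=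
    (contDiff_bU (p := p) (q := q) m).contDiffAt.comp a h1
  have h3 := contDiffAt_mqForm (contDiff_lU (p := p) (q := q) m).contDiffAt h2
  exact (contDiffAt_scalU ha m).smul h3

theorem contDiffOn_phi0 : ContDiffOn ℝ ∞ (fun x : V p q × HomZ p q => phi0 x.1 x.2)
    (Set.univ ×ˢ Dplus p q) := by
  have hS : ∀ a ∈ (Set.univ : Set (V p q)) ×ˢ Dplus p q,
      ContDiffAt ℝ ∞ (fun a : V p q × HomZ p q => ((a.2, secF a.1 a.2) : HomZ p q × Neg q)) a :=
    fun a ha => contDiffAt_snd.prodMk (contDiffAt_secF ha.2 ∞)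
  have h1 : ContDiffOn ℝ ∞ (fun a : V p q × HomZ p q => Uex (a.2, secF a.1 a.2))
      (Set.univ ×ˢ Dplus p q) := fun a ha =>
    (ContDiffAt.comp (g := Uex) a (contDiffAt_Uex (a := (a.2, secF a.1 a.2)) ha.2 ∞)
      (hS a ha)).contDiffWithinAt
  have h2 : ContDiffOn ℝ ∞ (fun a : V p q × HomZ p q =>
      fderiv ℝ (fun Y => ((Y, secF a.1 Y) : HomZ p q × Neg q)) a.2) (Set.univ ×ˢ Dplus p q) := by
    intro a ha
    refine (ContDiffAt.fderiv (n := ∞)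
      (f := fun (a : V p q × HomZ p q) Y => ((Y, secF a.1 Y) : HomZ p q × Neg q))
      (g := fun a => a.2) ?_ contDiffAt_snd (by simp)).contDiffWithinAt
    exact ContDiffAt.comp (g := fun a : V p q × HomZ p q => ((a.2, secF a.1 a.2) : HomZ p q × Neg q))
      (a, a.2) (hS (a.1, a.2) ha) ((contDiffAt_fst.comp _ contDiffAt_fst).prodMk contDiffAt_snd)
  refine (contDiffOn_form_comp h1 h2).congr fun a ha => ?_
  rw [phi0_eq ha.2, sec_eq ha.2, (sec_eventuallyEq ha.2 a.1).fderiv_eq]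

/-! ### The explicit form on the symmetric space -/

/-- The defining relation `(1 - X* X) s_v(X) = v₂ - X* v₁` is differentiated along a line; no
derivative of an inverse operator is needed. -/
theorem gram_fderiv_secF {X : HomZ p q} (hX : X ∈ Dplus p q) (v : V p q) (x : HomZ p q) :
    gram X (fderiv ℝ (secF v) X x) - (X†) (x (secF v X)) = -(x†) (v.1 - X (secF v X)) := by
  have h1 : HasFDerivAt (secF v) (fderiv ℝ (secF v) X) X :=
    ((contDiffAt_secF_right hX v 1).differentiableAt one_ne_zero).hasFDerivAt
  have h2 : HasDerivAt (fun s : ℝ => X + s • x) x 0 := by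
    simpa using ((hasDerivAt_id (0 : ℝ)).smul_const x).const_add X
  have h0 : X + (0 : ℝ) • x = X := by rw [zero_smul, add_zero]
  have hA : HasDerivAt (fun s : ℝ => adjL (X + s • x)) (adjL x) 0 :=
    (adjL (p := p) (q := q)).hasFDerivAt.comp_hasDerivAt 0 h2
  have h3 : HasDerivAt (fun s : ℝ => secF v (X + s • x)) (fderiv ℝ (secF v) X x) 0 :=
    HasFDerivAt.comp_hasDerivAt_of_eq (l := secF v) 0 h1 h2 h0.symm
  have h4 : HasDerivAt (fun s : ℝ => (X + s • x) (secF v (X + s • x)))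
      (x (secF v X) + X (fderiv ℝ (secF v) X x)) 0 := by
    have := h2.clm_apply h3
    simpa only [h0] using this
  have h5 : HasDerivAt (fun s : ℝ => secF v (X + s • x) -
      adjL (X + s • x) ((X + s • x) (secF v (X + s • x))))
      (fderiv ℝ (secF v) X x - (adjL x (X (secF v X)) +
        adjL X (x (secF v X) + X (fderiv ℝ (secF v) X x)))) 0 := by
    have := h3.sub (hA.clm_apply h4)
    simp only [h0] at this
    exact this
  have h6 : HasDerivAt (fun s : ℝ => v.2 - adjL (X + s • x) v.1) (-(adjL x v.1)) 0 := by
    have := (hasDerivAt_const (0 : ℝ) v.2).sub (hA.clm_apply (hasDerivAt_const (0 : ℝ) v.1))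
    simp only [map_zero, add_zero, zero_sub] at this
    exact this
  have hev : (fun s : ℝ => secF v (X + s • x) -
      adjL (X + s • x) ((X + s • x) (secF v (X + s • x)))) =ᶠ[𝓝 0]
      fun s : ℝ => v.2 - adjL (X + s • x) v.1 := by
    have hmem : ∀ᶠ s in 𝓝 (0 : ℝ), X + s • x ∈ Dplus p q := by
      refine h2.continuousAt.eventually_mem ?_
      rw [h0]
      exact isOpen_Dplus.mem_nhds hX
    filter_upwards [hmem] with s hs
    exact gram_gramInv hs _
  have h7 := h5.unique (h6.congr_of_eventuallyEq hev)
  simp only [adjL_apply, map_add] at h7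
  have h8 : ∀ z, gram X z = z - (X†) (X z) := fun z => rfl
  rw [h8, map_sub, neg_sub]
  rw [← sub_eq_zero] at h7 ⊢
  rw [← h7]
  abel

/-- After the pullback by `s_v`, the linear form and the curvature rows all have the form `x*
(vector of z₀^⊥)`, which exposes the dependence on the length of `v`. -/
theorem lU_sec {X : HomZ p q} (hX : X ∈ Dplus p q) (v : V p q) (x : HomZ p q) :
    lU X (secF v X) (fderiv ℝ (sec v) X x) = (x†) ((2 * √Real.pi) • (v.1 - X (secF v X))) := by
  have h1 : fderiv ℝ (sec v) X x = (x, fderiv ℝ (secF v) X x) := by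
    rw [(sec_eventuallyEq hX v).fderiv_eq]
    have h2 := (hasFDerivAt_id (𝕜 := ℝ) X).prodMk
      ((contDiffAt_secF_right hX v 1).differentiableAt one_ne_zero).hasFDerivAt
    exact congrArg (fun f : HomZ p q →L[ℝ] HomZ p q × Neg q => f x) h2.fderiv
  rw [h1, lU_apply, gram_fderiv_secF hX, map_smul, neg_smul, smul_neg, neg_neg]

theorem phi0_apply {g : (EndV p q)ˣ} (hg : g ∈ Gplus p q) (v : V p q) (x : Fin q → HomZ p q) :
    phi0 v (projD (g : EndV p q)) x =
      scalU (projD (g : EndV p q), secF v (projD (g : EndV p q))) *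
      ((-1) ^ (q * (q - 1) / 2) * quadE (q + 1) p fun t => (Matrix.of fun i j =>
        ((x i)†) ((2 * √Real.pi) • (v.1 - projD (g : EndV p q) (secF v (projD (g : EndV p q)))) +
          b11 (g : EndV p q) (WithLp.toLp 2 t)) j).det) := by
  have hX := projD_mem_Dplus (Gplus_le hg)
  rw [phi0_eq hX, sec_eq hX]
  change Uex _ (fun i => fderiv ℝ (sec v) (projD (g : EndV p q)) (x i)) = _
  rw [Uex_apply (Gplus_le hg)]
  simp_rw [lU_sec hX]
  have h1 : ∀ i, (fderiv ℝ (sec v) (projD (g : EndV p q)) (x i)).1 = x i := by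
    intro i
    rw [(sec_eventuallyEq hX v).fderiv_eq]
    have h2 := (hasFDerivAt_id (𝕜 := ℝ) (projD (g : EndV p q))).prodMk
      ((contDiffAt_secF_right hX v 1).differentiableAt one_ne_zero).hasFDerivAt
    exact congrArg (fun f : HomZ p q →L[ℝ] HomZ p q × Neg q => (f (x i)).1) h2.fderiv
  simp_rw [h1, ← map_add]
  rfl

/-! ### Integration by parts for the quadrature formula -/

/-- Stein's identity `E[i z P(i z)] = -E[P'(i z)]`. It involves moments up to order `deg P + 1`,
hence the strict bound on the degree. -/
theorem quadWeight_ibp {N : ℕ} {P : Polynomial ℝ} (hP : P.natDegree < N) :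
    ∑ s, quadWeight N s * (((s : ℕ) : ℝ) * P.eval ((s : ℕ) : ℝ)) =
      -∑ s, quadWeight N s * P.derivative.eval ((s : ℕ) : ℝ) := by
  have h1 : ∀ x : ℝ, P.derivative.eval x = ∑ k ∈ Finset.range N, P.coeff k * k * x ^ (k - 1) := by
    intro x
    rw [Polynomial.derivative_eval, Polynomial.sum_over_range' P (by simp) N hP]
  simp_rw [h1, Polynomial.eval_eq_sum_range' hP, Finset.mul_sum]
  rw [Finset.sum_comm, Finset.sum_comm (s := Finset.univ) (t := Finset.range N),
    ← Finset.sum_neg_distrib]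
  refine Finset.sum_congr rfl fun k hk => ?_
  have hk : k < N := Finset.mem_range.1 hk
  have h2 := quadWeight_spec (N := N) (k := k + 1) hk
  have h3 := quadWeight_spec (N := N) (k := k - 1) (by omega)
  have h4 := imGaussMoment_succ k
  rw [← h2, ← h3] at h4
  calc ∑ s, quadWeight N s * (((s : ℕ) : ℝ) * (P.coeff k * ((s : ℕ) : ℝ) ^ k)) =
      P.coeff k * ∑ s, quadWeight N s * ((s : ℕ) : ℝ) ^ (k + 1) := by
        rw [Finset.mul_sum]
        exact Finset.sum_congr rfl fun s _ => by ring
    _ = _ := by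
        rw [h4, Finset.mul_sum, Finset.mul_sum, ← Finset.sum_neg_distrib]
        exact Finset.sum_congr rfl fun s _ => by ring

theorem quadE_ibp {N p : ℕ} {f f' : (Fin p → ℝ) → ℝ} (α : Fin p)
    (h : ∀ t : Fin p → ℝ, ∃ P : Polynomial ℝ, P.natDegree < N ∧
      (∀ s, f (Function.update t α s) = P.eval s) ∧
      ∀ s, f' (Function.update t α s) = P.derivative.eval s) :
    quadE N p (fun t => t α * f t) = -quadE N p f' := by
  cases p with
  | zero => exact α.elim0
  | succ m =>
    have hcast : ∀ (r : Fin (N + 1)) (s : Fin m → Fin (N + 1)),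
        (fun i => (((α.insertNth r s : Fin (m + 1) → Fin (N + 1)) i : ℕ) : ℝ)) =
          Function.update (fun i => (((α.insertNth 0 s : Fin (m + 1) → Fin (N + 1)) i : ℕ) : ℝ)) α
            ((r : ℕ) : ℝ) := by
      intro r s
      funext i
      rcases eq_or_ne i α with rfl | hi
      · simp
      · obtain ⟨j, rfl⟩ := Fin.exists_succAbove_eq hi
        simp
    rw [quadE, quadE, ← (Fin.insertNthEquiv (fun _ => Fin (N + 1)) α).sum_comp,
      ← (Fin.insertNthEquiv (fun _ => Fin (N + 1)) α).sum_comp, Fintype.sum_prod_type_right,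
      Fintype.sum_prod_type_right, ← Finset.sum_neg_distrib]
    refine Finset.sum_congr rfl fun s _ => ?_
    obtain ⟨P, hdeg, hf, hf'⟩ :=
      h fun i => (((α.insertNth 0 s : Fin (m + 1) → Fin (N + 1)) i : ℕ) : ℝ)
    have e1 : ∀ r, f (fun i => (((α.insertNth r s : Fin (m + 1) → Fin (N + 1)) i : ℕ) : ℝ)) =
        P.eval ((r : ℕ) : ℝ) := fun r => by rw [hcast r s, hf]
    have e2 : ∀ r, f' (fun i => (((α.insertNth r s : Fin (m + 1) → Fin (N + 1)) i : ℕ) : ℝ)) =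
        P.derivative.eval ((r : ℕ) : ℝ) := fun r => by rw [hcast r s, hf']
    simp only [Fin.insertNthEquiv, Equiv.coe_fn_mk, e1, e2,
      Fin.prod_univ_succAbove _ α, Fin.insertNth_apply_same, Fin.insertNth_apply_succAbove]
    have h1 := congrArg (fun y => (∏ i, quadWeight N (s i)) * y) (quadWeight_ibp hdeg)
    simp only [Finset.mul_sum, mul_neg] at h1
    convert h1 using 1
    · exact Finset.sum_congr rfl fun r _ => by ring
    · congr 1
      exact Finset.sum_congr rfl fun r _ => by ring

theorem quadE_add (N p : ℕ) (f g : (Fin p → ℝ) → ℝ) :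
    quadE N p (fun t => f t + g t) = quadE N p f + quadE N p g := by
  rw [quadE, quadE, quadE, ← Finset.sum_add_distrib]
  exact Finset.sum_congr rfl fun s _ => by ring

theorem quadE_sum {ι : Type*} (J : Finset ι) (N p : ℕ) (f : ι → (Fin p → ℝ) → ℝ) :
    quadE N p (fun t => ∑ i ∈ J, f i t) = ∑ i ∈ J, quadE N p (f i) := by
  simp only [quadE]
  rw [Finset.sum_comm]
  exact Finset.sum_congr rfl fun s _ => by rw [Finset.mul_sum]

/-! ### Derivatives of determinants -/

theorem hasDerivAt_det {n : Type*} [Fintype n] [DecidableEq n] {M : ℝ → Matrix n n ℝ}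
    {M' : Matrix n n ℝ} {s : ℝ} (h : ∀ i j, HasDerivAt (fun s => M s i j) (M' i j) s) :
    HasDerivAt (fun s => (M s).det) (∑ k, ((M s).updateCol k fun i => M' i k).det) s := by
  have h1 : ∀ σ : Equiv.Perm n, HasDerivAt (fun s => ((Equiv.Perm.sign σ : ℤ) : ℝ) *
      ∏ i, M s (σ i) i) (((Equiv.Perm.sign σ : ℤ) : ℝ) *
        ∑ k, (∏ i ∈ Finset.univ.erase k, M s (σ i) i) * M' (σ k) k) s := by
    intro σ
    have := HasDerivAt.fun_finsetProd (u := Finset.univ) (fun i _ => h (σ i) i)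
    simp only [smul_eq_mul] at this
    exact this.const_mul _
  have h2 := HasDerivAt.fun_sum (u := Finset.univ) fun σ _ => h1 σ
  simp only [Matrix.det_apply']
  refine h2.congr_deriv ?_
  rw [Finset.sum_comm]
  refine Finset.sum_congr rfl fun σ _ => ?_
  rw [Finset.mul_sum]
  refine Finset.sum_congr rfl fun k _ => ?_
  congr 1
  rw [← Finset.prod_erase_mul _ _ (Finset.mem_univ k)]
  congr 1
  · refine Finset.prod_congr rfl fun i hi => ?_
    rw [Matrix.updateCol_ne (Finset.ne_of_mem_erase hi)]
  · rw [Matrix.updateCol_self]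

/-- The affine family of matrices `M + ∑ t_α R_α`. -/
def affMat {m n : Type*} (M : Matrix m n ℝ) (R : Fin p → Matrix m n ℝ) (t : Fin p → ℝ) :
    Matrix m n ℝ := M + ∑ α, t α • R α

theorem affMat_apply {m n : Type*} (M : Matrix m n ℝ) (R : Fin p → Matrix m n ℝ) (t : Fin p → ℝ)
    (i : m) (j : n) : affMat M R t i j = M i j + ∑ α, t α * R α i j := by
  simp [affMat, Matrix.sum_apply]

theorem affMat_update {m n : Type*} (M : Matrix m n ℝ) (R : Fin p → Matrix m n ℝ) (t : Fin p → ℝ)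
    (α : Fin p) (s : ℝ) : affMat M R (Function.update t α s) =
      s • R α + affMat M R (Function.update t α 0) := by
  have h : ∀ s, affMat M R (Function.update t α s) =
      M + (s • R α + ∑ β ∈ Finset.univ.erase α, t β • R β) := by
    intro s
    rw [affMat, ← Finset.add_sum_erase _ _ (Finset.mem_univ α), Function.update_self]
    congr 2
    exact Finset.sum_congr rfl fun β hβ => by
      rw [Function.update_of_ne (Finset.ne_of_mem_erase hβ)]
  rw [h, h, zero_smul, zero_add]
  abel

/-- In each variable the determinant is a polynomial of degree at most `q`, so order `q + 1` is
exact for the integration by parts. -/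
theorem quadE_mul_det (M : Matrix (Fin q) (Fin q) ℝ) (R : Fin p → Matrix (Fin q) (Fin q) ℝ)
    (α : Fin p) :
    quadE (q + 1) p (fun t => t α * (affMat M R t).det) =
      -quadE (q + 1) p fun t => ∑ k, ((affMat M R t).updateCol k fun i => R α i k).det := by
  refine quadE_ibp α fun t => ?_
  let A := R α
  let B := affMat M R (Function.update t α 0)
  let P : Polynomial ℝ := ((Polynomial.X : Polynomial ℝ) • A.map Polynomial.C +
    B.map Polynomial.C).det
  have hP : ∀ s, (affMat M R (Function.update t α s)).det = P.eval s := by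
    intro s
    rw [affMat_update]
    have h := RingHom.map_det (Polynomial.evalRingHom s)
      ((Polynomial.X : Polynomial ℝ) • A.map Polynomial.C + B.map Polynomial.C)
    change _ = (Polynomial.evalRingHom s) P
    rw [h]
    congr 1
    ext i j
    simp only [RingHom.mapMatrix_apply, Matrix.map_apply, Matrix.add_apply, Matrix.smul_apply,
      smul_eq_mul, map_add, Polynomial.eval_mul, Polynomial.coe_evalRingHom, Polynomial.eval_X,
      Polynomial.eval_C, A, B]
  refine ⟨P, ?_, hP, fun s => ?_⟩
  · have := Polynomial.natDegree_det_X_add_C_le A B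
    rw [Fintype.card_fin] at this
    exact Nat.lt_succ_of_le this
  -- The column formula and the formal derivative of `P` are derivatives of the same function, hence
  -- equal.
  · have h1 : HasDerivAt (fun s => (affMat M R (Function.update t α s)).det)
        (∑ k, ((affMat M R (Function.update t α s)).updateCol k fun i => R α i k).det) s := by
      refine hasDerivAt_det (M' := R α) fun i j => ?_
      have hfun : (fun s => affMat M R (Function.update t α s) i j) =
          fun s => s * R α i j + affMat M R (Function.update t α 0) i j := by
        funext s
        rw [affMat_update]
        rfl
      rw [hfun]
      simpa using ((hasDerivAt_id s).mul_const (R α i j)).add_const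
        (affMat M R (Function.update t α 0) i j)
    have h2 : HasDerivAt (fun s => (affMat M R (Function.update t α s)).det)
        (P.derivative.eval s) s := by
      simp_rw [hP]
      exact P.hasDerivAt s
    exact h1.unique h2

/-! ### Alternating sums of minors -/

/-- The determinant of the square matrix with first column `a` followed by the columns of `C`,
expanded along the first column. -/
def colDet (a : Fin (q + 1) → ℝ) (C : Matrix (Fin (q + 1)) (Fin q) ℝ) : ℝ :=
  ∑ i : Fin (q + 1), (-1) ^ (i : ℕ) * a i * (C.submatrix i.succAbove id).det

/-- The matrix with first column `a` followed by the columns of `C`. -/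
def consCol (a : Fin (q + 1) → ℝ) (C : Matrix (Fin (q + 1)) (Fin q) ℝ) :
    Matrix (Fin (q + 1)) (Fin (q + 1)) ℝ :=
  Matrix.of fun i => Fin.cons (a i) (C i)

theorem colDet_eq (a : Fin (q + 1) → ℝ) (C : Matrix (Fin (q + 1)) (Fin q) ℝ) :
    colDet a C = (consCol a C).det := by
  rw [Matrix.det_succ_column_zero]
  rfl

theorem colDet_combination (u : Fin q → ℝ) (C : Matrix (Fin (q + 1)) (Fin q) ℝ) :
    colDet (fun i => ∑ k, u k * C i k) C = 0 := by
  rw [colDet_eq, ← Matrix.exists_mulVec_eq_zero_iff]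
  refine ⟨Fin.cons 1 (fun k => -u k), fun h => ?_, ?_⟩
  · simpa using congrFun h 0
  · funext i
    simp [Matrix.mulVec, dotProduct, Fin.sum_univ_succ, consCol, mul_comm]

theorem colDet_swap (a b : Fin (q + 1) → ℝ) (C : Matrix (Fin (q + 1)) (Fin q) ℝ) (k : Fin q) :
    colDet a (C.updateCol k b) = -colDet b (C.updateCol k a) := by
  have h : consCol b (C.updateCol k a) =
      (consCol a (C.updateCol k b)).submatrix id (Equiv.swap 0 k.succ) := by
    ext i j
    rw [Matrix.submatrix_apply, id]
    refine Fin.cases ?_ (fun j => ?_) j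
    · rw [Equiv.swap_apply_left]
      simp [consCol]
    · rcases eq_or_ne j k with rfl | hj
      · rw [Equiv.swap_apply_right]
        simp [consCol]
      · rw [Equiv.swap_apply_of_ne_of_ne (Fin.succ_ne_zero j)
          (fun h => hj (Fin.succ_injective _ h))]
        simp [consCol, Matrix.updateCol_ne hj]
  rw [colDet_eq, colDet_eq, h, Matrix.det_permute', Equiv.Perm.sign_swap (Fin.succ_ne_zero k).symm]
  simp

theorem submatrix_updateCol {m : ℕ} (C : Matrix (Fin (m + 1)) (Fin q) ℝ) (k : Fin q)
    (a : Fin (m + 1) → ℝ) (i : Fin (m + 1)) :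
    (C.updateCol k a).submatrix i.succAbove id =
      (C.submatrix i.succAbove id).updateCol k fun j => a (i.succAbove j) := by
  ext j l
  rcases eq_or_ne l k with rfl | hl
  · simp
  · simp [Matrix.updateCol_ne hl]

theorem affMat_submatrix (M : Matrix (Fin (q + 1)) (Fin q) ℝ)
    (R : Fin p → Matrix (Fin (q + 1)) (Fin q) ℝ) (t : Fin p → ℝ) (i : Fin (q + 1)) :
    (affMat M R t).submatrix i.succAbove id =
      affMat (M.submatrix i.succAbove id) (fun α => (R α).submatrix i.succAbove id) t := by
  ext j k
  simp [affMat_apply]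

/-- The algebraic identity behind the closedness of the Mathai-Quillen form. -/
theorem sum_quadE_eq_zero (κ : ℝ) (e : Matrix (Fin (q + 1)) (Fin q) ℝ)
    (R : Fin p → Matrix (Fin (q + 1)) (Fin q) ℝ) (u : Fin q → ℝ) :
    ∑ i : Fin (q + 1), (-1) ^ (i : ℕ) * quadE (q + 1) p (fun t =>
      -κ ^ 2 * (∑ k, u k * e i k) * ((affMat (-κ • e) R t).submatrix i.succAbove id).det +
      κ * ∑ k, (((affMat (-κ • e) R t).submatrix i.succAbove id).updateCol k fun j =>
        ∑ α, R α i k * ∑ m, R α (i.succAbove j) m * u m).det) = 0 := by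
  set C := affMat (-κ • e) R with hC
  set xu : Fin p → Fin (q + 1) → ℝ := fun α i => ∑ m, R α i m * u m with hxu
  -- The entries of `e` are replaced by those of `C = -κ e + ∑ t_α R_α`; the price is a term linear
  -- in the variables `t_α`.
  have hI : ∀ (t : Fin p → ℝ) (i : Fin (q + 1)), -κ ^ 2 * (∑ k, u k * e i k) =
      κ * (∑ k, u k * C t i k) - κ * ∑ α, t α * xu α i := by
    intro t i
    simp only [hC, hxu, affMat_apply, Matrix.smul_apply, smul_eq_mul, mul_add, Finset.sum_add_distrib]
    have : ∑ k, u k * ∑ α, t α * R α i k = ∑ α, t α * ∑ m, R α i m * u m := by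
      simp_rw [Finset.mul_sum]
      rw [Finset.sum_comm]
      exact Finset.sum_congr rfl fun α _ => Finset.sum_congr rfl fun k _ => by ring
    rw [this, add_sub_cancel_right, Finset.mul_sum, Finset.mul_sum]
    exact Finset.sum_congr rfl fun k _ => by ring
  have hcr : ∀ (t : Fin p → ℝ) (i : Fin (q + 1)) (k : Fin q),
      (((C t).submatrix i.succAbove id).updateCol k fun j => ∑ α, R α i k * xu α (i.succAbove j)).det
      = ∑ α, R α i k * (((C t).updateCol k (xu α)).submatrix i.succAbove id).det := by
    intro t i k
    have h : (fun j => ∑ α, R α i k * xu α (i.succAbove j)) =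
        ∑ α, R α i k • fun j => xu α (i.succAbove j) := by
      funext j
      simp
    rw [h, ← Matrix.cramer_apply, map_sum, Finset.sum_apply]
    refine Finset.sum_congr rfl fun α _ => ?_
    rw [map_smul, Pi.smul_apply, Matrix.cramer_apply, smul_eq_mul, submatrix_updateCol]
  have hsplit : ∀ i : Fin (q + 1), quadE (q + 1) p (fun t =>
      -κ ^ 2 * (∑ k, u k * e i k) * ((C t).submatrix i.succAbove id).det +
      κ * ∑ k, (((C t).submatrix i.succAbove id).updateCol k fun j =>
        ∑ α, R α i k * xu α (i.succAbove j)).det) =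
      κ * quadE (q + 1) p (fun t => (∑ k, u k * C t i k) *
        ((C t).submatrix i.succAbove id).det) +
      (κ * ∑ α, xu α i * quadE (q + 1) p (fun t => ∑ k,
        (((C t).updateCol k fun i => R α i k).submatrix i.succAbove id).det) +
      κ * ∑ k, ∑ α, R α i k * quadE (q + 1) p (fun t =>
        (((C t).updateCol k (xu α)).submatrix i.succAbove id).det)) := by
    intro i
    -- Each factor `t_α` is removed by integration by parts, which puts a column of `R α` into the
    -- minor.
    have hibp : ∀ α, quadE (q + 1) p (fun t => ∑ k,
        (((C t).updateCol k fun i => R α i k).submatrix i.succAbove id).det) =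
        -quadE (q + 1) p (fun t => t α * ((C t).submatrix i.succAbove id).det) := by
      intro α
      simp_rw [submatrix_updateCol, hC, affMat_submatrix]
      rw [quadE_mul_det, neg_neg]
      rfl
    simp_rw [hibp, hcr, ← quadE_const_mul, ← quadE_sum, mul_neg, Finset.sum_neg_distrib, mul_neg,
      ← quadE_const_mul, ← quadE_sum, ← sub_eq_neg_add, ← quadE_const_mul]
    rw [← sub_eq_zero, sub_eq_add_neg, ← neg_one_mul]
    simp only [sub_eq_add_neg, ← neg_one_mul (quadE _ _ _), ← quadE_const_mul, ← quadE_add]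
    have hz : quadE (q + 1) p (fun _ => 0) = 0 := by simp [quadE]
    rw [← hz]
    congr 1
    funext t
    have : ∑ α, xu α i * (t α * ((C t).submatrix i.succAbove id).det) =
        (∑ α, t α * xu α i) * ((C t).submatrix i.succAbove id).det := by
      rw [Finset.sum_mul]
      exact Finset.sum_congr rfl fun α _ => by ring
    linear_combination ((C t).submatrix i.succAbove id).det * hI t i + κ * this
  have hz : quadE (q + 1) p (fun _ => 0) = 0 := by simp [quadE]
  rw [Finset.sum_congr rfl fun i _ => by rw [hsplit i]]
  simp only [mul_add, Finset.sum_add_distrib]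
  -- An alternating sum of minors is a determinant of size `q + 1`. Its additional column is here a
  -- combination of the other columns.
  have t1 : ∑ i : Fin (q + 1), (-1 : ℝ) ^ (i : ℕ) * (κ * quadE (q + 1) p (fun t =>
      (∑ k, u k * C t i k) * ((C t).submatrix i.succAbove id).det)) = 0 := by
    simp_rw [← quadE_const_mul]
    rw [← quadE_sum, ← hz]
    congr 1
    funext t
    have := colDet_combination u (C t)
    rw [colDet] at this
    rw [← mul_zero κ, ← this, Finset.mul_sum]
    exact Finset.sum_congr rfl fun i _ => by ring
  have t2 : ∑ i : Fin (q + 1), (-1 : ℝ) ^ (i : ℕ) * (κ * ∑ α, xu α i *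
      quadE (q + 1) p (fun t => ∑ k,
        (((C t).updateCol k fun i => R α i k).submatrix i.succAbove id).det)) =
      κ * ∑ α, ∑ k, quadE (q + 1) p (fun t => colDet (xu α) ((C t).updateCol k fun i => R α i k)) := by
    simp_rw [colDet, quadE_sum, quadE_const_mul, Finset.mul_sum]
    rw [Finset.sum_comm]
    refine Finset.sum_congr rfl fun α _ => ?_
    rw [Finset.sum_comm]
    exact Finset.sum_congr rfl fun k _ => Finset.sum_congr rfl fun i _ => by ring
  have t3 : ∑ i : Fin (q + 1), (-1 : ℝ) ^ (i : ℕ) * (κ * ∑ k, ∑ α, R α i k *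
      quadE (q + 1) p (fun t => (((C t).updateCol k (xu α)).submatrix i.succAbove id).det)) =
      κ * ∑ α, ∑ k, quadE (q + 1) p (fun t =>
        colDet (fun i => R α i k) ((C t).updateCol k (xu α))) := by
    simp_rw [colDet, quadE_sum, quadE_const_mul, Finset.mul_sum]
    rw [Finset.sum_comm, Finset.sum_comm (s := Finset.univ (α := Fin p))]
    refine Finset.sum_congr rfl fun k _ => ?_
    rw [Finset.sum_comm]
    exact Finset.sum_congr rfl fun α _ => Finset.sum_congr rfl fun i _ => by ring
  rw [t1, t2, t3, zero_add, ← mul_add, ← Finset.sum_add_distrib]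
  -- The two remaining sums differ by the exchange of the additional column with column `k`, and
  -- cancel.
  refine mul_eq_zero_of_right _ (Finset.sum_eq_zero fun α _ => ?_)
  rw [← Finset.sum_add_distrib]
  refine Finset.sum_eq_zero fun k _ => ?_
  rw [← quadE_add, ← hz]
  congr 1
  funext t
  rw [colDet_swap]
  ring

/-! ### The Mathai-Quillen form is closed -/

/-- An even function has zero derivative at the origin, so where `π b = 0` the argument `π x` may be
frozen at `0`. It serves with `π` the projection to `X`, since `gram` and `gramInv'` are even. -/
theorem fderiv_even_diag {A B F : Type*} [NormedAddCommGroup A] [NormedSpace ℝ A]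
    [NormedAddCommGroup B] [NormedSpace ℝ B] [NormedAddCommGroup F] [NormedSpace ℝ F]
    {G : A → B → F} {π : B →L[ℝ] A} {b : B} (hb : π b = 0)
    (hd : DifferentiableAt ℝ (fun x : A × B => G x.1 x.2) (0, b))
    (heven : ∀ Y x, G (-Y) x = G Y x) :
    fderiv ℝ (fun x => G (π x) x) b = fderiv ℝ (G 0) b := by
  set D := fderiv ℝ (fun x : A × B => G x.1 x.2) (0, b) with hD
  have h0 : HasFDerivAt (fun x : A × B => G x.1 x.2) D (0, b) := hd.hasFDerivAt
  have hin : HasFDerivAt (fun Y : A => (Y, b))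
      ((ContinuousLinearMap.id ℝ A).prod (0 : A →L[ℝ] B)) 0 :=
    (hasFDerivAt_id (0 : A)).prodMk (hasFDerivAt_const b (0 : A))
  have h1 : HasFDerivAt (fun Y => G Y b)
      (D ∘L (ContinuousLinearMap.id ℝ A).prod (0 : A →L[ℝ] B)) 0 :=
    HasFDerivAt.comp (g := fun x : A × B => G x.1 x.2) (f := fun Y : A => (Y, b)) (0 : A) h0 hin
  have h2 : HasFDerivAt (fun Y => G (-Y) b)
      ((D ∘L (ContinuousLinearMap.id ℝ A).prod (0 : A →L[ℝ] B)) ∘L (-ContinuousLinearMap.id ℝ A)) 0 :=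
    HasFDerivAt.comp (g := fun Y => G Y b) (0 : A) (by rw [neg_zero]; exact h1)
      (hasFDerivAt_id (0 : A)).neg
  simp_rw [heven] at h2
  have h3 : ∀ Y : A, D (Y, 0) = 0 := by
    intro Y
    have h4 := congrArg (fun f : A →L[ℝ] F => f Y) (h1.unique h2)
    have h5 : D (Y, 0) = D (-Y, 0) := h4
    have h6 : D (-Y, 0) = -D (Y, 0) := by
      rw [← map_neg]
      simp
    rw [h6] at h5
    have h7 : (2 : ℝ) • D (Y, 0) = 0 := by
      rw [two_smul]
      nth_rewrite 1 [h5]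
      exact neg_add_cancel _
    exact (smul_eq_zero.1 h7).resolve_left two_ne_zero
  have h8 : HasFDerivAt (fun x => G (π x) x) (D ∘L π.prod (ContinuousLinearMap.id ℝ B)) b :=
    HasFDerivAt.comp (g := fun x : A × B => G x.1 x.2) b (by rw [hb]; exact h0)
      (π.hasFDerivAt.prodMk (hasFDerivAt_id b))
  have h9 : HasFDerivAt (G 0) (D ∘L (0 : B →L[ℝ] A).prod (ContinuousLinearMap.id ℝ B)) b :=
    HasFDerivAt.comp (g := fun x : A × B => G x.1 x.2) b h0
      ((hasFDerivAt_const (0 : A) b).prodMk (hasFDerivAt_id b))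
  rw [h8.fderiv, h9.fderiv]
  ext1 x
  change D (π x, x) = D (0, x)
  have h10 : ((π x, x) : A × B) = (π x, 0) + (0, x) := by simp
  rw [h10, map_add, h3, zero_add]

theorem gram_neg (X : HomZ p q) : gram (-X) = gram X := by
  simp [gram]

theorem gramInv'_neg (X : HomZ p q) : gramInv' (-X) = gramInv' X := by
  simp [gramInv', gramInv, gram_neg]

theorem gram_zero : gram (0 : HomZ p q) = 1 := by simp [gram]

theorem gramInv'_zero : gramInv' (0 : HomZ p q) = 1 := by simp [gramInv']

/-- The form `lU` with the Gram operator of `Y`. -/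
def lUat (Y : HomZ p q) (a : HomZ p q × Neg q) : (HomZ p q × Neg q) →L[ℝ] Neg q :=
  -(2 * √Real.pi) • (gram Y ∘L ContinuousLinearMap.snd ℝ (HomZ p q) (Neg q) -
    (adjL a.1) ∘L (ContinuousLinearMap.apply ℝ (Pos p) a.2) ∘L
      ContinuousLinearMap.fst ℝ (HomZ p q) (Neg q))

theorem contDiff_lUat (m : WithTop ℕ∞) :
    ContDiff ℝ m fun b : HomZ p q × (HomZ p q × Neg q) => lUat b.1 b.2 := by
  refine ContDiff.const_smul _ (ContDiff.sub ?_ ?_)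
  · exact ((contDiff_gram m).comp contDiff_fst).clm_comp contDiff_const
  · refine ((adjL (p := p) (q := q)).contDiff.comp (contDiff_fst.comp contDiff_snd)).clm_comp
      (ContDiff.clm_comp ?_ contDiff_const)
    exact (ContinuousLinearMap.apply ℝ (Pos p) (E := Neg q)).contDiff.comp
      (contDiff_snd.comp contDiff_snd)

/-- The Mathai-Quillen form with the even functions of `X` evaluated at `Y`. -/
def Uat (Y : HomZ p q) (a : HomZ p q × Neg q) : (HomZ p q × Neg q) [⋀^Fin q]→L[ℝ] ℝ :=
  scalU (Y, a.2) • mqForm (lUat Y a) (bU (gramInv' Y))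

theorem Uat_neg (Y : HomZ p q) (a : HomZ p q × Neg q) : Uat (-Y) a = Uat Y a := by
  rw [Uat, Uat, scalU, scalU, lUat, lUat, gram_neg, gramInv'_neg]

theorem differentiableAt_Uat (u : Neg q) :
    DifferentiableAt ℝ (fun b : HomZ p q × (HomZ p q × Neg q) => Uat b.1 b.2) (0, (0, u)) := by
  have h1 : ContDiffAt ℝ 1 (fun b : HomZ p q × (HomZ p q × Neg q) => gramInv' b.1) (0, (0, u)) :=
    ContDiffAt.comp (g := gramInv') (0, (0, u)) (contDiffAt_gramInv' zero_mem_Dplus 1) contDiffAt_fst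
  have h2 : ContDiffAt ℝ 1 (fun b : HomZ p q × (HomZ p q × Neg q) => bU (q := q) (gramInv' b.1))
      (0, (0, u)) := (contDiff_bU (p := p) (q := q) 1).contDiffAt.comp _ h1
  have h3 := contDiffAt_mqForm (contDiff_lUat (p := p) (q := q) 1).contDiffAt h2
  have h4 : ContDiffAt ℝ 1 (fun b : HomZ p q × (HomZ p q × Neg q) => scalU (b.1, b.2.2))
      (0, (0, u)) :=
    ContDiffAt.comp (g := scalU (p := p) (q := q)) (0, (0, u))
      (contDiffAt_scalU (a := (0, u)) zero_mem_Dplus 1)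
      (contDiffAt_fst.prodMk (contDiffAt_snd.comp _ contDiffAt_snd))
  exact (h4.smul h3).differentiableAt one_ne_zero

/-- The matrix of the `Neg`-components. -/
def negMat {m : ℕ} (v : Fin m → HomZ p q × Neg q) : Matrix (Fin m) (Fin q) ℝ :=
  Matrix.of fun i k => (v i).2 k

/-- The matrices of the `Hom`-components. -/
def homMat {m : ℕ} (v : Fin m → HomZ p q × Neg q) (α : Fin p) : Matrix (Fin m) (Fin q) ℝ :=
  Matrix.of fun i k => (v i).1 (stdBasis q k) α

theorem scalU_zero (u : Neg q) :
    scalU ((0 : HomZ p q), u) = cst q * Real.exp (-(2 * Real.pi * ⟪u, u⟫)) := by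
  have h : (1 : Neg q →L[ℝ] Neg q).det = 1 := LinearMap.det_id
  simp [scalU, gram_zero, h]

theorem Uat_zero_apply (a : HomZ p q × Neg q) (y : Fin q → HomZ p q × Neg q) :
    Uat 0 a y = cst q * Real.exp (-(2 * Real.pi * ⟪a.2, a.2⟫)) * ((-1) ^ (q * (q - 1) / 2) *
      quadE (q + 1) p fun t => (Matrix.of fun i j =>
        affMat (-(2 * √Real.pi) • negMat y) (homMat y) t i j +
          2 * √Real.pi * (a.1†) ((y i).1 a.2) j).det) := by
  have hs : ∀ (c : ℝ) (f : (HomZ p q × Neg q) [⋀^Fin q]→L[ℝ] ℝ), (c • f) y = c * f y :=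
    fun _ _ => rfl
  have h := mqForm_apply_of_eq (lUat 0 a) (R := ContinuousLinearMap.fst ℝ (HomZ p q) (Neg q))
    (B := bU (gramInv' (0 : HomZ p q))) (fun x y => by rw [bU_apply, gramInv'_zero]; rfl) y
  rw [Uat, hs, scalU_zero, h]
  congr 4
  funext t
  congr 2
  ext i j
  have h1 := sum_rowForm (ContinuousLinearMap.fst ℝ (HomZ p q) (Neg q)) t (y i) j
  simp_rw [rowForm_coord] at h1
  have h2 : lUat 0 a (y i) = -(2 * √Real.pi) • ((y i).2 - (a.1†) ((y i).1 a.2)) := by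
    change -(2 * √Real.pi) • (gram 0 (y i).2 - (a.1†) ((y i).1 a.2)) = _
    rw [gram_zero]
    rfl
  rw [affMat_apply, h2]
  have h3 : ∀ w z : Neg q, (w + z) j = w j + z j := fun _ _ => rfl
  have h4 : ∀ (c : ℝ) (w z : Neg q), (c • (w - z)) j = c * (w j - z j) := fun _ _ _ => rfl
  rw [h3, h4, ← h1]
  simp only [Matrix.smul_apply, negMat, homMat, Matrix.of_apply, smul_eq_mul]
  change _ = _ + ∑ α, t α * (((y i).1) (stdBasis q j)) α + _
  change _ + ∑ α, t α * (((y i).1) (stdBasis q j)) α = _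
  ring

theorem hasDerivAt_quadE {N : ℕ} {F : (Fin p → ℝ) → ℝ → ℝ} {F' : (Fin p → ℝ) → ℝ} {s : ℝ}
    (h : ∀ t, HasDerivAt (F t) (F' t) s) :
    HasDerivAt (fun s => quadE N p fun t => F t s) (quadE N p F') s := by
  simp only [quadE]
  exact HasDerivAt.fun_sum fun r _ => (h _).const_mul _

theorem adjoint_apply_coord (x y : HomZ p q) (u : Neg q) (k : Fin q) :
    (x†) (y u) k = ∑ α, x (stdBasis q k) α * ∑ m, y (stdBasis q m) α * u m := by
  have h1 : (x†) (y u) k = ⟪x (stdBasis q k), y u⟫ := by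
    rw [← ContinuousLinearMap.adjoint_inner_right, stdBasis_apply,
      EuclideanSpace.inner_single_left]
    simp
  have h2 : ∀ α, y u α = ∑ m, y (stdBasis q m) α * u m := by
    intro α
    conv_lhs => rw [← (stdBasis q).sum_repr u]
    rw [map_sum]
    simp [stdBasis, mul_comm]
  rw [h1, PiLp.inner_apply]
  refine Finset.sum_congr rfl fun α _ => ?_
  rw [← h2]
  simp [mul_comm]

/-- One term comes from the Gaussian factor, with `4 π = (2 √π)²`. The other comes from the
connection term `x* (y u)`, which vanishes at `s = 0` and is differentiated one column at a time. -/
theorem hasDerivAt_Uat (u : Neg q) (y : Fin q → HomZ p q × Neg q) (x : HomZ p q) (η : Neg q) :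
    HasDerivAt (fun s : ℝ => Uat 0 ((s • x, u + s • η) : HomZ p q × Neg q) y)
      (cst q * Real.exp (-(2 * Real.pi * ⟪u, u⟫)) * (-1) ^ (q * (q - 1) / 2) *
        quadE (q + 1) p fun t => -(2 * √Real.pi) ^ 2 * (∑ k, u k * η k) *
          (affMat (-(2 * √Real.pi) • negMat y) (homMat y) t).det +
          2 * √Real.pi * ∑ k, ((affMat (-(2 * √Real.pi) • negMat y) (homMat y) t).updateCol k
            fun i => (x†) ((y i).1 u) k).det) 0 := by
  have hu : HasDerivAt (fun s : ℝ => u + s • η) η 0 := by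
    simpa using ((hasDerivAt_id (0 : ℝ)).smul_const η).const_add u
  have hin : HasDerivAt (fun s : ℝ => ⟪u + s • η, u + s • η⟫) (2 * ⟪u, η⟫) 0 := by
    have h := hu.inner ℝ hu
    simp only [zero_smul, add_zero] at h
    refine h.congr_deriv ?_
    rw [real_inner_comm u η]
    ring
  have hexp : HasDerivAt (fun s : ℝ => cst q * Real.exp (-(2 * Real.pi * ⟪u + s • η, u + s • η⟫)))
      (cst q * Real.exp (-(2 * Real.pi * ⟪u, u⟫)) * (-(2 * √Real.pi) ^ 2 * ⟪u, η⟫)) 0 := by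
    have h := ((hin.const_mul (2 * Real.pi)).fun_neg.exp).const_mul (cst q)
    refine h.congr_deriv ?_
    have h4 : (2 * √Real.pi) ^ 2 = 4 * Real.pi := by
      rw [mul_pow, Real.sq_sqrt Real.pi_nonneg]
      norm_num
    simp only [zero_smul, add_zero]
    rw [h4]
    ring
  have hdet : ∀ t, HasDerivAt (fun s : ℝ => (Matrix.of fun i j =>
      affMat (-(2 * √Real.pi) • negMat y) (homMat y) t i j +
        2 * √Real.pi * ((s • x)†) ((y i).1 (u + s • η)) j).det)
      (2 * √Real.pi * ∑ k, ((affMat (-(2 * √Real.pi) • negMat y) (homMat y) t).updateCol k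
            fun i => (x†) ((y i).1 u) k).det) 0 := by
    intro t
    have h := hasDerivAt_det (M := fun s : ℝ => (Matrix.of fun i j =>
      affMat (-(2 * √Real.pi) • negMat y) (homMat y) t i j +
        2 * √Real.pi * ((s • x)†) ((y i).1 (u + s • η)) j))
      (M' := Matrix.of fun i j => 2 * √Real.pi * (x†) ((y i).1 u) j) (s := 0) ?_
    · convert h using 1
      have h0 : (Matrix.of fun i j => affMat (-(2 * √Real.pi) • negMat y) (homMat y) t i j +
          2 * √Real.pi * (((0 : ℝ) • x)†) ((y i).1 (u + (0 : ℝ) • η)) j) =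
          affMat (-(2 * √Real.pi) • negMat y) (homMat y) t := by
        ext i j
        simp
      rw [h0, Finset.mul_sum]
      refine Finset.sum_congr rfl fun k _ => ?_
      rw [← Matrix.det_updateCol_smul]
      rfl
    · intro i j
      have h1 : HasDerivAt (fun s : ℝ => s * (x†) ((y i).1 (u + s • η)) j)
          ((x†) ((y i).1 u) j) 0 := by
        have h2 : HasDerivAt (fun s : ℝ => (x†) ((y i).1 (u + s • η)) j)
            ((x†) ((y i).1 η) j) 0 := by
          have h3 : (fun s : ℝ => (x†) ((y i).1 (u + s • η)) j) =
              fun s : ℝ => (x†) ((y i).1 u) j + s * (x†) ((y i).1 η) j := by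
            funext s
            simp
          rw [h3]
          simpa using ((hasDerivAt_id (0 : ℝ)).mul_const ((x†) ((y i).1 η) j)).const_add
            ((x†) ((y i).1 u) j)
        refine ((hasDerivAt_id (0 : ℝ)).fun_mul h2).congr_deriv ?_
        simp
      have h4 : (fun s : ℝ => affMat (-(2 * √Real.pi) • negMat y) (homMat y) t i j +
          2 * √Real.pi * ((s • x)†) ((y i).1 (u + s • η)) j) = fun s : ℝ =>
          affMat (-(2 * √Real.pi) • negMat y) (homMat y) t i j +
          2 * √Real.pi * (s * (x†) ((y i).1 (u + s • η)) j) := by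
        funext s
        have h5 : ∀ z, ((s • x)†) z j = s * (x†) z j := fun z => by simp
        rw [h5]
      simp only [Matrix.of_apply]
      rw [h4]
      exact (h1.const_mul _).const_add _
  have hprod := hexp.fun_mul ((hasDerivAt_quadE (N := q + 1) hdet).const_mul
    ((-1 : ℝ) ^ (q * (q - 1) / 2)))
  simp only [Uat_zero_apply]
  refine hprod.congr_deriv ?_
  have h0 : ∀ t, (Matrix.of fun i j => affMat (-(2 * √Real.pi) • negMat y) (homMat y) t i j +
      2 * √Real.pi * (((0 : ℝ) • x)†) ((y i).1 (u + (0 : ℝ) • η)) j) =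
      affMat (-(2 * √Real.pi) • negMat y) (homMat y) t := by
    intro t
    ext i j
    simp
  simp_rw [h0]
  have h1 : ⟪u, η⟫ = ∑ k, u k * η k := by
    rw [PiLp.inner_apply]
    exact Finset.sum_congr rfl fun k _ => by simp [mul_comm]
  rw [quadE_add, quadE_const_mul (q + 1) p (2 * √Real.pi),
    quadE_const_mul (q + 1) p (-(2 * √Real.pi) ^ 2 * ∑ k, u k * η k), h1]
  simp only [zero_smul, add_zero]
  ring

theorem differentiableAt_form_apply {E T : Type*} [NormedAddCommGroup E] [NormedSpace ℝ E]
    [NormedAddCommGroup T] [NormedSpace ℝ T] {n : ℕ} {η : E → T [⋀^Fin n]→L[ℝ] ℝ} {e : E}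
    (h : DifferentiableAt ℝ η e) (y : Fin n → T) : DifferentiableAt ℝ (fun e => η e y) e :=
  (h.hasFDerivAt.continuousAlternatingMap_apply_const y).differentiableAt

theorem fderiv_even_diag_of_line {A B : Type*} [NormedAddCommGroup A] [NormedSpace ℝ A]
    [NormedAddCommGroup B] [NormedSpace ℝ B] {G : A → B → ℝ} {π : B →L[ℝ] A} {b : B}
    (hb : π b = 0) (hd : DifferentiableAt ℝ (fun x : A × B => G x.1 x.2) (0, b))
    (he : ∀ a b, G (-a) b = G a b) {c : ℝ → B} {x : B} {d : ℝ} (hc : HasDerivAt c x 0)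
    (hc0 : b = c 0) (hG : HasDerivAt (fun s => G 0 (c s)) d 0) :
    fderiv ℝ (fun a => G (π a) a) b x = d := by
  have hd0 : DifferentiableAt ℝ (fun a : B => G 0 a) b :=
    DifferentiableAt.comp (g := fun x : A × B => G x.1 x.2) b hd
      ((differentiableAt_const 0).prodMk differentiableAt_id)
  rw [fderiv_even_diag hb hd he]
  exact (HasFDerivAt.comp_hasDerivAt_of_eq (0 : ℝ) hd0.hasFDerivAt hc hc0).unique hG

/-- At `X = 0` the even terms are frozen, and the alternating sum of the derivatives is that of
`sum_quadE_eq_zero` with `κ = 2 √π`. -/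
theorem extDeriv_Uex_zero (u : Neg q) : extDeriv Uex ((0, u) : HomZ p q × Neg q) = 0 := by
  have hdiff : DifferentiableAt ℝ (Uex (p := p) (q := q)) (0, u) :=
    (contDiffAt_Uex (a := (0, u)) zero_mem_Dplus 1).differentiableAt one_ne_zero
  ext v
  rw [extDeriv_apply hdiff]
  have key : ∀ i : Fin (q + 1), fderiv ℝ (fun a => Uex a (i.removeNth v)) (0, u) (v i) =
      cst q * Real.exp (-(2 * Real.pi * ⟪u, u⟫)) * (-1) ^ (q * (q - 1) / 2) *
        quadE (q + 1) p fun t => -(2 * √Real.pi) ^ 2 * (∑ k, u k * negMat v i k) *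
          ((affMat (-(2 * √Real.pi) • negMat v) (homMat v) t).submatrix i.succAbove id).det +
          2 * √Real.pi * ∑ k,
            (((affMat (-(2 * √Real.pi) • negMat v) (homMat v) t).submatrix i.succAbove id).updateCol k
              fun j => ∑ α, homMat v α i k * ∑ m, homMat v α (i.succAbove j) m * u m).det := by
    intro i
    set y := i.removeNth v with hy
    have hdU : DifferentiableAt ℝ (fun b : HomZ p q × (HomZ p q × Neg q) => Uat b.1 b.2 y)
        (0, (0, u)) := differentiableAt_form_apply (differentiableAt_Uat (p := p) u) y
    have hline : HasDerivAt (fun s : ℝ => ((s • (v i).1, u + s • (v i).2) : HomZ p q × Neg q))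
        (v i) 0 := by
      have ha : HasDerivAt (fun s : ℝ => s • (v i).1) (v i).1 0 := by
        simpa using (hasDerivAt_id (0 : ℝ)).smul_const (v i).1
      have hb : HasDerivAt (fun s : ℝ => u + s • (v i).2) (v i).2 0 := by
        simpa using ((hasDerivAt_id (0 : ℝ)).smul_const (v i).2).const_add u
      exact ha.prodMk hb
    have h0 : ((0 : HomZ p q), u) = ((0 : ℝ) • (v i).1, u + (0 : ℝ) • (v i).2) := by simp
    have h3 := fderiv_even_diag_of_line
      (G := fun (Y : HomZ p q) (a : HomZ p q × Neg q) => Uat Y a y)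
      (π := ContinuousLinearMap.fst ℝ (HomZ p q) (Neg q)) (b := (0, u)) rfl hdU
      (fun Y a => by rw [Uat_neg]) hline h0 (hasDerivAt_Uat u y (v i).1 (v i).2)
    refine Eq.trans h3 ?_
    congr 2
    funext t
    have hM : (affMat (-(2 * √Real.pi) • negMat v) (homMat v) t).submatrix i.succAbove id =
        affMat (-(2 * √Real.pi) • negMat y) (homMat y) t := by
      rw [affMat_submatrix]
      rfl
    rw [hM]
    congr 2
    refine Finset.sum_congr rfl fun k _ => ?_
    congr 2
    funext j
    exact adjoint_apply_coord _ _ _ _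
  simp_rw [key]
  have h := sum_quadE_eq_zero (2 * √Real.pi) (negMat v) (homMat v) u
  have h' := congrArg (fun z => cst q * Real.exp (-(2 * Real.pi * ⟪u, u⟫)) *
    (-1) ^ (q * (q - 1) / 2) * z) h
  simp only [mul_zero, Finset.mul_sum] at h'
  change _ = (0 : ℝ)
  rw [← h']
  refine Finset.sum_congr rfl fun i _ => ?_
  simp only [zsmul_eq_mul, Int.cast_pow, Int.cast_neg, Int.cast_one, Finset.mul_sum]
  ring

/-- An element of the group carries the point to one over `X = 0`; the form is invariant, and
pullback commutes with the exterior derivative. -/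
theorem extDeriv_Uex {a : HomZ p q × Neg q} (ha : a.1 ∈ Dplus p q) : extDeriv Uex a = 0 := by
  obtain ⟨g, hg, w, hw⟩ := exists_projE_eq ha a.2
  have hw : projE ((g : EndV p q), w) = a := hw
  have hgi := inv_mem hg
  have hgiO := Gplus_le hgi
  have hact : actE ((g⁻¹ : (EndV p q)ˣ) : EndV p q) a = (0, w) := by
    rw [← hw, actE_projE hgiO (Gplus_le hg), inv_mul_cancel]
    exact Prod.ext (actD_one 0) rfl
  have h1 : (fun b => (Uex (actE ((g⁻¹ : (EndV p q)ˣ) : EndV p q) b)).compContinuousLinearMap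
      (fderiv ℝ (actE ((g⁻¹ : (EndV p q)ˣ) : EndV p q)) b)) =ᶠ[𝓝 a] Uex := by
    have hopen : {b : HomZ p q × Neg q | b.1 ∈ Dplus p q} ∈ 𝓝 a :=
      (isOpen_Dplus.preimage continuous_fst).mem_nhds ha
    filter_upwards [hopen] with b hb using Uex_actE hgi hb
  rw [← h1.extDeriv_eq]
  have hmem : (actE ((g⁻¹ : (EndV p q)ˣ) : EndV p q) a).1 ∈ Dplus p q := by
    rw [hact]
    exact zero_mem_Dplus
  have h2 := extDeriv_pullback (𝕜 := ℝ) (r := 2)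
    (f := actE ((g⁻¹ : (EndV p q)ˣ) : EndV p q)) (x := a)
    ((contDiffAt_Uex hmem 1).differentiableAt one_ne_zero) (contDiffAt_actE hgiO ha 2) (by simp)
  rw [h2, hact, extDeriv_Uex_zero]
  ext v
  rfl

/-! ### The form `φ⁰(v)` is closed, and so is the family `φ⁰(t v)` -/

theorem extDeriv_phi0 {X : HomZ p q} (hX : X ∈ Dplus p q) (v : V p q) :
    extDeriv (phi0 v) X = 0 := by
  have h1 : phi0 v =ᶠ[𝓝 X] fun Y =>
      (Uex (sec v Y)).compContinuousLinearMap (fderiv ℝ (sec v) Y) := by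
    filter_upwards [isOpen_Dplus.mem_nhds hX] with Y hY using phi0_eq hY v
  have hmem : (sec v X).1 ∈ Dplus p q := by
    rw [sec_eq hX]
    exact hX
  rw [h1.extDeriv_eq, extDeriv_pullback (𝕜 := ℝ) (r := 2) (f := sec v) (x := X)
    ((contDiffAt_Uex hmem 1).differentiableAt one_ne_zero) (contDiffAt_sec hX v 2) (by simp),
    extDeriv_Uex hmem]
  ext y
  rfl

theorem contDiffOn_right {A B F : Type*} [NormedAddCommGroup A] [NormedSpace ℝ A]
    [NormedAddCommGroup B] [NormedSpace ℝ B] [NormedAddCommGroup F] [NormedSpace ℝ F]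
    {m : WithTop ℕ∞} {f : A → B → F} {s : Set B}
    (hf : ContDiffOn ℝ m (fun x : A × B => f x.1 x.2) (Set.univ ×ˢ s)) (a : A) :
    ContDiffOn ℝ m (f a) s :=
  ContDiffOn.comp (g := fun x : A × B => f x.1 x.2) (f := fun b : B => (a, b)) hf
    (contDiff_const.prodMk contDiff_id).contDiffOn fun _ hb => ⟨Set.mem_univ a, hb⟩

theorem contDiffAt_scale {A B F : Type*} [NormedAddCommGroup A] [NormedSpace ℝ A]
    [NormedAddCommGroup B] [NormedSpace ℝ B] [NormedAddCommGroup F] [NormedSpace ℝ F]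
    {m : WithTop ℕ∞} {f : A → B → F} {a : A} {x : ℝ × B}
    (hf : ContDiffAt ℝ m (fun x : A × B => f x.1 x.2) (x.1 • a, x.2)) :
    ContDiffAt ℝ m (fun x : ℝ × B => (x.2, f (x.1 • a) x.2)) x :=
  contDiffAt_snd.prodMk (ContDiffAt.comp (g := fun x : A × B => f x.1 x.2) x hf
    ((contDiffAt_fst.smul contDiffAt_const).prodMk contDiffAt_snd))

theorem isClosedForm_phi0 {Γ : Subgroup (EndV p q)ˣ} (hΓ : Γ ≤ Gplus p q) (v : V p q) :
    IsClosedForm (stab Γ v) (phi0 v) where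
  smooth := contDiffOn_right contDiffOn_phi0 v
  invariant := by
    intro γ hγ X hX
    rw [pullD_phi0 v (hΓ hγ.1) hX, ((stab Γ v).inv_mem hγ).2]
  closed := fun X hX => extDeriv_phi0 hX v

/-- The family `(t, X) ↦ s_{tv}(X)` of sections. -/
def secT (v : V p q) (x : ℝ × HomZ p q) : HomZ p q × Neg q := (x.2, secF (x.1 • v) x.2)

/-- The pullback of the Mathai-Quillen form by the family of sections `s_{tv}`. -/
def phiT (v : V p q) (x : ℝ × HomZ p q) : (ℝ × HomZ p q) [⋀^Fin q]→L[ℝ] ℝ :=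
  (Uex (secT v x)).compContinuousLinearMap (fderiv ℝ (secT v) x)

theorem contDiffAt_secT (v : V p q) {x : ℝ × HomZ p q} (hx : x.2 ∈ Dplus p q) (m : WithTop ℕ∞) :
    ContDiffAt ℝ m (secT v) x := by
  have hm : ((x.1 • v, x.2) : V p q × HomZ p q).2 ∈ Dplus p q := hx
  exact contDiffAt_scale (f := secF) (contDiffAt_secF hm m)

/-- Closedness on `ℝ × 𝔻⁺` of a form that restricts to `φ⁰(t v)` on the slices says that `∂_t φ⁰(t
v)` is exact. It replaces an explicit transgression form. -/
theorem extDeriv_phiT (v : V p q) {x : ℝ × HomZ p q} (hx : x.2 ∈ Dplus p q) :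
    extDeriv (phiT v) x = 0 := by
  have hmem : (secT v x).1 ∈ Dplus p q := hx
  have h := extDeriv_pullback (𝕜 := ℝ) (r := 2) (f := secT v) (x := x)
    ((contDiffAt_Uex hmem 1).differentiableAt one_ne_zero) (contDiffAt_secT v hx 2) (by simp)
  refine h.trans ?_
  rw [extDeriv_Uex hmem]
  ext y
  rfl

theorem contDiffOn_phiT (v : V p q) :
    ContDiffOn ℝ ∞ (phiT v) (Set.univ ×ˢ Dplus p q) := by
  have hopen : IsOpen ((Set.univ : Set ℝ) ×ˢ Dplus p q) := isOpen_univ.prod isOpen_Dplus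
  have h1 : ContDiffOn ℝ ∞ (fun x => Uex (secT v x)) (Set.univ ×ˢ Dplus p q) := fun x hx => by
    have hmem : (secT v x).1 ∈ Dplus p q := hx.2
    exact (ContDiffAt.comp (g := Uex) x (contDiffAt_Uex hmem ∞)
      (contDiffAt_secT v hx.2 ∞)).contDiffWithinAt
  have h2 : ContDiffOn ℝ ∞ (fderiv ℝ (secT v)) (Set.univ ×ˢ Dplus p q) := fun x hx =>
    ((contDiffAt_secT v hx.2 ∞).fderiv_right (m := ∞) (by simp)).contDiffWithinAt
  exact contDiffOn_form_comp h1 h2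

theorem phiT_apply (v : V p q) {x : ℝ × HomZ p q} (hx : x.2 ∈ Dplus p q)
    (y : Fin q → HomZ p q) : phiT v x (fun i => (0, y i)) = phi0 (x.1 • v) x.2 y := by
  have h1 : HasFDerivAt (secT v) (fderiv ℝ (secT v) x) (x.1, x.2) :=
    ((contDiffAt_secT v hx 1).differentiableAt one_ne_zero).hasFDerivAt
  have h2 : HasFDerivAt (fun X : HomZ p q => (x.1, X))
      ((0 : HomZ p q →L[ℝ] ℝ).prod (ContinuousLinearMap.id ℝ (HomZ p q))) x.2 :=
    (hasFDerivAt_const x.1 x.2).prodMk (hasFDerivAt_id x.2)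
  have h3 := (HasFDerivAt.comp (g := secT v) (f := fun X : HomZ p q => (x.1, X)) x.2 h1
    h2).congr_of_eventuallyEq (sec_eventuallyEq hx (x.1 • v))
  rw [phi0_eq hx, sec_eq hx, h3.fderiv]
  rfl

/-! ### Closed forms and sums over permutations -/

section Perm

open Equiv

variable {T : Type*} [NormedAddCommGroup T] [NormedSpace ℝ T]

/-- The alternating sum over the `n + 1` positions of the derivative is antisymmetrised. The cycle
that moves position `0` to `i` has sign `(-1) ^ i`, so each position gives the same sum over
permutations. -/
theorem sum_perm_fin_eq_zero {n : ℕ} {F : T →L[ℝ] T [⋀^Fin n]→L[ℝ] ℝ}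
    (hF : ContinuousAlternatingMap.alternatizeUncurryFin F = 0) (v : Fin (n + 1) → T) :
    ∑ τ : Perm (Fin (n + 1)), ((Perm.sign τ : ℤ) : ℝ) *
      F (v (τ 0)) (fun i => v (τ i.succ)) = 0 := by
  have h0 : ∀ τ : Perm (Fin (n + 1)), ∑ i : Fin (n + 1), ((Perm.sign τ : ℤ) : ℝ) *
      ((-1) ^ (i : ℕ) * F (v (τ i)) (fun j => v (τ (i.succAbove j)))) = 0 := by
    intro τ
    have h := congrArg (fun A => A (v ∘ τ)) hF
    simp only [ContinuousAlternatingMap.alternatizeUncurryFin_apply] at h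
    rw [← Finset.mul_sum]
    refine mul_eq_zero_of_right _ (Eq.trans ?_ h)
    refine Finset.sum_congr rfl fun i _ => ?_
    simp only [zsmul_eq_mul, Int.cast_pow, Int.cast_neg, Int.cast_one]
    rfl
  have h1 : ∑ i : Fin (n + 1), ∑ τ : Perm (Fin (n + 1)), ((Perm.sign τ : ℤ) : ℝ) *
      ((-1) ^ (i : ℕ) * F (v (τ i)) (fun j => v (τ (i.succAbove j)))) = 0 := by
    rw [Finset.sum_comm]
    exact Finset.sum_eq_zero fun τ _ => h0 τ
  have h2 : ∀ i : Fin (n + 1), ∑ τ : Perm (Fin (n + 1)), ((Perm.sign τ : ℤ) : ℝ) *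
      ((-1) ^ (i : ℕ) * F (v (τ i)) (fun j => v (τ (i.succAbove j)))) =
      ∑ τ : Perm (Fin (n + 1)), ((Perm.sign τ : ℤ) : ℝ) *
        F (v (τ 0)) (fun i => v (τ i.succ)) := by
    intro i
    refine Fintype.sum_equiv (Equiv.mulRight (i.cycleRange⁻¹ : Perm (Fin (n + 1)))) _ _ fun τ => ?_
    have e0 : (i.cycleRange⁻¹ : Perm (Fin (n + 1))) 0 = i := Fin.cycleRange_symm_zero i
    have e1 : ∀ j : Fin n, (i.cycleRange⁻¹ : Perm (Fin (n + 1))) j.succ = i.succAbove j :=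
      Fin.cycleRange_symm_succ i
    simp only [Equiv.coe_mulRight, Perm.mul_apply, e0, e1, Perm.sign_mul, Perm.sign_inv,
      Fin.sign_cycleRange]
    push_cast
    ring
  simp_rw [h2] at h1
  rw [Finset.sum_const, nsmul_eq_mul] at h1
  exact (mul_eq_zero.1 h1).resolve_left (by simp [Nat.cast_add_one_ne_zero])

/-- The sum is averaged over the permutations that move only the range of `f`. These do not affect
`c`, and the inner sum vanishes by `sum_perm_fin_eq_zero`. -/
theorem sum_perm_embedding_eq_zero {n : ℕ} {F : T →L[ℝ] T [⋀^Fin n]→L[ℝ] ℝ}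
    (hF : ContinuousAlternatingMap.alternatizeUncurryFin F = 0) {J : Type*} [Fintype J]
    [DecidableEq J] (f : Fin (n + 1) ↪ J) (e : J → T) (c : Perm J → ℝ)
    (hc : ∀ τ (h : Perm (Fin (n + 1))), c (τ * h.viaFintypeEmbedding f) = c τ) :
    ∑ τ : Perm J, ((Perm.sign τ : ℤ) : ℝ) *
      (F (e (τ (f 0))) (fun i => e (τ (f i.succ))) * c τ) = 0 := by
  set g : Perm J → ℝ := fun τ => ((Perm.sign τ : ℤ) : ℝ) *
      (F (e (τ (f 0))) (fun i => e (τ (f i.succ))) * c τ) with hg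
  have h1 : ∀ h : Perm (Fin (n + 1)), ∑ τ, g (τ * h.viaFintypeEmbedding f) = ∑ τ, g τ := fun h =>
    Fintype.sum_equiv (Equiv.mulRight (h.viaFintypeEmbedding f)) _ _ fun τ => rfl
  have h2 : ∑ h : Perm (Fin (n + 1)), ∑ τ, g (τ * h.viaFintypeEmbedding f) = 0 := by
    rw [Finset.sum_comm]
    refine Finset.sum_eq_zero fun τ _ => ?_
    have h3 := congrArg (fun z => ((Perm.sign τ : ℤ) : ℝ) * c τ * z)
      (sum_perm_fin_eq_zero hF fun i => e (τ (f i)))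
    simp only [mul_zero, Finset.mul_sum] at h3
    rw [← h3]
    refine Finset.sum_congr rfl fun h _ => ?_
    simp only [hg, hc, Perm.mul_apply, Perm.viaFintypeEmbedding_apply_image, Perm.sign_mul,
      Perm.viaFintypeEmbedding_sign]
    push_cast
    ring
  simp_rw [h1] at h2
  rw [Finset.sum_const, nsmul_eq_mul] at h2
  refine (mul_eq_zero.1 h2).resolve_left ?_
  simp [Fintype.card_perm, Nat.factorial_ne_zero]

/-- The index `(none; inl i)` of a derivative and of the arguments of the first form. -/
def embL (q k : ℕ) : Fin (q + 1) ↪ Unit ⊕ (Fin q ⊕ Fin k) where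
  toFun := Fin.cases (Sum.inl ()) fun i => Sum.inr (Sum.inl i)
  inj' := by
    intro i j
    refine Fin.cases ?_ (fun i => ?_) i <;> refine Fin.cases ?_ (fun j => ?_) j <;> simp

/-- The index `(none; inr j)` of a derivative and of the arguments of the second form. -/
def embR (q k : ℕ) : Fin (k + 1) ↪ Unit ⊕ (Fin q ⊕ Fin k) where
  toFun := Fin.cases (Sum.inl ()) fun i => Sum.inr (Sum.inr i)
  inj' := by
    intro i j
    refine Fin.cases ?_ (fun i => ?_) i <;> refine Fin.cases ?_ (fun j => ?_) j <;> simp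

theorem notMem_range_embL {q k : ℕ} (j : Fin k) :
    (Sum.inr (Sum.inr j) : Unit ⊕ (Fin q ⊕ Fin k)) ∉ Set.range (embL q k) := by
  rintro ⟨i, hi⟩
  refine Fin.cases (fun h => ?_) (fun i h => ?_) i hi
  · exact Sum.inl_ne_inr h
  · exact Sum.inl_ne_inr (Sum.inr_injective h)

theorem notMem_range_embR {q k : ℕ} (j : Fin q) :
    (Sum.inr (Sum.inl j) : Unit ⊕ (Fin q ⊕ Fin k)) ∉ Set.range (embR q k) := by
  rintro ⟨i, hi⟩
  refine Fin.cases (fun h => ?_) (fun i h => ?_) i hi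
  · exact Sum.inl_ne_inr h
  · exact Sum.inr_ne_inl (Sum.inr_injective h)

theorem sum_perm_left_eq_zero {q k : ℕ} {F : T →L[ℝ] T [⋀^Fin q]→L[ℝ] ℝ}
    (hF : ContinuousAlternatingMap.alternatizeUncurryFin F = 0) (η : T [⋀^Fin k]→L[ℝ] ℝ)
    (e : Unit ⊕ (Fin q ⊕ Fin k) → T) :
    ∑ τ : Perm (Unit ⊕ (Fin q ⊕ Fin k)), ((Perm.sign τ : ℤ) : ℝ) *
      (F (e (τ (Sum.inl ()))) (fun i => e (τ (Sum.inr (Sum.inl i)))) *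
        η (fun i => e (τ (Sum.inr (Sum.inr i))))) = 0 :=
  sum_perm_embedding_eq_zero hF (embL q k) e (fun τ => η (fun i => e (τ (Sum.inr (Sum.inr i)))))
    fun τ h => by
      simp only [Perm.mul_apply,
        Perm.viaFintypeEmbedding_apply_notMem_range _ _ (notMem_range_embL _)]

theorem sum_perm_right_eq_zero {q k : ℕ} {F : T →L[ℝ] T [⋀^Fin k]→L[ℝ] ℝ}
    (hF : ContinuousAlternatingMap.alternatizeUncurryFin F = 0) (φ : T [⋀^Fin q]→L[ℝ] ℝ)
    (e : Unit ⊕ (Fin q ⊕ Fin k) → T) :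
    ∑ τ : Perm (Unit ⊕ (Fin q ⊕ Fin k)), ((Perm.sign τ : ℤ) : ℝ) *
      (F (e (τ (Sum.inl ()))) (fun i => e (τ (Sum.inr (Sum.inr i)))) *
        φ (fun i => e (τ (Sum.inr (Sum.inl i))))) = 0 :=
  sum_perm_embedding_eq_zero hF (embR q k) e (fun τ => φ (fun i => e (τ (Sum.inr (Sum.inl i)))))
    fun τ h => by
      simp only [Perm.mul_apply,
        Perm.viaFintypeEmbedding_apply_notMem_range _ _ (notMem_range_embR _)]

/-- The form `φ ∧ η`, up to a factor, is a sum over permutations. -/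
theorem sum_perm_eq_domCoprod {q k : ℕ} (φ : T [⋀^Fin q]→ₗ[ℝ] ℝ) (η : T [⋀^Fin k]→ₗ[ℝ] ℝ)
    (e : Fin q ⊕ Fin k → T) :
    ∑ σ : Perm (Fin q ⊕ Fin k), ((Perm.sign σ : ℤ) : ℝ) *
      (φ (fun i => e (σ (Sum.inl i))) * η (fun i => e (σ (Sum.inr i)))) =
    ((q.factorial * k.factorial : ℕ) : ℝ) *
      (LinearMap.mul' ℝ ℝ).compAlternatingMap (φ.domCoprod η) e := by
  have h := congrArg (fun A : T [⋀^Fin q ⊕ Fin k]→ₗ[ℝ] (ℝ ⊗[ℝ] ℝ) => LinearMap.mul' ℝ ℝ (A e))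
    (MultilinearMap.domCoprod_alternization_eq φ η)
  simp only [MultilinearMap.alternatization_apply, map_sum, Fintype.card_fin] at h
  rw [LinearMap.compAlternatingMap_apply, ← nsmul_eq_mul]
  refine Eq.trans ?_ (h.trans ?_)
  · refine Finset.sum_congr rfl fun σ _ => ?_
    rw [Units.smul_def, map_zsmul, zsmul_eq_mul]
    rfl
  · rw [AlternatingMap.smul_apply, map_nsmul]

/-- The alternating map `λ ∧ φ ∧ η`, up to a factor. -/
def triple {q k : ℕ} (l : T →ₗ[ℝ] ℝ) (φ : T [⋀^Fin q]→ₗ[ℝ] ℝ) (η : T [⋀^Fin k]→ₗ[ℝ] ℝ) :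
    T [⋀^Unit ⊕ (Fin q ⊕ Fin k)]→ₗ[ℝ] ℝ :=
  MultilinearMap.alternatization
    ((LinearMap.mul' ℝ ℝ).compMultilinearMap ((MultilinearMap.ofSubsingleton ℝ T ℝ () l).domCoprod
      ((LinearMap.mul' ℝ ℝ).compMultilinearMap
        (φ.toMultilinearMap.domCoprod η.toMultilinearMap))))

theorem triple_apply {q k : ℕ} (l : T →ₗ[ℝ] ℝ) (φ : T [⋀^Fin q]→ₗ[ℝ] ℝ)
    (η : T [⋀^Fin k]→ₗ[ℝ] ℝ) (e : Unit ⊕ (Fin q ⊕ Fin k) → T) :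
    triple l φ η e = ∑ τ : Perm (Unit ⊕ (Fin q ⊕ Fin k)), ((Perm.sign τ : ℤ) : ℝ) *
      (l (e (τ (Sum.inl ()))) * (φ (fun i => e (τ (Sum.inr (Sum.inl i)))) *
        η (fun i => e (τ (Sum.inr (Sum.inr i)))))) := by
  rw [triple, MultilinearMap.alternatization_apply]
  refine Finset.sum_congr rfl fun σ _ => ?_
  rw [Units.smul_def, zsmul_eq_mul]
  rfl

/-- The permutations of `Unit ⊕ ι` which fix the first point. -/
theorem sum_perm_fix {ι : Type*} [Fintype ι] [DecidableEq ι] (f : Perm (Unit ⊕ ι) → ℝ) :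
    ∑ τ ∈ Finset.univ.filter (fun τ : Perm (Unit ⊕ ι) => τ (Sum.inl ()) = Sum.inl ()), f τ =
      ∑ σ : Perm ι, f (Perm.sumCongr 1 σ) := by
  symm
  refine Finset.sum_bij (fun σ _ => Perm.sumCongr 1 σ) ?_ ?_ ?_ ?_
  · intro σ _
    simp
  · intro σ _ σ' _ h
    ext i
    have h1 := congrArg (fun τ : Perm (Unit ⊕ ι) => τ (Sum.inr i)) h
    simpa using h1
  · intro τ hτ
    have h1 : τ ∈ (Perm.sumCongrHom Unit ι).range := by
      refine Perm.mem_sumCongrHom_range_of_perm_mapsTo_inl ?_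
      rintro _ ⟨⟨⟩, rfl⟩
      exact ⟨(), ((Finset.mem_filter.1 hτ).2).symm⟩
    obtain ⟨⟨σ₀, σ⟩, rfl⟩ := h1
    refine ⟨σ, Finset.mem_univ _, ?_⟩
    have : σ₀ = 1 := Subsingleton.elim _ _
    subst this
    rfl
  · intro σ _
    rfl

end Perm

/-! ### Integration by parts for a family of closed forms -/

section Stokes

open Equiv

theorem integrable_of_continuousOn_compact {E : Type*} [NormedAddCommGroup E]
    [MeasurableSpace E] [OpensMeasurableSpace E] {μ : Measure E}
    [IsFiniteMeasureOnCompacts μ] {K : Set E} (hK : IsCompact K) {f : E → ℝ}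
    (hf : ContinuousOn f K) (h0 : ∀ x ∉ K, f x = 0) : Integrable f μ := by
  rw [← integrableOn_iff_integrable_of_support_subset (s := K)]
  · exact hf.integrableOn_compact hK
  · intro x hx
    by_contra h
    exact hx (h0 x h)

variable {E : Type*} [NormedAddCommGroup E] [NormedSpace ℝ E]

/-- The pullback to `ℝ × E` of a form on `E`. -/
def pullSnd {k : ℕ} (η : E → E [⋀^Fin k]→L[ℝ] ℝ) (x : ℝ × E) : (ℝ × E) [⋀^Fin k]→L[ℝ] ℝ :=
  (η x.2).compContinuousLinearMap (ContinuousLinearMap.snd ℝ ℝ E)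

theorem contDiffOn_pullSnd [FiniteDimensional ℝ E] {k : ℕ} {η : E → E [⋀^Fin k]→L[ℝ] ℝ} {O : Set E} {m : WithTop ℕ∞}
    (hη : ContDiffOn ℝ m η O) : ContDiffOn ℝ m (pullSnd η) (Set.univ ×ˢ O) :=
  contDiffOn_form_comp (hη.comp contDiff_snd.contDiffOn fun _ hx => hx.2) contDiffOn_const

theorem extDeriv_pullSnd {k : ℕ} {η : E → E [⋀^Fin k]→L[ℝ] ℝ} {x : ℝ × E}
    (hη : DifferentiableAt ℝ η x.2) (h : extDeriv η x.2 = 0) : extDeriv (pullSnd η) x = 0 := by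
  have h1 := extDeriv_pullback (𝕜 := ℝ) (r := 2) (f := fun x : ℝ × E => x.2) (x := x) hη
    contDiffAt_snd (by simp)
  have h2 : (fun y : ℝ × E => (η y.2).compContinuousLinearMap
      (fderiv ℝ (fun x : ℝ × E => x.2) y)) = pullSnd η := by
    funext y
    rw [fderiv_snd, pullSnd]
  rw [← h2, h1, h]
  ext v
  rfl

theorem fderiv_form_apply {T : Type*} [NormedAddCommGroup T] [NormedSpace ℝ T] {n : ℕ}
    {η : T → T [⋀^Fin n]→L[ℝ] ℝ} {x : T} (h : DifferentiableAt ℝ η x) (y : Fin n → T) (u : T) :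
    fderiv ℝ (fun x => η x y) x u = fderiv ℝ η x u y := by
  rw [(h.hasFDerivAt.continuousAlternatingMap_apply_const y).fderiv]
  rfl

/-- The frame of `ℝ × E` made of `∂_t` and of a family in `E`. -/
def frame {ι : Type*} (b : ι → E) : Unit ⊕ ι → ℝ × E := Sum.elim (fun _ => (1, 0)) fun i => (0, b i)

/-- This is `d(W ∧ η) = 0`, written as an antisymmetrised derivative of a product. The Leibniz rule
splits it into two sums, one for each closed form, without signs to track. -/
theorem sum_perm_fderiv_eq_zero {q k : ℕ} {W : ℝ × E → (ℝ × E) [⋀^Fin q]→L[ℝ] ℝ}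
    {η : ℝ × E → (ℝ × E) [⋀^Fin k]→L[ℝ] ℝ} {x : ℝ × E} (hW : DifferentiableAt ℝ W x)
    (hη : DifferentiableAt ℝ η x) (hW0 : extDeriv W x = 0) (hη0 : extDeriv η x = 0)
    (e : Unit ⊕ (Fin q ⊕ Fin k) → ℝ × E) :
    ∑ τ : Perm (Unit ⊕ (Fin q ⊕ Fin k)), ((Perm.sign τ : ℤ) : ℝ) *
      fderiv ℝ (fun x => W x (fun i => e (τ (Sum.inr (Sum.inl i)))) *
        η x (fun i => e (τ (Sum.inr (Sum.inr i))))) x (e (τ (Sum.inl ()))) = 0 := by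
  have h1 := sum_perm_left_eq_zero (F := fderiv ℝ W x) hW0 (η x) e
  have h2 := sum_perm_right_eq_zero (F := fderiv ℝ η x) hη0 (W x) e
  have h3 := congrArg₂ (· + ·) h1 h2
  simp only [add_zero, ← Finset.sum_add_distrib] at h3
  rw [← h3]
  refine Finset.sum_congr rfl fun τ _ => ?_
  rw [← mul_add]
  congr 1
  have h4 := differentiableAt_form_apply hW (fun i => e (τ (Sum.inr (Sum.inl i))))
  have h5 := differentiableAt_form_apply hη (fun i => e (τ (Sum.inr (Sum.inr i))))
  have h6 := (h4.hasFDerivAt.mul h5.hasFDerivAt).fderiv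
  have h7 := congrArg (fun A : ℝ × E →L[ℝ] ℝ => A (e (τ (Sum.inl ())))) h6
  refine h7.trans ?_
  simp only [add_apply, smul_apply, smul_eq_mul, fderiv_form_apply hW, fderiv_form_apply hη]
  ring

variable [MeasurableSpace E] [BorelSpace E] {μ : Measure E} [μ.IsAddHaarMeasure]

theorem hasDerivAt_integral_of_contDiffOn {O : Set E} (hO : IsOpen O) {χ : E → ℝ}
    (hχ : Continuous χ) (hc : HasCompactSupport χ) (hs : tsupport χ ⊆ O) {h : ℝ × E → ℝ}
    (hh : ContDiffOn ℝ 1 h (Set.univ ×ˢ O)) (t : ℝ) :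
    HasDerivAt (fun t => ∫ x, χ x * h (t, x) ∂μ)
      (∫ x, χ x * fderiv ℝ h (t, x) (1, 0) ∂μ) t := by
  have hopen : IsOpen ((Set.univ : Set ℝ) ×ˢ O) := isOpen_univ.prod hO
  have hcf : ContinuousOn (fun y => fderiv ℝ h y (1, 0)) (Set.univ ×ˢ O) :=
    (hh.continuousOn_fderiv_of_isOpen hopen le_rfl).clm_apply continuousOn_const
  have hχ0 : ∀ x ∉ tsupport χ, χ x = 0 := fun x hx => image_eq_zero_of_notMem_tsupport hx
  have hint : ∀ {f : ℝ × E → ℝ}, ContinuousOn f (Set.univ ×ˢ O) → ∀ s,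
      Integrable (fun x => χ x * f (s, x)) μ := by
    intro f hf s
    refine integrable_of_continuousOn_compact hc (hχ.continuousOn.mul ?_) fun x hx => by
      rw [hχ0 x hx, zero_mul]
    exact hf.comp (by fun_prop) fun x hx => ⟨Set.mem_univ _, hs hx⟩
  -- The dominating constant comes from the compact set `[t - 1, t + 1] × supp χ`.
  have hK : IsCompact (Metric.closedBall t 1 ×ˢ tsupport χ) := (isCompact_closedBall t 1).prod hc
  obtain ⟨C, hC⟩ := hK.exists_bound_of_continuousOn
    (hcf.mono (Set.prod_mono (Set.subset_univ _) hs))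
  refine (hasDerivAt_integral_of_dominated_loc_of_deriv_le (F := fun t x => χ x * h (t, x))
    (F' := fun t x => χ x * fderiv ℝ h (t, x) (1, 0)) (bound := fun x => |χ x| * C)
    (Metric.closedBall_mem_nhds t one_pos)
    (Filter.Eventually.of_forall fun s => (hint hh.continuousOn s).aestronglyMeasurable)
    (hint hh.continuousOn t) (hint hcf t).aestronglyMeasurable ?_ ?_ ?_).2
  · refine Filter.Eventually.of_forall fun x s hs' => ?_
    rw [norm_mul, Real.norm_eq_abs]
    by_cases hx : x ∈ tsupport χ
    · exact mul_le_mul_of_nonneg_left (hC (s, x) ⟨hs', hx⟩) (abs_nonneg _)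
    · simp [hχ0 x hx]
  · exact (hχ.integrable_of_hasCompactSupport hc).abs.mul_const C
  · refine Filter.Eventually.of_forall fun x s _ => ?_
    by_cases hx : x ∈ tsupport χ
    · have h1 : HasFDerivAt h (fderiv ℝ h (s, x)) (s, x) :=
        ((hh.contDiffAt (hopen.mem_nhds ⟨Set.mem_univ _, hs hx⟩)).differentiableAt
          one_ne_zero).hasFDerivAt
      have h2 : HasDerivAt (fun s : ℝ => (s, x)) (1, 0) s :=
        (hasDerivAt_id s).prodMk (hasDerivAt_const s x)
      exact (HasFDerivAt.comp_hasDerivAt_of_eq s h1 h2 rfl).const_mul (χ x)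
    · simp only [hχ0 x hx, zero_mul]
      exact hasDerivAt_const s 0

variable [FiniteDimensional ℝ E]

theorem integral_mul_fderiv_snd {O : Set E} (hO : IsOpen O) {χ : E → ℝ} (hχ : ContDiff ℝ 1 χ)
    (hc : HasCompactSupport χ) (hs : tsupport χ ⊆ O) {h : ℝ × E → ℝ}
    (hh : ContDiffOn ℝ 1 h (Set.univ ×ˢ O)) (t : ℝ) (w : E) :
    ∫ x, χ x * fderiv ℝ h (t, x) (0, w) ∂μ = -∫ x, fderiv ℝ χ x w * h (t, x) ∂μ := by
  have hopen : IsOpen ((Set.univ : Set ℝ) ×ˢ O) := isOpen_univ.prod hO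
  have hg : ContDiffOn ℝ 1 (fun x => h (t, x)) O :=
    hh.comp (contDiff_const.prodMk contDiff_id).contDiffOn fun x hx => ⟨Set.mem_univ _, hx⟩
  have hχ0 : ∀ x ∉ tsupport χ, χ x = 0 := fun x hx => image_eq_zero_of_notMem_tsupport hx
  have hχ1 : ∀ x ∉ tsupport χ, fderiv ℝ χ x = 0 := fun x hx => by
    by_contra h
    exact hx (support_fderiv_subset ℝ h)
  have hgf : ∀ x ∈ O, fderiv ℝ (fun x => h (t, x)) x w = fderiv ℝ h (t, x) (0, w) := by
    intro x hx
    have h1 : HasFDerivAt h (fderiv ℝ h (t, x)) (t, x) :=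
      ((hh.contDiffAt (hopen.mem_nhds ⟨Set.mem_univ _, hx⟩)).differentiableAt
        one_ne_zero).hasFDerivAt
    have h2 : HasFDerivAt (fun x : E => (t, x))
        ((0 : E →L[ℝ] ℝ).prod (ContinuousLinearMap.id ℝ E)) x :=
      (hasFDerivAt_const t x).prodMk (hasFDerivAt_id x)
    have h3 : HasFDerivAt (fun x => h (t, x)) _ x := HasFDerivAt.comp (g := h) x h1 h2
    rw [h3.fderiv]
    rfl
  have h1 := integral_mul_fderiv_eq_neg_fderiv_mul_of_integrable (μ := μ) (f := χ)
    (g := fun x => h (t, x)) (v := w) ?_ ?_ ?_ (fun x _ => (hχ.differentiable one_ne_zero) x)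
    (fun x hx => (hg.contDiffAt (hO.mem_nhds (hs hx))).differentiableAt one_ne_zero)
  · rw [← h1]
    refine integral_congr_ae (Filter.Eventually.of_forall fun x => ?_)
    by_cases hx : x ∈ tsupport χ
    · simp only [hgf x (hs hx)]
    · simp only [hχ0 x hx, zero_mul]
  · refine integrable_of_continuousOn_compact hc (ContinuousOn.mul ?_ ?_) fun x hx => by
      rw [hχ1 x hx]
      simp
    · exact ((hχ.continuous_fderiv one_ne_zero).clm_apply continuous_const).continuousOn
    · exact hg.continuousOn.mono hs
  · refine integrable_of_continuousOn_compact hc (hχ.continuous.continuousOn.mul ?_)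
      fun x hx => by rw [hχ0 x hx, zero_mul]
    exact ((hg.continuousOn_fderiv_of_isOpen hO le_rfl).clm_apply continuousOn_const).mono hs
  · exact integrable_of_continuousOn_compact hc
      (hχ.continuous.continuousOn.mul (hg.continuousOn.mono hs))
      fun x hx => by rw [hχ0 x hx, zero_mul]

/-- Stokes' theorem for the product of a family of closed forms, a closed form and a cutoff
function. -/
theorem hasDerivAt_integral_wedge {O : Set E} (hO : IsOpen O) {χ : E → ℝ} (hχ : ContDiff ℝ 1 χ)
    (hc : HasCompactSupport χ) (hs : tsupport χ ⊆ O) {q k : ℕ}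
    {W : ℝ × E → (ℝ × E) [⋀^Fin q]→L[ℝ] ℝ} {η : ℝ × E → (ℝ × E) [⋀^Fin k]→L[ℝ] ℝ}
    (hW : ContDiffOn ℝ 1 W (Set.univ ×ˢ O)) (hη : ContDiffOn ℝ 1 η (Set.univ ×ˢ O))
    (hW0 : ∀ x : ℝ × E, x.2 ∈ O → extDeriv W x = 0)
    (hη0 : ∀ x : ℝ × E, x.2 ∈ O → extDeriv η x = 0)
    (b : Fin q ⊕ Fin k → E) (t : ℝ) :
    HasDerivAt (fun t => ∫ x, χ x * ∑ σ : Perm (Fin q ⊕ Fin k), ((Perm.sign σ : ℤ) : ℝ) *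
        (W (t, x) (fun i => (0, b (σ (Sum.inl i)))) * η (t, x) (fun i => (0, b (σ (Sum.inr i))))) ∂μ)
      (∫ x, triple ((fderiv ℝ χ x).comp (ContinuousLinearMap.snd ℝ ℝ E)).toLinearMap
        (W (t, x)).toAlternatingMap (η (t, x)).toAlternatingMap (frame b) ∂μ) t := by
  have hopen : IsOpen ((Set.univ : Set ℝ) ×ˢ O) := isOpen_univ.prod hO
  set e := frame b with he
  set h : Perm (Unit ⊕ (Fin q ⊕ Fin k)) → ℝ × E → ℝ := fun τ x =>
    W x (fun i => e (τ (Sum.inr (Sum.inl i)))) * η x (fun i => e (τ (Sum.inr (Sum.inr i)))) with hh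
  have hsm : ∀ τ, ContDiffOn ℝ 1 (h τ) (Set.univ ×ˢ O) := fun τ =>
    (contDiffOn_form_apply (x := fun _ i => e (τ (Sum.inr (Sum.inl i)))) hW
      fun i => contDiffOn_const).mul
      (contDiffOn_form_apply (x := fun _ i => e (τ (Sum.inr (Sum.inr i)))) hη
        fun i => contDiffOn_const)
  have hχ0 : ∀ x ∉ tsupport χ, χ x = 0 := fun x hx => image_eq_zero_of_notMem_tsupport hx
  have hχ1 : ∀ x ∉ tsupport χ, fderiv ℝ χ x = 0 := fun x hx => by
    by_contra h
    exact hx (support_fderiv_subset ℝ h)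
  set a : Perm (Unit ⊕ (Fin q ⊕ Fin k)) → ℝ := fun τ =>
    ∫ x, χ x * fderiv ℝ (h τ) (t, x) (e (τ (Sum.inl ()))) ∂μ with ha
  set c : Perm (Unit ⊕ (Fin q ⊕ Fin k)) → ℝ := fun τ =>
    ∫ x, fderiv ℝ χ x (e (τ (Sum.inl ()))).2 * h τ (t, x) ∂μ with hcdef
  have hia : ∀ τ, Integrable
      (fun x => χ x * fderiv ℝ (h τ) (t, x) (e (τ (Sum.inl ())))) μ := by
    intro τ
    refine integrable_of_continuousOn_compact hc (hχ.continuous.continuousOn.mul ?_)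
      fun x hx => by rw [hχ0 x hx, zero_mul]
    exact (((hsm τ).continuousOn_fderiv_of_isOpen hopen le_rfl).clm_apply continuousOn_const).comp
      (f := fun x : E => (t, x)) (by fun_prop) fun x hx => ⟨Set.mem_univ _, hs hx⟩
  have hic : ∀ τ, Integrable (fun x => fderiv ℝ χ x (e (τ (Sum.inl ()))).2 * h τ (t, x)) μ := by
    intro τ
    refine integrable_of_continuousOn_compact hc (ContinuousOn.mul ?_ ?_)
      fun x hx => by rw [hχ1 x hx]; simp
    · exact ((hχ.continuous_fderiv one_ne_zero).clm_apply continuous_const).continuousOn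
    · exact (hsm τ).continuousOn.comp (f := fun x : E => (t, x)) (by fun_prop)
        fun x hx => ⟨Set.mem_univ _, hs hx⟩
  -- The vector at position `Sum.inl ()` is the direction of differentiation; closedness makes the
  -- sum over all frames vanish pointwise.
  have hsum0 : ∑ τ, ((Perm.sign τ : ℤ) : ℝ) * a τ = 0 := by
    have h1 : ∀ x, ∑ τ, ((Perm.sign τ : ℤ) : ℝ) *
        (χ x * fderiv ℝ (h τ) (t, x) (e (τ (Sum.inl ())))) = 0 := by
      intro x
      by_cases hx : x ∈ tsupport χ
      · have hm : (t, x) ∈ (Set.univ : Set ℝ) ×ˢ O := ⟨Set.mem_univ _, hs hx⟩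
        have h2 := sum_perm_fderiv_eq_zero (hW.contDiffAt (hopen.mem_nhds hm) |>.differentiableAt
          one_ne_zero) (hη.contDiffAt (hopen.mem_nhds hm) |>.differentiableAt one_ne_zero)
          (hW0 _ hm.2) (hη0 _ hm.2) e
        have h3 := congrArg (fun z => χ x * z) h2
        simp only [mul_zero, Finset.mul_sum] at h3
        rw [← h3]
        exact Finset.sum_congr rfl fun τ _ => by rw [mul_left_comm]
      · simp [hχ0 x hx]
    simp only [ha, ← integral_const_mul]
    rw [← integral_finsetSum _ fun τ _ => (hia τ).const_mul _]
    simp [h1]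
  -- If the direction is `∂_t`, the cutoff is not differentiated. If it lies in `E`, integration by
  -- parts moves the derivative to `χ` and changes the sign.
  have hfix : ∀ τ, τ (Sum.inl ()) = Sum.inl () → c τ = 0 := by
    intro τ hτ
    simp [hcdef, hτ, he, frame]
  have hnot : ∀ τ, τ (Sum.inl ()) ≠ Sum.inl () → a τ = -c τ := by
    intro τ hτ
    obtain ⟨i, hi⟩ : ∃ i, τ (Sum.inl ()) = Sum.inr i := by
      rcases hτ' : τ (Sum.inl ()) with u | i
      · exact absurd hτ' hτ
      · exact ⟨i, rfl⟩
    have h1 := integral_mul_fderiv_snd (μ := μ) hO hχ hc hs (hsm τ) t (b i)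
    simp only [ha, hcdef, hi, he, frame, Sum.elim_inr]
    exact h1
  -- The terms differentiated in `t` therefore add up to the terms that contain `dχ`.
  have hkey : ∑ τ ∈ Finset.univ.filter (fun τ : Perm (Unit ⊕ (Fin q ⊕ Fin k)) =>
      τ (Sum.inl ()) = Sum.inl ()), ((Perm.sign τ : ℤ) : ℝ) * a τ =
        ∑ τ, ((Perm.sign τ : ℤ) : ℝ) * c τ := by
    have h1 := Finset.sum_filter_add_sum_filter_not Finset.univ
      (fun τ : Perm (Unit ⊕ (Fin q ⊕ Fin k)) => τ (Sum.inl ()) = Sum.inl ())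
      (fun τ => ((Perm.sign τ : ℤ) : ℝ) * a τ)
    have h2 := Finset.sum_filter_add_sum_filter_not Finset.univ
      (fun τ : Perm (Unit ⊕ (Fin q ⊕ Fin k)) => τ (Sum.inl ()) = Sum.inl ())
      (fun τ => ((Perm.sign τ : ℤ) : ℝ) * c τ)
    have h3 : ∑ τ ∈ Finset.univ.filter (fun τ : Perm (Unit ⊕ (Fin q ⊕ Fin k)) =>
        τ (Sum.inl ()) = Sum.inl ()), ((Perm.sign τ : ℤ) : ℝ) * c τ = 0 :=
      Finset.sum_eq_zero fun τ hτ => by rw [hfix τ (Finset.mem_filter.1 hτ).2, mul_zero]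
    have h4 : ∑ τ ∈ Finset.univ.filter (fun τ : Perm (Unit ⊕ (Fin q ⊕ Fin k)) =>
        ¬ τ (Sum.inl ()) = Sum.inl ()), ((Perm.sign τ : ℤ) : ℝ) * a τ =
        -∑ τ ∈ Finset.univ.filter (fun τ : Perm (Unit ⊕ (Fin q ⊕ Fin k)) =>
        ¬ τ (Sum.inl ()) = Sum.inl ()), ((Perm.sign τ : ℤ) : ℝ) * c τ := by
      rw [← Finset.sum_neg_distrib]
      exact Finset.sum_congr rfl fun τ hτ => by rw [hnot τ (Finset.mem_filter.1 hτ).2, mul_neg]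
    linarith
  rw [sum_perm_fix] at hkey
  have hright : ∫ x, triple ((fderiv ℝ χ x).comp (ContinuousLinearMap.snd ℝ ℝ E)).toLinearMap
        (W (t, x)).toAlternatingMap (η (t, x)).toAlternatingMap e ∂μ =
      ∑ τ, ((Perm.sign τ : ℤ) : ℝ) * c τ := by
    simp only [triple_apply, hcdef, ← integral_const_mul]
    rw [← integral_finsetSum _ fun τ _ => (hic τ).const_mul _]
    rfl
  rw [hright, ← hkey]
  have hder := HasDerivAt.fun_sum (u := Finset.univ) fun (σ : Perm (Fin q ⊕ Fin k)) _ =>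
    (hasDerivAt_integral_of_contDiffOn (μ := μ) hO hχ.continuous hc hs
      (hsm (Perm.sumCongr 1 σ)) t).const_mul ((Perm.sign σ : ℤ) : ℝ)
  refine (hder.congr_deriv ?_).congr_of_eventuallyEq (Filter.Eventually.of_forall fun s => ?_)
  · refine Finset.sum_congr rfl fun σ _ => ?_
    rw [Perm.sign_sumCongr, Perm.sign_one, one_mul]
    rfl
  · have hi : ∀ σ : Perm (Fin q ⊕ Fin k), Integrable (fun x => ((Perm.sign σ : ℤ) : ℝ) *
        (χ x * h (Perm.sumCongr 1 σ) (s, x))) μ := by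
      intro σ
      refine Integrable.const_mul ?_ _
      refine integrable_of_continuousOn_compact hc (hχ.continuous.continuousOn.mul ?_)
        fun x hx => by rw [hχ0 x hx, zero_mul]
      exact (hsm _).continuousOn.comp (f := fun x : E => (s, x)) (by fun_prop)
        fun x hx => ⟨Set.mem_univ _, hs hx⟩
    simp only [← integral_const_mul]
    rw [← integral_finsetSum _ fun σ _ => hi σ]
    refine integral_congr_ae (Filter.Eventually.of_forall fun x => ?_)
    simp only [Finset.mul_sum]
    refine Finset.sum_congr rfl fun σ _ => ?_
    rw [mul_left_comm]
    rfl

end Stokes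

/-! ### Unfolding -/

section Unfold

theorem integrable_of_hasSum {α ι : Type*} [Countable ι] [MeasurableSpace α] {ν : Measure α}
    {f : ι → α → ℝ} {h : α → ℝ} (hf : ∀ i, Integrable (f i) ν)
    (hs : Summable fun i => ∫ x, ‖f i x‖ ∂ν) (hh : ∀ᵐ x ∂ν, HasSum (fun i => f i x) (h x)) :
    Integrable h ν ∧ HasSum (fun i => ∫ x, f i x ∂ν) (∫ x, h x ∂ν) := by
  have hm : AEStronglyMeasurable h ν :=
    (AEMeasurable.congr (AEMeasurable.tsum fun i => (hf i).aestronglyMeasurable.aemeasurable)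
      (hh.mono fun x hx => hx.tsum_eq)).aestronglyMeasurable
  have h2 : HasSum (fun i => ∫ x, f i x ∂ν) (∫ x, h x ∂ν) := by
    have h3 := hasSum_integral_of_summable_integral_norm hf hs
    rwa [integral_congr_ae (hh.mono fun x hx => hx.tsum_eq)] at h3
  refine ⟨⟨hm, ?_⟩, h2⟩
  have hle : ∫⁻ x, ‖h x‖ₑ ∂ν ≤ ∑' i, ∫⁻ x, ‖f i x‖ₑ ∂ν := by
    rw [← lintegral_tsum fun i => (hf i).aestronglyMeasurable.enorm]
    refine lintegral_mono_ae (hh.mono fun x hx => ?_)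
    rw [← hx.tsum_eq]
    exact enorm_tsum_le_tsum_enorm
  refine lt_of_le_of_lt hle ?_
  have h4 : ∀ i, ∫⁻ x, ‖f i x‖ₑ ∂ν = ENNReal.ofReal (∫ x, ‖f i x‖ ∂ν) := fun i =>
    (ofReal_integral_norm_eq_lintegral_enorm (hf i)).symm
  simp_rw [h4]
  rw [← ENNReal.ofReal_tsum_of_nonneg (fun i => integral_nonneg fun x => norm_nonneg _) hs]
  exact ENNReal.ofReal_lt_top

variable {E : Type*} [NormedAddCommGroup E] [NormedSpace ℝ E] [FiniteDimensional ℝ E]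
  [MeasurableSpace E] [BorelSpace E] {μ : Measure E} [μ.IsAddHaarMeasure]

/-- The integral over `O` of a function is the integral over `F` of the sum of its transforms, when
`O` is the disjoint union of the images of `F`. -/
theorem integral_unfold {ι : Type*} [Countable ι] {F O : Set E} (hF : MeasurableSet F)
    {a : ι → E → E} {a' : ι → E → E →L[ℝ] E} (ha : ∀ i, ∀ x ∈ F, HasFDerivAt (a i) (a' i x) x)
    (hinj : ∀ i, Set.InjOn (a i) F) (hdisj : Pairwise (Function.onFun Disjoint fun i => a i '' F))
    (hU : ⋃ i, a i '' F = O) {f h : E → ℝ} (hf : IntegrableOn f O μ)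
    (hsum : ∀ x ∈ F, HasSum (fun i => |(a' i x).det| * f (a i x)) (h x)) :
    IntegrableOn h F μ ∧ ∫ x in F, h x ∂μ = ∫ x in O, f x ∂μ := by
  have hw : ∀ i, ∀ x ∈ F, HasFDerivWithinAt (a i) (a' i x) F x := fun i x hx =>
    (ha i x hx).hasFDerivWithinAt
  have hmeas : ∀ i, MeasurableSet (a i '' F) := fun i =>
    measurable_image_of_fderivWithin hF (hw i) (hinj i)
  rw [← hU] at hf
  have h1 : ∀ i, IntegrableOn (fun x => |(a' i x).det| * f (a i x)) F μ := fun i =>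
    (integrableOn_image_iff_integrableOn_abs_det_fderiv_smul μ hF (hw i) (hinj i) f).1
      (hf.mono_set (Set.subset_iUnion (fun i => a i '' F) i))
  have h2 : ∀ i, ∫ x in F, ‖|(a' i x).det| * f (a i x)‖ ∂μ = ∫ x in a i '' F, ‖f x‖ ∂μ := by
    intro i
    rw [integral_image_eq_integral_abs_det_fderiv_smul μ hF (hw i) (hinj i)]
    simp
  -- By the change of variables these norms integrate to the integrals of `|f|` over the disjoint
  -- pieces of `O`.
  have h3 : Summable fun i => ∫ x in F, ‖|(a' i x).det| * f (a i x)‖ ∂μ := by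
    simp_rw [h2]
    exact (hasSum_integral_iUnion hmeas hdisj hf.norm).summable
  have h4 := integrable_of_hasSum (ν := μ.restrict F) h1 h3
    ((ae_restrict_iff' hF).2 (Filter.Eventually.of_forall hsum))
  refine ⟨h4.1, h4.2.unique ?_⟩
  have h5 := hasSum_integral_iUnion hmeas hdisj hf
  rw [hU] at h5
  refine h5.congr_fun ?_
  intro i
  rw [integral_image_eq_integral_abs_det_fderiv_smul μ hF (hw i) (hinj i)]
  rfl

end Unfold

/-! ### Discrete groups acting on `𝔻⁺` -/

/-- The majorant of `Q` attached to the plane of `X`. -/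
def majorant (X : HomZ p q) (v : V p q) : ℝ :=
  Q v v + 2 * ⟪gramInv X (v.2 - (X†) v.1), v.2 - (X†) v.1⟫

/-- The majorant changes the sign of `Q` on the plane, and becomes the Euclidean norm squared of
`g⁻¹ v`. It is thus positive definite and equivariant. -/
theorem majorant_projD {g : (EndV p q)ˣ} (hg : g ∈ orthGroup p q) (v : V p q) :
    majorant (projD (g : EndV p q)) v =
      ‖(((g⁻¹ : (EndV p q)ˣ) : EndV p q) v).1‖ ^ 2 +
        ‖(((g⁻¹ : (EndV p q)ˣ) : EndV p q) v).2‖ ^ 2 := by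
  have h1 : Q v v = ‖(((g⁻¹ : (EndV p q)ˣ) : EndV p q) v).1‖ ^ 2 -
      ‖(((g⁻¹ : (EndV p q)ˣ) : EndV p q) v).2‖ ^ 2 := by
    rw [← (orthGroup p q).inv_mem hg v v, Q, real_inner_self_eq_norm_sq, real_inner_self_eq_norm_sq]
  have h2 : ⟪gramInv (projD (g : EndV p q)) (v.2 - ((projD (g : EndV p q))†) v.1),
      v.2 - ((projD (g : EndV p q))†) v.1⟫ =
      ‖(((g⁻¹ : (EndV p q)ˣ) : EndV p q) v).2‖ ^ 2 := by
    rw [gramInv_eq hg, inv_apply_snd hg, ← real_inner_self_eq_norm_sq,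
      ContinuousLinearMap.adjoint_inner_right]
    rfl
  rw [majorant, h1, h2]
  ring

theorem actD_projD {g k : (EndV p q)ˣ} (hg : g ∈ orthGroup p q) (hk : k ∈ orthGroup p q) :
    actD (g : EndV p q) (projD (k : EndV p q)) = projD ((g * k : (EndV p q)ˣ) : EndV p q) :=
  (actD_mul hg hk zero_mem_Dplus).symm

theorem majorant_actD {g : (EndV p q)ˣ} (hg : g ∈ orthGroup p q) {X : HomZ p q}
    (hX : X ∈ Dplus p q) (v : V p q) :
    majorant (actD (g : EndV p q) X) ((g : EndV p q) v) = majorant X v := by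
  obtain ⟨k, hk, rfl⟩ := exists_projD_eq hX
  rw [actD_projD hg (Gplus_le hk), majorant_projD ((orthGroup p q).mul_mem hg (Gplus_le hk)),
    majorant_projD (Gplus_le hk)]
  have h : (((g * k)⁻¹ : (EndV p q)ˣ) : EndV p q) ((g : EndV p q) v) =
      ((k⁻¹ : (EndV p q)ˣ) : EndV p q) v := by
    rw [mul_inv_rev]
    change ((k⁻¹ : (EndV p q)ˣ) : EndV p q) (((g⁻¹ : (EndV p q)ˣ) : EndV p q) ((g : EndV p q) v)) = _
    rw [inv_apply_apply]
  rw [h]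

theorem majorant_pos {X : HomZ p q} (hX : X ∈ Dplus p q) {v : V p q} (hv : v ≠ 0) :
    0 < majorant X v := by
  obtain ⟨k, hk, rfl⟩ := exists_projD_eq hX
  rw [majorant_projD (Gplus_le hk)]
  by_contra h
  have h1 := sq_nonneg ‖(((k⁻¹ : (EndV p q)ˣ) : EndV p q) v).1‖
  have h2 := sq_nonneg ‖(((k⁻¹ : (EndV p q)ˣ) : EndV p q) v).2‖
  have h3 : ((k⁻¹ : (EndV p q)ˣ) : EndV p q) v = 0 := by
    refine Prod.ext ?_ ?_
    · exact norm_eq_zero.1 (pow_eq_zero_iff two_ne_zero |>.1 (by linarith))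
    · exact norm_eq_zero.1 (pow_eq_zero_iff two_ne_zero |>.1 (by linarith))
  apply hv
  rw [← apply_inv_apply k v, h3, map_zero]

theorem majorant_smul (X : HomZ p q) (c : ℝ) (v : V p q) :
    majorant X (c • v) = c ^ 2 * majorant X v := by
  have h : (c • v).2 - (X†) (c • v).1 = c • (v.2 - (X†) v.1) := by simp [smul_sub]
  rw [majorant, majorant, h]
  simp only [Q, map_smul, real_inner_smul_left, real_inner_smul_right, Prod.smul_fst,
    Prod.smul_snd]
  ring

theorem continuousOn_majorant :
    ContinuousOn (fun x : HomZ p q × V p q => majorant x.1 x.2) (Dplus p q ×ˢ Set.univ) := by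
  have h1 : Continuous fun x : HomZ p q × V p q => x.2.2 - adjL x.1 x.2.1 :=
    continuous_snd.snd.sub
      (((adjL (p := p) (q := q)).continuous.comp continuous_fst).clm_apply continuous_snd.fst)
  have h2 : ContinuousOn (fun x : HomZ p q × V p q => gramInv x.1) (Dplus p q ×ˢ Set.univ) :=
    ContinuousOn.comp (g := gramInv) (t := Dplus p q)
      (fun X hX => ((contDiffAt_gramInv hX 1).continuousAt).continuousWithinAt)
      continuous_fst.continuousOn fun x hx => hx.1
  have h3 : Continuous fun x : HomZ p q × V p q => Q x.2 x.2 :=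
    (continuous_snd.fst.inner continuous_snd.fst).sub (continuous_snd.snd.inner continuous_snd.snd)
  exact h3.continuousOn.add
    (continuousOn_const.mul ((h2.clm_apply h1.continuousOn).inner h1.continuousOn))

theorem closedBall_subset_Dplus {r : ℝ} (hr : r < 1) :
    Metric.closedBall (0 : HomZ p q) r ⊆ Dplus p q := by
  rw [Dplus_eq_ball]
  exact Metric.closedBall_subset_ball hr

/-- By homogeneity it is enough to take `v` on the unit sphere, where the majorant is continuous and
positive on a compact set of pairs `(X, v)`. -/
theorem exists_majorant_le {r : ℝ} (hr : r < 1) :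
    ∃ C : ℝ, 0 ≤ C ∧ ∀ X : HomZ p q, ‖X‖ ≤ r → ∀ v : V p q,
      majorant X v ≤ C * ‖v‖ ^ 2 ∧ ‖v‖ ^ 2 ≤ C * majorant X v := by
  set K : Set (HomZ p q × V p q) := Metric.closedBall 0 r ×ˢ Metric.sphere 0 1 with hK
  have hKc : IsCompact K := (isCompact_closedBall _ _).prod (isCompact_sphere _ _)
  have hKs : K ⊆ Dplus p q ×ˢ Set.univ :=
    Set.prod_mono (closedBall_subset_Dplus hr) (Set.subset_univ _)
  have hpos : ∀ x ∈ K, 0 < majorant x.1 x.2 := fun x hx =>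
    majorant_pos (closedBall_subset_Dplus hr hx.1) fun h => by
      have h1 : ‖x.2‖ = 1 := by simpa using hx.2
      rw [h, norm_zero] at h1
      exact zero_ne_one h1
  have hc := continuousOn_majorant.mono hKs
  obtain ⟨C₁, h₁⟩ := hKc.exists_bound_of_continuousOn hc
  obtain ⟨C₂, h₂⟩ := hKc.exists_bound_of_continuousOn (hc.inv₀ fun x hx => (hpos x hx).ne')
  refine ⟨max (max C₁ C₂) 0, le_max_right _ _, fun X hX v => ?_⟩
  by_cases hv : v = 0
  · have h0 : majorant X (0 : V p q) = 0 := by simpa using majorant_smul X 0 (0 : V p q)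
    rw [hv, h0]
    simp
  have hn : 0 < ‖v‖ := norm_pos_iff.2 hv
  have hx : (X, ‖v‖⁻¹ • v) ∈ K := by
    refine ⟨by simpa using hX, ?_⟩
    simp [norm_smul, hn.ne']
  have hm : majorant X v = ‖v‖ ^ 2 * majorant X (‖v‖⁻¹ • v) := by
    rw [← majorant_smul, smul_smul, mul_inv_cancel₀ hn.ne', one_smul]
  have hp := hpos _ hx
  have e1 := (le_abs_self _).trans (h₁ _ hx)
  have e2 := (le_abs_self _).trans (h₂ _ hx)
  rw [hm]
  constructor
  · rw [mul_comm]
    exact mul_le_mul_of_nonneg_right (e1.trans ((le_max_left _ _).trans (le_max_left _ _)))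
      (sq_nonneg _)
  · have e3 : (majorant X (‖v‖⁻¹ • v))⁻¹ ≤ max (max C₁ C₂) 0 :=
      e2.trans ((le_max_right _ _).trans (le_max_left _ _))
    have e4 : 1 ≤ max (max C₁ C₂) 0 * majorant X (‖v‖⁻¹ • v) := by
      have := mul_le_mul_of_nonneg_right e3 hp.le
      rwa [inv_mul_cancel₀ hp.ne'] at this
    nlinarith [sq_nonneg ‖v‖]

/-- The norm of `g v` is compared with the majorant at `g X`, which equals the majorant of `v` at
`X`, and this with the norm of `v`. -/
theorem exists_norm_apply_le {r : ℝ} (hr : r < 1) :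
    ∃ M : ℝ, ∀ g ∈ orthGroup p q, ∀ X : HomZ p q, ‖X‖ ≤ r → ‖actD (g : EndV p q) X‖ ≤ r →
      ∀ v : V p q, ‖(g : EndV p q) v‖ ≤ M * ‖v‖ := by
  obtain ⟨C, hC, h⟩ := exists_majorant_le (p := p) (q := q) hr
  refine ⟨C, fun g hg X hX hgX v => ?_⟩
  have hXD : X ∈ Dplus p q := closedBall_subset_Dplus hr (by simpa using hX)
  have h1 := (h _ hgX ((g : EndV p q) v)).2
  rw [majorant_actD hg hXD] at h1
  have h2 := (h X hX v).1
  have h3 : ‖(g : EndV p q) v‖ ^ 2 ≤ (C * ‖v‖) ^ 2 := by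
    rw [mul_pow]
    nlinarith
  exact abs_le_of_sq_le_sq' h3 (by positivity) |>.2

/-- A group acting properly discontinuously and freely on `𝔻⁺`. -/
structure IsProperFree (Γ : Subgroup (EndV p q)ˣ) : Prop where
  le : Γ ≤ Gplus p q
  finite : ∀ r : ℝ, r < 1 → {γ : (EndV p q)ˣ | γ ∈ Γ ∧
    ∃ X : HomZ p q, ‖X‖ ≤ r ∧ ‖actD (γ : EndV p q) X‖ ≤ r}.Finite
  free : ∀ γ ∈ Γ, ∀ X ∈ Dplus p q, actD (γ : EndV p q) X = X → γ = 1

/-- Such a `γ` sends each vector of a `ℤ`-basis of `L` to a point of `L` of bounded norm, of which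
there are finitely many. The basis also spans `V` over `ℝ`, so its images determine `γ`. -/
theorem finite_of_lattice (L : Submodule ℤ (V p q)) [DiscreteTopology L] [IsZLattice ℝ L]
    {Γ : Subgroup (EndV p q)ˣ} (hG : Γ ≤ Gplus p q)
    (hL : ∀ γ ∈ Γ, ∀ x ∈ L, (γ : EndV p q) x ∈ L) {r : ℝ} (hr : r < 1) :
    {γ : (EndV p q)ˣ | γ ∈ Γ ∧
      ∃ X : HomZ p q, ‖X‖ ≤ r ∧ ‖actD (γ : EndV p q) X‖ ≤ r}.Finite := by
  obtain ⟨M, hM⟩ := exists_norm_apply_le (p := p) (q := q) hr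
  have : Module.Finite ℤ L := ZLattice.module_finite ℝ L
  have : Module.Free ℤ L := ZLattice.module_free ℝ L
  let e := (Module.Free.chooseBasis ℤ L).ofZLatticeBasis ℝ L
  have he : ∀ i, e i ∈ L := fun i => by
    rw [Basis.ofZLatticeBasis_apply]
    exact (Module.Free.chooseBasis ℤ L i).2
  have hfin : ∀ R : ℝ, (Metric.closedBall (0 : V p q) R ∩ (L : Set (V p q))).Finite := by
    intro R
    have : DiscreteTopology (L.toAddSubgroup) := inferInstanceAs (DiscreteTopology L)
    exact Metric.finite_isBounded_inter_isClosed DiscreteTopology.isDiscrete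
      Metric.isBounded_closedBall
      (AddSubgroup.isClosed_of_discrete (H := L.toAddSubgroup))
  set S : Set (Module.Free.ChooseBasisIndex ℤ L → V p q) :=
    Set.univ.pi fun i => Metric.closedBall 0 (M * ‖e i‖) ∩ (L : Set (V p q)) with hS
  have hSf : S.Finite := Set.Finite.pi fun i => hfin _
  refine Set.Finite.of_finite_image (f := fun (γ : (EndV p q)ˣ) i => (γ : EndV p q) (e i))
    (hSf.subset ?_) ?_
  · rintro _ ⟨γ, ⟨hγ, X, hX, hγX⟩, rfl⟩ i _
    refine ⟨?_, hL γ hγ _ (he i)⟩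
    simpa using hM γ (Gplus_le (hG hγ)) X hX hγX (e i)
  · intro γ _ γ' _ h
    refine Units.ext (ContinuousLinearMap.coe_injective (e.ext fun i => congrFun h i))

theorem isProperFree_of_lattice (L : Submodule ℤ (V p q)) [DiscreteTopology L] [IsZLattice ℝ L]
    {Γ : Subgroup (EndV p q)ˣ} (hG : Γ ≤ Gplus p q)
    (hL : ∀ γ ∈ Γ, ∀ x ∈ L, (γ : EndV p q) x ∈ L)
    (htf : ∀ γ ∈ Γ, ∀ n : ℕ, 0 < n → γ ^ n = 1 → γ = 1) : IsProperFree Γ where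
  le := hG
  finite := fun r hr => finite_of_lattice L hG hL hr
  free := by
    intro γ hγ X hX hfix
    have hXn : ‖X‖ < 1 := (mem_Dplus_iff_norm X).1 hX
    -- The powers of an element fixing `X` all fix `X`, so they form a finite set. The element has
    -- finite order, and is trivial because `Γ` is torsion-free.
    have hpow : ∀ n : ℕ, actD ((γ ^ n : (EndV p q)ˣ) : EndV p q) X = X := by
      intro n
      induction n with
      | zero => exact actD_one X
      | succ n ih =>
        rw [pow_succ, actD_mul (Gplus_le (hG (Γ.pow_mem hγ n))) (Gplus_le (hG hγ)) hX, hfix, ih]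
    have hf : (Submonoid.powers γ : Set (EndV p q)ˣ).Finite := by
      refine (finite_of_lattice L hG hL hXn).subset ?_
      rintro _ ⟨n, rfl⟩
      exact ⟨Γ.pow_mem hγ n, X, le_rfl, (congrArg norm (hpow n)).le⟩
    obtain ⟨n, hn, h1⟩ := isOfFinOrder_iff_pow_eq_one.1 (finite_powers.1 hf)
    exact htf γ hγ n hn h1

theorem IsProperFree.mono {Γ Γ' : Subgroup (EndV p q)ˣ} (h : IsProperFree Γ) (hle : Γ' ≤ Γ) :
    IsProperFree Γ' where
  le := hle.trans h.le
  finite := fun r hr => (h.finite r hr).subset fun _ hγ => ⟨hle hγ.1, hγ.2⟩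
  free := fun γ hγ => h.free γ (hle hγ)

theorem stab_le (Γ : Subgroup (EndV p q)ˣ) (v : V p q) : stab Γ v ≤ Γ := fun _ h => h.1

section ProperFree

variable {Γ : Subgroup (EndV p q)ˣ}

theorem IsProperFree.mem_orthGroup (h : IsProperFree Γ) (γ : Γ) : (γ : (EndV p q)ˣ) ∈ orthGroup p q :=
  Gplus_le (h.le γ.2)

theorem IsProperFree.countable (h : IsProperFree Γ) : Countable Γ := by
  have h1 : (Γ : Set (EndV p q)ˣ) ⊆ ⋃ n : ℕ, {γ : (EndV p q)ˣ | γ ∈ Γ ∧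
      ∃ X : HomZ p q, ‖X‖ ≤ 1 - 1 / (n + 1 : ℝ) ∧
        ‖actD (γ : EndV p q) X‖ ≤ 1 - 1 / (n + 1 : ℝ)} := by
    intro γ hγ
    have h2 : ‖actD (γ : EndV p q) 0‖ < 1 :=
      (mem_Dplus_iff_norm _).1 (actD_mem_Dplus (h.mem_orthGroup ⟨γ, hγ⟩) zero_mem_Dplus)
    obtain ⟨n, hn⟩ := exists_nat_one_div_lt (sub_pos.2 h2)
    refine Set.mem_iUnion.2 ⟨n, hγ, 0, ?_, by linarith⟩
    rw [norm_zero, sub_nonneg, div_le_one (by positivity)]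
    linarith [(Nat.cast_nonneg n : (0 : ℝ) ≤ n)]
  refine Set.Countable.to_subtype (Set.Countable.mono h1 (Set.countable_iUnion fun n => ?_))
  exact (h.finite _ (by linarith [show (0 : ℝ) < 1 / (n + 1 : ℝ) by positivity])).countable

/-- Local finiteness of the translates of a ball. -/
theorem IsProperFree.locallyFinite (h : IsProperFree Γ) {X : HomZ p q} (hX : X ∈ Dplus p q)
    {r : ℝ} (hr : r < 1) : ∃ S : Finset Γ, ∀ᶠ Y in 𝓝 X, ∀ γ : Γ,
      ‖actD ((γ : (EndV p q)ˣ) : EndV p q) Y‖ ≤ r → γ ∈ S := by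
  have hXn : ‖X‖ < 1 := (mem_Dplus_iff_norm X).1 hX
  set R := max r ((1 + ‖X‖) / 2) with hR
  have hR1 : R < 1 := max_lt hr (by linarith)
  have hf : {γ : Γ | ∃ X : HomZ p q, ‖X‖ ≤ R ∧
      ‖actD ((γ : (EndV p q)ˣ) : EndV p q) X‖ ≤ R}.Finite := by
    refine Set.Finite.of_finite_image (f := fun γ : Γ => (γ : (EndV p q)ˣ))
      ((h.finite R hR1).subset ?_) Subtype.val_injective.injOn
    rintro _ ⟨γ, hγ, rfl⟩
    exact ⟨γ.2, hγ⟩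
  refine ⟨hf.toFinset, ?_⟩
  have hlt : ‖X‖ < R := lt_of_lt_of_le (by linarith) (le_max_right _ _)
  filter_upwards [continuous_norm.continuousAt.eventually_lt continuousAt_const hlt] with Y hY γ hγ
  rw [Set.Finite.mem_toFinset]
  exact ⟨Y, hY.le, hγ.trans (le_max_left _ _)⟩

theorem continuousAt_actD {g : (EndV p q)ˣ} (hg : g ∈ orthGroup p q) {X : HomZ p q}
    (hX : X ∈ Dplus p q) : ContinuousAt (actD (g : EndV p q)) X :=
  (contDiffAt_actD_right (isUnit_autFac hg hX) 1).continuousAt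

/-- By local finiteness only finitely many elements can bring a small ball back to itself. Each
nontrivial one moves `X`, and is excluded by separating `X` from its image. -/
theorem IsProperFree.exists_nhds (h : IsProperFree Γ) {X : HomZ p q} (hX : X ∈ Dplus p q) :
    ∃ U : Set (HomZ p q), IsOpen U ∧ X ∈ U ∧ U ⊆ Dplus p q ∧ ∀ γ : Γ, ∀ Y ∈ U,
      actD ((γ : (EndV p q)ˣ) : EndV p q) Y ∈ U → γ = 1 := by
  have hXn : ‖X‖ < 1 := (mem_Dplus_iff_norm X).1 hX
  have hr : (1 + ‖X‖) / 2 < 1 := by linarith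
  obtain ⟨S, hS⟩ := h.locallyFinite hX hr
  have h1 : ∀ γ : Γ, ∃ N ∈ 𝓝 X, ∀ Y ∈ N, actD ((γ : (EndV p q)ˣ) : EndV p q) Y ∈ N → γ = 1 := by
    intro γ
    by_cases hγ : γ = 1
    · exact ⟨Set.univ, Filter.univ_mem, fun _ _ _ => hγ⟩
    · have hne : X ≠ actD ((γ : (EndV p q)ˣ) : EndV p q) X := fun he =>
        hγ (Subtype.ext (h.free γ γ.2 X hX he.symm))
      obtain ⟨A, B, hA, hB, hXA, hXB, hAB⟩ := t2_separation hne
      refine ⟨A ∩ actD ((γ : (EndV p q)ˣ) : EndV p q) ⁻¹' B, Filter.inter_mem (hA.mem_nhds hXA)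
        ((continuousAt_actD (h.mem_orthGroup γ) hX).preimage_mem_nhds (hB.mem_nhds hXB)), ?_⟩
      intro Y hY hY'
      exact absurd hY'.1 (fun ha => Set.disjoint_left.1 hAB ha hY.2)
  choose N hN hN' using h1
  have hball : Metric.ball (0 : HomZ p q) ((1 + ‖X‖) / 2) ∈ 𝓝 X :=
    Metric.isOpen_ball.mem_nhds (by rw [mem_ball_zero_iff]; linarith)
  have hmem : (⋂ γ ∈ S, N γ) ∩ (Metric.ball 0 ((1 + ‖X‖) / 2) ∩ {Y | ∀ γ : Γ,
      ‖actD ((γ : (EndV p q)ˣ) : EndV p q) Y‖ ≤ (1 + ‖X‖) / 2 → γ ∈ S}) ∈ 𝓝 X :=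
    Filter.inter_mem ((Filter.biInter_finset_mem S).2 fun γ _ => hN γ) (Filter.inter_mem hball hS)
  obtain ⟨U, hU, hUo, hXU⟩ := mem_nhds_iff.1 hmem
  refine ⟨U, hUo, hXU, fun Y hY => ?_, fun γ Y hY hY' => ?_⟩
  · exact closedBall_subset_Dplus hr (Metric.ball_subset_closedBall (hU hY).2.1)
  · have hle : ‖actD ((γ : (EndV p q)ˣ) : EndV p q) Y‖ ≤ (1 + ‖X‖) / 2 :=
      (mem_ball_zero_iff.1 (hU hY').2.1).le
    have hγS : γ ∈ S := (hU hY).2.2 γ hle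
    exact hN' γ Y (Set.mem_iInter₂.1 (hU hY).1 γ hγS) (Set.mem_iInter₂.1 (hU hY').1 γ hγS)

/-- Countably many neighbourhoods that embed in the quotient cover `𝔻⁺`. From each one the points
whose orbit meets an earlier one are removed. -/
theorem IsProperFree.exists_isFundamentalSet (h : IsProperFree Γ) :
    ∃ F, IsFundamentalSet Γ (Dplus p q) F := by
  have := h.countable
  choose! U hUo hXU hUD hU using fun (X : HomZ p q) (hX : X ∈ Dplus p q) => h.exists_nhds hX
  obtain ⟨t, htD, htc, hcov⟩ := TopologicalSpace.countable_cover_nhdsWithin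
    (s := Dplus p q) (f := U) fun X hX => mem_nhdsWithin_of_mem_nhds ((hUo X hX).mem_nhds (hXU X hX))
  have htne : t.Nonempty := by
    by_contra hne
    rw [Set.not_nonempty_iff_eq_empty] at hne
    have := hcov (zero_mem_Dplus (p := p) (q := q))
    simp [hne] at this
  obtain ⟨x, rfl⟩ := htc.exists_eq_range htne
  have hxD : ∀ n, x n ∈ Dplus p q := fun n => htD ⟨n, rfl⟩
  set A : ℕ → Set (HomZ p q) := fun n => ⋃ γ : Γ,
    (Dplus p q ∩ actD ((γ : (EndV p q)ˣ) : EndV p q) ⁻¹' U (x n)) with hA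
  have hAo : ∀ n, IsOpen (A n) := fun n => isOpen_iUnion fun γ =>
    ContinuousOn.isOpen_inter_preimage
      (contDiffOn_actD (h.mem_orthGroup γ) 1).continuousOn isOpen_Dplus (hUo _ (hxD n))
  have hAinv : ∀ n (γ : Γ) X, X ∈ A n → actD ((γ : (EndV p q)ˣ) : EndV p q) X ∈ A n := by
    intro n γ X hX
    obtain ⟨δ, hXD, hδ⟩ := Set.mem_iUnion.1 hX
    refine Set.mem_iUnion.2 ⟨δ * γ⁻¹, actD_mem_Dplus (h.mem_orthGroup γ) hXD, ?_⟩
    change actD (((δ : (EndV p q)ˣ) * ((γ⁻¹ : Γ) : (EndV p q)ˣ) : (EndV p q)ˣ) : EndV p q) _ ∈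
      U (x n)
    rw [actD_mul (h.mem_orthGroup δ) (h.mem_orthGroup γ⁻¹)
      (actD_mem_Dplus (h.mem_orthGroup γ) hXD)]
    have he : actD (((γ⁻¹ : Γ) : (EndV p q)ˣ) : EndV p q)
        (actD ((γ : (EndV p q)ˣ) : EndV p q) X) = X := actD_inv_actD (h.mem_orthGroup γ) hXD
    rw [he]
    exact hδ
  have hAinv' : ∀ n (γ : Γ) X, X ∈ Dplus p q →
      actD ((γ : (EndV p q)ˣ) : EndV p q) X ∈ A n → X ∈ A n := by
    intro n γ X hXD hX
    have h1 := hAinv n γ⁻¹ _ hX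
    have he : actD (((γ⁻¹ : Γ) : (EndV p q)ˣ) : EndV p q)
        (actD ((γ : (EndV p q)ˣ) : EndV p q) X) = X := actD_inv_actD (h.mem_orthGroup γ) hXD
    rwa [he] at h1
  refine ⟨⋃ n, U (x n) \ ⋃ m < n, A m, ?_, ?_, ?_⟩
  · exact MeasurableSet.iUnion fun n => (hUo _ (hxD n)).measurableSet.diff
      (MeasurableSet.iUnion fun m => MeasurableSet.iUnion fun _ => (hAo m).measurableSet)
  · exact Set.iUnion_subset fun n X hX => hUD _ (hxD n) hX.1
  · intro X hXD
    have hex : ∃ n, X ∈ A n := by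
      obtain ⟨y, ⟨n, rfl⟩, hn⟩ := Set.mem_iUnion₂.1 (hcov hXD)
      refine ⟨n, Set.mem_iUnion.2 ⟨1, hXD, ?_⟩⟩
      change actD (1 : EndV p q) X ∈ U (x n)
      rwa [actD_one]
    classical
    -- The least index whose saturation contains `X`: every point of the orbit that lies in the
    -- fundamental set lies in this neighbourhood.
    set n := Nat.find hex with hn
    have hnA : X ∈ A n := Nat.find_spec hex
    have hlt : ∀ m < n, X ∉ A m := fun m hm => Nat.find_min hex hm
    have key : ∀ (γ : Γ), actD ((γ : (EndV p q)ˣ) : EndV p q) X ∈ ⋃ n, U (x n) \ ⋃ m < n, A m →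
        actD ((γ : (EndV p q)ˣ) : EndV p q) X ∈ U (x n) := by
      intro γ hγ
      obtain ⟨m, hm, hm'⟩ := Set.mem_iUnion.1 hγ
      have hXm : X ∈ A m := Set.mem_iUnion.2 ⟨γ, hXD, hm⟩
      have hmn : ¬ m < n := fun hlt' => hlt m hlt' hXm
      have hnm : ¬ n < m := fun hlt' => hm' (Set.mem_iUnion₂.2 ⟨n, hlt', hAinv n γ X hnA⟩)
      have : m = n := by omega
      rwa [← this]
    obtain ⟨γ, -, hγ⟩ := Set.mem_iUnion.1 hnA
    refine ⟨actD ((γ : (EndV p q)ˣ) : EndV p q) X, ⟨Set.mem_iUnion.2 ⟨n, hγ, ?_⟩, γ, γ.2, rfl⟩, ?_⟩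
    · intro hmem
      obtain ⟨m, hm, hm'⟩ := Set.mem_iUnion₂.1 hmem
      exact hlt m hm (hAinv' m γ X hXD hm')
    · rintro _ ⟨hY, δ, hδ, rfl⟩
      have h1 := key ⟨δ, hδ⟩ hY
      have h2 : actD (((⟨δ, hδ⟩ * γ⁻¹ : Γ) : (EndV p q)ˣ) : EndV p q)
          (actD ((γ : (EndV p q)ˣ) : EndV p q) X) = actD (δ : EndV p q) X := by
        change actD ((δ * ((γ⁻¹ : Γ) : (EndV p q)ˣ) : (EndV p q)ˣ) : EndV p q) _ = _
        rw [actD_mul (h.mem_orthGroup ⟨δ, hδ⟩) (h.mem_orthGroup γ⁻¹)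
          (actD_mem_Dplus (h.mem_orthGroup γ) hXD)]
        congr 1
        exact actD_inv_actD (h.mem_orthGroup γ) hXD
      have h3 := hU _ (hxD n) (⟨δ, hδ⟩ * γ⁻¹) _ hγ (by rw [h2]; exact h1)
      have h4 : (⟨δ, hδ⟩ : Γ) = γ := mul_inv_eq_one.1 h3
      rw [← h4]

end ProperFree

/-! ### The action preserves the orientation of `𝔻⁺` -/

/-- Joint smoothness gives continuity of the partial derivative in the parameter, which
`pos_of_mem_Gplus` requires of the Jacobian. -/
theorem continuousAt_fderiv_right {A B F : Type*} [NormedAddCommGroup A] [NormedSpace ℝ A]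
    [NormedAddCommGroup B] [NormedSpace ℝ B] [NormedAddCommGroup F] [NormedSpace ℝ F]
    {G : A → B → F} {a : A} {b : B} (h : ContDiffAt ℝ 2 (fun x : A × B => G x.1 x.2) (a, b)) :
    ContinuousAt (fun a => fderiv ℝ (G a) b) a := by
  have h1 : ContinuousAt (fun x : A × B => fderiv ℝ (fun x : A × B => G x.1 x.2) x) (a, b) :=
    (h.fderiv_right (m := 1) (by norm_num)).continuousAt
  have hin : ContinuousAt (fun a : A => (a, b)) a := by fun_prop
  have h2 : ContinuousAt (fun a' : A => (fderiv ℝ (fun x : A × B => G x.1 x.2) (a', b)).comp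
      (ContinuousLinearMap.inr ℝ A B)) a :=
    ContinuousAt.clm_comp (ContinuousAt.comp (f := fun a : A => (a, b)) (x := a) h1 hin)
      continuousAt_const
  refine h2.congr ?_
  have h3 : ∀ᶠ x in 𝓝 (a, b), ContDiffAt ℝ 2 (fun x : A × B => G x.1 x.2) x :=
    h.eventually (by simp)
  filter_upwards [hin.eventually h3] with a' ha'
  have h4 : HasFDerivAt (fun b' : B => (a', b')) (ContinuousLinearMap.inr ℝ A B) b :=
    (hasFDerivAt_const a' b).prodMk (hasFDerivAt_id b)
  have h5 : HasFDerivAt (fun b' => G a' b') _ b :=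
    HasFDerivAt.comp (g := fun x : A × B => G x.1 x.2) b
      (ha'.differentiableAt two_ne_zero).hasFDerivAt h4
  exact h5.fderiv.symm

theorem hasFDerivAt_actD {g : (EndV p q)ˣ} (hg : g ∈ orthGroup p q) {X : HomZ p q}
    (hX : X ∈ Dplus p q) :
    HasFDerivAt (actD (g : EndV p q)) (fderiv ℝ (actD (g : EndV p q)) X) X :=
  ((contDiffAt_actD_right (isUnit_autFac hg hX) 1).differentiableAt one_ne_zero).hasFDerivAt

theorem det_fderiv_actD_ne_zero {g : (EndV p q)ˣ} (hg : g ∈ orthGroup p q) {X : HomZ p q}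
    (hX : X ∈ Dplus p q) : (fderiv ℝ (actD (g : EndV p q)) X).det ≠ 0 := by
  have h1 := hasFDerivAt_actD hg hX
  have h2 := hasFDerivAt_actD ((orthGroup p q).inv_mem hg) (actD_mem_Dplus hg hX)
  have h3 := h2.comp X h1
  have h4 : actD ((g⁻¹ : (EndV p q)ˣ) : EndV p q) ∘ actD (g : EndV p q) =ᶠ[𝓝 X] id := by
    filter_upwards [isOpen_Dplus.mem_nhds hX] with Y hY using actD_inv_actD hg hY
  have h5 := (h3.congr_of_eventuallyEq h4.symm).unique (hasFDerivAt_id X)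
  intro h0
  have h6 : LinearMap.det ((fderiv ℝ (actD ((g⁻¹ : (EndV p q)ˣ) : EndV p q))
      (actD (g : EndV p q) X)).toLinearMap.comp (fderiv ℝ (actD (g : EndV p q)) X).toLinearMap) =
      1 := by
    have h7 := congrArg (fun f : HomZ p q →L[ℝ] HomZ p q => LinearMap.det f.toLinearMap) h5
    exact h7.trans LinearMap.det_id
  rw [LinearMap.det_comp] at h6
  have h8 : LinearMap.det (fderiv ℝ (actD (g : EndV p q)) X).toLinearMap = 0 := h0
  rw [h8, mul_zero] at h6
  exact zero_ne_one h6

/-- The Jacobian is continuous in `g`, does not vanish on the orthogonal group, and is `1` at the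
identity. -/
theorem det_fderiv_actD_pos {g : (EndV p q)ˣ} (hg : g ∈ Gplus p q) {X : HomZ p q}
    (hX : X ∈ Dplus p q) : 0 < (fderiv ℝ (actD (g : EndV p q)) X).det := by
  refine pos_of_mem_Gplus (f := fun g => (fderiv ℝ (actD (g : EndV p q)) X).det) ?_
    (fun g hg => det_fderiv_actD_ne_zero hg hX) ?_ hg
  · intro g hg
    refine ContinuousAt.continuousWithinAt ?_
    have h1 : ContinuousAt (fun g : EndV p q => fderiv ℝ (actD g) X) (g : EndV p q) :=
      continuousAt_fderiv_right (G := fun (g : EndV p q) (X : HomZ p q) => actD g X)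
        (contDiffAt_actD (isUnit_autFac hg hX) 2)
    have h2 : ContinuousAt (fun g : (EndV p q)ˣ => fderiv ℝ (actD (g : EndV p q)) X) g :=
      ContinuousAt.comp (g := fun g : EndV p q => fderiv ℝ (actD g) X)
        (f := fun g : (EndV p q)ˣ => (g : EndV p q)) h1 Units.continuous_val.continuousAt
    exact ContinuousAt.comp (g := fun f : HomZ p q →L[ℝ] HomZ p q => f.det)
      continuous_clm_det.continuousAt h2
  · have h1 : actD ((1 : (EndV p q)ˣ) : EndV p q) = (id : HomZ p q → HomZ p q) :=
      funext actD_one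
    have h2 : (ContinuousLinearMap.id ℝ (HomZ p q)).det = 1 := LinearMap.det_id
    rw [h1, fderiv_id, h2]
    exact one_pos

/-! ### Fundamental sets -/

section Fundamental

variable {Γ : Subgroup (EndV p q)ˣ}

theorem IsProperFree.injOn (h : IsProperFree Γ) (γ : Γ) :
    Set.InjOn (actD ((γ : (EndV p q)ˣ) : EndV p q)) (Dplus p q) := by
  intro X hX Y hY hXY
  rw [← actD_inv_actD (h.mem_orthGroup γ) hX, hXY, actD_inv_actD (h.mem_orthGroup γ) hY]

theorem IsFundamentalSet.iUnion_image {S F : Set (HomZ p q)} (hF : IsFundamentalSet Γ S F)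
    (h : IsProperFree Γ) (hS : S ⊆ Dplus p q)
    (hinv : ∀ γ ∈ Γ, ∀ X ∈ S, actD (γ : EndV p q) X ∈ S) :
    ⋃ γ : Γ, actD ((γ : (EndV p q)ˣ) : EndV p q) '' F = S := by
  refine Set.Subset.antisymm (Set.iUnion_subset fun γ => ?_) fun X hX => ?_
  · rintro _ ⟨X, hX, rfl⟩
    exact hinv γ γ.2 X (hF.subset hX)
  · obtain ⟨Y, ⟨hY, γ, hγ, hXY⟩, -⟩ := hF.unique X hX
    refine Set.mem_iUnion.2 ⟨⟨γ, hγ⟩⁻¹, Y, hY, ?_⟩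
    rw [← hXY]
    exact actD_inv_actD (h.mem_orthGroup ⟨γ, hγ⟩) (hS hX)

theorem IsFundamentalSet.eq_of_actD_eq {S F : Set (HomZ p q)} (hF : IsFundamentalSet Γ S F)
    (h : IsProperFree Γ) (hS : S ⊆ Dplus p q) {X Y : HomZ p q} (hX : X ∈ F) (hY : Y ∈ F)
    {γ δ : Γ} (he : actD ((γ : (EndV p q)ˣ) : EndV p q) X =
      actD ((δ : (EndV p q)ˣ) : EndV p q) Y) : γ = δ := by
  have hXD := hS (hF.subset hX)
  have hYD := hS (hF.subset hY)
  have h1 : actD (((δ⁻¹ * γ : Γ) : (EndV p q)ˣ) : EndV p q) X = Y := by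
    change actD ((((δ⁻¹ : Γ) : (EndV p q)ˣ) * (γ : (EndV p q)ˣ) : (EndV p q)ˣ) : EndV p q) X = Y
    rw [actD_mul (h.mem_orthGroup δ⁻¹) (h.mem_orthGroup γ) hXD, he]
    exact actD_inv_actD (h.mem_orthGroup δ) hYD
  obtain ⟨Z, -, hZ⟩ := hF.unique X (hF.subset hX)
  have h2 : Y = X := (hZ Y ⟨hY, _, (δ⁻¹ * γ).2, h1⟩).trans
    (hZ X ⟨hX, 1, Γ.one_mem, actD_one X⟩).symm
  have h3 := h.free _ (δ⁻¹ * γ).2 X hXD (h1.trans h2)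
  exact (inv_mul_eq_one.1 (Subtype.ext h3 : δ⁻¹ * γ = 1)).symm

theorem IsFundamentalSet.disjoint {S F : Set (HomZ p q)} (hF : IsFundamentalSet Γ S F)
    (h : IsProperFree Γ) (hS : S ⊆ Dplus p q) : Pairwise (Function.onFun Disjoint fun γ : Γ =>
      actD ((γ : (EndV p q)ˣ) : EndV p q) '' F) := by
  intro γ δ hne
  refine Set.disjoint_left.2 ?_
  rintro _ ⟨X, hX, rfl⟩ ⟨Y, hY, he⟩
  exact hne (hF.eq_of_actD_eq h hS hX hY he.symm)

theorem IsFundamentalSet.inter {S F S' : Set (HomZ p q)} (hF : IsFundamentalSet Γ S F)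
    (hS' : MeasurableSet S') (hsub : S' ⊆ S)
    (hinv : ∀ γ ∈ Γ, ∀ X ∈ S', actD (γ : EndV p q) X ∈ S') :
    IsFundamentalSet Γ S' (F ∩ S') where
  measurable := hF.measurable.inter hS'
  subset := Set.inter_subset_right
  unique := by
    intro X hX
    obtain ⟨Y, ⟨hY, γ, hγ, hXY⟩, hu⟩ := hF.unique X (hsub hX)
    refine ⟨Y, ⟨⟨hY, ?_⟩, γ, hγ, hXY⟩, fun Z hZ => hu Z ⟨hZ.1.1, hZ.2⟩⟩
    rw [← hXY]
    exact hinv γ hγ X hX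

theorem IsFundamentalSet.integral_unfold {F : Set (HomZ p q)}
    (hF : IsFundamentalSet Γ (Dplus p q) F) (h : IsProperFree Γ) {μ : Measure (HomZ p q)}
    [μ.IsAddHaarMeasure] {f k : HomZ p q → ℝ} (hf : IntegrableOn f (Dplus p q) μ)
    (hsum : ∀ X ∈ F, HasSum (fun γ : Γ => (fderiv ℝ (actD ((γ : (EndV p q)ˣ) : EndV p q)) X).det *
      f (actD ((γ : (EndV p q)ˣ) : EndV p q) X)) (k X)) :
    IntegrableOn k F μ ∧ ∫ X in F, k X ∂μ = ∫ X in Dplus p q, f X ∂μ := by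
  have := h.countable
  refine MQ.integral_unfold hF.measurable (a := fun γ : Γ => actD ((γ : (EndV p q)ˣ) : EndV p q))
    (a' := fun γ : Γ => fderiv ℝ (actD ((γ : (EndV p q)ˣ) : EndV p q)))
    (fun γ X hX => hasFDerivAt_actD (h.mem_orthGroup γ) (hF.subset hX))
    (fun γ => (h.injOn γ).mono hF.subset) (hF.disjoint h subset_rfl)
    (hF.iUnion_image h subset_rfl fun γ hγ X hX => actD_mem_Dplus (h.mem_orthGroup ⟨γ, hγ⟩) hX)
    hf fun X hX => ?_
  refine (hsum X hX).congr_fun fun γ => ?_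
  rw [abs_of_pos (det_fderiv_actD_pos (h.le γ.2) (hF.subset hX))]

/-! ### Cutoff functions -/

/-- The function equals `s⁻¹` for `s ≥ 1` and vanishes for `s ≤ 1/2`. It inverts an orbit sum where
this sum is at least `1`, and avoids division where it vanishes. -/
theorem contDiff_smoothTransition_div :
    ContDiff ℝ 1 fun s : ℝ => Real.smoothTransition (2 * s - 1) * s⁻¹ := by
  rw [contDiff_iff_contDiffAt]
  intro s
  by_cases hs : s < 1 / 2
  · refine contDiffAt_const (c := (0 : ℝ)) |>.congr_of_eventuallyEq ?_
    filter_upwards [Iio_mem_nhds hs] with x hx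
    rw [Real.smoothTransition.zero_of_nonpos (by linarith [Set.mem_Iio.1 hx]), zero_mul]
  · have h0 : s ≠ 0 := fun h => hs (by rw [h]; norm_num)
    have h1 : ContDiff ℝ 1 fun s : ℝ => Real.smoothTransition (2 * s - 1) :=
      Real.smoothTransition.contDiff.comp ((contDiff_const.mul contDiff_id).sub contDiff_const)
    exact h1.contDiffAt.mul (contDiffAt_id.inv h0)

/-- A bump `ρ` equal to `1` on the ball of radius `r` has an invariant orbit sum `P`, locally finite
and at least `1` on orbits that meet the ball. There the translates of `ρ / P` add up to `1`, and
`θ` is a smooth substitute for `1 / P` everywhere. -/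
theorem IsProperFree.exists_cutoff (h : IsProperFree Γ) {r : ℝ} (hr : r < 1) :
    ∃ χ : HomZ p q → ℝ, ContDiff ℝ 1 χ ∧ HasCompactSupport χ ∧ tsupport χ ⊆ Dplus p q ∧
      (∀ X ∈ Dplus p q, ∃ S : Finset Γ, ∀ᶠ Y in 𝓝 X, ∀ γ : Γ, γ ∉ S →
        χ (actD ((γ : (EndV p q)ˣ) : EndV p q) Y) = 0) ∧
      ∀ X ∈ Dplus p q, (∃ γ ∈ Γ, ‖actD (γ : EndV p q) X‖ ≤ r) →
        HasSum (fun γ : Γ => χ (actD ((γ : (EndV p q)ˣ) : EndV p q) X)) 1 := by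
  obtain ⟨r₁, h01, hr₁, hr₁'⟩ : ∃ r₁ : ℝ, 0 < r₁ ∧ r ≤ r₁ ∧ r₁ < 1 :=
    ⟨max r (1 / 2), lt_max_of_lt_right (by norm_num), le_max_left _ _, max_lt hr (by norm_num)⟩
  let ρ : ContDiffBump (0 : HomZ p q) := ⟨r₁, (1 + r₁) / 2, h01, by linarith⟩
  have hR : (1 + r₁) / 2 < 1 := by linarith
  have hρ : ContDiff ℝ 1 ρ := ρ.contDiff
  have hρ0 : ∀ X, ρ X ≠ 0 → ‖X‖ ≤ (1 + r₁) / 2 := by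
    intro X hX
    have h1 : X ∈ Function.support ρ := hX
    rw [ρ.support_eq] at h1
    exact (mem_ball_zero_iff.1 h1).le
  have hlf : ∀ X ∈ Dplus p q, ∃ S : Finset Γ, ∀ᶠ Y in 𝓝 X, ∀ γ : Γ, γ ∉ S →
      ρ (actD ((γ : (EndV p q)ˣ) : EndV p q) Y) = 0 := by
    intro X hX
    obtain ⟨S, hS⟩ := h.locallyFinite hX hR
    refine ⟨S, hS.mono fun Y hY γ hγ => ?_⟩
    by_contra hne
    exact hγ (hY γ (hρ0 _ hne))
  set P : HomZ p q → ℝ := fun X => ∑' γ : Γ, ρ (actD ((γ : (EndV p q)ˣ) : EndV p q) X) with hP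
  have hPsum : ∀ X ∈ Dplus p q,
      Summable fun γ : Γ => ρ (actD ((γ : (EndV p q)ˣ) : EndV p q) X) := by
    intro X hX
    obtain ⟨S, hS⟩ := hlf X hX
    exact summable_of_ne_finset_zero (s := S) hS.self_of_nhds
  have hPsm : ∀ X ∈ Dplus p q, ContDiffAt ℝ 1 P X := by
    intro X hX
    obtain ⟨S, hS⟩ := hlf X hX
    have h1 : P =ᶠ[𝓝 X] fun Y => ∑ γ ∈ S, ρ (actD ((γ : (EndV p q)ˣ) : EndV p q) Y) := by
      filter_upwards [hS] with Y hY
      exact tsum_eq_sum hY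
    refine (ContDiffAt.sum fun γ _ => ?_).congr_of_eventuallyEq h1
    exact ContDiffAt.comp (g := ρ) X hρ.contDiffAt
      (contDiffAt_actD_right (isUnit_autFac (h.mem_orthGroup γ) hX) 1)
  have hPinv : ∀ X ∈ Dplus p q, ∀ γ : Γ, P (actD ((γ : (EndV p q)ˣ) : EndV p q) X) = P X := by
    intro X hX γ
    rw [hP]
    simp only
    rw [← (Equiv.mulRight γ).tsum_eq fun δ : Γ => ρ (actD ((δ : (EndV p q)ˣ) : EndV p q) X)]
    refine tsum_congr fun δ => ?_
    rw [← actD_mul (h.mem_orthGroup δ) (h.mem_orthGroup γ) hX]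
    rfl
  set θ : ℝ → ℝ := fun s => Real.smoothTransition (2 * s - 1) * s⁻¹ with hθ
  set χ : HomZ p q → ℝ := fun X => ρ X * θ (P X) with hχ
  have hχ0 : ∀ X, ρ X = 0 → χ X = 0 := fun X hX => by rw [hχ]; simp only [hX, zero_mul]
  have hsub : tsupport χ ⊆ Metric.closedBall 0 ((1 + r₁) / 2) := by
    refine closure_minimal (fun X hX => ?_) Metric.isClosed_closedBall
    rw [mem_closedBall_zero_iff]
    exact hρ0 X fun h0 => hX (hχ0 X h0)
  have hsubD : tsupport χ ⊆ Dplus p q := hsub.trans (closedBall_subset_Dplus hR)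
  refine ⟨χ, ?_, ?_, hsubD, ?_, ?_⟩
  · rw [contDiff_iff_contDiffAt]
    intro X
    by_cases hX : X ∈ Dplus p q
    · exact hρ.contDiffAt.mul (contDiff_smoothTransition_div.contDiffAt.comp X (hPsm X hX))
    · have hX' : X ∉ tsupport χ := fun hm => hX (hsubD hm)
      exact contDiffAt_const (c := (0 : ℝ)) |>.congr_of_eventuallyEq
        (notMem_tsupport_iff_eventuallyEq.1 hX')
  · exact HasCompactSupport.of_support_subset_isCompact (isCompact_closedBall _ _)
      (subset_closure.trans hsub)
  · intro X hX
    obtain ⟨S, hS⟩ := hlf X hX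
    exact ⟨S, hS.mono fun Y hY γ hγ => hχ0 _ (hY γ hγ)⟩
  · rintro X hX ⟨γ, hγ, hle⟩
    have h1 : 1 ≤ P X := by
      have h2 : ρ (actD (γ : EndV p q) X) = 1 :=
        ρ.one_of_mem_closedBall (mem_closedBall_zero_iff.2 (hle.trans hr₁))
      have h3 := (hPsum X hX).le_tsum ⟨γ, hγ⟩ fun δ _ => ρ.nonneg
      exact h2 ▸ h3
    have h4 : P X * θ (P X) = 1 := by
      rw [hθ]
      simp only
      rw [Real.smoothTransition.one_of_one_le (by linarith), one_mul,
        mul_inv_cancel₀ (by linarith)]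
    have h5 := (hPsum X hX).hasSum.mul_right (θ (P X))
    have h6 : (∑' γ : Γ, ρ (actD ((γ : (EndV p q)ˣ) : EndV p q) X)) * θ (P X) = 1 := h4
    rw [h6] at h5
    refine h5.congr_fun fun δ => ?_
    rw [hχ]
    simp only
    rw [hPinv X hX δ]

end Fundamental

/-! ### Forms of top degree -/

section Top

variable {E : Type*} [NormedAddCommGroup E] [NormedSpace ℝ E]

theorem alternating_map_basis {ι : Type*} [Fintype ι] [DecidableEq ι] (b : Basis ι ℝ E)
    (α : E [⋀^ι]→ₗ[ℝ] ℝ) (A : E →ₗ[ℝ] E) : α (fun i => A (b i)) = LinearMap.det A * α b := by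
  have h := congrArg (fun β : E [⋀^ι]→ₗ[ℝ] ℝ => β (A ∘ b)) (α.eq_smul_basis_det b)
  refine h.trans ?_
  change α b * b.det (A ∘ b) = _
  rw [Basis.det_comp, Basis.det_self, mul_one, mul_comm]

theorem triple_comp {T : Type*} [NormedAddCommGroup T] [NormedSpace ℝ T] {q k : ℕ}
    (l : T →ₗ[ℝ] ℝ) (φ : T [⋀^Fin q]→ₗ[ℝ] ℝ) (η : T [⋀^Fin k]→ₗ[ℝ] ℝ) (A : T →ₗ[ℝ] T)
    (e : Unit ⊕ (Fin q ⊕ Fin k) → T) :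
    triple l φ η (fun i => A (e i)) =
      triple (l ∘ₗ A) (φ.compLinearMap A) (η.compLinearMap A) e := by
  rw [triple_apply, triple_apply]
  rfl

theorem frame_eq {ι : Type*} (b : Basis ι ℝ E) :
    frame b = ((Basis.singleton Unit ℝ).prod b : Basis (Unit ⊕ ι) ℝ (ℝ × E)) := by
  funext i
  rw [Basis.prod_apply]
  rcases i with i | i
  · simp [frame]
  · simp [frame]

theorem triple_frame {q k : ℕ} (b : Basis (Fin q ⊕ Fin k) ℝ E)
    (l : ℝ × E →ₗ[ℝ] ℝ) (φ : (ℝ × E) [⋀^Fin q]→ₗ[ℝ] ℝ) (η : (ℝ × E) [⋀^Fin k]→ₗ[ℝ] ℝ)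
    (A : E →ₗ[ℝ] E) : LinearMap.det A * triple l φ η (frame b) =
      triple (l ∘ₗ LinearMap.id.prodMap A) (φ.compLinearMap (LinearMap.id.prodMap A))
        (η.compLinearMap (LinearMap.id.prodMap A)) (frame b) := by
  have : Module.Finite ℝ E := b.finiteDimensional_of_finite
  rw [← triple_comp, frame_eq, alternating_map_basis, LinearMap.det_prodMap, LinearMap.det_id,
    one_mul]

theorem triple_sum {T ι : Type*} [NormedAddCommGroup T] [NormedSpace ℝ T] {q k : ℕ}
    (S : Finset ι) (l : ι → T →ₗ[ℝ] ℝ) (φ : T [⋀^Fin q]→ₗ[ℝ] ℝ) (η : T [⋀^Fin k]→ₗ[ℝ] ℝ)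
    (e : Unit ⊕ (Fin q ⊕ Fin k) → T) :
    ∑ i ∈ S, triple (l i) φ η e = triple (∑ i ∈ S, l i) φ η e := by
  simp only [triple_apply]
  rw [Finset.sum_comm]
  refine Finset.sum_congr rfl fun τ _ => ?_
  rw [LinearMap.sum_apply, Finset.sum_mul, Finset.mul_sum]

theorem triple_zero_left {T : Type*} [NormedAddCommGroup T] [NormedSpace ℝ T] {q k : ℕ}
    (φ : T [⋀^Fin q]→ₗ[ℝ] ℝ) (η : T [⋀^Fin k]→ₗ[ℝ] ℝ) (e : Unit ⊕ (Fin q ⊕ Fin k) → T) :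
    triple (0 : T →ₗ[ℝ] ℝ) φ η e = 0 := by
  rw [triple_apply]
  simp

theorem triple_zero_right {T : Type*} [NormedAddCommGroup T] [NormedSpace ℝ T] {q k : ℕ}
    (l : T →ₗ[ℝ] ℝ) (φ : T [⋀^Fin q]→ₗ[ℝ] ℝ) (e : Unit ⊕ (Fin q ⊕ Fin k) → T) :
    triple l φ (0 : T [⋀^Fin k]→ₗ[ℝ] ℝ) e = 0 := by
  rw [triple_apply]
  simp

end Top

theorem wedge_comp {k : ℕ} (φ : HomZ p q [⋀^Fin q]→L[ℝ] ℝ) (η : HomZ p q [⋀^Fin k]→L[ℝ] ℝ)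
    (A : HomZ p q →L[ℝ] HomZ p q) (e : Fin q ⊕ Fin k → HomZ p q) :
    wedge φ η (fun i => A (e i)) =
      wedge (φ.compContinuousLinearMap A) (η.compContinuousLinearMap A) e := by
  have hne : ((q.factorial * k.factorial : ℕ) : ℝ) ≠ 0 :=
    Nat.cast_ne_zero.2 (Nat.mul_ne_zero (Nat.factorial_ne_zero _) (Nat.factorial_ne_zero _))
  refine mul_left_cancel₀ hne ?_
  rw [wedge, wedge, ← sum_perm_eq_domCoprod, ← sum_perm_eq_domCoprod]
  rfl

/-! ### Invariance under the stabiliser -/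

theorem secF_smul (c : ℝ) (v : V p q) (X : HomZ p q) : secF (c • v) X = c • secF v X := by
  have h : (c • v).2 - (X†) (c • v).1 = c • (v.2 - (X†) v.1) := by simp [smul_sub]
  rw [secF, h, map_smul, secF]

theorem secF_actD {g : (EndV p q)ˣ} (hg : g ∈ Gplus p q) {X : HomZ p q} (hX : X ∈ Dplus p q)
    {v : V p q} (hv : (g : EndV p q) v = v) :
    secF v (actD (g : EndV p q) X) = autFac (g : EndV p q) X (secF v X) := by
  have hv' : ((g⁻¹ : (EndV p q)ˣ) : EndV p q) v = v := by
    conv_lhs => rw [← hv]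
    exact inv_apply_apply g v
  have h := sec_actD hg hX v
  rw [hv', sec_eq (actD_mem_Dplus (Gplus_le hg) hX), sec_eq hX] at h
  exact congrArg Prod.snd h

theorem phiT_actD {g : (EndV p q)ˣ} (hg : g ∈ Gplus p q) {X : HomZ p q} (hX : X ∈ Dplus p q)
    {v : V p q} (hv : (g : EndV p q) v = v) (t : ℝ) :
    (phiT v (t, actD (g : EndV p q) X)).compContinuousLinearMap
      ((ContinuousLinearMap.id ℝ ℝ).prodMap (fderiv ℝ (actD (g : EndV p q)) X)) =
        phiT v (t, X) := by
  have hgX := actD_mem_Dplus (Gplus_le hg) hX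
  have hvt : ∀ t : ℝ, (g : EndV p q) (t • v) = t • v := fun t => by rw [map_smul, hv]
  have he : ∀ y : ℝ × HomZ p q, y.2 ∈ Dplus p q →
      secT v (y.1, actD (g : EndV p q) y.2) = actE (g : EndV p q) (secT v y) := fun y hy =>
    Prod.ext rfl (secF_actD hg hy (hvt y.1))
  have hm1 : ((t, actD (g : EndV p q) X) : ℝ × HomZ p q).2 ∈ Dplus p q := hgX
  have hm2 : ((t, X) : ℝ × HomZ p q).2 ∈ Dplus p q := hX
  have hm3 : (secT v (t, X)).1 ∈ Dplus p q := hX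
  have h1 : HasFDerivAt (secT v) _ (t, actD (g : EndV p q) X) :=
    ((contDiffAt_secT v hm1 1).differentiableAt one_ne_zero).hasFDerivAt
  have h2 : HasFDerivAt (fun y : ℝ × HomZ p q => (y.1, actD (g : EndV p q) y.2))
      ((ContinuousLinearMap.id ℝ ℝ).prodMap (fderiv ℝ (actD (g : EndV p q)) X)) (t, X) :=
    HasFDerivAt.prodMap (t, X) (hasFDerivAt_id t) (hasFDerivAt_actD (Gplus_le hg) hX)
  have h3 : HasFDerivAt (fun y : ℝ × HomZ p q => secT v (y.1, actD (g : EndV p q) y.2)) _ (t, X) :=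
    HasFDerivAt.comp (g := secT v) (t, X) h1 h2
  have h4 : HasFDerivAt (secT v) _ (t, X) :=
    ((contDiffAt_secT v hm2 1).differentiableAt one_ne_zero).hasFDerivAt
  have h5 := (differentiableAt_actE (Gplus_le hg) hm3).hasFDerivAt
  have h6 : HasFDerivAt (fun y : ℝ × HomZ p q => actE (g : EndV p q) (secT v y)) _ (t, X) :=
    HasFDerivAt.comp (g := actE (g : EndV p q)) (t, X) h5 h4
  have h7 : (fun y : ℝ × HomZ p q => secT v (y.1, actD (g : EndV p q) y.2)) =ᶠ[𝓝 (t, X)]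
      fun y => actE (g : EndV p q) (secT v y) := by
    filter_upwards [(isOpen_Dplus.preimage continuous_snd).mem_nhds hm2] with y hy using he y hy
  have h8 := h3.unique (h6.congr_of_eventuallyEq h7)
  ext x
  have h9 := congrArg (fun A : (HomZ p q × Neg q) [⋀^Fin q]→L[ℝ] ℝ =>
    A fun i => fderiv ℝ (secT v) (t, X) (x i)) (Uex_actE hg hm3)
  refine Eq.trans ?_ h9
  rw [← he (t, X) hX]
  change Uex _ (fun i => ((fderiv ℝ (secT v) (t, actD (g : EndV p q) X)).comp
    ((ContinuousLinearMap.id ℝ ℝ).prodMap (fderiv ℝ (actD (g : EndV p q)) X))) (x i)) = _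
  rw [h8]
  rfl

/-! ### Unfolding the integral, and its independence of the length of `v` -/

open Equiv in
theorem wedge_apply {k : ℕ} (φ : HomZ p q [⋀^Fin q]→L[ℝ] ℝ) (η : HomZ p q [⋀^Fin k]→L[ℝ] ℝ)
    (e : Fin q ⊕ Fin k → HomZ p q) :
    wedge φ η e = ((q.factorial * k.factorial : ℕ) : ℝ)⁻¹ *
      ∑ σ : Perm (Fin q ⊕ Fin k), ((Perm.sign σ : ℤ) : ℝ) *
        (φ (fun i => e (σ (Sum.inl i))) * η (fun i => e (σ (Sum.inr i)))) := by
  have hne : ((q.factorial * k.factorial : ℕ) : ℝ) ≠ 0 :=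
    Nat.cast_ne_zero.2 (Nat.mul_ne_zero (Nat.factorial_ne_zero _) (Nat.factorial_ne_zero _))
  have h := sum_perm_eq_domCoprod φ.toAlternatingMap η.toAlternatingMap e
  rw [eq_inv_mul_iff_mul_eq₀ hne]
  exact h.symm

theorem wedge_zero_right {k : ℕ} (φ : HomZ p q [⋀^Fin q]→L[ℝ] ℝ) (e : Fin q ⊕ Fin k → HomZ p q) :
    wedge φ (0 : HomZ p q [⋀^Fin k]→L[ℝ] ℝ) e = 0 := by
  rw [wedge_apply]
  simp

theorem contDiffOn_wedge {E : Type*} [NormedAddCommGroup E] [NormedSpace ℝ E] {k : ℕ}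
    {φ : E → HomZ p q [⋀^Fin q]→L[ℝ] ℝ} {η : E → HomZ p q [⋀^Fin k]→L[ℝ] ℝ}
    {s : Set E} {m : WithTop ℕ∞} (hφ : ContDiffOn ℝ m φ s) (hη : ContDiffOn ℝ m η s)
    (e : Fin q ⊕ Fin k → HomZ p q) : ContDiffOn ℝ m (fun X => wedge (φ X) (η X) e) s := by
  simp only [wedge_apply]
  refine contDiffOn_const.mul (ContDiffOn.sum fun σ _ => contDiffOn_const.mul ?_)
  exact (contDiffOn_form_apply (x := fun _ i => e (σ (Sum.inl i))) hφ
      fun i => contDiffOn_const).mul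
    (contDiffOn_form_apply (x := fun _ i => e (σ (Sum.inr i))) hη fun i => contDiffOn_const)

/-- A compact subset of the open unit ball lies in a strictly smaller ball. -/
theorem HasCompactSupportMod.exists_radius {Γ : Subgroup (EndV p q)ˣ} {k : ℕ}
    {η : HomZ p q → HomZ p q [⋀^Fin k]→L[ℝ] ℝ} (h : HasCompactSupportMod Γ η) :
    ∃ r : ℝ, r < 1 ∧ ∀ X ∈ Dplus p q, η X ≠ 0 → ∃ γ ∈ Γ, ‖actD (γ : EndV p q) X‖ ≤ r := by
  obtain ⟨C, hC, hCD, h0⟩ := h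
  have hr : ∃ r : ℝ, r < 1 ∧ ∀ X ∈ C, ‖X‖ ≤ r := by
    rcases C.eq_empty_or_nonempty with hE | hne
    · exact ⟨0, one_pos, by simp [hE]⟩
    · obtain ⟨X, hX, hm⟩ := hC.exists_isMaxOn hne continuous_norm.continuousOn
      exact ⟨‖X‖, (mem_Dplus_iff_norm X).1 (hCD hX), fun Y hY => hm hY⟩
  obtain ⟨r, hr1, hr⟩ := hr
  refine ⟨r, hr1, fun X hX hne => ?_⟩
  by_contra hno
  push Not at hno
  exact hne (h0 X hX fun γ hγ hmem => absurd (hr _ hmem) (not_le.2 (hno γ hγ)))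

section Transgression

variable {Γ : Subgroup (EndV p q)ˣ} {k : ℕ} {η : HomZ p q → HomZ p q [⋀^Fin k]→L[ℝ] ℝ}
  {χ : HomZ p q → ℝ}

theorem det_mul_wedge (b : Basis (Fin q ⊕ Fin k) ℝ (HomZ p q))
    (A : HomZ p q →L[ℝ] HomZ p q) (φ : HomZ p q [⋀^Fin q]→L[ℝ] ℝ)
    (η : HomZ p q [⋀^Fin k]→L[ℝ] ℝ) : A.det * wedge φ η b =
      wedge (φ.compContinuousLinearMap A) (η.compContinuousLinearMap A) b := by
  rw [← wedge_comp]
  exact (alternating_map_basis b (wedge φ η) A.toLinearMap).symm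

theorem integrable_cutoff_mul (hχ : ContDiff ℝ 1 χ) (hc : HasCompactSupport χ)
    (hs : tsupport χ ⊆ Dplus p q) {f : HomZ p q → ℝ} (hf : ContinuousOn f (Dplus p q))
    {μ : Measure (HomZ p q)} [μ.IsAddHaarMeasure] : Integrable (fun X => χ X * f X) μ :=
  integrable_of_continuousOn_compact hc (hχ.continuous.continuousOn.mul (hf.mono hs))
    fun X hX => by rw [image_eq_zero_of_notMem_tsupport hX, zero_mul]

/-- The form `φ ∧ η` is invariant and the translates of `χ` add up to `1` wherever `η ≠ 0`, so the
sum over `Γ` of the translates of `χ φ ∧ η` is `φ ∧ η`. -/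
theorem integral_wedge_unfold (h : IsProperFree Γ)
    {φ : HomZ p q → HomZ p q [⋀^Fin q]→L[ℝ] ℝ} (hφ : IsClosedForm Γ φ) (hη : IsClosedForm Γ η)
    (hχ : ContDiff ℝ 1 χ) (hc : HasCompactSupport χ) (hs : tsupport χ ⊆ Dplus p q)
    (hsum : ∀ X ∈ Dplus p q, η X ≠ 0 →
      HasSum (fun γ : Γ => χ (actD ((γ : (EndV p q)ˣ) : EndV p q) X)) 1)
    (b : Basis (Fin q ⊕ Fin k) ℝ (HomZ p q)) {F : Set (HomZ p q)}
    (hF : IsFundamentalSet Γ (Dplus p q) F) {μ : Measure (HomZ p q)} [μ.IsAddHaarMeasure] :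
    IntegrableOn (fun X => wedge (φ X) (η X) b) F μ ∧
      ∫ X in F, wedge (φ X) (η X) b ∂μ = ∫ X, χ X * wedge (φ X) (η X) b ∂μ := by
  have hcont : ContinuousOn (fun X => wedge (φ X) (η X) b) (Dplus p q) :=
    (contDiffOn_wedge hφ.smooth hη.smooth b).continuousOn
  have hint := integrable_cutoff_mul (μ := μ) hχ hc hs hcont
  have h0 : ∀ X ∉ Dplus p q, χ X * wedge (φ X) (η X) b = 0 := fun X hX => by
    rw [image_eq_zero_of_notMem_tsupport fun hm => hX (hs hm), zero_mul]
  rw [← setIntegral_eq_integral_of_forall_compl_eq_zero h0]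
  refine hF.integral_unfold h hint.integrableOn fun X hX => ?_
  have hXD := hF.subset hX
  have h1 : ∀ γ : Γ, (fderiv ℝ (actD ((γ : (EndV p q)ˣ) : EndV p q)) X).det *
      (χ (actD ((γ : (EndV p q)ˣ) : EndV p q) X) *
        wedge (φ (actD ((γ : (EndV p q)ˣ) : EndV p q) X))
          (η (actD ((γ : (EndV p q)ˣ) : EndV p q) X)) b) =
      χ (actD ((γ : (EndV p q)ˣ) : EndV p q) X) * wedge (φ X) (η X) b := by
    intro γ
    rw [mul_left_comm, det_mul_wedge]
    have e1 := hφ.invariant γ γ.2 X hXD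
    have e2 := hη.invariant γ γ.2 X hXD
    rw [pullD] at e1 e2
    rw [e1, e2]
  simp_rw [h1]
  by_cases hne : η X = 0
  · rw [hne]
    simp only [wedge_zero_right, mul_zero]
    exact hasSum_zero
  · simpa using (hsum X hXD hne).mul_right (wedge (φ X) (η X) b)

/-- Where `η ≠ 0`, an open condition, the translates of `χ` form a locally finite sum that is
constantly `1`, so their differentials add up to `0`. -/
theorem hasSum_fderiv_cutoff (h : IsProperFree Γ) (hη : IsClosedForm Γ η) (hχ : ContDiff ℝ 1 χ)
    (hlf : ∀ X ∈ Dplus p q, ∃ S : Finset Γ, ∀ᶠ Y in 𝓝 X, ∀ γ : Γ, γ ∉ S →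
        χ (actD ((γ : (EndV p q)ˣ) : EndV p q) Y) = 0)
    (hsum : ∀ X ∈ Dplus p q, η X ≠ 0 →
      HasSum (fun γ : Γ => χ (actD ((γ : (EndV p q)ˣ) : EndV p q) X)) 1)
    {X : HomZ p q} (hX : X ∈ Dplus p q) (hne : η X ≠ 0) : ∃ S : Finset Γ,
      (∀ γ : Γ, γ ∉ S → (fderiv ℝ χ (actD ((γ : (EndV p q)ˣ) : EndV p q) X)).comp
        (fderiv ℝ (actD ((γ : (EndV p q)ˣ) : EndV p q)) X) = 0) ∧
      ∑ γ ∈ S, (fderiv ℝ χ (actD ((γ : (EndV p q)ˣ) : EndV p q) X)).comp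
        (fderiv ℝ (actD ((γ : (EndV p q)ˣ) : EndV p q)) X) = 0 := by
  obtain ⟨S, hS⟩ := hlf X hX
  have hd : ∀ γ : Γ, HasFDerivAt (fun Y => χ (actD ((γ : (EndV p q)ˣ) : EndV p q) Y))
      ((fderiv ℝ χ (actD ((γ : (EndV p q)ˣ) : EndV p q) X)).comp
        (fderiv ℝ (actD ((γ : (EndV p q)ˣ) : EndV p q)) X)) X := fun γ =>
    HasFDerivAt.comp (g := χ) X ((hχ.differentiable one_ne_zero _).hasFDerivAt)
      (hasFDerivAt_actD (h.mem_orthGroup γ) hX)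
  refine ⟨S, fun γ hγ => ?_, ?_⟩
  · have h1 : (fun Y => χ (actD ((γ : (EndV p q)ˣ) : EndV p q) Y)) =ᶠ[𝓝 X] fun _ => 0 := by
      filter_upwards [hS] with Y hY using hY γ hγ
    exact (hd γ).unique ((hasFDerivAt_const (0 : ℝ) X).congr_of_eventuallyEq h1)
  · have h1 : (fun Y => ∑ γ ∈ S, χ (actD ((γ : (EndV p q)ˣ) : EndV p q) Y)) =ᶠ[𝓝 X]
        fun _ => 1 := by
      have hopen : ∀ᶠ Y in 𝓝 X, η Y ≠ 0 :=
        (hη.smooth.continuousOn.continuousAt (isOpen_Dplus.mem_nhds hX)).eventually_ne hne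
      filter_upwards [hS, hopen, isOpen_Dplus.mem_nhds hX] with Y hY hY' hYD
      rw [← (hsum Y hYD hY').tsum_eq]
      exact (tsum_eq_sum hY).symm
    exact (HasFDerivAt.fun_sum fun γ _ => hd γ).unique
      ((hasFDerivAt_const (1 : ℝ) X).congr_of_eventuallyEq h1)

/-- After unfolding, the integrand is a sum over `Γ` of pullbacks of `dχ`, multiplied by invariant
forms. This sum vanishes where `η ≠ 0` by `hasSum_fderiv_cutoff`, and trivially elsewhere. -/
theorem integral_triple_eq_zero (h : IsProperFree Γ) {v : V p q}
    (hv : ∀ γ ∈ Γ, (γ : EndV p q) v = v) (hη : IsClosedForm Γ η)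
    (hχ : ContDiff ℝ 1 χ) (hc : HasCompactSupport χ) (hs : tsupport χ ⊆ Dplus p q)
    (hlf : ∀ X ∈ Dplus p q, ∃ S : Finset Γ, ∀ᶠ Y in 𝓝 X, ∀ γ : Γ, γ ∉ S →
        χ (actD ((γ : (EndV p q)ˣ) : EndV p q) Y) = 0)
    (hsum : ∀ X ∈ Dplus p q, η X ≠ 0 →
      HasSum (fun γ : Γ => χ (actD ((γ : (EndV p q)ˣ) : EndV p q) X)) 1)
    (b : Basis (Fin q ⊕ Fin k) ℝ (HomZ p q)) {μ : Measure (HomZ p q)} [μ.IsAddHaarMeasure]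
    (t : ℝ) :
    ∫ X, triple ((fderiv ℝ χ X).comp (ContinuousLinearMap.snd ℝ ℝ (HomZ p q))).toLinearMap
      (phiT v (t, X)).toAlternatingMap (pullSnd η (t, X)).toAlternatingMap (frame b) ∂μ = 0 := by
  have hχ1 : ∀ x ∉ tsupport χ, fderiv ℝ χ x = 0 := fun x hx => by
    by_contra h
    exact hx (support_fderiv_subset ℝ h)
  have hz : ∀ X ∉ tsupport χ,
      triple ((fderiv ℝ χ X).comp (ContinuousLinearMap.snd ℝ ℝ (HomZ p q))).toLinearMap
      (phiT v (t, X)).toAlternatingMap (pullSnd η (t, X)).toAlternatingMap (frame b) = 0 := by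
    intro X hX
    rw [hχ1 X hX]
    exact triple_zero_left _ _ _
  have hmap : Set.MapsTo (fun X : HomZ p q => (t, X)) (Dplus p q) (Set.univ ×ˢ Dplus p q) :=
    fun X hX => ⟨Set.mem_univ _, hX⟩
  have hcp : Continuous fun X : HomZ p q => (t, X) := by fun_prop
  have hW : ContinuousOn (fun X => phiT v (t, X)) (Dplus p q) :=
    (contDiffOn_phiT v).continuousOn.comp hcp.continuousOn hmap
  have hE : ContinuousOn (fun X => pullSnd η (t, X)) (Dplus p q) :=
    (contDiffOn_pullSnd hη.smooth).continuousOn.comp hcp.continuousOn hmap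
  have hint : Integrable (fun X =>
      triple ((fderiv ℝ χ X).comp (ContinuousLinearMap.snd ℝ ℝ (HomZ p q))).toLinearMap
      (phiT v (t, X)).toAlternatingMap (pullSnd η (t, X)).toAlternatingMap (frame b)) μ := by
    refine integrable_of_continuousOn_compact hc ?_ hz
    simp only [triple_apply]
    refine continuousOn_finsetSum _ fun τ _ => continuousOn_const.mul (ContinuousOn.mul ?_ ?_)
    · exact ((hχ.continuous_fderiv one_ne_zero).clm_apply continuous_const).continuousOn
    · have e1 := contDiffOn_form_apply (m := 0)
        (x := fun _ i => frame b (τ (Sum.inr (Sum.inl i)))) (contDiffOn_zero.2 (hW.mono hs))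
        fun i => contDiffOn_const
      have e2 := contDiffOn_form_apply (m := 0)
        (x := fun _ i => frame b (τ (Sum.inr (Sum.inr i)))) (contDiffOn_zero.2 (hE.mono hs))
        fun i => contDiffOn_const
      exact e1.continuousOn.mul e2.continuousOn
  obtain ⟨F, hF⟩ := h.exists_isFundamentalSet
  rw [← setIntegral_eq_integral_of_forall_compl_eq_zero
    (s := Dplus p q) fun X hX => hz X fun hm => hX (hs hm)]
  refine Eq.trans (hF.integral_unfold (k := fun _ => 0) h hint.integrableOn fun X hX => ?_).2.symm
    (by simp)
  have hXD := hF.subset hX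
  have hterm : ∀ γ : Γ, (fderiv ℝ (actD ((γ : (EndV p q)ˣ) : EndV p q)) X).det *
      triple ((fderiv ℝ χ (actD ((γ : (EndV p q)ˣ) : EndV p q) X)).comp
        (ContinuousLinearMap.snd ℝ ℝ (HomZ p q))).toLinearMap
      (phiT v (t, actD ((γ : (EndV p q)ˣ) : EndV p q) X)).toAlternatingMap
      (pullSnd η (t, actD ((γ : (EndV p q)ˣ) : EndV p q) X)).toAlternatingMap (frame b) =
      triple (((fderiv ℝ χ (actD ((γ : (EndV p q)ˣ) : EndV p q) X)).comp
        (fderiv ℝ (actD ((γ : (EndV p q)ˣ) : EndV p q)) X)).toLinearMap ∘ₗ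
          LinearMap.snd ℝ ℝ (HomZ p q))
      (phiT v (t, X)).toAlternatingMap (pullSnd η (t, X)).toAlternatingMap (frame b) := by
    intro γ
    have e1 := phiT_actD (h.le γ.2) hXD (hv γ γ.2) t
    have e2 := hη.invariant γ γ.2 X hXD
    rw [pullD] at e2
    have e3 : (pullSnd η (t, actD ((γ : (EndV p q)ˣ) : EndV p q) X)).compContinuousLinearMap
        ((ContinuousLinearMap.id ℝ ℝ).prodMap
          (fderiv ℝ (actD ((γ : (EndV p q)ˣ) : EndV p q)) X)) = pullSnd η (t, X) := by
      rw [pullSnd, pullSnd, ← e2]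
      rfl
    rw [← e1, ← e3]
    exact triple_frame b _ _ _ _
  simp_rw [hterm]
  by_cases hne : η X = 0
  · have h0 : pullSnd η (t, X) = 0 := by
      rw [pullSnd, hne]
      rfl
    rw [h0]
    have h1 : ((0 : (ℝ × HomZ p q) [⋀^Fin k]→L[ℝ] ℝ)).toAlternatingMap = 0 := rfl
    rw [h1]
    simp only [triple_zero_right]
    exact hasSum_zero
  · obtain ⟨S, hS0, hS1⟩ := hasSum_fderiv_cutoff h hη hχ hlf hsum hXD hne
    have h2 : HasSum _ _ := hasSum_sum_of_ne_finset_zero (s := S) (f := fun γ : Γ =>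
      triple (((fderiv ℝ χ (actD ((γ : (EndV p q)ˣ) : EndV p q) X)).comp
        (fderiv ℝ (actD ((γ : (EndV p q)ˣ) : EndV p q)) X)).toLinearMap ∘ₗ
          LinearMap.snd ℝ ℝ (HomZ p q))
      (phiT v (t, X)).toAlternatingMap (pullSnd η (t, X)).toAlternatingMap (frame b))
      fun γ hγ => by
        rw [hS0 γ hγ]
        exact triple_zero_left _ _ _
    rw [triple_sum] at h2
    have h3 : ∑ γ ∈ S, ((fderiv ℝ χ (actD ((γ : (EndV p q)ˣ) : EndV p q) X)).comp
        (fderiv ℝ (actD ((γ : (EndV p q)ˣ) : EndV p q)) X)).toLinearMap ∘ₗ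
          LinearMap.snd ℝ ℝ (HomZ p q) = 0 := by
      ext x
      · simp
      · have h4 := congrArg (fun A : HomZ p q →L[ℝ] ℝ => A x) hS1
        simpa [LinearMap.sum_apply] using h4
    rw [h3, triple_zero_left] at h2
    exact h2

/-- The integral of `φ⁰(t v) ∧ η` over the quotient does not depend on `t`. -/
theorem integral_cutoff_eq (h : IsProperFree Γ) {v : V p q}
    (hv : ∀ γ ∈ Γ, (γ : EndV p q) v = v) (hη : IsClosedForm Γ η)
    (hχ : ContDiff ℝ 1 χ) (hc : HasCompactSupport χ) (hs : tsupport χ ⊆ Dplus p q)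
    (hlf : ∀ X ∈ Dplus p q, ∃ S : Finset Γ, ∀ᶠ Y in 𝓝 X, ∀ γ : Γ, γ ∉ S →
        χ (actD ((γ : (EndV p q)ˣ) : EndV p q) Y) = 0)
    (hsum : ∀ X ∈ Dplus p q, η X ≠ 0 →
      HasSum (fun γ : Γ => χ (actD ((γ : (EndV p q)ˣ) : EndV p q) X)) 1)
    (b : Basis (Fin q ⊕ Fin k) ℝ (HomZ p q)) {μ : Measure (HomZ p q)} [μ.IsAddHaarMeasure]
    (t : ℝ) :
    ∫ X, χ X * wedge (phi0 (t • v) X) (η X) b ∂μ = ∫ X, χ X * wedge (phi0 v X) (η X) b ∂μ := by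
  -- Stokes expresses the derivative in `t` by an integral that contains `dχ`, and this integral
  -- vanishes by unfolding.
  have hder : ∀ t, HasDerivAt (fun t => ∫ X, χ X * ∑ σ : Equiv.Perm (Fin q ⊕ Fin k),
      ((Equiv.Perm.sign σ : ℤ) : ℝ) * (phiT v (t, X) (fun i => (0, b (σ (Sum.inl i)))) *
        pullSnd η (t, X) (fun i => (0, b (σ (Sum.inr i))))) ∂μ) 0 t := by
    intro t
    have h1 := hasDerivAt_integral_wedge (μ := μ) isOpen_Dplus hχ hc hs
      ((contDiffOn_phiT v).of_le (by norm_cast))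
      ((contDiffOn_pullSnd hη.smooth).of_le (by norm_cast))
      (fun x hx => extDeriv_phiT v hx)
      (fun x hx => extDeriv_pullSnd ((hη.smooth.contDiffAt (isOpen_Dplus.mem_nhds hx)
        |>.differentiableAt (by simp))) (hη.closed _ hx)) b t
    rwa [integral_triple_eq_zero h hv hη hχ hc hs hlf hsum b t] at h1
  have hconst := is_const_of_deriv_eq_zero (fun t => (hder t).differentiableAt)
    (fun t => (hder t).deriv) t 1
  have hre : ∀ t : ℝ, ∫ X, χ X * ∑ σ : Equiv.Perm (Fin q ⊕ Fin k),
      ((Equiv.Perm.sign σ : ℤ) : ℝ) * (phiT v (t, X) (fun i => (0, b (σ (Sum.inl i)))) *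
        pullSnd η (t, X) (fun i => (0, b (σ (Sum.inr i))))) ∂μ =
      ((q.factorial * k.factorial : ℕ) : ℝ) *
        ∫ X, χ X * wedge (phi0 (t • v) X) (η X) b ∂μ := by
    intro t
    rw [← integral_const_mul]
    refine integral_congr_ae (Filter.Eventually.of_forall fun X => ?_)
    simp only
    by_cases hX : X ∈ tsupport χ
    · have hm : ((t, X) : ℝ × HomZ p q).2 ∈ Dplus p q := hs hX
      rw [mul_left_comm]
      congr 1
      have h2 := sum_perm_eq_domCoprod (phi0 (t • v) X).toAlternatingMap (η X).toAlternatingMap b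
      refine Eq.trans ?_ h2
      refine Finset.sum_congr rfl fun σ _ => ?_
      rw [phiT_apply v hm]
      rfl
    · rw [image_eq_zero_of_notMem_tsupport hX, zero_mul, zero_mul, mul_zero]
  have hne : ((q.factorial * k.factorial : ℕ) : ℝ) ≠ 0 :=
    Nat.cast_ne_zero.2 (Nat.mul_ne_zero (Nat.factorial_ne_zero _) (Nat.factorial_ne_zero _))
  simp only [hre] at hconst
  simpa using mul_left_cancel₀ hne hconst

end Transgression

/-! ### Linear changes of variables and Gaussian integrals -/

section Measure

theorem Basis_addHaar_eq_smul {ι E : Type*} [Fintype ι] [DecidableEq ι] [NormedAddCommGroup E]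
    [NormedSpace ℝ E] [MeasurableSpace E] [BorelSpace E] (b c : Basis ι ℝ E) :
    b.addHaar = ENNReal.ofReal |b.det c| • c.addHaar := by
  have : FiniteDimensional ℝ E := b.finiteDimensional_of_finite
  have h := Measure.addHaarMeasure_unique b.addHaar c.parallelepiped
  rw [← Basis.addHaar_def, Basis.coe_parallelepiped, Measure.addHaar_parallelepiped] at h
  exact h

/-- The standard basis of `ℝ^q × ℝ^k`. -/
def prodBasis (q k : ℕ) : Basis (Fin q ⊕ Fin k) ℝ (Neg q × (Fin k → ℝ)) :=
  (stdBasis q).prod (Pi.basisFun ℝ (Fin k))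

theorem prodBasis_inl {q k : ℕ} (i : Fin q) : prodBasis q k (Sum.inl i) = (stdBasis q i, 0) := by
  rw [prodBasis, Basis.prod_apply]
  rfl

theorem prodBasis_inr {q k : ℕ} (j : Fin k) : prodBasis q k (Sum.inr j) = (0, Pi.single j 1) := by
  rw [prodBasis, Basis.prod_apply]
  simp

theorem addHaar_prodBasis (q k : ℕ) : (prodBasis q k).addHaar = volume := by
  have h1 : (stdBasis q).addHaar = volume :=
    (EuclideanSpace.basisFun (Fin q) ℝ).addHaar_eq_volume
  have h2 : (Pi.basisFun ℝ (Fin k)).addHaar = volume := by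
    rw [Basis.addHaar_def, Basis.parallelepiped_basisFun, addHaarMeasure_eq_volume_pi]
  rw [prodBasis, Basis.prod_addHaar, h1, h2]
  rfl

theorem integral_addHaar_eq {E : Type*} [NormedAddCommGroup E] [NormedSpace ℝ E]
    [MeasurableSpace E] [BorelSpace E] {k : ℕ} (b : Basis (Fin q ⊕ Fin k) ℝ E)
    (A : (Neg q × (Fin k → ℝ)) ≃L[ℝ] E) (x₀ : E) (f : E → ℝ) :
    ∫ x, f x ∂b.addHaar =
      |b.det fun i => A (prodBasis q k i)| * ∫ w, f (x₀ + A w) := by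
  have : FiniteDimensional ℝ E := b.finiteDimensional_of_finite
  have h1 : Measure.map A volume = ((prodBasis q k).map A.toLinearEquiv).addHaar := by
    rw [← addHaar_prodBasis]
    exact Basis.map_addHaar (prodBasis q k) A
  have h2 : b.det ((prodBasis q k).map A.toLinearEquiv) =
      b.det fun i => A (prodBasis q k i) := by
    congr 1
  rw [Basis_addHaar_eq_smul b ((prodBasis q k).map A.toLinearEquiv), ← h1, integral_smul_measure,
    h2, ENNReal.toReal_ofReal (abs_nonneg _), smul_eq_mul]
  congr 1
  have h3 : ∫ x, f x ∂(Measure.map A volume) = ∫ x, f (x₀ + x) ∂(Measure.map A volume) := by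
    rw [h1]
    exact (integral_add_left_eq_self f x₀).symm
  rw [h3]
  exact A.toHomeomorph.measurableEmbedding.integral_map _

theorem integrable_gaussian (c : ℝ) (hc : 0 < c) :
    Integrable fun y : Neg q => Real.exp (-c * ‖y‖ ^ 2) := by
  refine Integrable.of_integral_ne_zero ?_
  rw [GaussianFourier.integral_rexp_neg_mul_sq_norm hc]
  exact (Real.rpow_pos_of_pos (div_pos Real.pi_pos hc) _).ne'

/-- For `X = g z₀` one has `gramInv X = ρ ρ†`, so `y ↦ ρ(g)† y` reduces the integral to the standard
Gaussian. Its Jacobian factor `1 / det ρ(g)` is `det (gram X) ^ (1/2)`. -/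
theorem integral_gaussian_gramInv {X : HomZ p q} (hX : X ∈ Dplus p q) :
    ∫ y : Neg q, Real.exp (-(2 * Real.pi * ⟪gramInv X y, y⟫)) =
      2 ^ (-(q : ℝ) / 2) * (gram X).det ^ (1 / 2 : ℝ) := by
  obtain ⟨g, hg, rfl⟩ := exists_projD_eq hX
  have hgO := Gplus_le hg
  set A : Neg q →L[ℝ] Neg q := (rho (g : EndV p q))† with hA
  have hdA : A.det = (rho (g : EndV p q)).det := det_adjoint_clm _
  have hpos : 0 < A.det := hdA ▸ det_rho_pos hg
  have hne : LinearMap.det A.toLinearMap ≠ 0 := hpos.ne'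
  have h1 : ∀ y, ⟪gramInv (projD (g : EndV p q)) y, y⟫ = ‖A y‖ ^ 2 := by
    intro y
    rw [gramInv_eq hgO, ← real_inner_self_eq_norm_sq, hA, ContinuousLinearMap.adjoint_inner_right]
    rfl
  have hinj : Function.Injective A :=
    (LinearMap.equivOfDetNeZero A.toLinearMap hne).injective
  have hemb : MeasurableEmbedding A :=
    (A.toLinearMap.isClosedEmbedding_of_injective (LinearMap.ker_eq_bot.2 hinj)).measurableEmbedding
  have h2 : ∫ y : Neg q, Real.exp (-(2 * Real.pi * ‖A y‖ ^ 2)) =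
      ∫ w, Real.exp (-(2 * Real.pi * ‖w‖ ^ 2)) ∂(Measure.map A volume) :=
    (hemb.integral_map fun w => Real.exp (-(2 * Real.pi * ‖w‖ ^ 2))).symm
  have h3 : Measure.map A (volume : Measure (Neg q)) =
      ENNReal.ofReal |(LinearMap.det A.toLinearMap)⁻¹| • volume :=
    Measure.map_linearMap_addHaar_eq_smul_addHaar volume hne
  have h4 : ∫ w : Neg q, Real.exp (-(2 * Real.pi * ‖w‖ ^ 2)) = 2 ^ (-(q : ℝ) / 2) := by
    have h5 := GaussianFourier.integral_rexp_neg_mul_sq_norm (V := Neg q) (b := 2 * Real.pi)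
      (by positivity)
    simp only [neg_mul] at h5
    rw [h5, finrank_euclideanSpace, Fintype.card_fin]
    have h6 : Real.pi / (2 * Real.pi) = 2⁻¹ := by
      field_simp
    rw [h6, Real.inv_rpow zero_le_two, ← Real.rpow_neg zero_le_two, neg_div]
  have h7 : (gram (projD (g : EndV p q))).det ^ (1 / 2 : ℝ) =
      |(LinearMap.det A.toLinearMap)⁻¹| := by
    have h8 := det_inverse_rho_adjoint hg
    have hgp := det_gram_pos hX
    have h9 : ((Ring.inverse (rho (g : EndV p q)))†).det = (A.det)⁻¹ := by
      rw [det_adjoint_clm, hdA]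
      have h10 : Ring.inverse (rho (g : EndV p q)) * rho (g : EndV p q) = 1 :=
        Ring.inverse_mul_cancel _ (isUnit_rho hgO)
      have h11 : (Ring.inverse (rho (g : EndV p q))).det * (rho (g : EndV p q)).det = 1 := by
        have h12 := congrArg (fun f : Neg q →L[ℝ] Neg q => LinearMap.det f.toLinearMap) h10
        refine Eq.trans ?_ (h12.trans LinearMap.det_id)
        exact (LinearMap.det_comp _ _).symm
      exact eq_inv_of_mul_eq_one_left h11
    rw [h9, Real.rpow_neg hgp.le] at h8
    have h13 : |(LinearMap.det A.toLinearMap)⁻¹| = (A.det)⁻¹ := abs_of_pos (inv_pos.2 hpos)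
    rw [h13]
    have h14 : (gram (projD (g : EndV p q))).det ^ (1 / 2 : ℝ) ≠ 0 :=
      (Real.rpow_pos_of_pos hgp _).ne'
    field_simp at h8
    field_simp
    linarith
  simp_rw [h1]
  rw [h2, h3, integral_smul_measure, h4, h7, ENNReal.toReal_ofReal (abs_nonneg _), smul_eq_mul,
    mul_comm]

/-- Laplace's method, in the coordinates `x₀ + n(s y) + κ(u)`. -/
theorem tendsto_integral_laplace {E : Type*} [NormedAddCommGroup E] [NormedSpace ℝ E] {k : ℕ}
    (n : Neg q →L[ℝ] E) (κ : (Fin k → ℝ) →L[ℝ] E) (π : E →L[ℝ] (Fin k → ℝ)) (hn : ∀ y, π (n y) = 0)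
    (hκ : ∀ u, π (κ u) = u) (x₀ : E) {H : ℝ × (E × Neg q) → ℝ} (hH : Continuous H) {C R c : ℝ}
    (hc : 0 < c)
    (hC : ∀ s ∈ Set.Icc (0 : ℝ) 1, ∀ x y, |H (s, (x, y))| ≤ C * Real.exp (-c * ‖y‖ ^ 2))
    (hR : ∀ s x y, R < ‖x‖ → H (s, (x, y)) = 0) :
    Integrable (fun w : Neg q × (Fin k → ℝ) => H (0, (x₀ + κ w.2, w.1))) ∧
    Filter.Tendsto (fun s : ℝ => ∫ w : Neg q × (Fin k → ℝ), H (s, (x₀ + n (s • w.1) + κ w.2, w.1)))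
      (𝓝[>] 0) (𝓝 (∫ w : Neg q × (Fin k → ℝ), H (0, (x₀ + κ w.2, w.1)))) := by
  have hcont : Continuous fun z : ℝ × (Neg q × (Fin k → ℝ)) =>
      H (z.1, (x₀ + n (z.1 • z.2.1) + κ z.2.2, z.2.1)) := by fun_prop
  -- The bound is Gaussian in `y` and has compact support in `u`: since `π` kills the normal part
  -- and inverts `κ`, a bounded point `x` has bounded `u`.
  set bound : Neg q × (Fin k → ℝ) → ℝ := fun w => Real.exp (-c * ‖w.1‖ ^ 2) *
    (Metric.closedBall (0 : Fin k → ℝ) (‖π‖ * (R + ‖x₀‖))).indicator (fun _ => C) w.2 with hb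
  have hbi : Integrable bound := by
    refine Integrable.mul_prod (integrable_gaussian c hc) ?_
    refine (integrable_indicator_iff measurableSet_closedBall).2 ?_
    exact integrableOn_const (measure_closedBall_lt_top.ne)
  have hle : ∀ s ∈ Set.Icc (0 : ℝ) 1, ∀ w : Neg q × (Fin k → ℝ),
      ‖H (s, (x₀ + n (s • w.1) + κ w.2, w.1))‖ ≤ bound w := by
    intro s hs w
    rw [Real.norm_eq_abs, hb]
    simp only
    by_cases hw : w.2 ∈ Metric.closedBall (0 : Fin k → ℝ) (‖π‖ * (R + ‖x₀‖))
    · rw [Set.indicator_of_mem hw, mul_comm]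
      exact hC s hs _ _
    · rw [Set.indicator_of_notMem hw, mul_zero]
      rw [hR, abs_zero]
      by_contra hx
      push Not at hx
      apply hw
      rw [mem_closedBall_zero_iff]
      have h1 : w.2 = π (x₀ + n (s • w.1) + κ w.2 - x₀) := by
        rw [add_assoc, add_sub_cancel_left, map_add, hn, hκ, zero_add]
      rw [h1]
      refine (π.le_opNorm _).trans (mul_le_mul_of_nonneg_left ?_ (norm_nonneg _))
      exact (norm_sub_le _ _).trans (add_le_add_left hx _)
  have h0 : ∀ w : Neg q × (Fin k → ℝ), H (0, (x₀ + n ((0 : ℝ) • w.1) + κ w.2, w.1)) =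
      H (0, (x₀ + κ w.2, w.1)) := fun w => by rw [zero_smul, map_zero, add_zero]
  refine ⟨?_, tendsto_integral_filter_of_dominated_convergence bound ?_ ?_ hbi ?_⟩
  · refine hbi.mono' ?_ (Filter.Eventually.of_forall fun w => ?_)
    · exact (by fun_prop : Continuous fun w : Neg q × (Fin k → ℝ) =>
        H (0, (x₀ + κ w.2, w.1))).aestronglyMeasurable
    · rw [← h0]
      exact hle 0 ⟨le_rfl, zero_le_one⟩ w
  · exact Filter.Eventually.of_forall fun s => (by fun_prop : Continuous
      fun w : Neg q × (Fin k → ℝ) =>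
        H (s, (x₀ + n (s • w.1) + κ w.2, w.1))).aestronglyMeasurable
  · filter_upwards [Ioc_mem_nhdsGT (zero_lt_one (α := ℝ))] with s hs
    exact Filter.Eventually.of_forall fun w => hle s ⟨hs.1.le, hs.2⟩ w
  · refine Filter.Eventually.of_forall fun w => ?_
    rw [← h0]
    have h1 : Continuous fun s : ℝ => H (s, (x₀ + n (s • w.1) + κ w.2, w.1)) := by fun_prop
    exact (h1.tendsto 0).mono_left nhdsWithin_le_nhds

end Measure

/-! ### The form `φ⁰(t v)` for large `t` -/

theorem quadE_const (N n : ℕ) (c : ℝ) : quadE N n (fun _ => c) = c := by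
  have h0 : ∑ s, quadWeight N s = 1 := by
    have h := quadWeight_spec (N := N) (k := 0) (Nat.zero_le _)
    simp only [pow_zero, mul_one] at h
    rw [h]
    simp [imGaussMoment]
  rw [quadE, ← Finset.sum_mul]
  have h1 := Finset.prod_univ_sum (fun _ : Fin n => (Finset.univ : Finset (Fin (N + 1))))
    fun _ s => quadWeight N s
  rw [Fintype.piFinset_univ] at h1
  rw [← h1]
  simp [h0]

theorem mul_quadE (N n : ℕ) (c : ℝ) (f : (Fin n → ℝ) → ℝ) :
    c * quadE N n f = quadE N n fun t => c * f t := by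
  rw [quadE, quadE, Finset.mul_sum]
  exact Finset.sum_congr rfl fun s _ => by ring

/-- The linear form `x ↦ 2 √π x^* (v₁ - X s_v(X))`. -/
def limLin (v : V p q) (X : HomZ p q) : (HomZ p q × Neg q) →L[ℝ] Neg q :=
  (ContinuousLinearMap.apply ℝ (Neg q) ((2 * √Real.pi) • (v.1 - X (secF v X)))) ∘L
    (adjL (p := p) (q := q)) ∘L ContinuousLinearMap.fst ℝ (HomZ p q) (Neg q)

theorem limLin_apply (v : V p q) (X : HomZ p q) (x : HomZ p q × Neg q) :
    limLin v X x = (x.1†) ((2 * √Real.pi) • (v.1 - X (secF v X))) := rfl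

theorem contDiffAt_limLin {X : HomZ p q} (hX : X ∈ Dplus p q) (v : V p q) (m : WithTop ℕ∞) :
    ContDiffAt ℝ m (limLin v) X := by
  have h1 : ContDiffAt ℝ m (fun X : HomZ p q => (2 * √Real.pi) • (v.1 - X (secF v X))) X :=
    (contDiffAt_const.sub (contDiffAt_id.clm_apply (contDiffAt_secF_right hX v m))).const_smul _
  have h2 : ContDiffAt ℝ m (fun X : HomZ p q => ContinuousLinearMap.apply ℝ (Neg q)
      ((2 * √Real.pi) • (v.1 - X (secF v X)))) X :=
    (ContinuousLinearMap.apply ℝ (Neg q) (E := Pos p)).contDiff.contDiffAt.comp X h1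
  exact h2.clm_comp contDiffAt_const

theorem contDiffAt_compInl {E F G : Type*} [NormedAddCommGroup E] [NormedSpace ℝ E]
    [NormedAddCommGroup F] [NormedSpace ℝ F] [NormedAddCommGroup G] [NormedSpace ℝ G]
    {m : WithTop ℕ∞} {f : E → (F × G) [⋀^Fin q]→L[ℝ] ℝ} {a : E} (hf : ContDiffAt ℝ m f a) :
    ContDiffAt ℝ m
      (fun x => (f x).compContinuousLinearMap (ContinuousLinearMap.inl ℝ F G)) a := by
  let Λ : ((F × G) [⋀^Fin q]→L[ℝ] ℝ) →L[ℝ] (F [⋀^Fin q]→L[ℝ] ℝ) :=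
    ContinuousAlternatingMap.compContinuousLinearMapCLM (ContinuousLinearMap.inl ℝ F G)
  exact Λ.contDiff.contDiffAt.comp a hf

/-- The form `e^{2π ⟪(1 - X^*X)⁻¹ y, y⟫} s^q φ⁰(v / s)`, where `y = v₂ - X^* v₁`; it extends
smoothly to `s = 0`. -/
def limForm (v : V p q) (a : ℝ × HomZ p q) : HomZ p q [⋀^Fin q]→L[ℝ] ℝ :=
  (cst q * (gram a.2).det ^ (-(1 / 2) : ℝ)) •
    (mqForm (limLin v a.2) ((a.1 ^ 2) • bU (gramInv' a.2))).compContinuousLinearMap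
      (ContinuousLinearMap.inl ℝ (HomZ p q) (Neg q))

theorem limForm_apply (v : V p q) (a : ℝ × HomZ p q) (x : Fin q → HomZ p q) :
    limForm v a x = cst q * (gram a.2).det ^ (-(1 / 2) : ℝ) *
      mqForm (limLin v a.2) ((a.1 ^ 2) • bU (gramInv' a.2)) fun i => (x i, 0) := rfl

theorem contDiffAt_limCurv {a : ℝ × HomZ p q} (ha : a.2 ∈ Dplus p q) (m : WithTop ℕ∞) :
    ContDiffAt ℝ m (fun a : ℝ × HomZ p q => (a.1 ^ 2) • bU (q := q) (gramInv' a.2)) a := by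
  have h1 : ContDiffAt ℝ m (fun a : ℝ × HomZ p q => gramInv' a.2) a :=
    ContDiffAt.comp (g := gramInv') a (contDiffAt_gramInv' ha m) contDiffAt_snd
  have h2 : ContDiffAt ℝ m (fun a : ℝ × HomZ p q => bU (q := q) (gramInv' a.2)) a :=
    (contDiff_bU (p := p) (q := q) m).contDiffAt.comp a h1
  exact (contDiffAt_fst.pow 2).smul h2

theorem contDiffAt_limScal {a : ℝ × HomZ p q} (ha : a.2 ∈ Dplus p q) (m : WithTop ℕ∞) :
    ContDiffAt ℝ m (fun a : ℝ × HomZ p q => cst q * (gram a.2).det ^ (-(1 / 2) : ℝ)) a := by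
  have hmem : ((a.2, (0 : Neg q)) : HomZ p q × Neg q).1 ∈ Dplus p q := ha
  have h6 : ContDiffAt ℝ m (fun a : ℝ × HomZ p q => scalU (a.2, (0 : Neg q))) a :=
    ContDiffAt.comp (g := scalU (p := p) (q := q)) a
      (contDiffAt_scalU hmem m) (contDiffAt_snd.prodMk contDiffAt_const)
  have h7 : ∀ a : ℝ × HomZ p q, scalU (a.2, (0 : Neg q)) =
      cst q * (gram a.2).det ^ (-(1 / 2) : ℝ) := by
    intro a
    simp [scalU]
  simp_rw [h7] at h6
  exact h6

theorem contDiffAt_limForm {a : ℝ × HomZ p q} (ha : a.2 ∈ Dplus p q) (v : V p q)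
    (m : WithTop ℕ∞) : ContDiffAt ℝ m (limForm v) a := by
  have h4 : ContDiffAt ℝ m (fun a : ℝ × HomZ p q => limLin v a.2) a :=
    ContDiffAt.comp (g := limLin v) a (contDiffAt_limLin ha v m) contDiffAt_snd
  have h5 := contDiffAt_mqForm h4 (contDiffAt_limCurv ha m)
  have h9 := contDiffAt_compInl h5
  exact (contDiffAt_limScal ha m).smul h9

/-- The linear map `x ↦ c b₁₁(g)^* x`. -/
def blockLin (c : ℝ) (g : EndV p q) : (HomZ p q × Neg q) →L[ℝ] HomZ p q :=
  c • (ContinuousLinearMap.compL ℝ (Neg q) (Pos p) (Pos p) ((b11 g)†)) ∘L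
    ContinuousLinearMap.fst ℝ (HomZ p q) (Neg q)

theorem blockLin_apply (c : ℝ) (g : EndV p q) (z : HomZ p q × Neg q) :
    blockLin c g z = c • (((b11 g)†) ∘L z.1) := rfl

theorem adjoint_blockLin (c : ℝ) (g : EndV p q) (z : HomZ p q × Neg q) :
    (blockLin c g z)† = c • ((z.1†) ∘L b11 g) := by
  rw [blockLin_apply, LinearIsometryEquiv.map_smulₛₗ, ContinuousLinearMap.adjoint_comp,
    ContinuousLinearMap.adjoint_adjoint]
  rfl

theorem sq_smul_bU {g : (EndV p q)ˣ} (hg : g ∈ orthGroup p q) (c : ℝ) (x y : HomZ p q × Neg q) :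
    ((c ^ 2) • bU (gramInv' (projD (g : EndV p q)))) x y =
      (blockLin c (g : EndV p q) y)† ∘L blockLin c (g : EndV p q) x -
        (blockLin c (g : EndV p q) x)† ∘L blockLin c (g : EndV p q) y := by
  have hb : ((c ^ 2) • bU (gramInv' (projD (g : EndV p q)))) x y =
      (c ^ 2) • bU (gramInv' (projD (g : EndV p q))) x y := rfl
  rw [hb, adjoint_blockLin, adjoint_blockLin, blockLin_apply, blockLin_apply, bU_apply,
    gramInv'_eq hg]
  ext1 w
  simp [smul_smul, pow_two, smul_sub]

/-- A factor `t` leaves each of the `q` rows of the determinants, and the curvature is then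
multiplied by `t⁻²`. In the variable `s = t⁻¹` the remaining form is smooth up to `s = 0`. -/
theorem phi0_smul {X : HomZ p q} (hX : X ∈ Dplus p q) (v : V p q) {t : ℝ} (ht : t ≠ 0) :
    phi0 (t • v) X =
      (Real.exp (-(2 * Real.pi * ⟪gramInv X (t • (v.2 - (X†) v.1)), t • (v.2 - (X†) v.1)⟫)) *
        t ^ q) • limForm v (t⁻¹, X) := by
  obtain ⟨g, hg, rfl⟩ := exists_projD_eq hX
  ext x
  have hs : ∀ (c : ℝ) (f : HomZ p q [⋀^Fin q]→L[ℝ] ℝ), (c • f) x = c * f x := fun _ _ => rfl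
  rw [hs, phi0_apply hg, limForm_apply]
  rw [mqForm_apply_of_eq (limLin v (projD (g : EndV p q))) (sq_smul_bU (Gplus_le hg) t⁻¹)]
  have hsc : scalU (projD (g : EndV p q), secF (t • v) (projD (g : EndV p q))) =
      cst q * (gram (projD (g : EndV p q))).det ^ (-(1 / 2) : ℝ) *
        Real.exp (-(2 * Real.pi * ⟪gramInv (projD (g : EndV p q))
          (t • (v.2 - ((projD (g : EndV p q))†) v.1)),
            t • (v.2 - ((projD (g : EndV p q))†) v.1)⟫)) := by
    have h1 : secF (t • v) (projD (g : EndV p q)) = gramInv (projD (g : EndV p q))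
        (t • (v.2 - ((projD (g : EndV p q))†) v.1)) := by
      rw [secF_smul, secF, map_smul]
    rw [scalU, h1, gram_gramInv hX, real_inner_comm]
  rw [hsc]
  have hq : (quadE (q + 1) p fun τ => (Matrix.of fun i j =>
        ((x i)†) ((2 * √Real.pi) • ((t • v).1 - projD (g : EndV p q)
          (secF (t • v) (projD (g : EndV p q)))) +
          b11 (g : EndV p q) (WithLp.toLp 2 τ)) j).det) =
      t ^ q * quadE (q + 1) p fun τ => (Matrix.of fun i j =>
        (limLin v (projD (g : EndV p q)) (x i, 0) + ((blockLin t⁻¹ (g : EndV p q) (x i, 0))†) (WithLp.toLp 2 τ)) j).det := by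
    rw [mul_quadE]
    congr 1
    funext τ
    have hd := Matrix.det_smul (Matrix.of fun i j =>
        (limLin v (projD (g : EndV p q)) (x i, 0) + ((blockLin t⁻¹ (g : EndV p q) (x i, 0))†) (WithLp.toLp 2 τ)) j) t
    rw [Fintype.card_fin] at hd
    rw [← hd]
    congr 1
    ext i j
    have ha : ((blockLin t⁻¹ (g : EndV p q) (x i, (0 : Neg q)))†) (WithLp.toLp 2 τ) =
        t⁻¹ • ((x i)†) (b11 (g : EndV p q) (WithLp.toLp 2 τ)) := by
      rw [adjoint_blockLin]
      rfl
    have hv : (2 * √Real.pi) • ((t • v).1 - projD (g : EndV p q)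
        (secF (t • v) (projD (g : EndV p q)))) =
        t • (2 * √Real.pi) • (v.1 - projD (g : EndV p q) (secF v (projD (g : EndV p q)))) := by
      rw [secF_smul, map_smul, Prod.smul_fst, ← smul_sub, smul_comm]
    have hm : ((x i)†) ((2 * √Real.pi) • ((t • v).1 - projD (g : EndV p q)
          (secF (t • v) (projD (g : EndV p q)))) + b11 (g : EndV p q) (WithLp.toLp 2 τ)) =
        t • (limLin v (projD (g : EndV p q)) (x i, 0) +
          t⁻¹ • ((x i)†) (b11 (g : EndV p q) (WithLp.toLp 2 τ))) := by
      rw [hv, limLin_apply, map_add, map_smul, smul_add, smul_inv_smul₀ ht]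
    have hz : ∀ w z : Neg q, w = t • z → w j = t * z j := fun w z h => by rw [h]; rfl
    rw [← ha] at hm
    exact hz _ _ hm
  rw [hq]
  ring

/-- At `s = 0` the curvature disappears, the determinants do not depend on the quadrature variables,
and the total weight is `1`. -/
theorem limForm_zero (v : V p q) (X : HomZ p q) (x : Fin q → HomZ p q) :
    limForm v (0, X) x = cst q * (gram X).det ^ (-(1 / 2) : ℝ) * ((-1) ^ (q * (q - 1) / 2) *
      ((2 * √Real.pi) ^ q * (Matrix.of fun i j => (((x i)†) (v.1 - X (secF v X))) j).det)) := by
  have hB : ∀ x y : HomZ p q × Neg q, (((0 : ℝ) ^ 2) • bU (gramInv' X)) x y =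
      ((0 : (HomZ p q × Neg q) →L[ℝ] HomZ p q) y)† ∘L (0 : (HomZ p q × Neg q) →L[ℝ] HomZ p q) x -
      ((0 : (HomZ p q × Neg q) →L[ℝ] HomZ p q) x)† ∘L
        (0 : (HomZ p q × Neg q) →L[ℝ] HomZ p q) y := by
    intro x y
    have hb : (((0 : ℝ) ^ 2) • bU (gramInv' X)) x y = ((0 : ℝ) ^ 2) • bU (gramInv' X) x y := rfl
    have hz : ∀ z, (0 : (HomZ p q × Neg q) →L[ℝ] HomZ p q) z = 0 := fun z => rfl
    rw [hb, hz, hz, zero_pow two_ne_zero, zero_smul, ContinuousLinearMap.comp_zero, sub_zero]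
  rw [limForm_apply, mqForm_apply_of_eq (limLin v X) (R := 0) (p := p) hB]
  have h : ∀ τ : Fin p → ℝ, (Matrix.of fun i j => (limLin v X (x i, 0) +
      ((((0 : (HomZ p q × Neg q) →L[ℝ] HomZ p q) (x i, 0))†) (WithLp.toLp 2 τ))) j).det =
      (2 * √Real.pi) ^ q * (Matrix.of fun i j => (((x i)†) (v.1 - X (secF v X))) j).det := by
    intro τ
    have hd := Matrix.det_smul (Matrix.of fun i j => (((x i)†) (v.1 - X (secF v X))) j)
      (2 * √Real.pi)
    rw [Fintype.card_fin] at hd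
    rw [← hd]
    congr 1
    ext i j
    have h0 : (((0 : (HomZ p q × Neg q) →L[ℝ] HomZ p q) (x i, 0))†) (WithLp.toLp 2 τ) = 0 := by
      simp
    change (limLin v X (x i, 0) + _ : Neg q) j = _
    rw [h0, add_zero, limLin_apply, map_smul]
    rfl
  simp_rw [h]
  rw [quadE_const]

/-! ### Laplace's method -/

open Equiv in
-- A permutation mixing the two blocks puts a vector of the second block into `φ` and contributes
-- `0`; the other `q! k!` permutations contribute equally.
theorem wedge_eq_mul {k : ℕ} (φ : HomZ p q [⋀^Fin q]→L[ℝ] ℝ) (η : HomZ p q [⋀^Fin k]→L[ℝ] ℝ)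
    (e : Fin q ⊕ Fin k → HomZ p q)
    (h : ∀ x : Fin q → HomZ p q, (∃ i j, x i = e (Sum.inr j)) → φ x = 0) :
    wedge φ η e = φ (fun i => e (Sum.inl i)) * η fun j => e (Sum.inr j) := by
  have hne : ((q.factorial * k.factorial : ℕ) : ℝ) ≠ 0 :=
    Nat.cast_ne_zero.2 (Nat.mul_ne_zero (Nat.factorial_ne_zero _) (Nat.factorial_ne_zero _))
  rw [wedge_apply, inv_mul_eq_iff_eq_mul₀ hne]
  have h1 : ∑ σ : Perm (Fin q ⊕ Fin k), ((Perm.sign σ : ℤ) : ℝ) *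
        (φ (fun i => e (σ (Sum.inl i))) * η (fun i => e (σ (Sum.inr i)))) =
      ∑ τ : Perm (Fin q) × Perm (Fin k), φ (fun i => e (Sum.inl i)) * η fun j => e (Sum.inr j) := by
    symm
    refine Finset.sum_of_injOn (Perm.sumCongrHom (Fin q) (Fin k))
      Perm.sumCongrHom_injective.injOn (fun _ _ => Finset.mem_coe.2 (Finset.mem_univ _)) ?_ ?_
    · intro σ _ hσ
      have h2 : ∃ i j, σ (Sum.inl i) = Sum.inr j := by
        by_contra hno
        push Not at hno
        refine hσ ?_
        have h3 : σ ∈ (Perm.sumCongrHom (Fin q) (Fin k)).range := by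
          refine Perm.mem_sumCongrHom_range_of_perm_mapsTo_inl ?_
          rintro _ ⟨i, rfl⟩
          rcases hh : σ (Sum.inl i) with j | j
          · exact ⟨j, rfl⟩
          · exact absurd hh (hno i j)
        obtain ⟨τ, rfl⟩ := h3
        exact ⟨τ, Finset.mem_coe.2 (Finset.mem_univ _), rfl⟩
      obtain ⟨i, j, hij⟩ := h2
      rw [h _ ⟨i, j, congrArg e hij⟩, zero_mul, mul_zero]
    · rintro ⟨σ, τ⟩ _
      have h3 : φ (fun i => e (Sum.inl (σ i))) = ((Perm.sign σ : ℤ) : ℝ) *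
          φ (fun i => e (Sum.inl i)) := by
        have := φ.toAlternatingMap.map_perm (fun i => e (Sum.inl i)) σ
        rw [Units.smul_def, zsmul_eq_mul] at this
        exact this
      have h4 : η (fun i => e (Sum.inr (τ i))) = ((Perm.sign τ : ℤ) : ℝ) *
          η (fun i => e (Sum.inr i)) := by
        have := η.toAlternatingMap.map_perm (fun i => e (Sum.inr i)) τ
        rw [Units.smul_def, zsmul_eq_mul] at this
        exact this
      have hsq : ∀ u : ℤˣ, ((u : ℤ) : ℝ) * ((u : ℤ) : ℝ) = 1 := by
        intro u
        rcases Int.units_eq_one_or u with rfl | rfl <;> simp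
      have h5 : Perm.sign (Perm.sumCongrHom (Fin q) (Fin k) (σ, τ)) =
          Perm.sign σ * Perm.sign τ := Perm.sign_sumCongr σ τ
      change _ = _ * (φ (fun i => e (Sum.inl (σ i))) * η (fun i => e (Sum.inr (τ i))))
      rw [h3, h4, h5]
      push_cast
      linear_combination (-(φ (fun i => e (Sum.inl i)) * η fun j => e (Sum.inr j))) *
        (((Perm.sign τ : ℤ) : ℝ) * ((Perm.sign τ : ℤ) : ℝ) *
        hsq (Perm.sign σ) + hsq (Perm.sign τ))
  rw [h1, Finset.sum_const, Finset.card_univ, Fintype.card_prod, Fintype.card_perm,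
    Fintype.card_perm, Fintype.card_fin, Fintype.card_fin, nsmul_eq_mul]

theorem wedge_smul_left {k : ℕ} (c : ℝ) (φ : HomZ p q [⋀^Fin q]→L[ℝ] ℝ)
    (η : HomZ p q [⋀^Fin k]→L[ℝ] ℝ) (e : Fin q ⊕ Fin k → HomZ p q) :
    wedge (c • φ) η e = c * wedge φ η e := by
  have hs : ∀ x : Fin q → HomZ p q, (c • φ) x = c * φ x := fun _ => rfl
  rw [wedge_apply, wedge_apply, mul_left_comm c, Finset.mul_sum Finset.univ _ c]
  refine congrArg _ (Finset.sum_congr rfl fun σ _ => ?_)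
  rw [hs]
  ring

/-- The map `y ↦ -‖c‖⁻² c ⊗ y`, a right inverse of `X ↦ -X^* c`. -/
def normalMap (c : Pos p) : Neg q →L[ℝ] HomZ p q :=
  LinearMap.toContinuousLinearMap
    { toFun := fun y => -((‖c‖ ^ 2)⁻¹ • (innerSL ℝ y).smulRight c)
      map_add' := fun y z => by
        ext1 w
        simp [add_smul]
        abel
      map_smul' := fun r y => by
        ext1 w
        simp [mul_smul, smul_comm r] }

theorem normalMap_apply (c : Pos p) (y w : Neg q) :
    normalMap c y w = -((‖c‖ ^ 2)⁻¹ • ⟪y, w⟫ • c) := rfl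

theorem adjoint_normalMap {c : Pos p} (hc : c ≠ 0) (y : Neg q) : ((normalMap c y)†) c = -y := by
  refine ext_inner_right ℝ fun w => ?_
  rw [ContinuousLinearMap.adjoint_inner_left, normalMap_apply, inner_neg_right, inner_neg_left,
    real_inner_smul_right, real_inner_smul_right, real_inner_self_eq_norm_sq]
  have : ‖c‖ ≠ 0 := norm_ne_zero_iff.2 hc
  field_simp

/-- A linear parametrisation `κ` of the space of the `X` with `X^* c = 0`, with a left inverse. -/
structure IsTangentParam (c : Pos p) {k : ℕ} (κ : (Fin k → ℝ) →L[ℝ] HomZ p q)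
    (π : HomZ p q →L[ℝ] (Fin k → ℝ)) : Prop where
  adjoint_apply : ∀ u, ((κ u)†) c = 0
  proj_normal : ∀ y, π (normalMap c y) = 0
  proj_apply : ∀ u, π (κ u) = u
  apply_proj : ∀ X : HomZ p q, (X†) c = 0 → κ (π X) = X

/-- The map `X ↦ X* c` has the right inverse `y ↦ -normalMap c y`, so its kernel has dimension `(q +
k) - q`. The projection to the kernel along the image of `normalMap c` provides `π`. -/
theorem exists_isTangentParam {c : Pos p} (hc : c ≠ 0) {k : ℕ}
    (b : Basis (Fin q ⊕ Fin k) ℝ (HomZ p q)) :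
    ∃ (κ : (Fin k → ℝ) →L[ℝ] HomZ p q) (π : HomZ p q →L[ℝ] (Fin k → ℝ)),
      IsTangentParam c κ π := by
  let ev : HomZ p q →L[ℝ] Neg q := (ContinuousLinearMap.apply ℝ (Neg q) c) ∘L adjL
  have hev : ∀ X, ev X = (X†) c := fun _ => rfl
  have hevn : ∀ y, ev (normalMap c y) = -y := fun y => adjoint_normalMap hc y
  let K : Submodule ℝ (HomZ p q) := LinearMap.ker ev.toLinearMap
  have hK : ∀ X, X ∈ K ↔ (X†) c = 0 := fun X => LinearMap.mem_ker
  have hfr : finrank ℝ (Fin k → ℝ) = finrank ℝ K := by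
    have h1 := LinearMap.finrank_range_add_finrank_ker ev.toLinearMap
    have h2 : LinearMap.range ev.toLinearMap = ⊤ := by
      rw [LinearMap.range_eq_top]
      intro y
      exact ⟨normalMap c (-y), by simpa using hevn (-y)⟩
    rw [h2, finrank_top, finrank_euclideanSpace_fin, finrank_eq_card_basis b, Fintype.card_sum,
      Fintype.card_fin, Fintype.card_fin] at h1
    rw [finrank_fin_fun]
    exact (Nat.add_left_cancel h1).symm
  let e : (Fin k → ℝ) ≃L[ℝ] K := ContinuousLinearEquiv.ofFinrankEq hfr
  have hP : ∀ X, (ContinuousLinearMap.id ℝ (HomZ p q) + normalMap c ∘L ev) X ∈ K := by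
    intro X
    rw [hK, ← hev]
    change ev (X + normalMap c (ev X)) = 0
    rw [map_add, hevn, add_neg_cancel]
  let P : HomZ p q →L[ℝ] K :=
    (ContinuousLinearMap.id ℝ (HomZ p q) + normalMap c ∘L ev).codRestrict K hP
  have hPX : ∀ X, ((P X : K) : HomZ p q) = X + normalMap c (ev X) := fun _ => rfl
  refine ⟨K.subtypeL ∘L (e : (Fin k → ℝ) →L[ℝ] K), (e.symm : K →L[ℝ] (Fin k → ℝ)) ∘L P, ?_⟩
  refine ⟨fun u => (hK _).1 (e u).2, fun y => ?_, fun u => ?_, fun X hX => ?_⟩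
  · change e.symm (P (normalMap c y)) = 0
    have : P (normalMap c y) = 0 := Subtype.ext (by rw [hPX, hevn, map_neg, add_neg_cancel]; rfl)
    rw [this, map_zero]
  · change e.symm (P ((e u : K) : HomZ p q)) = u
    have h0 : ev ((e u : K) : HomZ p q) = 0 := (hK _).1 (e u).2
    have : P ((e u : K) : HomZ p q) = e u := Subtype.ext (by rw [hPX, h0, map_zero, add_zero])
    rw [this, e.symm_apply_apply]
  · change ((e (e.symm (P X)) : K) : HomZ p q) = X
    rw [e.apply_symm_apply, hPX, hev, hX, map_zero, add_zero]

/-- The linear coordinates on `Hom(z₀, z₀^⊥)` which are adapted to `κ`. -/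
def IsTangentParam.coords {c : Pos p} (hc : c ≠ 0) {k : ℕ} {κ : (Fin k → ℝ) →L[ℝ] HomZ p q}
    {π : HomZ p q →L[ℝ] (Fin k → ℝ)} (h : IsTangentParam c κ π) :
    (Neg q × (Fin k → ℝ)) ≃L[ℝ] HomZ p q :=
  ContinuousLinearEquiv.equivOfInverse ((normalMap c).coprod κ)
    ((-((ContinuousLinearMap.apply ℝ (Neg q) c) ∘L adjL)).prod π)
    (by
      rintro ⟨y, u⟩
      have h1 : (((normalMap c).coprod κ (y, u))†) c = -y := by
        change adjL (normalMap c y + κ u) c = -y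
        rw [map_add, add_apply, adjL_apply, adjL_apply, adjoint_normalMap hc,
          h.adjoint_apply, add_zero]
      refine Prod.ext ?_ ?_
      · change -((((normalMap c).coprod κ (y, u))†) c) = y
        rw [h1, neg_neg]
      · change π (normalMap c y + κ u) = u
        rw [map_add, h.proj_normal, h.proj_apply, zero_add])
    (by
      intro X
      change normalMap c (-((X†) c)) + κ (π X) = X
      have h1 : ((X + normalMap c ((X†) c))†) c = 0 := by
        rw [← adjL_apply, map_add, add_apply, adjL_apply, adjL_apply, adjoint_normalMap hc,
          add_neg_cancel]
      have h2 := h.apply_proj _ h1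
      rw [map_add, h.proj_normal, add_zero] at h2
      rw [h2, map_neg]
      abel)

theorem IsTangentParam.coords_apply {c : Pos p} (hc : c ≠ 0) {k : ℕ}
    {κ : (Fin k → ℝ) →L[ℝ] HomZ p q} {π : HomZ p q →L[ℝ] (Fin k → ℝ)} (h : IsTangentParam c κ π)
    (w : Neg q × (Fin k → ℝ)) : h.coords hc w = normalMap c w.1 + κ w.2 := rfl

section Laplace

variable {k : ℕ} {η : HomZ p q → HomZ p q [⋀^Fin k]→L[ℝ] ℝ} {χ : HomZ p q → ℝ}

/-- The integrand of Laplace's method. -/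
def laplace (χ : HomZ p q → ℝ) (v : V p q) (η : HomZ p q → HomZ p q [⋀^Fin k]→L[ℝ] ℝ)
    (b : Fin q ⊕ Fin k → HomZ p q) (a : ℝ × (HomZ p q × Neg q)) : ℝ :=
  χ a.2.1 * wedge (limForm v (a.1, a.2.1)) (η a.2.1) b *
    Real.exp (-(2 * Real.pi * ⟪gramInv a.2.1 a.2.2, a.2.2⟫))

theorem continuousOn_wedge_limForm (v : V p q) (hη : ContDiffOn ℝ ∞ η (Dplus p q))
    (b : Fin q ⊕ Fin k → HomZ p q) :
    ContinuousOn (fun a : ℝ × HomZ p q => wedge (limForm v a) (η a.2) b)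
      (Set.univ ×ˢ Dplus p q) := by
  have h1 : ContDiffOn ℝ 0 (limForm v) (Set.univ ×ˢ Dplus p q) := fun a ha =>
    (contDiffAt_limForm ha.2 v 0).contDiffWithinAt
  have h2 : ContDiffOn ℝ 0 (fun a : ℝ × HomZ p q => η a.2) (Set.univ ×ˢ Dplus p q) :=
    ContDiffOn.comp (g := η) (hη.of_le bot_le) contDiffOn_snd fun a ha => ha.2
  exact (contDiffOn_wedge h1 h2 b).continuousOn

theorem continuous_laplace (v : V p q) (hη : ContDiffOn ℝ ∞ η (Dplus p q))
    (hχ : Continuous χ) (hs : tsupport χ ⊆ Dplus p q) (b : Fin q ⊕ Fin k → HomZ p q) :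
    Continuous (laplace χ v η b) := by
  rw [continuous_iff_continuousAt]
  rintro ⟨s, X, y⟩
  by_cases hX : X ∈ Dplus p q
  · have h1 : ContinuousAt (fun a : ℝ × (HomZ p q × Neg q) =>
        wedge (limForm v (a.1, a.2.1)) (η a.2.1) b) (s, X, y) := by
      have h := (continuousOn_wedge_limForm v hη b).continuousAt (x := (s, X))
        ((isOpen_univ.prod isOpen_Dplus).mem_nhds ⟨trivial, hX⟩)
      exact ContinuousAt.comp (g := fun a : ℝ × HomZ p q => wedge (limForm v a) (η a.2) b)
        (f := fun a : ℝ × (HomZ p q × Neg q) => (a.1, a.2.1)) h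
        (continuous_fst.prodMk (continuous_fst.comp continuous_snd)).continuousAt
    have h2 : ContinuousAt (fun a : ℝ × (HomZ p q × Neg q) => gramInv a.2.1) (s, X, y) :=
      ContinuousAt.comp (g := gramInv) (f := fun a : ℝ × (HomZ p q × Neg q) => a.2.1)
        (contDiffAt_gramInv hX 0).continuousAt (continuous_fst.comp continuous_snd).continuousAt
    have h3 : ContinuousAt (fun a : ℝ × (HomZ p q × Neg q) => a.2.2) (s, X, y) :=
      (continuous_snd.comp continuous_snd).continuousAt
    have h4 : ContinuousAt (fun a : ℝ × (HomZ p q × Neg q) => χ a.2.1) (s, X, y) :=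
      (hχ.comp (continuous_fst.comp continuous_snd)).continuousAt
    have h5 : ContinuousAt (fun a : ℝ × (HomZ p q × Neg q) => ⟪gramInv a.2.1 a.2.2, a.2.2⟫)
        (s, X, y) := (h2.clm_apply h3).inner h3
    exact (h4.mul h1).mul (h5.const_mul (2 * Real.pi)).neg.rexp
  · have h0 : ∀ᶠ a : ℝ × (HomZ p q × Neg q) in 𝓝 (s, X, y), χ a.2.1 = 0 := by
      have h1 : ∀ᶠ Y in 𝓝 X, χ Y = 0 := by
        filter_upwards [(isClosed_tsupport χ).isOpen_compl.mem_nhds fun h => hX (hs h)] with Y hY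
        exact image_eq_zero_of_notMem_tsupport hY
      have h2 : Filter.Tendsto (fun a : ℝ × (HomZ p q × Neg q) => a.2.1) (𝓝 (s, X, y)) (𝓝 X) :=
        (continuous_fst.comp continuous_snd).continuousAt
      exact h2.eventually h1
    refine ContinuousAt.congr (f := fun _ => (0 : ℝ)) continuousAt_const ?_
    filter_upwards [h0] with a ha
    rw [laplace, ha, zero_mul, zero_mul]

/-- The factor of the exponential is bounded on the compact set `[0, 1] × supp χ`, and
`norm_sq_le_inner_gramInv` bounds the exponential independently of `X`. -/
theorem exists_laplace_bound (v : V p q) (hη : ContDiffOn ℝ ∞ η (Dplus p q))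
    (hχ : Continuous χ) (hc : HasCompactSupport χ) (hs : tsupport χ ⊆ Dplus p q)
    (b : Fin q ⊕ Fin k → HomZ p q) :
    ∃ C : ℝ, ∀ s ∈ Set.Icc (0 : ℝ) 1, ∀ X y,
      |laplace χ v η b (s, (X, y))| ≤ C * Real.exp (-(2 * Real.pi) * ‖y‖ ^ 2) := by
  have hK : IsCompact (Set.Icc (0 : ℝ) 1 ×ˢ tsupport χ) := isCompact_Icc.prod hc
  have hcont : ContinuousOn (fun a : ℝ × HomZ p q => χ a.2 * wedge (limForm v a) (η a.2) b)
      (Set.Icc (0 : ℝ) 1 ×ˢ tsupport χ) :=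
    (hχ.comp continuous_snd).continuousOn.mul ((continuousOn_wedge_limForm v hη b).mono
      (Set.prod_mono (Set.subset_univ _) hs))
  obtain ⟨C, hC⟩ := hK.exists_bound_of_continuousOn hcont
  refine ⟨max C 0, fun s hsI X y => ?_⟩
  by_cases hX : X ∈ tsupport χ
  · rw [laplace, abs_mul, Real.abs_exp]
    refine mul_le_mul ((hC (s, X) ⟨hsI, hX⟩).trans (le_max_left _ _)) ?_ (Real.exp_pos _).le
      (le_max_right _ _)
    have h1 := norm_sq_le_inner_gramInv (hs hX) y
    refine Real.exp_le_exp.2 ?_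
    have h2 := mul_le_mul_of_nonneg_left h1 (by positivity : (0 : ℝ) ≤ 2 * Real.pi)
    change -(2 * Real.pi * ⟪gramInv X y, y⟫) ≤ _
    linarith
  · have h0 : laplace χ v η b (s, (X, y)) = 0 := by
      rw [laplace, image_eq_zero_of_notMem_tsupport hX, zero_mul, zero_mul]
    rw [h0, abs_zero]
    positivity

theorem cutoff_mul_wedge_eq (hs : tsupport χ ⊆ Dplus p q) (v : V p q)
    (b : Fin q ⊕ Fin k → HomZ p q) {s : ℝ} (h0 : s ≠ 0) (X : HomZ p q) :
    χ X * wedge (phi0 (s⁻¹ • v) X) (η X) b =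
      s⁻¹ ^ q * laplace χ v η b (s, (X, s⁻¹ • (v.2 - (X†) v.1))) := by
  by_cases hX : X ∈ Dplus p q
  · rw [phi0_smul hX v (inv_ne_zero h0), wedge_smul_left, inv_inv, laplace]
    ring
  · rw [laplace, image_eq_zero_of_notMem_tsupport fun h => hX (hs h)]
    ring

end Laplace

/-! ### The integral of `φ⁰(v) ∧ η` as an integral over `𝔻_v⁺` -/

theorem inv_pow_mul_exp_tendsto {c : ℝ} (hc : 0 < c) (n : ℕ) :
    Filter.Tendsto (fun s : ℝ => s⁻¹ ^ n * Real.exp (-c * s⁻¹ ^ 2)) (𝓝[>] 0) (𝓝 0) := by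
  have h0 := (tendsto_rpow_mul_exp_neg_mul_atTop_nhds_zero n c hc)
  have h1 : Filter.Tendsto (fun t : ℝ => t ^ n * Real.exp (-c * t ^ 2)) Filter.atTop (𝓝 0) := by
    refine squeeze_zero_norm' ?_ h0
    filter_upwards [Filter.eventually_ge_atTop (1 : ℝ)] with t ht
    rw [Real.norm_of_nonneg (by positivity), Real.rpow_natCast]
    refine mul_le_mul_of_nonneg_left (Real.exp_le_exp.2 ?_) (by positivity)
    nlinarith [mul_nonneg (mul_nonneg hc.le (zero_le_one.trans ht)) (sub_nonneg.2 ht)]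
  exact h1.comp tendsto_inv_nhdsGT_zero

section Laplace

variable {k : ℕ} {η : HomZ p q → HomZ p q [⋀^Fin k]→L[ℝ] ℝ} {χ : HomZ p q → ℝ}

/-- For `v ∈ z₀` nonzero the rescaled variable is `s⁻¹ v₂` for all `X`. The integrand is `O(s^{-q}
exp (-2 π ‖v₂‖² / s²))`, uniformly on the support of `χ`. -/
theorem tendsto_integral_of_fst_eq_zero (v : V p q) (h1 : v.1 = 0) (h2 : v.2 ≠ 0)
    (hη : ContDiffOn ℝ ∞ η (Dplus p q)) (hχ : Continuous χ) (hc : HasCompactSupport χ)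
    (hs : tsupport χ ⊆ Dplus p q) (b : Fin q ⊕ Fin k → HomZ p q) (μ : Measure (HomZ p q))
    [IsFiniteMeasureOnCompacts μ] :
    Filter.Tendsto (fun s : ℝ => ∫ X, χ X * wedge (phi0 (s⁻¹ • v) X) (η X) b ∂μ)
      (𝓝[>] 0) (𝓝 0) := by
  obtain ⟨C, hC⟩ := exists_laplace_bound v hη hχ hc hs b
  have hcp : 0 < 2 * Real.pi * ‖v.2‖ ^ 2 := by positivity
  have hlim := ((inv_pow_mul_exp_tendsto hcp q).mul_const C).mul_const (μ.real (tsupport χ))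
  rw [zero_mul, zero_mul] at hlim
  refine squeeze_zero_norm' ?_ hlim
  filter_upwards [Ioo_mem_nhdsGT (zero_lt_one (α := ℝ))] with s hsI
  have hzero : ∀ X ∉ tsupport χ, χ X * wedge (phi0 (s⁻¹ • v) X) (η X) b = 0 := fun X hX => by
    rw [image_eq_zero_of_notMem_tsupport hX, zero_mul]
  rw [← setIntegral_eq_integral_of_forall_compl_eq_zero hzero]
  refine norm_setIntegral_le_of_norm_le_const hc.measure_lt_top fun X _ => ?_
  have hs0 : 0 < s⁻¹ ^ q := pow_pos (inv_pos.2 hsI.1) q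
  rw [cutoff_mul_wedge_eq hs v b hsI.1.ne', Real.norm_eq_abs, abs_mul, abs_of_pos hs0, mul_assoc]
  refine mul_le_mul_of_nonneg_left ?_ hs0.le
  refine (hC s ⟨hsI.1.le, hsI.2.le⟩ X _).trans (le_of_eq ?_)
  rw [h1, map_zero, sub_zero, norm_smul, mul_comm, Real.norm_eq_abs,
    abs_of_pos (inv_pos.2 hsI.1)]
  congr 2
  ring

/-- The determinant which compares `b` with a basis adapted to `𝔻_v⁺`. -/
def coordDet {c : Pos p} (hc : c ≠ 0) {κ : (Fin k → ℝ) →L[ℝ] HomZ p q}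
    {π : HomZ p q →L[ℝ] (Fin k → ℝ)} (h : IsTangentParam c κ π)
    (b : Basis (Fin q ⊕ Fin k) ℝ (HomZ p q)) : ℝ :=
  b.det fun i => h.coords hc (prodBasis q k i)

theorem coordDet_ne_zero {c : Pos p} (hc : c ≠ 0) {κ : (Fin k → ℝ) →L[ℝ] HomZ p q}
    {π : HomZ p q →L[ℝ] (Fin k → ℝ)} (h : IsTangentParam c κ π)
    (b : Basis (Fin q ⊕ Fin k) ℝ (HomZ p q)) : coordDet hc h b ≠ 0 := by
  have h1 := b.isUnit_det ((prodBasis q k).map (h.coords hc).toLinearEquiv)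
  exact h1.ne_zero

theorem adjoint_chart {c : Pos p} (hc : c ≠ 0) {κ : (Fin k → ℝ) →L[ℝ] HomZ p q}
    {π : HomZ p q →L[ℝ] (Fin k → ℝ)} (h : IsTangentParam c κ π) (w y : Neg q) (u : Fin k → ℝ) :
    ((normalMap c (-w) + normalMap c y + κ u)†) c = w - y := by
  rw [← adjL_apply, map_add, map_add, add_apply, add_apply, adjL_apply, adjL_apply,
    adjL_apply, adjoint_normalMap hc, adjoint_normalMap hc, h.adjoint_apply]
  abel

/-- In the coordinates `X = x₀ + n(s y) + κ(u)`, with `x₀` a solution of `X* v₁ = v₂`, the section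
is governed by `v₂ - X* v₁ = s y`. The Jacobian `s ^ q` cancels the factor `s⁻¹ ^ q` of `phi0_smul`.
-/
theorem integral_cutoff_eq_laplace {v : V p q} (hv : v.1 ≠ 0) {κ : (Fin k → ℝ) →L[ℝ] HomZ p q}
    {π : HomZ p q →L[ℝ] (Fin k → ℝ)} (h : IsTangentParam v.1 κ π)
    (hs : tsupport χ ⊆ Dplus p q) (b : Basis (Fin q ⊕ Fin k) ℝ (HomZ p q)) {s : ℝ} (h0 : 0 < s) :
    ∫ X, χ X * wedge (phi0 (s⁻¹ • v) X) (η X) b ∂b.addHaar =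
      |coordDet hv h b| * ∫ w : Neg q × (Fin k → ℝ), laplace χ v η b
        (s, (normalMap v.1 (-v.2) + normalMap v.1 (s • w.1) + κ w.2, w.1)) := by
  let S : (Neg q × (Fin k → ℝ)) ≃L[ℝ] (Neg q × (Fin k → ℝ)) :=
    (ContinuousLinearEquiv.smulLeft (Units.mk0 s h0.ne')).prodCongr
      (ContinuousLinearEquiv.refl ℝ (Fin k → ℝ))
  have hS : ∀ w, S w = (s • w.1, w.2) := fun _ => rfl
  have hA : ∀ w, (S.trans (h.coords hv)) w = normalMap v.1 (s • w.1) + κ w.2 := fun _ => rfl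
  have hdet : (b.det fun i => (S.trans (h.coords hv)) (prodBasis q k i)) =
      s ^ q * coordDet hv h b := by
    have h1 : (fun i => (S.trans (h.coords hv)) (prodBasis q k i)) = fun i =>
        Sum.elim (fun _ : Fin q => s) (fun _ : Fin k => (1 : ℝ)) i •
          h.coords hv (prodBasis q k i) := by
      funext i
      rw [hA, h.coords_apply hv]
      rcases i with i | i
      · rw [prodBasis_inl]
        simp
      · rw [prodBasis_inr]
        simp
    rw [h1, AlternatingMap.map_smul_univ, coordDet]
    simp
  rw [integral_addHaar_eq b (S.trans (h.coords hv)) (normalMap v.1 (-v.2)), hdet, abs_mul,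
    abs_of_pos (pow_pos h0 q)]
  have hint : ∀ w : Neg q × (Fin k → ℝ),
      χ (normalMap v.1 (-v.2) + (S.trans (h.coords hv)) w) *
        wedge (phi0 (s⁻¹ • v) (normalMap v.1 (-v.2) + (S.trans (h.coords hv)) w))
          (η (normalMap v.1 (-v.2) + (S.trans (h.coords hv)) w)) b =
      s⁻¹ ^ q * laplace χ v η b
        (s, (normalMap v.1 (-v.2) + normalMap v.1 (s • w.1) + κ w.2, w.1)) := by
    intro w
    rw [cutoff_mul_wedge_eq hs v b h0.ne', hA, ← add_assoc, adjoint_chart hv h, sub_sub_cancel,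
      inv_smul_smul₀ h0.ne']
  simp_rw [hint]
  rw [integral_const_mul, inv_pow, mul_comm (s ^ q), mul_assoc, mul_inv_cancel_left₀
    (pow_pos h0 q).ne']

theorem secF_eq_zero {v : V p q} {X : HomZ p q} (h : (X†) v.1 = v.2) : secF v X = 0 := by
  rw [secF, h, sub_self, map_zero]

/-- The normalisation of the Mathai-Quillen form: `(-1) ^ (q (q - 1) / 2)` is the Berezin sign,
`(-1) ^ q` comes from `X ↦ X* v₁` on the normal coordinates, and `2 ^ (-q / 2)` is the Gaussian
integral. -/
theorem cst_mul_eq_one (q : ℕ) :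
    cst q * ((-1) ^ (q * (q - 1) / 2) * ((2 * √Real.pi) ^ q * (-1) ^ q)) *
      2 ^ (-(q : ℝ) / 2) = 1 := by
  have h1 : q * (q + 1) / 2 = q * (q - 1) / 2 + q := by
    have := Nat.triangle_succ q
    rwa [Nat.add_sub_cancel, mul_comm] at this
  have h2 : (2 * Real.pi) ^ (-(q : ℝ) / 2) * 2 ^ (-(q : ℝ) / 2) * (2 * √Real.pi) ^ q = 1 := by
    rw [← Real.mul_rpow (by positivity) (by positivity)]
    have h3 : 2 * √Real.pi = (2 * Real.pi * 2) ^ (1 / 2 : ℝ) := by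
      rw [← Real.sqrt_eq_rpow, show 2 * Real.pi * 2 = 2 ^ 2 * Real.pi by ring,
        Real.sqrt_mul (by positivity), Real.sqrt_sq (by positivity)]
    rw [h3, ← Real.rpow_natCast, ← Real.rpow_mul (by positivity), ← Real.rpow_add (by positivity),
      show -(q : ℝ) / 2 + 1 / 2 * q = 0 by ring, Real.rpow_zero]
  have h4 : ((-1 : ℝ) ^ (q * (q - 1) / 2)) ^ 2 = 1 := by
    rw [← pow_mul, mul_comm, pow_mul]
    simp
  have h5 : ((-1 : ℝ) ^ q) ^ 2 = 1 := by
    rw [← pow_mul, mul_comm, pow_mul]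
    simp
  rw [cst, h1, pow_add]
  linear_combination ((-1 : ℝ) ^ (q * (q - 1) / 2)) ^ 2 * ((-1 : ℝ) ^ q) ^ 2 * h2 +
    ((-1 : ℝ) ^ q) ^ 2 * h4 + h5

/-- In the adapted basis the limit form vanishes as soon as one argument is tangent to `𝔻_v⁺`, so
the wedge product is a product of two values. On the normal vectors the matrix is `-1`. -/
theorem coordDet_mul_wedge_limForm {v : V p q} (hv : v.1 ≠ 0)
    {κ : (Fin k → ℝ) →L[ℝ] HomZ p q} {π : HomZ p q →L[ℝ] (Fin k → ℝ)}
    (h : IsTangentParam v.1 κ π) (b : Basis (Fin q ⊕ Fin k) ℝ (HomZ p q)) {X : HomZ p q}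
    (hX : (X†) v.1 = v.2) :
    coordDet hv h b * wedge (limForm v (0, X)) (η X) b =
      cst q * (gram X).det ^ (-(1 / 2) : ℝ) * ((-1) ^ (q * (q - 1) / 2) *
        ((2 * √Real.pi) ^ q * (-1) ^ q)) * η X fun j => κ (Pi.single j 1) := by
  have h1 : wedge (limForm v (0, X)) (η X) (fun i => h.coords hv (prodBasis q k i)) =
      coordDet hv h b * wedge (limForm v (0, X)) (η X) b := by
    have h2 := congrArg (fun β : HomZ p q [⋀^Fin q ⊕ Fin k]→ₗ[ℝ] ℝ =>
      β fun i => h.coords hv (prodBasis q k i))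
      ((wedge (limForm v (0, X)) (η X)).eq_smul_basis_det b)
    rw [mul_comm]
    exact h2
  have hl : ∀ i, h.coords hv (prodBasis q k (Sum.inl i)) = normalMap v.1 (stdBasis q i) := by
    intro i
    rw [h.coords_apply hv, prodBasis_inl, map_zero, add_zero]
  have hr : ∀ j, h.coords hv (prodBasis q k (Sum.inr j)) = κ (Pi.single j 1) := by
    intro j
    rw [h.coords_apply hv, prodBasis_inr, map_zero, zero_add]
  have hsec : v.1 - X (secF v X) = v.1 := by rw [secF_eq_zero hX, map_zero, sub_zero]
  rw [← h1, wedge_eq_mul]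
  · simp_rw [hl, hr]
    rw [limForm_zero, hsec]
    have hm : (Matrix.of fun i j => (((normalMap v.1 (stdBasis q i))†) v.1) j) =
        -(1 : Matrix (Fin q) (Fin q) ℝ) := by
      ext i j
      change (((normalMap v.1 (stdBasis q i))†) v.1) j = _
      rw [adjoint_normalMap hv]
      simp [stdBasis, Matrix.one_apply, eq_comm]
    rw [hm, Matrix.det_neg, Matrix.det_one, mul_one, Fintype.card_fin]
  · rintro x ⟨i, j, hij⟩
    rw [limForm_zero, hsec, Matrix.det_eq_zero_of_row_eq_zero i]
    · ring
    · intro l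
      change (((x i)†) v.1) l = 0
      rw [hij, hr, h.adjoint_apply]
      rfl

/-- The Gaussian integral over the normal directions produces `det (gram X) ^ (1/2)`, which cancels
the power in `limForm`; the constants cancel by `cst_mul_eq_one`. -/
theorem integral_laplace_zero {v : V p q} (hv : v.1 ≠ 0) (hs : tsupport χ ⊆ Dplus p q)
    {κ : (Fin k → ℝ) →L[ℝ] HomZ p q} {π : HomZ p q →L[ℝ] (Fin k → ℝ)}
    (h : IsTangentParam v.1 κ π) (b : Basis (Fin q ⊕ Fin k) ℝ (HomZ p q)) {X : HomZ p q}
    (hX : (X†) v.1 = v.2) :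
    ∫ y, laplace χ v η b (0, (X, y)) =
      (coordDet hv h b)⁻¹ * (χ X * η X fun j => κ (Pi.single j 1)) := by
  by_cases hD : X ∈ Dplus p q
  · have h1 : ∀ y, laplace χ v η b (0, (X, y)) = χ X * wedge (limForm v (0, X)) (η X) b *
      Real.exp (-(2 * Real.pi * ⟪gramInv X y, y⟫)) := fun _ => rfl
    simp_rw [h1]
    rw [integral_const_mul, integral_gaussian_gramInv hD, eq_inv_mul_iff_mul_eq₀
      (coordDet_ne_zero hv h b)]
    have h2 := coordDet_mul_wedge_limForm (η := η) hv h b hX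
    have h3 : (gram X).det ^ (-(1 / 2) : ℝ) * (gram X).det ^ (1 / 2 : ℝ) = 1 := by
      rw [← Real.rpow_add (det_gram_pos hD)]
      simp
    have h4 := cst_mul_eq_one q
    set d := (gram X).det ^ (-(1 / 2) : ℝ)
    set d' := (gram X).det ^ (1 / 2 : ℝ)
    set e := η X fun j => κ (Pi.single j 1)
    linear_combination χ X * (2 ^ (-(q : ℝ) / 2) * d') * h2 + χ X * e * d * d' * h4 + χ X * e * h3
  · have h0 : χ X = 0 := image_eq_zero_of_notMem_tsupport fun hm => hD (hs hm)
    have h1 : ∀ y, laplace χ v η b (0, (X, y)) = 0 := fun y => by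
      rw [laplace]
      change χ X * _ * _ = 0
      rw [h0, zero_mul, zero_mul]
    simp_rw [h1]
    simp [h0]

variable {Γ : Subgroup (EndV p q)ˣ}

theorem integral_cutoff_eq_zero (h : IsProperFree Γ) {v : V p q} (h1 : v.1 = 0) (h2 : v.2 ≠ 0)
    (hv : ∀ γ ∈ Γ, (γ : EndV p q) v = v) (hη : IsClosedForm Γ η)
    (hχ : ContDiff ℝ 1 χ) (hc : HasCompactSupport χ) (hs : tsupport χ ⊆ Dplus p q)
    (hlf : ∀ X ∈ Dplus p q, ∃ S : Finset Γ, ∀ᶠ Y in 𝓝 X, ∀ γ : Γ, γ ∉ S →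
        χ (actD ((γ : (EndV p q)ˣ) : EndV p q) Y) = 0)
    (hsum : ∀ X ∈ Dplus p q, η X ≠ 0 →
      HasSum (fun γ : Γ => χ (actD ((γ : (EndV p q)ˣ) : EndV p q) X)) 1)
    (b : Basis (Fin q ⊕ Fin k) ℝ (HomZ p q)) :
    ∫ X, χ X * wedge (phi0 v X) (η X) b ∂b.addHaar = 0 := by
  have hlim := tendsto_integral_of_fst_eq_zero v h1 h2 hη.smooth hχ.continuous hc hs b b.addHaar
  simp_rw [fun s : ℝ => integral_cutoff_eq (μ := b.addHaar) h hv hη hχ hc hs hlf hsum b s⁻¹] at hlim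
  exact tendsto_nhds_unique tendsto_const_nhds hlim

/-- The integral for `s⁻¹ v` does not depend on `s`, hence equals its limit at `s = 0`. Fubini
separates the normal Gaussian from the integral along `𝔻_v⁺`. -/
theorem integral_cutoff_eq_integral (h : IsProperFree Γ) {v : V p q} (hv1 : v.1 ≠ 0)
    (hv : ∀ γ ∈ Γ, (γ : EndV p q) v = v) (hη : IsClosedForm Γ η)
    (hχ : ContDiff ℝ 1 χ) (hc : HasCompactSupport χ) (hs : tsupport χ ⊆ Dplus p q)
    (hlf : ∀ X ∈ Dplus p q, ∃ S : Finset Γ, ∀ᶠ Y in 𝓝 X, ∀ γ : Γ, γ ∉ S →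
        χ (actD ((γ : (EndV p q)ˣ) : EndV p q) Y) = 0)
    (hsum : ∀ X ∈ Dplus p q, η X ≠ 0 →
      HasSum (fun γ : Γ => χ (actD ((γ : (EndV p q)ˣ) : EndV p q) X)) 1)
    (b : Basis (Fin q ⊕ Fin k) ℝ (HomZ p q)) {κ : (Fin k → ℝ) →L[ℝ] HomZ p q}
    {π : HomZ p q →L[ℝ] (Fin k → ℝ)} (hκ : IsTangentParam v.1 κ π) :
    ∫ X, χ X * wedge (phi0 v X) (η X) b ∂b.addHaar =
      |coordDet hv1 hκ b| * (coordDet hv1 hκ b)⁻¹ *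
        ∫ u, χ (normalMap v.1 (-v.2) + κ u) *
          η (normalMap v.1 (-v.2) + κ u) fun j => κ (Pi.single j 1) := by
  obtain ⟨C, hC⟩ := exists_laplace_bound v hη.smooth hχ.continuous hc hs b
  obtain ⟨R, hR⟩ := hc.isCompact.isBounded.exists_norm_le
  have hR' : ∀ (s : ℝ) (X : HomZ p q) (y : Neg q), R < ‖X‖ → laplace χ v η b (s, (X, y)) = 0 := by
    intro s X y hX
    rw [laplace]
    change χ X * _ * _ = 0
    rw [image_eq_zero_of_notMem_tsupport fun hm => absurd (hR X hm) (not_le.2 hX), zero_mul,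
      zero_mul]
  obtain ⟨hint, hlim⟩ := tendsto_integral_laplace (normalMap v.1) κ π hκ.proj_normal hκ.proj_apply
    (normalMap v.1 (-v.2)) (continuous_laplace v hη.smooth hχ.continuous hs b)
    (by positivity : (0 : ℝ) < 2 * Real.pi) hC hR'
  have hlim' := hlim.const_mul |coordDet hv1 hκ b|
  have hconst : Filter.Tendsto (fun _ : ℝ => ∫ X, χ X * wedge (phi0 v X) (η X) b ∂b.addHaar)
      (𝓝[>] 0) (𝓝 (|coordDet hv1 hκ b| * ∫ w : Neg q × (Fin k → ℝ),
        laplace χ v η b (0, (normalMap v.1 (-v.2) + κ w.2, w.1)))) := by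
    refine hlim'.congr' ?_
    filter_upwards [self_mem_nhdsWithin] with s hs0
    rw [← integral_cutoff_eq_laplace hv1 hκ hs b hs0,
      integral_cutoff_eq (μ := b.addHaar) h hv hη hχ hc hs hlf hsum b s⁻¹]
  rw [tendsto_nhds_unique tendsto_const_nhds hconst, Measure.volume_eq_prod,
    integral_prod_symm _ (by rwa [← Measure.volume_eq_prod])]
  have hu : ∀ u, ∫ y, laplace χ v η b (0, (normalMap v.1 (-v.2) + κ u, y)) =
      (coordDet hv1 hκ b)⁻¹ * (χ (normalMap v.1 (-v.2) + κ u) *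
        η (normalMap v.1 (-v.2) + κ u) fun j => κ (Pi.single j 1)) := by
    intro u
    refine integral_laplace_zero hv1 hs hκ b ?_
    have := adjoint_chart hv1 hκ v.2 0 u
    rwa [map_zero, add_zero, sub_zero] at this
  simp_rw [hu]
  rw [integral_const_mul, mul_assoc]

end Laplace

/-! ### The submanifold `𝔻_v⁺` and its orientation -/

/-- The vector of the graph over `w` pairs with `v` to `⟨w, X* v₁ - v₂⟩`. The locus is thus cut out
of the ball by an affine equation, and is covered by one affine chart. -/
theorem mem_Dv_iff {v : V p q} {X : HomZ p q} :
    X ∈ Dv v ↔ X ∈ Dplus p q ∧ (X†) v.1 = v.2 := by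
  have h1 : ∀ w : Neg q, Q ((X w, w) : V p q) v = ⟪w, (X†) v.1 - v.2⟫ := by
    intro w
    rw [inner_sub_right, ContinuousLinearMap.adjoint_inner_right]
    rfl
  refine and_congr_right fun _ => ⟨fun h => ?_, fun h y hy => ?_⟩
  · rw [← sub_eq_zero]
    refine inner_self_eq_zero (𝕜 := ℝ).1 ?_
    rw [← h1]
    exact h _ ((mem_plane_iff X _).2 rfl)
  · have h2 : y = (X y.2, y.2) := Prod.ext ((mem_plane_iff X y).1 hy) rfl
    rw [h2, h1, h, sub_self, inner_zero_right]

theorem Dv_subset (v : V p q) : Dv v ⊆ Dplus p q := fun _ h => h.1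

theorem Dv_eq_empty {v : V p q} (h1 : v.1 = 0) (h2 : v.2 ≠ 0) : Dv v = ∅ := by
  refine Set.eq_empty_of_forall_notMem fun X hX => h2 ?_
  rw [← (mem_Dv_iff.1 hX).2, h1, map_zero]

theorem measurableSet_Dv (v : V p q) : MeasurableSet (Dv v) := by
  have h : Dv v = Dplus p q ∩ {X | adjL X v.1 = v.2} := Set.ext fun X => mem_Dv_iff
  rw [h]
  refine isOpen_Dplus.measurableSet.inter (IsClosed.measurableSet (isClosed_eq ?_ continuous_const))
  exact (adjL (p := p) (q := q)).continuous.clm_apply continuous_const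

theorem mem_Dv_iff_secF {v : V p q} {X : HomZ p q} (hX : X ∈ Dplus p q) :
    X ∈ Dv v ↔ secF v X = 0 := by
  rw [mem_Dv_iff]
  refine ⟨fun h => secF_eq_zero h.2, fun h => ⟨hX, ?_⟩⟩
  have h1 := gram_gramInv hX (v.2 - (X†) v.1)
  rw [secF] at h
  rw [h, map_zero] at h1
  exact (sub_eq_zero.1 h1.symm).symm

theorem actD_mem_Dv {g : (EndV p q)ˣ} (hg : g ∈ Gplus p q) {v : V p q}
    (hv : (g : EndV p q) v = v) {X : HomZ p q} (hX : X ∈ Dv v) :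
    actD (g : EndV p q) X ∈ Dv v := by
  have hXD := Dv_subset v hX
  rw [mem_Dv_iff_secF (actD_mem_Dplus (Gplus_le hg) hXD), secF_actD hg hXD hv,
    (mem_Dv_iff_secF hXD).1 hX, map_zero]

/-- The derivative of `X ↦ v₂ - X^* v₁`. -/
def defect (c : Pos p) : HomZ p q →L[ℝ] Neg q := -((ContinuousLinearMap.apply ℝ (Neg q) c) ∘L adjL)

theorem defect_apply (c : Pos p) (x : HomZ p q) : defect c x = -((x†) c) := rfl

theorem fderiv_secF_of_mem_Dv {v : V p q} {X : HomZ p q} (hX : X ∈ Dv v) (x : HomZ p q) :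
    fderiv ℝ (secF v) X x = gramInv X (defect v.1 x) := by
  have hXD := Dv_subset v hX
  have h := gram_fderiv_secF hXD v x
  rw [(mem_Dv_iff_secF hXD).1 hX, map_zero, map_zero, map_zero, sub_zero, sub_zero] at h
  rw [defect_apply, ← gramInv_gram hXD (fderiv ℝ (secF v) X x), h]

theorem fderiv_sec_snd {v : V p q} {X : HomZ p q} (hX : X ∈ Dv v) (x : HomZ p q) :
    (fderiv ℝ (sec v) X x).2 = gramInv X (defect v.1 x) := by
  have hXD := Dv_subset v hX
  rw [← fderiv_secF_of_mem_Dv hX, (sec_eventuallyEq hXD v).fderiv_eq]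
  have h1 : HasFDerivAt (secF v) (fderiv ℝ (secF v) X) X :=
    ((contDiffAt_secF_right hXD v 1).differentiableAt one_ne_zero).hasFDerivAt
  have h2 : HasFDerivAt (fun X => (X, secF v X)) _ X := (hasFDerivAt_id X).prodMk h1
  rw [h2.fderiv]
  rfl

/-- The equivariance of the section is differentiated at one of its zeros, where the derivative of
the automorphy factor drops out. The action on the normal bundle is therefore through `autFac`, of
positive determinant. -/
theorem gramInv_defect_fderiv_actD {g : (EndV p q)ˣ} (hg : g ∈ Gplus p q) {v : V p q}
    (hv : (g : EndV p q) v = v) {X : HomZ p q} (hX : X ∈ Dv v) (x : HomZ p q) :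
    gramInv (actD (g : EndV p q) X) (defect v.1 (fderiv ℝ (actD (g : EndV p q)) X x)) =
      autFac (g : EndV p q) X (gramInv X (defect v.1 x)) := by
  have hXD := Dv_subset v hX
  have hgX := actD_mem_Dv hg hv hX
  have h0 := (mem_Dv_iff_secF hXD).1 hX
  have hd : ∀ Y ∈ Dplus p q, HasFDerivAt (secF v) (fderiv ℝ (secF v) Y) Y := fun Y hY =>
    ((contDiffAt_secF_right hY v 1).differentiableAt one_ne_zero).hasFDerivAt
  rw [← fderiv_secF_of_mem_Dv hgX, ← fderiv_secF_of_mem_Dv hX]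
  have h1 : HasFDerivAt (fun Y => secF v (actD (g : EndV p q) Y)) _ X :=
    HasFDerivAt.comp (g := secF v) X (hd _ (Dv_subset v hgX)) (hasFDerivAt_actD (Gplus_le hg) hXD)
  have h2 : HasFDerivAt (fun Y : HomZ p q => autFac (g : EndV p q) Y)
      (ContinuousLinearMap.compL ℝ (Neg q) (Pos p) (Neg q) (b21 (g : EndV p q))) X :=
    ((ContinuousLinearMap.compL ℝ (Neg q) (Pos p) (Neg q)
      (b21 (g : EndV p q))).hasFDerivAt).add_const _
  have h3 := h2.clm_apply (hd X hXD)
  have h4 : (fun Y => secF v (actD (g : EndV p q) Y)) =ᶠ[𝓝 X]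
      fun Y => autFac (g : EndV p q) Y (secF v Y) := by
    filter_upwards [isOpen_Dplus.mem_nhds hXD] with Y hY using secF_actD hg hY hv
  have h5 := h1.unique (h3.congr_of_eventuallyEq h4)
  have h6 := congrArg (fun f : HomZ p q →L[ℝ] Neg q => f x) h5
  refine h6.trans ?_
  simp [h0]

theorem det_gramInv_pos {X : HomZ p q} (hX : X ∈ Dplus p q) : 0 < (gramInv X).det := by
  have h1 : (gram X).det * (gramInv X).det = 1 := by
    have h2 : gram X ∘L gramInv X = ContinuousLinearMap.id ℝ (Neg q) := by
      ext1 y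
      exact gram_gramInv hX y
    have h3 := congrArg ContinuousLinearMap.det h2
    change LinearMap.det ((gram X).toLinearMap ∘ₗ (gramInv X).toLinearMap) = _ at h3
    rw [LinearMap.det_comp] at h3
    rw [ContinuousLinearMap.det, ContinuousLinearMap.det, h3]
    simp [ContinuousLinearMap.det]
  exact (pos_iff_pos_of_mul_pos (h1 ▸ one_pos)).1 (det_gram_pos hX)

theorem stdBasis_det_comp (A : Neg q →L[ℝ] Neg q) (x : Fin q → Neg q) :
    (stdBasis q).det (fun i => A (x i)) = A.det * (stdBasis q).det x :=
  (stdBasis q).det_comp A.toLinearMap x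

/-- The determinant of a frame whose last vectors are tangent to `𝔻_v⁺`. -/
theorem det_sumElim {c : Pos p} (hc : c ≠ 0) {k : ℕ} {κ : (Fin k → ℝ) →L[ℝ] HomZ p q}
    {π : HomZ p q →L[ℝ] (Fin k → ℝ)} (h : IsTangentParam c κ π)
    (b : Basis (Fin q ⊕ Fin k) ℝ (HomZ p q)) (n : Fin q → HomZ p q) (τ : Fin k → HomZ p q)
    (hτ : ∀ j, defect c (τ j) = 0) :
    b.det (Sum.elim n τ) = coordDet hc h b * ((stdBasis q).det (fun i => defect c (n i)) *
      (Pi.basisFun ℝ (Fin k)).det fun j => π (τ j)) := by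
  have hX : ∀ X : HomZ p q, h.coords hc (defect c X, π X) = X := fun X =>
    (h.coords hc).apply_symm_apply X
  have h1 : Sum.elim n τ = fun i => h.coords hc
      (Sum.elim (fun i => (defect c (n i), π (n i))) (fun j => (0, π (τ j))) i) := by
    funext i
    rcases i with i | j
    · exact (hX (n i)).symm
    · have := hX (τ j)
      rw [hτ] at this
      exact this.symm
  have h2 : ∀ f : Fin q ⊕ Fin k → Neg q × (Fin k → ℝ),
      b.det (fun i => h.coords hc (f i)) = coordDet hc h b * (prodBasis q k).det f := by
    intro f
    have h3 := congrArg (fun β : (Neg q × (Fin k → ℝ)) [⋀^Fin q ⊕ Fin k]→ₗ[ℝ] ℝ => β f)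
      ((b.det.compLinearMap (h.coords hc).toLinearEquiv.toLinearMap).eq_smul_basis_det
        (prodBasis q k))
    exact h3
  rw [h1, h2]
  congr 1
  rw [Basis.det_apply, Basis.det_apply, Basis.det_apply]
  -- Tangent vectors have no normal component, so the matrix is block triangular.
  have h4 : (prodBasis q k).toMatrix
      (Sum.elim (fun i => (defect c (n i), π (n i))) (fun j => ((0 : Neg q), π (τ j)))) =
      Matrix.fromBlocks ((stdBasis q).toMatrix fun i => defect c (n i)) 0
        ((Pi.basisFun ℝ (Fin k)).toMatrix fun i => π (n i))
        ((Pi.basisFun ℝ (Fin k)).toMatrix fun j => π (τ j)) := by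
    ext i j
    rcases i with i | i <;> rcases j with j | j <;>
      simp [Basis.toMatrix_apply, prodBasis]
  rw [h4, Matrix.det_fromBlocks_zero₁₂]

/-! ### Integration over `𝔻_v⁺` -/

section Param

variable {k : ℕ} {v : V p q} {b : Basis (Fin q ⊕ Fin k) ℝ (HomZ p q)} {U : Set (Fin k → ℝ)}
  {ψ : (Fin k → ℝ) → HomZ p q} {ε : ℤˣ} {κ : (Fin k → ℝ) →L[ℝ] HomZ p q}
  {π : HomZ p q →L[ℝ] (Fin k → ℝ)}

/-- The affine parametrisation of `𝔻_v⁺`. -/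
def chart (v : V p q) (κ : (Fin k → ℝ) →L[ℝ] HomZ p q) (u : Fin k → ℝ) : HomZ p q :=
  normalMap v.1 (-v.2) + κ u

theorem adjoint_chart_apply (hv : v.1 ≠ 0) (hκ : IsTangentParam v.1 κ π) (u : Fin k → ℝ) :
    ((chart v κ u)†) v.1 = v.2 := by
  have := adjoint_chart hv hκ v.2 0 u
  rwa [map_zero, add_zero, sub_zero] at this

theorem proj_chart (hκ : IsTangentParam v.1 κ π) (u : Fin k → ℝ) : π (chart v κ u) = u := by
  rw [chart, map_add, hκ.proj_normal, hκ.proj_apply, zero_add]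

theorem chart_proj (hv : v.1 ≠ 0) (hκ : IsTangentParam v.1 κ π) {X : HomZ p q} (hX : X ∈ Dv v) :
    chart v κ (π X) = X := by
  have h1 : ((X - normalMap v.1 (-v.2))†) v.1 = 0 := by
    rw [← adjL_apply, map_sub, sub_apply, adjL_apply, adjL_apply, adjoint_normalMap hv, neg_neg,
      (mem_Dv_iff.1 hX).2, sub_self]
  have h2 := hκ.apply_proj _ h1
  rw [map_sub, hκ.proj_normal, sub_zero] at h2
  rw [chart, h2]
  abel

theorem contDiff_chart (v : V p q) (κ : (Fin k → ℝ) →L[ℝ] HomZ p q) (m : WithTop ℕ∞) :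
    ContDiff ℝ m (chart v κ) := contDiff_const.add κ.contDiff

theorem fderiv_chart (v : V p q) (κ : (Fin k → ℝ) →L[ℝ] HomZ p q) (u : Fin k → ℝ) :
    fderiv ℝ (chart v κ) u = κ :=
  (κ.hasFDerivAt.const_add (normalMap v.1 (-v.2))).fderiv

/-- The sign of a real number, as a unit. -/
def signUnit (d : ℝ) : ℤˣ := if 0 < d then 1 else -1

theorem signUnit_eq {d : ℝ} (hd : d ≠ 0) : ((signUnit d : ℤ) : ℝ) = |d| * d⁻¹ := by
  rw [signUnit]
  rcases hd.lt_or_gt with h | h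
  · rw [if_neg h.not_gt, abs_of_neg h]
    simp [hd]
  · rw [if_pos h, abs_of_pos h]
    simp [hd]

theorem chart_mem_Dv (hv : v.1 ≠ 0) (hκ : IsTangentParam v.1 κ π) {u : Fin k → ℝ}
    (hu : chart v κ u ∈ Dplus p q) : chart v κ u ∈ Dv v :=
  mem_Dv_iff.2 ⟨hu, adjoint_chart_apply hv hκ u⟩

theorem defect_tangent (hκ : IsTangentParam v.1 κ π) (u : Fin k → ℝ) :
    defect v.1 (κ u) = 0 := by
  rw [defect_apply, hκ.adjoint_apply, neg_zero]

/-- At points of `𝔻_v⁺` the derivative of the section is `gramInv X ∘ defect v.1`, and `gramInv X`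
has positive determinant. The orientation sign of the affine chart is then that of `coordDet`. -/
theorem isParam_chart (hv : v.1 ≠ 0) (hκ : IsTangentParam v.1 κ π)
    (b : Basis (Fin q ⊕ Fin k) ℝ (HomZ p q)) :
    IsParam v b (chart v κ ⁻¹' Dplus p q) (chart v κ) (signUnit (coordDet hv hκ b)) where
  isOpen := isOpen_Dplus.preimage (contDiff_chart v κ 0).continuous
  smooth := (contDiff_chart v κ ∞).contDiffOn
  injOn := fun u _ u' _ h => by rw [← proj_chart hκ u, h, proj_chart hκ]
  image := by
    refine Set.Subset.antisymm ?_ fun X hX => ?_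
    · rintro _ ⟨u, hu, rfl⟩
      exact chart_mem_Dv hv hκ hu
    · have h := chart_proj hv hκ hX
      exact ⟨π X, by rw [Set.mem_preimage, h]; exact Dv_subset v hX, h⟩
  oriented := by
    intro u hu n hn
    have hX := chart_mem_Dv hv hκ hu
    simp_rw [fderiv_sec_snd hX] at hn
    rw [stdBasis_det_comp (gramInv (chart v κ u)) fun i => defect v.1 (n i)] at hn
    have h1 := (pos_iff_pos_of_mul_pos hn).1 (det_gramInv_pos hu)
    simp_rw [fderiv_chart]
    rw [det_sumElim hv hκ b n _ fun j => defect_tangent hκ _, signUnit_eq (coordDet_ne_zero hv hκ b)]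
    have h2 : (Pi.basisFun ℝ (Fin k)).det (fun j => π (κ (Pi.single j 1))) = 1 := by
      simp_rw [hκ.proj_apply]
      have h3 : (fun j : Fin k => (Pi.single j 1 : Fin k → ℝ)) = Pi.basisFun ℝ (Fin k) := by
        funext j
        rw [Pi.basisFun_apply]
      rw [h3, Basis.det_self]
    rw [h2, mul_one, ← mul_assoc, mul_assoc |coordDet hv hκ b|,
      inv_mul_cancel₀ (coordDet_ne_zero hv hκ b), mul_one]
    exact mul_pos (abs_pos.2 (coordDet_ne_zero hv hκ b)) h1

theorem IsParam.mem_Dv (hp : IsParam v b U ψ ε) {u : Fin k → ℝ} (hu : u ∈ U) : ψ u ∈ Dv v :=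
  hp.image ▸ Set.mem_image_of_mem ψ hu

theorem IsParam.hasFDerivAt (hp : IsParam v b U ψ ε) {u : Fin k → ℝ} (hu : u ∈ U) :
    HasFDerivAt ψ (fderiv ℝ ψ u) u :=
  ((hp.smooth.contDiffAt (hp.isOpen.mem_nhds hu)).differentiableAt (by simp)).hasFDerivAt

theorem IsParam.defect_fderiv (hp : IsParam v b U ψ ε) {u : Fin k → ℝ} (hu : u ∈ U)
    (x : Fin k → ℝ) : defect v.1 (fderiv ℝ ψ u x) = 0 := by
  have h1 : HasFDerivAt (fun u => defect v.1 (ψ u)) _ u :=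
    HasFDerivAt.comp (g := defect v.1) u (defect v.1).hasFDerivAt (hp.hasFDerivAt hu)
  have h2 : (fun u => defect v.1 (ψ u)) =ᶠ[𝓝 u] fun _ => -v.2 := by
    filter_upwards [hp.isOpen.mem_nhds hu] with w hw
    rw [defect_apply, (mem_Dv_iff.1 (hp.mem_Dv hw)).2]
  have h3 := h1.unique ((hasFDerivAt_const (-v.2) u).congr_of_eventuallyEq h2)
  exact congrArg (fun f : (Fin k → ℝ) →L[ℝ] Neg q => f x) h3

/-- The derivative of `u ↦ π (γ ψ(u))`. -/
def transDeriv (π : HomZ p q →L[ℝ] (Fin k → ℝ)) (ψ : (Fin k → ℝ) → HomZ p q) (g : EndV p q)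
    (u : Fin k → ℝ) : (Fin k → ℝ) →L[ℝ] (Fin k → ℝ) :=
  π ∘L fderiv ℝ (actD g) (ψ u) ∘L fderiv ℝ ψ u

theorem basisFun_det_comp (A : (Fin k → ℝ) →L[ℝ] (Fin k → ℝ)) :
    (Pi.basisFun ℝ (Fin k)).det (fun j => A (Pi.single j 1)) = A.det := by
  have h := (Pi.basisFun ℝ (Fin k)).det_comp A.toLinearMap (Pi.basisFun ℝ (Fin k))
  rw [Basis.det_self, mul_one] at h
  rw [ContinuousLinearMap.det, ← h]
  congr 1
  funext j
  simp

theorem IsParam.defect_fderiv_actD (hp : IsParam v b U ψ ε) {g : (EndV p q)ˣ}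
    (hg : g ∈ Gplus p q) (hgv : (g : EndV p q) v = v) {u : Fin k → ℝ} (hu : u ∈ U)
    (x : Fin k → ℝ) :
    defect v.1 (fderiv ℝ (actD (g : EndV p q)) (ψ u) (fderiv ℝ ψ u x)) = 0 := by
  have h1 := gramInv_defect_fderiv_actD hg hgv (hp.mem_Dv hu) (fderiv ℝ ψ u x)
  rw [hp.defect_fderiv hu, map_zero, map_zero] at h1
  rw [← gram_gramInv (Dv_subset v (actD_mem_Dv hg hgv (hp.mem_Dv hu)))
    (defect v.1 (fderiv ℝ (actD (g : EndV p q)) (ψ u) (fderiv ℝ ψ u x))), h1, map_zero]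

/-- An element fixing `v` preserves the orientation of `𝔻⁺` and, through `autFac`, that of the
normal bundle; hence it preserves that of `𝔻_v⁺`. The change from `ψ` to the affine chart has the
sign that compares their orientations. -/
theorem IsParam.det_transDeriv_pos (hp : IsParam v b U ψ ε) (hv : v.1 ≠ 0)
    (hκ : IsTangentParam v.1 κ π) {g : (EndV p q)ˣ}
    (hg : g ∈ Gplus p q) (hgv : (g : EndV p q) v = v) {u : Fin k → ℝ} (hu : u ∈ U) :
    0 < ((ε : ℤ) : ℝ) * (coordDet hv hκ b * (transDeriv π ψ (g : EndV p q) u).det) := by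
  have hX := hp.mem_Dv hu
  have hXD := Dv_subset v hX
  have hgX := actD_mem_Dv hg hgv hX
  have hgXD := Dv_subset v hgX
  set n : Fin q → HomZ p q := fun i => normalMap v.1 (stdBasis q i) with hn
  have hdn : ∀ i, defect v.1 (n i) = stdBasis q i := by
    intro i
    rw [defect_apply, hn]
    simp only
    rw [adjoint_normalMap hv, neg_neg]
  have h1 : 0 < (stdBasis q).det fun i => (fderiv ℝ (sec v) (ψ u) (n i)).2 := by
    simp_rw [fderiv_sec_snd hX, hdn]
    rw [stdBasis_det_comp (gramInv (ψ u)) (stdBasis q), Basis.det_self, mul_one]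
    exact det_gramInv_pos hXD
  have h2 := hp.oriented u hu n h1
  have h3 : b.det (Sum.elim (fun i => fderiv ℝ (actD (g : EndV p q)) (ψ u) (n i))
      fun j => fderiv ℝ (actD (g : EndV p q)) (ψ u) (fderiv ℝ ψ u (Pi.single j 1))) =
      (fderiv ℝ (actD (g : EndV p q)) (ψ u)).det *
        b.det (Sum.elim n fun j => fderiv ℝ ψ u (Pi.single j 1)) := by
    have h4 := b.det_comp (fderiv ℝ (actD (g : EndV p q)) (ψ u)).toLinearMap
      (Sum.elim n fun j => fderiv ℝ ψ u (Pi.single j 1))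
    rw [ContinuousLinearMap.det, ← h4]
    congr 1
    funext i
    rcases i with i | j <;> rfl
  rw [det_sumElim hv hκ b _ _ fun j => hp.defect_fderiv_actD hg hgv hu _] at h3
  have h5 : (Pi.basisFun ℝ (Fin k)).det (fun j =>
      π (fderiv ℝ (actD (g : EndV p q)) (ψ u) (fderiv ℝ ψ u (Pi.single j 1)))) =
      (transDeriv π ψ (g : EndV p q) u).det := basisFun_det_comp (transDeriv π ψ (g : EndV p q) u)
  have h6 : 0 < (stdBasis q).det fun i =>
      defect v.1 (fderiv ℝ (actD (g : EndV p q)) (ψ u) (n i)) := by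
    have h7 : 0 < (stdBasis q).det fun i => gramInv (actD (g : EndV p q) (ψ u))
        (defect v.1 (fderiv ℝ (actD (g : EndV p q)) (ψ u) (n i))) := by
      simp_rw [gramInv_defect_fderiv_actD hg hgv hX, hdn]
      rw [stdBasis_det_comp (autFac (g : EndV p q) (ψ u)) fun i => gramInv (ψ u) (stdBasis q i),
        stdBasis_det_comp (gramInv (ψ u)) (stdBasis q), Basis.det_self, mul_one]
      exact mul_pos (det_autFac_pos hg hXD) (det_gramInv_pos hXD)
    rw [stdBasis_det_comp (gramInv (actD (g : EndV p q) (ψ u))) fun i =>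
      defect v.1 (fderiv ℝ (actD (g : EndV p q)) (ψ u) (n i))] at h7
    exact (pos_iff_pos_of_mul_pos h7).1 (det_gramInv_pos hgXD)
  rw [h5] at h3
  have h8 := mul_pos (det_fderiv_actD_pos hg hXD) h2
  rw [mul_left_comm, ← h3] at h8
  refine (pos_iff_pos_of_mul_pos (a := (stdBasis q).det fun i =>
      defect v.1 (fderiv ℝ (actD (g : EndV p q)) (ψ u) (n i))) ?_).1 h6
  linarith

/-- The point `g ψ(u)` stays in `𝔻_v⁺`, on whose tangent space `κ ∘ π` is the identity, so the two
frames there differ by `transDeriv`. -/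
theorem IsParam.det_mul_form (hp : IsParam v b U ψ ε)
    (hκ : IsTangentParam v.1 κ π) {g : (EndV p q)ˣ}
    (hg : g ∈ Gplus p q) (hgv : (g : EndV p q) v = v) {u : Fin k → ℝ} (hu : u ∈ U)
    {η : HomZ p q → HomZ p q [⋀^Fin k]→L[ℝ] ℝ}
    (hη : pullD (g : EndV p q) η (ψ u) = η (ψ u)) :
    (transDeriv π ψ (g : EndV p q) u).det *
      η (actD (g : EndV p q) (ψ u)) (fun j => κ (Pi.single j 1)) =
        η (ψ u) fun j => fderiv ℝ ψ u (Pi.single j 1) := by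
  have h1 := alternating_map_basis (Pi.basisFun ℝ (Fin k))
    ((η (actD (g : EndV p q) (ψ u))).toAlternatingMap.compLinearMap κ.toLinearMap)
    (transDeriv π ψ (g : EndV p q) u).toLinearMap
  have h2 : ((η (actD (g : EndV p q) (ψ u))).toAlternatingMap.compLinearMap κ.toLinearMap)
      (Pi.basisFun ℝ (Fin k)) = η (actD (g : EndV p q) (ψ u)) (fun j => κ (Pi.single j 1)) := by
    change η (actD (g : EndV p q) (ψ u)) (fun j => κ (Pi.basisFun ℝ (Fin k) j)) = _
    simp_rw [Pi.basisFun_apply]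
  rw [h2] at h1
  refine h1.symm.trans ?_
  rw [← hη]
  change η (actD (g : EndV p q) (ψ u)) (fun j => κ (π (fderiv ℝ (actD (g : EndV p q)) (ψ u)
    (fderiv ℝ ψ u (Pi.basisFun ℝ (Fin k) j))))) = η (actD (g : EndV p q) (ψ u)) fun j =>
      fderiv ℝ (actD (g : EndV p q)) (ψ u) (fderiv ℝ ψ u (Pi.single j 1))
  congr 1
  funext j
  rw [Pi.basisFun_apply]
  refine hκ.apply_proj _ ?_
  have h3 := hp.defect_fderiv_actD hg hgv hu (Pi.single j 1)
  rwa [defect_apply, neg_eq_zero] at h3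

end Param

/-! ### Poincaré duality -/

section Duality

variable {k : ℕ} {v : V p q} {b : Basis (Fin q ⊕ Fin k) ℝ (HomZ p q)} {U : Set (Fin k → ℝ)}
  {ψ : (Fin k → ℝ) → HomZ p q} {ε : ℤˣ} {κ : (Fin k → ℝ) →L[ℝ] HomZ p q}
  {π : HomZ p q →L[ℝ] (Fin k → ℝ)} {Γ : Subgroup (EndV p q)ˣ}
  {η : HomZ p q → HomZ p q [⋀^Fin k]→L[ℝ] ℝ} {χ : HomZ p q → ℝ}

theorem integrable_cutoff_chart (hκ : IsTangentParam v.1 κ π) (hη : ContDiffOn ℝ ∞ η (Dplus p q))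
    (hχ : Continuous χ) (hc : HasCompactSupport χ) (hs : tsupport χ ⊆ Dplus p q) :
    Integrable fun u => χ (chart v κ u) * η (chart v κ u) fun j => κ (Pi.single j 1) := by
  have hcont := (contDiff_chart v κ 0).continuous
  refine integrable_of_continuousOn_compact (K := π '' tsupport χ ∩ chart v κ ⁻¹' tsupport χ)
    ((hc.isCompact.image π.continuous).inter_right ((isClosed_tsupport χ).preimage hcont)) ?_ ?_
  · have h1 : ContDiffOn ℝ 0 (fun X => η X fun j => κ (Pi.single j 1)) (Dplus p q) :=
      contDiffOn_form_apply (x := fun _ j => κ (Pi.single j 1)) (hη.of_le bot_le)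
        fun i => contDiffOn_const
    exact (hχ.comp hcont).continuousOn.mul
      (h1.continuousOn.comp hcont.continuousOn fun u hu => hs hu.2)
  · intro u hu
    have h2 : chart v κ u ∉ tsupport χ := fun h => hu ⟨⟨_, h, proj_chart hκ u⟩, h⟩
    rw [image_eq_zero_of_notMem_tsupport h2, zero_mul]

/-- The maps `u ↦ π (γ ψ(u))`, for `γ ∈ Γ`, carry `U ∩ ψ⁻¹ F` to disjoint pieces that fill the
domain of the affine chart. Unfolding the chart integral gives the integral for `ψ` and `F`, so the
result depends on neither. -/
theorem IsParam.integral_eq (hp : IsParam v b U ψ ε) (h : IsProperFree Γ) (hv1 : v.1 ≠ 0)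
    (hv : ∀ γ ∈ Γ, (γ : EndV p q) v = v) (hη : IsClosedForm Γ η)
    (hχ : Continuous χ) (hc : HasCompactSupport χ) (hs : tsupport χ ⊆ Dplus p q)
    (hsum : ∀ X ∈ Dplus p q, η X ≠ 0 →
      HasSum (fun γ : Γ => χ (actD ((γ : (EndV p q)ˣ) : EndV p q) X)) 1)
    (hκ : IsTangentParam v.1 κ π) {F : Set (HomZ p q)} (hF : IsFundamentalSet Γ (Dv v) F) :
    IntegrableOn (fun u => η (ψ u) fun i => fderiv ℝ ψ u (Pi.single i 1)) (U ∩ ψ ⁻¹' F) ∧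
    ((ε : ℤ) : ℝ) * ∫ u in U ∩ ψ ⁻¹' F, η (ψ u) (fun i => fderiv ℝ ψ u (Pi.single i 1)) =
      |coordDet hv1 hκ b| * (coordDet hv1 hκ b)⁻¹ *
        ∫ u, χ (chart v κ u) * η (chart v κ u) fun j => κ (Pi.single j 1) := by
  have := h.countable
  have hDne := coordDet_ne_zero hv1 hκ b
  -- `δ` is the orientation sign of the affine chart; `ε δ` is the sign of the Jacobians of the
  -- change from `ψ` to the chart.
  set δ : ℝ := |coordDet hv1 hκ b| * (coordDet hv1 hκ b)⁻¹ with hδ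
  have hδ2 : δ * δ = 1 := by
    have h1 : |coordDet hv1 hκ b| * |coordDet hv1 hκ b| =
        coordDet hv1 hκ b * coordDet hv1 hκ b := abs_mul_abs_self _
    rw [hδ]
    field_simp
    nlinarith [h1]
  have hε2 : ((ε : ℤ) : ℝ) * ((ε : ℤ) : ℝ) = 1 := by
    rcases Int.units_eq_one_or ε with h1 | h1 <;> rw [h1] <;> simp
  have hG : ∀ γ : Γ, (γ : (EndV p q)ˣ) ∈ Gplus p q := fun γ => h.le γ.2
  have hfix : ∀ γ : Γ, ((γ : (EndV p q)ˣ) : EndV p q) v = v := fun γ => hv γ γ.2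
  have hmem : ∀ γ : Γ, ∀ u ∈ U, actD ((γ : (EndV p q)ˣ) : EndV p q) (ψ u) ∈ Dv v :=
    fun γ u hu => actD_mem_Dv (hG γ) (hfix γ) (hp.mem_Dv hu)
  have hch : ∀ γ : Γ, ∀ u ∈ U, chart v κ (π (actD ((γ : (EndV p q)ˣ) : EndV p q) (ψ u))) =
      actD ((γ : (EndV p q)ˣ) : EndV p q) (ψ u) := fun γ u hu => chart_proj hv1 hκ (hmem γ u hu)
  have hmeas : MeasurableSet (U ∩ ψ ⁻¹' F) := by
    have h1 : Measurable (U.domRestrict ψ) := (hp.smooth.continuousOn.domRestrict).measurable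
    have h2 : U ∩ ψ ⁻¹' F = Subtype.val '' (U.domRestrict ψ ⁻¹' F) := by
      ext u
      simp [Set.domRestrict, and_comm]
    rw [h2]
    exact hp.isOpen.measurableSet.subtype_image (h1 hF.measurable)
  have hunion : ⋃ γ : Γ, (fun u => π (actD ((γ : (EndV p q)ˣ) : EndV p q) (ψ u))) ''
      (U ∩ ψ ⁻¹' F) = chart v κ ⁻¹' Dplus p q := by
    refine Set.Subset.antisymm (Set.iUnion_subset fun γ => ?_) fun u hu => ?_
    · rintro _ ⟨u, hu, rfl⟩
      rw [Set.mem_preimage]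
      simp only
      rw [hch γ u hu.1]
      exact Dv_subset v (hmem γ u hu.1)
    · have h1 := chart_mem_Dv hv1 hκ hu
      rw [← hF.iUnion_image h (Dv_subset v)
        fun γ hγ X hX => actD_mem_Dv (h.le hγ) (hv γ hγ) hX] at h1
      obtain ⟨γ, Y, hY, hYu⟩ := Set.mem_iUnion.1 h1
      obtain ⟨w, hw, rfl⟩ := (hp.image.symm ▸ hF.subset hY : Y ∈ ψ '' U)
      refine Set.mem_iUnion.2 ⟨γ, w, ⟨hw, hY⟩, ?_⟩
      simp only
      rw [hYu, proj_chart hκ]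
  have hf := integrable_cutoff_chart hκ hη.smooth hχ hc hs
  obtain ⟨hi, he⟩ := integral_unfold (μ := (volume : Measure (Fin k → ℝ))) hmeas
    (a := fun (γ : Γ) u => π (actD ((γ : (EndV p q)ˣ) : EndV p q) (ψ u)))
    (a' := fun (γ : Γ) u => transDeriv π ψ ((γ : (EndV p q)ˣ) : EndV p q) u)
    (fun γ u hu => by
      have h1 := (hasFDerivAt_actD (h.mem_orthGroup γ)
        (Dv_subset v (hp.mem_Dv hu.1))).comp u (hp.hasFDerivAt hu.1)
      exact HasFDerivAt.comp (g := π) u π.hasFDerivAt h1)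
    (fun γ u hu w hw huw => by
      have h1 := congrArg (chart v κ) huw
      simp only at h1
      rw [hch γ u hu.1, hch γ w hw.1] at h1
      exact hp.injOn hu.1 hw.1 (h.injOn γ (Dv_subset v (hp.mem_Dv hu.1))
        (Dv_subset v (hp.mem_Dv hw.1)) h1))
    (by
      intro γ γ' hne
      refine Set.disjoint_left.2 ?_
      rintro _ ⟨u, hu, rfl⟩ ⟨w, hw, huw⟩
      have h1 := congrArg (chart v κ) huw
      simp only at h1
      rw [hch γ' w hw.1, hch γ u hu.1] at h1
      exact hne (hF.eq_of_actD_eq h (Dv_subset v) hu.2 hw.2 h1.symm))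
    hunion
    (f := fun u => χ (chart v κ u) * η (chart v κ u) fun j => κ (Pi.single j 1))
    (h := fun u => (((ε : ℤ) : ℝ) * δ) * η (ψ u) fun i => fderiv ℝ ψ u (Pi.single i 1))
    hf.integrableOn
    (fun u hu => by
      have hXD := Dv_subset v (hp.mem_Dv hu.1)
      have hterm : ∀ γ : Γ, |(transDeriv π ψ ((γ : (EndV p q)ˣ) : EndV p q) u).det| *
          (χ (chart v κ (π (actD ((γ : (EndV p q)ˣ) : EndV p q) (ψ u)))) *
            η (chart v κ (π (actD ((γ : (EndV p q)ˣ) : EndV p q) (ψ u))))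
              fun j => κ (Pi.single j 1)) =
          χ (actD ((γ : (EndV p q)ˣ) : EndV p q) (ψ u)) *
            ((((ε : ℤ) : ℝ) * δ) * η (ψ u) fun i => fderiv ℝ ψ u (Pi.single i 1)) := by
        intro γ
        rw [hch γ u hu.1]
        have h1 := hp.det_mul_form hκ (hG γ) (hfix γ) hu.1 (hη.invariant γ γ.2 _ hXD)
        have h2 := hp.det_transDeriv_pos hv1 hκ (hG γ) (hfix γ) hu.1
        have h3 : |(transDeriv π ψ ((γ : (EndV p q)ˣ) : EndV p q) u).det| =
            (((ε : ℤ) : ℝ) * δ) * (transDeriv π ψ ((γ : (EndV p q)ˣ) : EndV p q) u).det := by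
          set d := (transDeriv π ψ ((γ : (EndV p q)ˣ) : EndV p q) u).det
          have h4 := abs_of_pos h2
          have h5 : |((ε : ℤ) : ℝ)| = 1 := by
            rcases Int.units_eq_one_or ε with h1 | h1 <;> rw [h1] <;> simp
          rw [abs_mul, abs_mul, h5, one_mul] at h4
          have h6 : |coordDet hv1 hκ b| = δ * coordDet hv1 hκ b := by
            rw [hδ]
            field_simp
          rw [h6] at h4
          have h7 : coordDet hv1 hκ b * |d| =
              coordDet hv1 hκ b * (((ε : ℤ) : ℝ) * δ * d) := by
            linear_combination δ * h4 - (coordDet hv1 hκ b * |d|) * hδ2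
          exact mul_left_cancel₀ hDne h7
        rw [h3, ← h1]
        ring
      refine HasSum.congr_fun (f := fun γ : Γ => χ (actD ((γ : (EndV p q)ˣ) : EndV p q) (ψ u)) *
            ((((ε : ℤ) : ℝ) * δ) * η (ψ u) fun i => fderiv ℝ ψ u (Pi.single i 1))) ?_ hterm
      -- The translates of `χ` are known to add up to `1` only where `η` does not vanish.
      by_cases h0 : η (ψ u) = 0
      · have h1 : (η (ψ u) fun i => fderiv ℝ ψ u (Pi.single i 1)) = 0 := by rw [h0]; rfl
        rw [h1]
        simp
      · have h1 := (hsum _ hXD h0).mul_right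
          ((((ε : ℤ) : ℝ) * δ) * η (ψ u) fun i => fderiv ℝ ψ u (Pi.single i 1))
        rwa [one_mul] at h1)
  have hne : ((ε : ℤ) : ℝ) * δ ≠ 0 := by
    intro h0
    have : ((ε : ℤ) : ℝ) * δ * (((ε : ℤ) : ℝ) * δ) = 1 := by
      linear_combination δ * δ * hε2 + hδ2
    rw [h0] at this
    simp at this
  refine ⟨?_, ?_⟩
  · have h1 := Integrable.const_mul hi (((ε : ℤ) : ℝ) * δ)⁻¹
    refine h1.congr (Filter.Eventually.of_forall fun u => ?_)
    simp only
    rw [inv_mul_cancel_left₀ hne]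
  · have h0 : ∀ u ∉ chart v κ ⁻¹' Dplus p q,
        (χ (chart v κ u) * η (chart v κ u) fun j => κ (Pi.single j 1)) = 0 := fun u hu => by
      rw [image_eq_zero_of_notMem_tsupport fun hm => hu (hs hm), zero_mul]
    rw [← setIntegral_eq_integral_of_forall_compl_eq_zero h0, ← he, integral_const_mul]
    linear_combination (-(((ε : ℤ) : ℝ) *
      ∫ u in U ∩ ψ ⁻¹' F, η (ψ u) (fun i => fderiv ℝ ψ u (Pi.single i 1)))) * hδ2

theorem hasIntegralDv_of_empty (Γ : Subgroup (EndV p q)ˣ) (hv : Dv v = ∅)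
    (b : Basis (Fin q ⊕ Fin k) ℝ (HomZ p q)) (η : HomZ p q → HomZ p q [⋀^Fin k]→L[ℝ] ℝ) :
    HasIntegralDv Γ v b η 0 := by
  have hU : ∀ (U : Set (Fin k → ℝ)) (ψ : (Fin k → ℝ) → HomZ p q) (ε : ℤˣ),
      IsParam v b U ψ ε → U = ∅ := fun U ψ ε hp => by
    have h := hp.image
    rwa [hv, Set.image_eq_empty] at h
  refine ⟨⟨∅, MeasurableSet.empty, Set.empty_subset _, ?_⟩, ⟨∅, fun _ => 0, 1, ?_⟩, ?_⟩
  · rw [hv]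
    exact fun X hX => absurd hX (Set.notMem_empty X)
  · exact ⟨isOpen_empty, contDiffOn_const, Set.injOn_empty _, by rw [hv, Set.image_empty],
      fun u hu => absurd hu (Set.notMem_empty u)⟩
  · intro F _ U ψ ε hp
    rw [hU U ψ ε hp, Set.empty_inter]
    simp

/-- The common value is the cutoff integral over `𝔻⁺`, which does not involve the fundamental sets.
When `v₁ ≠ 0` the sign of `Q(v, v)` plays no role: the affine chart may have an empty domain. -/
theorem exists_hasIntegral (h : IsProperFree Γ) (hv0 : v ≠ 0)
    (hv : ∀ γ ∈ Γ, (γ : EndV p q) v = v) (hφ : IsClosedForm Γ (phi0 v)) (hη : IsClosedForm Γ η)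
    (hηc : HasCompactSupportMod Γ η) (b : Basis (Fin q ⊕ Fin k) ℝ (HomZ p q)) :
    ∃ I : ℝ, HasIntegral Γ b (fun X => wedge (phi0 v X) (η X)) I ∧ HasIntegralDv Γ v b η I := by
  obtain ⟨r, hr, hrη⟩ := hηc.exists_radius
  obtain ⟨χ, hχ, hc, hs, hlf, hsum'⟩ := h.exists_cutoff hr
  have hsum : ∀ X ∈ Dplus p q, η X ≠ 0 →
      HasSum (fun γ : Γ => χ (actD ((γ : (EndV p q)ˣ) : EndV p q) X)) 1 := fun X hX h0 =>
    hsum' X hX (hrη X hX h0)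
  obtain ⟨F₀, hF₀⟩ := h.exists_isFundamentalSet
  refine ⟨∫ X, χ X * wedge (phi0 v X) (η X) b ∂b.addHaar, ⟨⟨F₀, hF₀⟩, fun F hF =>
    integral_wedge_unfold h hφ hη hχ hc hs hsum b hF⟩, ?_⟩
  by_cases hv1 : v.1 = 0
  · have hv2 : v.2 ≠ 0 := fun h2 => hv0 (Prod.ext hv1 h2)
    rw [integral_cutoff_eq_zero h hv1 hv2 hv hη hχ hc hs hlf hsum b]
    exact hasIntegralDv_of_empty Γ (Dv_eq_empty hv1 hv2) b η
  · obtain ⟨κ, π, hκ⟩ := exists_isTangentParam hv1 b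
    rw [integral_cutoff_eq_integral h hv1 hv hη hχ hc hs hlf hsum b hκ]
    exact ⟨⟨_, hF₀.inter (measurableSet_Dv v) (Dv_subset v)
        fun γ hγ X hX => actD_mem_Dv (h.le hγ) (hv γ hγ) hX⟩,
      ⟨_, _, _, isParam_chart hv1 hκ b⟩, fun F hF U ψ ε hp =>
        hp.integral_eq h hv1 hv hη hχ.continuous hc hs hsum hκ hF⟩

end Duality

end MQ

end

theorem mainTheorem2 (p q : ℕ)
    (L : Submodule ℤ (MQ.V p q)) [DiscreteTopology L] [IsZLattice ℝ L]
    (Γ : Subgroup (MQ.EndV p q)ˣ) (hΓG : Γ ≤ MQ.Gplus p q)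
    (hΓL : ∀ γ ∈ Γ, ∀ x ∈ L, (γ : MQ.EndV p q) x ∈ L)
    (hΓtf : ∀ γ ∈ Γ, ∀ n : ℕ, 0 < n → γ ^ n = 1 → γ = 1) :
    (∀ (v : MQ.V p q), ∀ g ∈ MQ.Gplus p q,
      ((MQ.phi0 v (MQ.projD (g : MQ.EndV p q))).compContinuousLinearMap
        (MQ.dProjD (g : MQ.EndV p q))).toAlternatingMap =
          MQ.berezinFormula v (g : MQ.EndV p q)) ∧
    ContDiffOn ℝ ∞ (fun x : MQ.V p q × MQ.HomZ p q => MQ.phi0 x.1 x.2)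
      (Set.univ ×ˢ MQ.Dplus p q) ∧
    (∀ (v : MQ.V p q), ∀ g ∈ MQ.Gplus p q, ∀ X ∈ MQ.Dplus p q,
      MQ.pullD (g : MQ.EndV p q) (MQ.phi0 v) X =
        MQ.phi0 (((g⁻¹ : (MQ.EndV p q)ˣ) : MQ.EndV p q) v) X) ∧
    (∀ v : MQ.V p q, v ≠ 0 → MQ.IsPoincareDual (MQ.stab Γ v) v (MQ.phi0 v)) := by
  refine ⟨fun v g hg => MQ.phi0_dProjD v hg, MQ.contDiffOn_phi0,
    fun v g hg X hX => MQ.pullD_phi0 v hg hX, fun v hv => ?_⟩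
  have h := MQ.isClosedForm_phi0 hΓG v
  exact ⟨h, fun k b η hη hηc => MQ.exists_hasIntegral
    ((MQ.isProperFree_of_lattice L hΓG hΓL hΓtf).mono (MQ.stab_le Γ v)) hv
    (fun γ hγ => hγ.2) h hη hηc b⟩
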